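/- Let $H=(a,b/\mathbb Q)$, $a,b<0$, be a definite quaternion algebra over $\mathbb Q$ with reduced trace $\mathrm{tr}$ and reduced norm $\mathrm{nr}$, let $\Delta x=(\mathrm{tr}\,x)^2-4\,\mathrm{nr}\,x$, and let $\mathcal O\subset H$ be any order. The norm $N(\mathfrak a)$ of a lattice $\mathfrak a$ is the gcd of the reduced norms of its elements. Let $\mathcal O^\sharp=\{x\in H:\mathrm{tr}(x\mathcal O)\subseteq\mathbb Z\}$, $N(\mathcal O)=N(\mathcal O^\sharp)^{-1}$ (here, for the order $\mathcal O$, this notation does not mean the norm of the lattice $\mathcal O$), $\omega=\omega(\mathcal O)=\gcd\{\Delta x: x\in\mathcal O\}>0$, and let $\omega_0$ be the squarefree integer with $\omega/\omega_0$ a square. Let $\mathrm{disc}(\mathcal O)$ be the reduced discriminant, i.e. the positive square root of $\det(\mathrm{tr}(e_i\bar e_j))$ for a $\mathbb Z$-basis $(e_i)$ of $\mathcal O$. A left $\mathcal O$-ideal is a lattice $\mathfrak a\subset H$ with $\mathfrak a_p=\mathcal O_px_p$, $x_p\in H_p^\times$, for every prime $p$; two are equivalent if $\mathfrak b=\mathfrak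 a x$ with $x\in H^\times$. Let $M(\mathcal O)$ be the free $\mathbb Z$-module on the (finitely many) classes, $\deg:M(\mathcal O)\to\mathbb Z$ the map sending each class to $1$, and $\langle[\mathfrak a],[\mathfrak b]\rangle=\frac12\#\{x\in H^\times:\mathfrak ax=\mathfrak b\}$, extended bilinearly. Put $t_n[\mathfrak a]=\sum[\mathfrak b]$, the sum over the left $\mathcal O$-ideals $\mathfrak b\subseteq\mathfrak a$ with $N(\mathfrak b)=n\,N(\mathfrak a)$. For $d\ge0$ let $a_d([\mathfrak a])$ be the number of orbits, under translation by $\mathbb Z$, of the $x\in H$ with $\mathfrak ax\subseteq\mathfrak a$ and $\Delta x=-d$, and let $e_d=\sum_{[\mathfrak a]}a_d([\mathfrak a])\,[\mathfrak a]/\langle[\mathfrak a],[\mathfrak a]\rangle$, so that $\langle e_d,[\mathfrak a]\rangle=a_d([\mathfrak a])$. For $4\mid L$ and a Dirichlet character $\chi$ modulo $L$ let $M_{3/2}(L,\chi)$ be the space of holomorphic $f$ on the upper half-plane with $f(\gamma z)=\chi(d)\,j(\gamma,z)^3f(z)$ for $\gamma=\begin{pmatrix}a&b\\c&d\end{pmatrix}\in\Gamma_0(L)$,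 where $j(\gamma,z)=\theta(\gamma z)/\theta(z)$ and $\theta(z)=\sum_{n\in\mathbb Z}e^{2\pi in^2z}$, that are holomorphic at all cusps; a cusp form is one that vanishes at all cusps. Then: (1) $L=L(\mathcal O)=4N(\mathcal O)/\omega(\mathcal O)$ is a positive integer divisible by $4$; there is a Dirichlet character $\chi_{\mathcal O}$ modulo $L$ with $\chi_{\mathcal O}(n)=\left(\frac{\omega_0}{n}\right)$ (Kronecker symbol) for all $n\ge1$ prime to $L$; and for every $v\in M(\mathcal O)$ the series $$\Theta(v)(z)=\tfrac12\sum_{d\ge0}\langle e_d,v\rangle\,q^{d/\omega},\qquad q=e^{2\pi iz},$$ converges on the upper half-plane and defines an element of $M_{3/2}(L,\chi_{\mathcal O})$. The map $\Theta:M(\mathcal O)\to M_{3/2}(L,\chi_{\mathcal O})$ is $\mathbb Z$-linear. (2) $\Theta(v)$ is a cusp form if and only if $\deg v=0$. (3) $\Theta(v)|T(n^2)=\Theta(t_nv)$ for every $v\in M(\mathcal O)$ and every $n\ge1$ with $(n,\mathrm{disc}(\mathcal O))=1$. Here $T(n^2)$ is given on Fourier coefficients as follows, with $\chi(p)=\left(\frac{\omega_0}{p}\right)$.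 For a prime $p$, $T(p^2)$ sends $\sum_m c(m)q^m$ to $\sum_m b(m)q^m$ with $$b(m)=c(p^2m)+\chi(p)\left(\tfrac{-m}{p}\right)c(m)+\chi(p)^2\,p\,c(m/p^2)\qquad(c(m/p^2)=0\text{ if }p^2\nmid m);$$ for $p=2$ (which occurs only when $\mathrm{disc}(\mathcal O)$ is odd) this is Kohnen's operator on the plus space, i.e. $b(m)$ is given by this formula if $-\omega_0m\equiv0,1\pmod 4$ and $b(m)=0$ otherwise. Further $T(1)=1$, $T(p^{2k+4})=T(p^2)T(p^{2k+2})-\chi(p)^2\,p\,T(p^{2k})$, and $T(n^2)=\prod_{p^k\| n}T(p^{2k})$. -/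

import Mathlib

open scoped MatrixGroups

noncomputable section

/-! ### Arithmetic preliminaries -/

/-- The greatest common divisor of a set of rational numbers: the non-negative generator of the
subgroup of `ℚ` spanned by the set (and `0` if that subgroup is not cyclic). -/
def ratGcd (S : Set ℚ) : ℚ :=
  open Classical in
  if h : ∃ r : ℚ, 0 ≤ r ∧ AddSubgroup.closure S = AddSubgroup.zmultiples r then h.choose else 0

/-- The Kronecker symbol `(a / n)` for `n ≥ 1`: the Jacobi symbol on the odd part of `n`, and
`(a / 2) = 0, 1, -1` according to whether `a` is even, `a ≡ ±1` or `a ≡ ±3` modulo `8`. -/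
def kroneckerSymbol (a : ℤ) (n : ℕ) : ℤ :=
  ZMod.χ₈ (a : ZMod 8) ^ n.factorization 2 * jacobiSym a (n / 2 ^ n.factorization 2)

/-- The squarefree integer that differs from `n ≥ 1` by a square factor. -/
def squarefreePart (n : ℕ) : ℕ :=
  ∏ p ∈ n.primeFactors with Odd (n.factorization p), p

/-! ### Quaternion algebras, orders, ideals -/

/-- The quaternion algebra `(a, b / K)` with basis `1, i, j, k = ij = -ji`, `i² = a`, `j² = b`.
Every quaternion algebra over `ℚ` has this shape, and `(a, b / ℚ)` is definite if and only if
`a < 0` and `b < 0`. -/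
abbrev QuatAlg (K : Type*) [Field K] (a b : K) : Type _ := QuaternionAlgebra K a 0 b

section Quat

variable {a b : ℚ}

/-- The reduced trace. -/
def trd (x : QuatAlg ℚ a b) : ℚ := (x + star x).re

/-- The reduced norm. -/
def nrd (x : QuatAlg ℚ a b) : ℚ := (x * star x).re

/-- The discriminant of the reduced characteristic polynomial. -/
def charDisc (x : QuatAlg ℚ a b) : ℚ := trd x ^ 2 - 4 * nrd x

/-- The underlying lattice of a subring. -/
def subringLattice (O : Subring (QuatAlg ℚ a b)) : Submodule ℤ (QuatAlg ℚ a b) :=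
  AddSubgroup.toIntSubmodule O.toAddSubgroup

/-- An order is a subring (with the same `1`) that is a full lattice. -/
def IsOrder (O : Subring (QuatAlg ℚ a b)) : Prop :=
  Submodule.IsLattice ℚ (subringLattice O)

/-- The norm of a lattice: the gcd of the reduced norms of its elements. -/
def latticeNorm (M : Set (QuatAlg ℚ a b)) : ℚ := ratGcd (nrd '' M)

/-- The dual of a lattice for the trace form. -/
def traceDual (M : Set (QuatAlg ℚ a b)) : Set (QuatAlg ℚ a b) :=
  {x | ∀ y ∈ M, ∃ k : ℤ, trd (x * y) = k}

/-- `N(O)`, the inverse of the norm of the dual lattice of `O`. -/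
def orderN (O : Subring (QuatAlg ℚ a b)) : ℚ :=
  (latticeNorm (traceDual (O : Set (QuatAlg ℚ a b))))⁻¹

/-- `ω(O)`, the gcd of the integers `charDisc x`, `x ∈ O`. -/
def orderOmega (O : Subring (QuatAlg ℚ a b)) : ℕ :=
  sSup {m : ℕ | ∀ x ∈ O, ∃ k : ℤ, charDisc x = m * k}

/-- The reduced discriminant of an order: the positive square root of the determinant (a square)
of the Gram matrix of the bilinear form `trd (x * star y)` in a `ℤ`-basis of the order. -/
def reducedDisc (O : Subring (QuatAlg ℚ a b)) : ℕ :=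
  open Classical in
  if h : Nonempty (Module.Basis (Fin 4) ℤ (subringLattice O)) then
    Nat.sqrt (Matrix.det (Matrix.of fun i j : Fin 4 =>
      trd ((h.some i : QuatAlg ℚ a b) * star (h.some j : QuatAlg ℚ a b)))).num.natAbs
  else 0

/-- The embedding of the quaternion algebra in its completion at `p`. -/
def localEmb (p : ℕ) [Fact p.Prime] (x : QuatAlg ℚ a b) :
    QuatAlg ℚ_[p] (a : ℚ_[p]) (b : ℚ_[p]) :=
  ⟨(x.re : ℚ_[p]), (x.imI : ℚ_[p]), (x.imJ : ℚ_[p]), (x.imK : ℚ_[p])⟩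

/-- The localization `M_p = M ⊗ ℤ_p` of a lattice, inside the completion at `p`. -/
def localization (p : ℕ) [Fact p.Prime] (M : Submodule ℤ (QuatAlg ℚ a b)) :
    Submodule ℤ_[p] (QuatAlg ℚ_[p] (a : ℚ_[p]) (b : ℚ_[p])) :=
  Submodule.span ℤ_[p] (localEmb p '' (M : Set (QuatAlg ℚ a b)))

/-- A left `O`-ideal: a full lattice `I` such that for every prime `p` there is an invertible
`x` in the completion at `p` with `I_p = O_p x`. -/
structure LeftIdeal (O : Subring (QuatAlg ℚ a b)) where
  lattice : Submodule ℤ (QuatAlg ℚ a b)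
  isLattice : Submodule.IsLattice ℚ lattice
  locally_principal : ∀ (p : ℕ) [Fact p.Prime],
    ∃ x : (QuatAlg ℚ_[p] (a : ℚ_[p]) (b : ℚ_[p]))ˣ,
      (localization p lattice : Set (QuatAlg ℚ_[p] (a : ℚ_[p]) (b : ℚ_[p]))) =
        (fun y => y * (x : QuatAlg ℚ_[p] (a : ℚ_[p]) (b : ℚ_[p]))) ''
          (localization p (subringLattice O) : Set (QuatAlg ℚ_[p] (a : ℚ_[p]) (b : ℚ_[p])))

/-- The lattice `M x`. -/
def latticeMul (M : Submodule ℤ (QuatAlg ℚ a b)) (x : QuatAlg ℚ a b) :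
    Submodule ℤ (QuatAlg ℚ a b) :=
  M.map (LinearMap.mulRight ℤ x)

lemma latticeMul_one (M : Submodule ℤ (QuatAlg ℚ a b)) : latticeMul M 1 = M := by
  simp [latticeMul]

lemma latticeMul_mul (M : Submodule ℤ (QuatAlg ℚ a b)) (x y : QuatAlg ℚ a b) :
    latticeMul (latticeMul M x) y = latticeMul M (x * y) := by
  simp [latticeMul, LinearMap.mulRight_mul, Submodule.map_comp]

/-- Two left `O`-ideals `I`, `J` are in the same class if `I x = J` for an invertible `x`. -/
instance leftIdealSetoid (O : Subring (QuatAlg ℚ a b)) : Setoid (LeftIdeal O) where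
  r I J := ∃ x : (QuatAlg ℚ a b)ˣ, latticeMul I.lattice x = J.lattice
  iseqv :=
    { refl := fun I => ⟨1, by simpa using latticeMul_one I.lattice⟩
      symm := by
        rintro I J ⟨x, h⟩
        refine ⟨x⁻¹, ?_⟩
        rw [← h, latticeMul_mul, Units.mul_inv, latticeMul_one]
      trans := by
        rintro I J K ⟨x, h⟩ ⟨y, h'⟩
        refine ⟨x * y, ?_⟩
        rw [← h', ← h, latticeMul_mul, Units.val_mul] }

/-- The set of left `O`-ideal classes. -/
abbrev IdealClass (O : Subring (QuatAlg ℚ a b)) : Type := Quotient (leftIdealSetoid O)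

/-- `M(O)`, the free `ℤ`-module on the left `O`-ideal classes. -/
abbrev IdealModule (O : Subring (QuatAlg ℚ a b)) : Type := IdealClass O →₀ ℤ

/-- The right order `{x | I x ⊆ I}`. -/
def rightOrder (M : Submodule ℤ (QuatAlg ℚ a b)) : Set (QuatAlg ℚ a b) :=
  {x | ∀ y ∈ M, y * x ∈ M}

variable {O : Subring (QuatAlg ℚ a b)}

/-- The degree map `M(O) → ℤ`, which sends every ideal class to `1`. -/
def degree (v : IdealModule O) : ℤ := v.sum fun _ n => n

/-- The height pairing of two ideal classes `[I]`, `[J]`: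
half the number of invertible `x` with `I x = J`. -/
def heightClass (c c' : IdealClass O) : ℚ :=
  (Nat.card {x : (QuatAlg ℚ a b)ˣ // latticeMul c.out.lattice x = c'.out.lattice} : ℚ) / 2

/-- The bilinear extension of the height pairing. Its first argument is an element
`∑ u(c) c` of `M(O) ⊗ ℚ`, written as the function `u` of its coefficients (there are finitely
many ideal classes); only the term `c' = c` of the inner sum can be nonzero. -/
def heightPairing (u : IdealClass O → ℚ) (v : IdealModule O) : ℚ :=
  v.sum fun c n => (∑ᶠ c' : IdealClass O, u c' * heightClass c' c) * n

/-- The special points of discriminant `-d` for an ideal with lattice `M`. -/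
def specialPoints (d : ℕ) (M : Submodule ℤ (QuatAlg ℚ a b)) : Set (QuatAlg ℚ a b) :=
  {x | x ∈ rightOrder M ∧ charDisc x = -(d : ℚ)}

/-- The number `a_d([I])` of orbits of special points of discriminant `-d` for `I` under
translation by integers. (It is `0` unless `-d ≡ 0, 1 (mod 4)`.) -/
def specialCount (d : ℕ) (c : IdealClass O) : ℕ :=
  Set.ncard ((QuotientAddGroup.mk :
      QuatAlg ℚ a b → QuatAlg ℚ a b ⧸ AddSubgroup.zmultiples (1 : QuatAlg ℚ a b)) ''
    specialPoints d c.out.lattice)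

/-- The vector `e_d = ∑ a_d(c) c^∨`, where `c^∨ = c / ⟨c, c⟩`. -/
def eVec (O : Subring (QuatAlg ℚ a b)) (d : ℕ) : IdealClass O → ℚ :=
  fun c => (specialCount d c : ℚ) / heightClass c c

/-- The set `T_m(I)` of left `O`-ideals `J ⊆ I` whose norm is `m` times the norm of `I`. -/
def heckeSet (m : ℕ) (I : LeftIdeal O) : Set (LeftIdeal O) :=
  {J | J.lattice ≤ I.lattice ∧
    latticeNorm (J.lattice : Set (QuatAlg ℚ a b)) =
      m * latticeNorm (I.lattice : Set (QuatAlg ℚ a b))}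

/-- The Hecke operator `t_m` on `M(O)`, `m ≥ 1`: it sends the class of `I` to the sum of the
classes of the elements of `T_m(I)`. -/
def heckeT (m : ℕ) : IdealModule O →ₗ[ℤ] IdealModule O :=
  Finsupp.lift (IdealModule O) ℤ (IdealClass O) fun c =>
    ∑ᶠ J ∈ heckeSet m c.out, Finsupp.single (⟦J⟧ : IdealClass O) (1 : ℤ)

end Quat

/-! ### Modular forms of weight 3/2 -/

/-- Shimura's theta series `θ(z) = ∑ exp(2πi n² z)`, the sum over all integers `n`. -/
def shimuraTheta (z : UpperHalfPlane) : ℂ := jacobiTheta (2 * (z : ℂ))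

/-- Shimura's automorphy factor of weight 1/2, `j(γ, z) = θ(γ z) / θ(z)`, for `γ ∈ Γ₀(4)`. -/
def thetaFactor (γ : SL(2, ℤ)) (z : UpperHalfPlane) : ℂ :=
  shimuraTheta (γ • z) / shimuraTheta z

/-- `(c z + d)^(-3/2) f((a z + b) / (c z + d))`; its behaviour as `Im z → ∞` is the behaviour of
`f` at the cusp `a / c`. -/
def atCusp (γ : SL(2, ℤ)) (f : UpperHalfPlane → ℂ) (z : UpperHalfPlane) : ℂ :=
  (UpperHalfPlane.denom γ z) ^ (-(3 / 2) : ℂ) * f (γ • z)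

/-- The space of modular forms of weight 3/2, level `N` (with `4 ∣ N`) and character `χ`. -/
def ModularForms32 (N : ℕ) (χ : DirichletCharacter ℂ N) : Submodule ℂ (UpperHalfPlane → ℂ) where
  carrier := {f | DifferentiableOn ℂ (fun w : ℂ => f (UpperHalfPlane.ofComplex w)) {w | 0 < w.im} ∧
    (∀ γ ∈ CongruenceSubgroup.Gamma0 N, ∀ z : UpperHalfPlane,
      f (γ • z) = χ ((γ 1 1 : ℤ) : ZMod N) * thetaFactor γ z ^ 3 * f z) ∧
    ∀ γ : SL(2, ℤ), UpperHalfPlane.IsBoundedAtImInfty (atCusp γ f)}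
  zero_mem' := by
    refine ⟨by simp, by simp, fun γ => ?_⟩
    have : atCusp γ (0 : UpperHalfPlane → ℂ) = fun _ => 0 := by ext z; simp [atCusp]
    rw [this]
    exact Filter.const_boundedAtFilter _ 0
  add_mem' := by
    rintro f g ⟨hf, hf', hf''⟩ ⟨hg, hg', hg''⟩
    refine ⟨hf.add hg, fun γ hγ z => ?_, fun γ => ?_⟩
    · simp only [Pi.add_apply, hf' γ hγ, hg' γ hγ]; ring
    · have : atCusp γ (f + g) = atCusp γ f + atCusp γ g := by ext z; simp [atCusp, mul_add]
      rw [this]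
      exact (hf'' γ).add (hg'' γ)
  smul_mem' := by
    rintro c f ⟨hf, hf', hf''⟩
    refine ⟨hf.const_smul c, fun γ hγ z => ?_, fun γ => ?_⟩
    · simp only [Pi.smul_apply, hf' γ hγ, smul_eq_mul]; ring
    · have : atCusp γ (c • f) = c • atCusp γ f := by ext z; simp [atCusp]; ring
      rw [this]
      exact (hf'' γ).smul c

/-- A modular form is a cusp form if it vanishes at every cusp. -/
def IsCuspForm32 (N : ℕ) (χ : DirichletCharacter ℂ N) (f : UpperHalfPlane → ℂ) : Prop :=
  f ∈ ModularForms32 N χ ∧ ∀ γ : SL(2, ℤ), UpperHalfPlane.IsZeroAtImInfty (atCusp γ f)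

/-! ### Hecke operators in weight 3/2

They act on forms whose level `N` and character are such that the character is `n ↦ (D / n)`, with
`D ≥ 1` squarefree; only primes `p` that are odd and prime to `N`, or `p = 2` and `N / 4` odd, are
relevant. -/

/-- The action of `T(p²)` on sequences of Fourier coefficients:
`b(m) = c(p² m) + χ(p) (-m / p) c(m) + χ(p²) p c(m / p²)`, where `χ(p) = (D / p)`, and
`c(m / p²) = 0` if `p² ∤ m`. For `p = 2` this is Kohnen's operator on the plus space, where
`b(m)` is given by this formula if `-D m ≡ 0, 1 (mod 4)` and is `0` otherwise. -/
def heckeCoeffPrime (D p : ℕ) : Module.End ℂ (ℕ → ℂ) where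
  toFun c m :=
    if p = 2 ∧ ¬ (-(D * m : ℤ) % 4 = 0 ∨ -(D * m : ℤ) % 4 = 1) then 0
    else c (p ^ 2 * m) + (kroneckerSymbol D p * kroneckerSymbol (-(m : ℤ)) p : ℤ) * c m
      + (kroneckerSymbol D p ^ 2 * p : ℤ) * (if p ^ 2 ∣ m then c (m / p ^ 2) else 0)
  map_add' c c' := by
    ext m
    simp only [Pi.add_apply]
    split_ifs <;> ring
  map_smul' r c := by
    ext m
    simp only [Pi.smul_apply, smul_eq_mul, RingHom.id_apply]
    split_ifs <;> ring

/-- The action of `T(p²ᵏ)`, defined by `T(1) = 1` and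
`T(p²ᵏ⁺⁴) = T(p²) T(p²ᵏ⁺²) - χ(p)² p T(p²ᵏ)`. -/
def heckeCoeffPrimePow (D p : ℕ) : ℕ → Module.End ℂ (ℕ → ℂ)
  | 0 => 1
  | 1 => heckeCoeffPrime D p
  | k + 2 => heckeCoeffPrime D p * heckeCoeffPrimePow D p (k + 1)
      - ((kroneckerSymbol D p ^ 2 * p : ℤ) : ℂ) • heckeCoeffPrimePow D p k

/-- The action of `T(n²)`, the product of the `T(p²ᵏ)` over the prime powers `pᵏ` that exactly
divide `n`. -/
def heckeCoeff (D n : ℕ) : Module.End ℂ (ℕ → ℂ) :=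
  (n.primeFactorsList.dedup.map fun p => heckeCoeffPrimePow D p (n.factorization p)).prod

/-- `f | T(n²)`, the function whose Fourier coefficients are obtained from those of `f`
by `heckeCoeff`. -/
def heckeForm (D n : ℕ) (f : UpperHalfPlane → ℂ) (z : UpperHalfPlane) : ℂ :=
  ∑' m : ℕ, heckeCoeff D n (fun k => (UpperHalfPlane.qExpansion 1 f).coeff k) m *
    Complex.exp (2 * Real.pi * Complex.I * m * (z : ℂ))

end

/-!
The coefficients `a_d([𝔞])` are representation numbers of a ternary quadratic form. An element `x` of
the right order of `𝔞` is determined, up to translation by `ℤ`, by the vector `x - x̄` of trace zero,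
whose norm is `-Δx` (`ncard_specialPoints`). On the lattice of these vectors the norm is `ω(𝒪)` times
an integral form `Q` (`IsNormForm`), so that `Θ([𝔞])` is half the theta series of `Q`
(`IsNormForm.hasSum_theta`).

Modularity. The dual of the lattice is controlled by the trace dual of the right order, whose norm is
that of `𝒪`; hence `Q` has level `L = 4 N(𝒪) / ω(𝒪)` (`LeftIdeal.hasLevel`). Poisson summation near a
rational point (`theta_add_rat`) describes `Q.theta (γ z)` for `γ ∈ Γ₀(L)` through a Gauss sum modulo
the lower right entry `d` of `γ` (`theta_transform`). The same formula holds for `x² + y² + z²`, whose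
theta series is `θ³` and vanishes nowhere (`shimuraTheta_ne_zero`); the quotient of the two formulas
contains `j(γ, z)³` and a quotient of Gauss sums (`theta_smul`). For a large prime `d` this quotient is
`(ω₀ / d)`, as `Q` is diagonalised by `i, j, k` over `ℚ` (`IsNormForm.hasGaussCharacter`). Translations
change `d` modulo the lower left entry without changing the theta series, so that by Dirichlet's
theorem on primes in progressions it is enough to know prime `d`; this also shows that `(ω₀ / n)` is a
character modulo `L` (`HasNebentypus.exists_character`, `HasNebentypus.transformsWith`).

Cusps. By `theta_add_rat` again, the value of the theta series of `Q` at a cusp is a factor independent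
of `Q` times an expression in `det Q` and a Gauss sum (`exists_cusp_expansion`). Left ideals have local
generators (`LeftIdeal.exists_isLocGen`), so that the forms of all right orders lie in one genus and
have the same values at the cusps (`LeftIdeal.similarAt`, `LeftIdeal.cuspValue_eq`). Hence `Θ(v)` takes
the value of `Θ([𝒪])` times `deg v`, and the value of a single theta series at `∞` is not zero.

Hecke operators. For `p` prime to the discriminant, `𝒪 / p𝒪` is a matrix algebra
(`exists_localSplitting`) and the ideals of norm `p N(𝔞)` in `𝔞` correspond to the `p + 1` lines of the
plane over `ℤ / p` (`bijective_lineIdeal`). Counting intermediate ideals gives the recursion and the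
multiplicativity of the `t_n` (`heckeSum_prime_pow`, `heckeSum_mul`). A vector of norm `d` belongs to
the ternary lattice of the ideal of a line if and only if the line is invariant under the corresponding
matrix. The number of such lines is `1 + (-d / p)`, increased by `p` for vectors divisible by `p`, if
the vector belongs to the lattice of `𝔞` (`card_lines_of_mem`), and it is `1` if only its multiple by
`p` does (`card_lines_of_not_mem`). Summing over the vectors gives the formula for `T(p²)`
(`heckeSum_specialNum`).
-/

open scoped MatrixGroups

noncomputable section

/-- The quaternion algebra `(a, b / ℚ)`. -/
local notation "𝔹" => QuatAlg ℚ

/-! ### Reduced trace and norm -/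

section Quat

variable {a b : ℚ}

lemma trd_eq (x : 𝔹 a b) : trd x = 2 * x.re := by
  simp [trd]; ring

lemma nrd_eq (x : 𝔹 a b) :
    nrd x = x.re ^ 2 - a * x.imI ^ 2 - b * x.imJ ^ 2 + a * b * x.imK ^ 2 := by
  simp [nrd]; ring

lemma charDisc_eq (x : 𝔹 a b) :
    charDisc x = 4 * (a * x.imI ^ 2 + b * x.imJ ^ 2 - a * b * x.imK ^ 2) := by
  rw [charDisc, trd_eq, nrd_eq]; ring

lemma trd_add (x y : 𝔹 a b) : trd (x + y) = trd x + trd y := by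
  simp only [trd_eq, QuaternionAlgebra.re_add]; ring

lemma trd_sub (x y : 𝔹 a b) : trd (x - y) = trd x - trd y := by
  simp only [trd_eq, QuaternionAlgebra.re_sub]; ring

lemma trd_smul (q : ℚ) (x : 𝔹 a b) : trd (q • x) = q * trd x := by
  simp only [trd_eq, QuaternionAlgebra.re_smul, smul_eq_mul]; ring

lemma trd_one : trd (1 : 𝔹 a b) = 2 := by simp [trd_eq]

lemma trd_star (x : 𝔹 a b) : trd (star x) = trd x := by simp [trd_eq]

lemma trd_mul_comm (x y : 𝔹 a b) : trd (x * y) = trd (y * x) := by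
  simp [trd_eq]; ring

lemma nrd_smul (q : ℚ) (x : 𝔹 a b) : nrd (q • x) = q ^ 2 * nrd x := by
  simp [nrd_eq]; ring

lemma nrd_one : nrd (1 : 𝔹 a b) = 1 := by simp [nrd_eq]

lemma nrd_zero : nrd (0 : 𝔹 a b) = 0 := by simp [nrd_eq]

lemma nrd_mul (x y : 𝔹 a b) : nrd (x * y) = nrd x * nrd y := by
  simp [nrd_eq]; ring

lemma nrd_star (x : 𝔹 a b) : nrd (star x) = nrd x := by simp [nrd_eq]

lemma nrd_add (x y : 𝔹 a b) :
    nrd (x + y) = nrd x + nrd y + trd (x * star y) := by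
  simp [nrd_eq, trd_eq]; ring

lemma add_star_eq (x : 𝔹 a b) : x + star x = trd x • (1 : 𝔹 a b) := by
  ext <;> simp [trd_eq]; ring

lemma mul_star_eq (x : 𝔹 a b) : x * star x = nrd x • (1 : 𝔹 a b) := by
  ext <;> simp [nrd_eq] <;> ring

lemma star_mul_eq (x : 𝔹 a b) : star x * x = nrd x • (1 : 𝔹 a b) := by
  ext <;> simp [nrd_eq] <;> ring

lemma star_eq_sub (x : 𝔹 a b) : star x = trd x • (1 : 𝔹 a b) - x :=
  eq_sub_of_add_eq' (add_star_eq x)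

lemma mul_self_eq (x : 𝔹 a b) :
    x * x = trd x • x - nrd x • (1 : 𝔹 a b) := by
  have := mul_star_eq x
  rw [star_eq_sub, mul_sub, mul_smul_comm, mul_one] at this
  rw [← this]; abel

lemma charDisc_smul (q : ℚ) (x : 𝔹 a b) : charDisc (q • x) = q ^ 2 * charDisc x := by
  rw [charDisc, charDisc, trd_smul, nrd_smul]; ring

lemma nrd_unit_ne_zero (y : (𝔹 a b)ˣ) : nrd (y : 𝔹 a b) ≠ 0 := by
  intro h
  have := nrd_mul (y : 𝔹 a b) (↑y⁻¹ : 𝔹 a b)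
  rw [Units.mul_inv, nrd_one, h, zero_mul] at this
  exact one_ne_zero this

lemma nrd_unit_inv (y : (𝔹 a b)ˣ) :
    nrd (↑y⁻¹ : 𝔹 a b) = (nrd (y : 𝔹 a b))⁻¹ := by
  have := nrd_mul (y : 𝔹 a b) (↑y⁻¹ : 𝔹 a b)
  rw [Units.mul_inv, nrd_one] at this
  exact eq_inv_of_mul_eq_one_right this.symm

lemma trd_conj (y : (𝔹 a b)ˣ) (x : 𝔹 a b) :
    trd ((y : 𝔹 a b) * x * (↑y⁻¹ : 𝔹 a b)) = trd x := by
  rw [trd_mul_comm, ← mul_assoc, Units.inv_mul, one_mul]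

lemma nrd_conj (y : (𝔹 a b)ˣ) (x : 𝔹 a b) :
    nrd ((y : 𝔹 a b) * x * (↑y⁻¹ : 𝔹 a b)) = nrd x := by
  rw [nrd_mul, nrd_mul, nrd_unit_inv]
  field_simp [nrd_unit_ne_zero y]

lemma charDisc_conj (y : (𝔹 a b)ˣ) (x : 𝔹 a b) :
    charDisc ((y : 𝔹 a b) * x * (↑y⁻¹ : 𝔹 a b)) = charDisc x := by
  rw [charDisc, charDisc, trd_conj, nrd_conj]

lemma charDisc_conj' (y : (𝔹 a b)ˣ) (x : 𝔹 a b) :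
    charDisc ((↑y⁻¹ : 𝔹 a b) * x * (y : 𝔹 a b)) = charDisc x := by
  simpa using charDisc_conj y⁻¹ x

/-- An element of non-zero reduced norm as a unit, with inverse `star x / nrd x`. -/
def unitOfNrd (x : 𝔹 a b) (hx : nrd x ≠ 0) : (𝔹 a b)ˣ where
  val := x
  inv := (nrd x)⁻¹ • star x
  val_inv := by rw [mul_smul_comm, mul_star_eq, smul_smul, inv_mul_cancel₀ hx, one_smul]
  inv_val := by rw [smul_mul_assoc, star_mul_eq, smul_smul, inv_mul_cancel₀ hx, one_smul]

lemma unit_inv_eq (y : (𝔹 a b)ˣ) :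
    (↑y⁻¹ : 𝔹 a b) = (nrd (y : 𝔹 a b))⁻¹ • star (y : 𝔹 a b) := by
  have h : y = unitOfNrd y (nrd_unit_ne_zero y) := Units.ext rfl
  conv_lhs => rw [h]
  rfl

section Definite

variable [ha : Fact (a < 0)] [hb : Fact (b < 0)]

lemma nrd_nonneg (x : 𝔹 a b) : 0 ≤ nrd x := by
  have h1 := ha.out; have h2 := hb.out
  rw [nrd_eq]
  nlinarith [mul_nonneg (neg_nonneg.2 h1.le) (sq_nonneg x.imI), mul_nonneg (neg_nonneg.2 h2.le) (sq_nonneg x.imJ),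
    mul_nonneg (mul_nonneg_of_nonpos_of_nonpos h1.le h2.le) (sq_nonneg x.imK), sq_nonneg x.re]

lemma neg_charDisc_nonneg (x : 𝔹 a b) : charDisc x ≤ 0 := by
  have h1 := ha.out; have h2 := hb.out
  rw [charDisc_eq]
  nlinarith [mul_nonneg (neg_nonneg.2 h1.le) (sq_nonneg x.imI), mul_nonneg (neg_nonneg.2 h2.le) (sq_nonneg x.imJ),
    mul_nonneg (mul_nonneg_of_nonpos_of_nonpos h1.le h2.le) (sq_nonneg x.imK)]

lemma im_eq_zero_of_charDisc_eq_zero {x : 𝔹 a b} (h : charDisc x = 0) :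
    x.imI = 0 ∧ x.imJ = 0 ∧ x.imK = 0 := by
  have h1 := ha.out; have h2 := hb.out
  have h3 : 0 < a * b := mul_pos_of_neg_of_neg h1 h2
  rw [charDisc_eq] at h
  have e1 := mul_nonneg (neg_nonneg.2 h1.le) (sq_nonneg x.imI)
  have e2 := mul_nonneg (neg_nonneg.2 h2.le) (sq_nonneg x.imJ)
  have e3 := mul_nonneg h3.le (sq_nonneg x.imK)
  refine ⟨?_, ?_, ?_⟩
  · have : -a * x.imI ^ 2 = 0 := by linarith
    simpa [h1.ne] using this
  · have : -b * x.imJ ^ 2 = 0 := by linarith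
    simpa [h2.ne] using this
  · have : a * b * x.imK ^ 2 = 0 := by linarith
    simpa [h1.ne, h2.ne] using this

lemma eq_zero_of_nrd_eq_zero {x : 𝔹 a b} (h : nrd x = 0) : x = 0 := by
  have h0 : charDisc x = 4 * x.re ^ 2 := by rw [charDisc, h, trd_eq]; ring
  have hre : x.re = 0 := by
    have := neg_charDisc_nonneg x
    have h' : x.re ^ 2 = 0 := le_antisymm (by linarith) (sq_nonneg _)
    simpa using h'
  rw [hre] at h0
  obtain ⟨h1, h2, h3⟩ := im_eq_zero_of_charDisc_eq_zero (by simpa using h0)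
  ext <;> simp [hre, h1, h2, h3]

lemma nrd_ne_zero {x : 𝔹 a b} (h : x ≠ 0) : nrd x ≠ 0 := fun h' => h (eq_zero_of_nrd_eq_zero h')

lemma nrd_unit_pos (y : (𝔹 a b)ˣ) : 0 < nrd (y : 𝔹 a b) :=
  lt_of_le_of_ne (nrd_nonneg _) (nrd_unit_ne_zero y).symm

end Definite

/-! ### Localization of lattices at a prime -/

/-- The localization `M ⊗ ℤ_(p)` of a subgroup `M` inside the ambient group: the elements some
multiple of which by an integer prime to `p` lies in `M`. -/
def locAt {V : Type*} [AddCommGroup V] (p : ℕ) (M : Submodule ℤ V) : Submodule ℤ V where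
  carrier := {x | ∃ m : ℕ, m.Coprime p ∧ m • x ∈ M}
  zero_mem' := ⟨1, by simp, by simp⟩
  add_mem' := by
    rintro x y ⟨m, hm, hx⟩ ⟨n, hn, hy⟩
    refine ⟨m * n, hm.mul_left hn, ?_⟩
    rw [smul_add]
    refine M.add_mem ?_ ?_
    · rw [mul_comm, mul_smul]; exact M.smul_of_tower_mem n hx
    · rw [mul_smul]; exact M.smul_of_tower_mem m hy
  smul_mem' := by
    rintro c x ⟨m, hm, hx⟩
    exact ⟨m, hm, by rw [smul_comm]; exact M.smul_mem c hx⟩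

section Loc

variable {V : Type*} [AddCommGroup V] {p : ℕ} {M N : Submodule ℤ V}

lemma mem_locAt {x : V} : x ∈ locAt p M ↔ ∃ m : ℕ, m.Coprime p ∧ m • x ∈ M := Iff.rfl

lemma le_locAt (p : ℕ) (M : Submodule ℤ V) : M ≤ locAt p M := fun x hx => ⟨1, by simp, by simpa using hx⟩

lemma locAt_mono (h : M ≤ N) : locAt p M ≤ locAt p N := fun _ ⟨m, hm, hx⟩ => ⟨m, hm, h hx⟩

lemma mem_locAt_of_nsmul_mem {x : V} {m : ℕ} (hm : m.Coprime p) (h : m • x ∈ locAt p M) :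
    x ∈ locAt p M := by
  obtain ⟨n, hn, h⟩ := h
  exact ⟨n * m, hn.mul_left hm, by rwa [mul_smul]⟩

lemma locAt_le_of_le_locAt (h : M ≤ locAt p N) : locAt p M ≤ locAt p N :=
  fun _ ⟨_, hm, hx⟩ => mem_locAt_of_nsmul_mem hm (h hx)

/-- The integers that multiply `x` into `M` form an ideal that is contained in no maximal ideal. -/
lemma mem_of_forall_mem_locAt {x : V} (h : ∀ p : ℕ, p.Prime → x ∈ locAt p M) : x ∈ M := by
  let I : Ideal ℤ :=
    { carrier := {n | n • x ∈ M}
      zero_mem' := by simp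
      add_mem' := fun {m n} hm hn => by
        simp only [Set.mem_ofPred_eq, add_smul] at *; exact M.add_mem hm hn
      smul_mem' := fun c n hn => by
        simp only [Set.mem_ofPred_eq, smul_eq_mul, mul_smul] at *; exact M.smul_mem c hn }
  by_cases hI : I = ⊤
  · have : (1 : ℤ) ∈ I := by rw [hI]; trivial
    simpa using (show (1 : ℤ) • x ∈ M from this)
  exfalso
  obtain ⟨g, hg⟩ := (IsPrincipalIdealRing.principal I).principal
  have hg1 : g.natAbs ≠ 1 := by
    intro h1
    exact hI (by rw [hg]; exact Ideal.span_singleton_eq_top.2 (Int.isUnit_iff_natAbs_eq.2 h1))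
  obtain ⟨p, hp, hpg⟩ := Nat.exists_prime_and_dvd hg1
  obtain ⟨m, hm, hmx⟩ := h p hp
  have hmI : (m : ℤ) ∈ I := by
    change (m : ℤ) • x ∈ M
    simpa using hmx
  rw [hg] at hmI
  have h2 : g ∣ m := Ideal.mem_span_singleton.1 hmI
  have h3 : p ∣ m := by
    have := hpg.trans (Int.natAbs_dvd_natAbs.2 h2)
    simpa using this
  exact hp.one_lt.ne' (Nat.eq_one_of_dvd_coprimes hm h3 dvd_rfl)

lemma le_of_forall_locAt_le (h : ∀ p : ℕ, p.Prime → N ≤ locAt p M) : N ≤ M :=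
  fun _ hx => mem_of_forall_mem_locAt fun p hp => h p hp hx

lemma exists_nsmul_mem_of_fg (hN : N.FG) (h : N ≤ locAt p M) :
    ∃ m : ℕ, m.Coprime p ∧ ∀ x ∈ N, m • x ∈ M := by
  induction N, hN using Submodule.fg_induction with
  | singleton x =>
    obtain ⟨m, hm, hx⟩ := h (Submodule.mem_span_singleton_self x)
    refine ⟨m, hm, fun y hy => ?_⟩
    obtain ⟨c, rfl⟩ := Submodule.mem_span_singleton.1 hy
    rw [smul_comm]; exact M.smul_mem c hx
  | sup N₁ N₂ _ _ h₁ h₂ =>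
    obtain ⟨m, hm, hx⟩ := h₁ (le_sup_left.trans h)
    obtain ⟨n, hn, hy⟩ := h₂ (le_sup_right.trans h)
    refine ⟨m * n, hm.mul_left hn, fun z hz => ?_⟩
    obtain ⟨x, hx', y, hy', rfl⟩ := Submodule.mem_sup.1 hz
    rw [smul_add]
    refine M.add_mem ?_ ?_
    · rw [mul_comm, mul_smul]; exact M.smul_of_tower_mem n (hx x hx')
    · rw [mul_smul]; exact M.smul_of_tower_mem m (hy y hy')

lemma mem_locAt_of_zsmul_mem {x : V} {m : ℤ} (hm : IsCoprime m (p : ℤ)) (h : m • x ∈ locAt p M) :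
    x ∈ locAt p M := by
  refine mem_locAt_of_nsmul_mem (m := m.natAbs) (Int.isCoprime_iff_gcd_eq_one.1 hm) ?_
  rcases Int.natAbs_eq m with h' | h'
  · rw [h', natCast_zsmul] at h; exact h
  · rw [h', neg_smul, natCast_zsmul] at h; exact neg_mem_iff.1 h

/-- The rationals act on the localization at `p` if their denominator is prime to `p`. -/
lemma ratSmul_mem_locAt [Module ℚ V] {x : V} (hx : x ∈ locAt p M) {q : ℚ} (hq : q.den.Coprime p) :
    q • x ∈ locAt p M := by
  refine mem_locAt_of_nsmul_mem hq ?_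
  rw [← Nat.cast_smul_eq_nsmul ℚ, smul_smul, mul_comm, Rat.mul_den_eq_num, Int.cast_smul_eq_zsmul]
  exact (locAt p M).smul_mem _ hx

end Loc

/-- The localization at `p` of a subring, as a subring. -/
def locRing (p : ℕ) (O : Subring (𝔹 a b)) : Subring (𝔹 a b) where
  carrier := locAt p (subringLattice O)
  zero_mem' := zero_mem _
  add_mem' := add_mem
  neg_mem' := neg_mem
  one_mem' := le_locAt p _ O.one_mem
  mul_mem' := by
    rintro x y ⟨m, hm, hx⟩ ⟨n, hn, hy⟩
    refine ⟨m * n, hm.mul_left hn, ?_⟩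
    have : (m * n) • (x * y) = (m • x) * (n • y) := by
      rw [smul_mul_smul_comm]
    rw [this]
    exact O.mul_mem hx hy

lemma mem_locRing {p : ℕ} {O : Subring (𝔹 a b)} {x : 𝔹 a b} :
    x ∈ locRing p O ↔ x ∈ locAt p (subringLattice O) := Iff.rfl

lemma mem_subringLattice {O : Subring (𝔹 a b)} {x : 𝔹 a b} :
    x ∈ subringLattice O ↔ x ∈ O := Iff.rfl

/-- `y` generates the lattice `I` as a left module over `O`, locally at `p`. -/
def IsLocGen (p : ℕ) (O : Subring (𝔹 a b)) (I : Submodule ℤ (𝔹 a b))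
    (y : (𝔹 a b)ˣ) : Prop :=
  ∀ x, x ∈ locAt p I ↔ x * (↑y⁻¹ : 𝔹 a b) ∈ locRing p O

lemma IsLocGen.mul_mem {p : ℕ} {O : Subring (𝔹 a b)} {I : Submodule ℤ (𝔹 a b)}
    {y : (𝔹 a b)ˣ} (h : IsLocGen p O I y) {u : 𝔹 a b} (hu : u ∈ locRing p O) :
    u * y ∈ locAt p I := (h _).2 (by simpa using hu)

end Quat

/-! ### Rational numbers integral at a prime -/

/-- A rational number is `p`-integral if its denominator is prime to `p`. -/
def PInt (p : ℕ) (q : ℚ) : Prop := q.den.Coprime p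

section PInt

variable {p : ℕ} {q r : ℚ}

lemma PInt.add (hq : PInt p q) (hr : PInt p r) : PInt p (q + r) :=
  Nat.Coprime.coprime_dvd_left (Rat.add_den_dvd q r) (Nat.Coprime.mul_left hq hr)

lemma PInt.neg (hq : PInt p q) : PInt p (-q) := by simpa [PInt] using hq

lemma pInt_intCast (p : ℕ) (k : ℤ) : PInt p (k : ℚ) := by simp [PInt]

lemma pInt_of_mul_eq_intCast {m : ℕ} (hm : m.Coprime p) {k : ℤ} (h : m * q = k) : PInt p q := by
  rcases Nat.eq_zero_or_pos m with rfl | hm0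
  · have : p = 1 := by simpa using hm
    simp [PInt, this]
  have : q = ((k : ℤ) : ℚ) / ((m : ℤ) : ℚ) := by
    rw [← h]; push_cast; field_simp
  refine Nat.Coprime.coprime_dvd_left ?_ hm
  have h2 := Rat.den_dvd k m
  rw [this]
  exact_mod_cast h2

lemma PInt.exists_mul_eq (h : PInt p q) : ∃ m : ℕ, m.Coprime p ∧ ∃ k : ℤ, m * q = k :=
  ⟨q.den, h, q.num, by rw [mul_comm]; exact Rat.mul_den_eq_num q⟩

lemma eq_intCast_of_forall_pInt (h : ∀ p : ℕ, p.Prime → PInt p q) : ∃ k : ℤ, q = k := by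
  have : q.den = 1 := by
    by_contra h1
    obtain ⟨p, hp, hd⟩ := Nat.exists_prime_and_dvd h1
    exact hp.one_lt.ne' (Nat.eq_one_of_dvd_coprimes (h p hp) hd dvd_rfl)
  exact ⟨q.num, (Rat.den_eq_one_iff q).1 this |>.symm⟩

lemma eq_one_of_forall_pInt (h0 : 0 < q) (h : ∀ p : ℕ, p.Prime → PInt p q)
    (h' : ∀ p : ℕ, p.Prime → PInt p q⁻¹) : q = 1 := by
  obtain ⟨k, hk⟩ := eq_intCast_of_forall_pInt h
  obtain ⟨l, hl⟩ := eq_intCast_of_forall_pInt h'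
  have hkl : k * l = 1 := by
    have : (k : ℚ) * l = 1 := by rw [← hk, ← hl, mul_inv_cancel₀ h0.ne']
    exact_mod_cast this
  have hk0 : 0 < k := by rw [hk] at h0; exact_mod_cast h0
  rcases Int.mul_eq_one_iff_eq_one_or_neg_one.1 hkl with h1 | h1
  · rw [hk, h1.1]; simp
  · omega

lemma pInt_iff_padicValRat (hp : p.Prime) : PInt p q ↔ 0 ≤ padicValRat p q := by
  have := Fact.mk hp
  constructor
  · intro h
    have : padicValNat p q.den = 0 := by
      apply padicValNat.eq_zero_of_not_dvd
      intro hd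
      exact hp.one_lt.ne' (Nat.eq_one_of_dvd_coprimes h hd dvd_rfl)
    rw [padicValRat, this]; simp
  · intro h
    by_contra hn
    have hd : p ∣ q.den := by
      by_contra hd
      exact hn ((Nat.Prime.coprime_iff_not_dvd hp).2 hd).symm
    have h1 : padicValInt p q.num = 0 := by
      apply padicValInt.eq_zero_of_not_dvd
      intro hd'
      have := Nat.dvd_gcd (Int.natAbs_dvd_natAbs.2 hd') (by simpa using hd)
      rw [q.reduced] at this
      exact hp.one_lt.ne' (Nat.dvd_one.1 (by simpa using this))
    have h2 : 1 ≤ padicValNat p q.den := one_le_padicValNat_of_dvd q.den_ne_zero hd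
    rw [padicValRat, h1] at h
    simp only [CharP.cast_eq_zero, zero_sub] at h
    have h3 : (1 : ℤ) ≤ padicValNat p q.den := by exact_mod_cast h2
    linarith

lemma padicValRat_eq_zero (hp : p.Prime) (h : PInt p q) (h' : PInt p q⁻¹) :
    padicValRat p q = 0 := by
  have := Fact.mk hp
  have h1 := (pInt_iff_padicValRat hp).1 h
  have h2 := (pInt_iff_padicValRat hp).1 h'
  rw [padicValRat.inv] at h2
  omega

end PInt

/-! ### The gcd of a set of rational numbers -/

/-- A set of rationals with bounded denominators generates a cyclic group. -/
lemma ratGcd_spec {S : Set ℚ} (h : ∃ D : ℕ, D ≠ 0 ∧ ∀ s ∈ S, ∃ k : ℤ, D * s = k) :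
    0 ≤ ratGcd S ∧ AddSubgroup.closure S = AddSubgroup.zmultiples (ratGcd S) := by
  have hex : ∃ r : ℚ, 0 ≤ r ∧ AddSubgroup.closure S = AddSubgroup.zmultiples r := by
    obtain ⟨D, hD, hS⟩ := h
    have hD' : (D : ℚ) ≠ 0 := by exact_mod_cast hD
    let f : ℤ →+ ℚ := (AddMonoidHom.mulLeft ((D : ℚ)⁻¹)).comp (Int.castAddHom ℚ)
    obtain ⟨g, hg⟩ := Int.subgroup_cyclic ((AddSubgroup.closure S).comap f)
    refine ⟨|f g|, abs_nonneg _, ?_⟩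
    have h1 : AddSubgroup.closure S = AddSubgroup.zmultiples (f g) := by
      rw [← AddMonoidHom.map_zmultiples, AddSubgroup.zmultiples_eq_closure, ← hg,
        AddSubgroup.map_comap_eq, eq_comm, inf_eq_right, AddSubgroup.closure_le]
      intro s hs
      obtain ⟨k, hk⟩ := hS s hs
      refine ⟨k, ?_⟩
      simp [f, ← hk, hD']
    rw [h1]
    rcases abs_choice (f g) with h2 | h2 <;> rw [h2]
    rw [AddSubgroup.zmultiples_neg]
  rw [ratGcd, dif_pos hex]
  exact hex.choose_spec

lemma exists_eq_mul_ratGcd {S : Set ℚ} (h : ∃ D : ℕ, D ≠ 0 ∧ ∀ s ∈ S, ∃ k : ℤ, D * s = k)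
    {s : ℚ} (hs : s ∈ S) : ∃ k : ℤ, s = k * ratGcd S := by
  have h1 : s ∈ AddSubgroup.zmultiples (ratGcd S) := by
    rw [← (ratGcd_spec h).2]; exact AddSubgroup.subset_closure hs
  obtain ⟨k, hk⟩ := AddSubgroup.mem_zmultiples_iff.1 h1
  exact ⟨k, by rw [← hk]; simp⟩

lemma ratGcd_induction {S : Set ℚ} (h : ∃ D : ℕ, D ≠ 0 ∧ ∀ s ∈ S, ∃ k : ℤ, D * s = k)
    {P : ℚ → Prop} (hS : ∀ s ∈ S, P s) (h0 : P 0) (hadd : ∀ x y, P x → P y → P (x + y))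
    (hneg : ∀ x, P x → P (-x)) : P (ratGcd S) := by
  have h1 : ratGcd S ∈ AddSubgroup.closure S := by
    rw [(ratGcd_spec h).2]; exact AddSubgroup.mem_zmultiples _
  exact AddSubgroup.closure_induction (p := fun x _ => P x) (fun x hx => hS x hx) h0
    (fun x y _ _ => hadd x y) (fun x _ => hneg x) h1

/-! ### Norms of lattices and integrality of orders -/

section Quat

variable {a b : ℚ}

/-- The coordinates of the elements of a finitely generated lattice have bounded denominators. -/
lemma exists_coord_denom {M : Submodule ℤ (𝔹 a b)} (hM : M.FG) :
    ∃ D : ℕ, D ≠ 0 ∧ ∀ x ∈ M, (∃ k : ℤ, D * x.re = k) ∧ (∃ k : ℤ, D * x.imI = k) ∧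
      (∃ k : ℤ, D * x.imJ = k) ∧ (∃ k : ℤ, D * x.imK = k) := by
  induction M, hM using Submodule.fg_induction with
  | singleton x =>
    refine ⟨x.re.den * x.imI.den * x.imJ.den * x.imK.den, by simp, fun y hy => ?_⟩
    obtain ⟨c, rfl⟩ := Submodule.mem_span_singleton.1 hy
    have key : ∀ q : ℚ, ∃ k : ℤ, (q.den : ℚ) * q = k := fun q => ⟨q.num, by
      rw [mul_comm]; exact Rat.mul_den_eq_num q⟩
    obtain ⟨k1, h1⟩ := key x.re
    obtain ⟨k2, h2⟩ := key x.imI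
    obtain ⟨k3, h3⟩ := key x.imJ
    obtain ⟨k4, h4⟩ := key x.imK
    refine ⟨⟨c * k1 * x.imI.den * x.imJ.den * x.imK.den, ?_⟩,
      ⟨c * k2 * x.re.den * x.imJ.den * x.imK.den, ?_⟩,
      ⟨c * k3 * x.re.den * x.imI.den * x.imK.den, ?_⟩,
      ⟨c * k4 * x.re.den * x.imI.den * x.imJ.den, ?_⟩⟩
    · push_cast; rw [← h1, QuaternionAlgebra.re_smul, zsmul_eq_mul]; ring
    · push_cast; rw [← h2, QuaternionAlgebra.imI_smul, zsmul_eq_mul]; ring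
    · push_cast; rw [← h3, QuaternionAlgebra.imJ_smul, zsmul_eq_mul]; ring
    · push_cast; rw [← h4, QuaternionAlgebra.imK_smul, zsmul_eq_mul]; ring
  | sup N₁ N₂ _ _ h₁ h₂ =>
    obtain ⟨D, hD, h⟩ := h₁
    obtain ⟨E, hE, h'⟩ := h₂
    refine ⟨D * E, mul_ne_zero hD hE, fun z hz => ?_⟩
    obtain ⟨x, hx, y, hy, rfl⟩ := Submodule.mem_sup.1 hz
    obtain ⟨⟨k1, h1⟩, ⟨k2, h2⟩, ⟨k3, h3⟩, ⟨k4, h4⟩⟩ := h x hx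
    obtain ⟨⟨l1, g1⟩, ⟨l2, g2⟩, ⟨l3, g3⟩, ⟨l4, g4⟩⟩ := h' y hy
    refine ⟨⟨E * k1 + D * l1, ?_⟩, ⟨E * k2 + D * l2, ?_⟩, ⟨E * k3 + D * l3, ?_⟩,
      ⟨E * k4 + D * l4, ?_⟩⟩
    · push_cast; rw [← h1, ← g1]; simp; ring
    · push_cast; rw [← h2, ← g2]; simp; ring
    · push_cast; rw [← h3, ← g3]; simp; ring
    · push_cast; rw [← h4, ← g4]; simp; ring

lemma exists_nrd_denom {M : Submodule ℤ (𝔹 a b)} (hM : M.FG) :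
    ∃ D : ℕ, D ≠ 0 ∧ ∀ s ∈ nrd '' (M : Set (𝔹 a b)), ∃ k : ℤ, D * s = k := by
  obtain ⟨D, hD, h⟩ := exists_coord_denom hM
  refine ⟨D ^ 2 * a.den * b.den, by simp [hD], ?_⟩
  rintro _ ⟨x, hx, rfl⟩
  obtain ⟨⟨k1, h1⟩, ⟨k2, h2⟩, ⟨k3, h3⟩, ⟨k4, h4⟩⟩ := h x hx
  have e1 : (a.den : ℚ) * a = a.num := by rw [mul_comm]; exact Rat.mul_den_eq_num a
  have e2 : (b.den : ℚ) * b = b.num := by rw [mul_comm]; exact Rat.mul_den_eq_num b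
  refine ⟨k1 ^ 2 * a.den * b.den - a.num * b.den * k2 ^ 2 - b.num * a.den * k3 ^ 2
    + a.num * b.num * k4 ^ 2, ?_⟩
  rw [nrd_eq]
  push_cast
  rw [← h1, ← h2, ← h3, ← h4, ← e1, ← e2]
  ring

lemma nrd_mem_latticeNorm {M : Submodule ℤ (𝔹 a b)} (hM : M.FG) {x : 𝔹 a b}
    (hx : x ∈ M) : ∃ k : ℤ, nrd x = k * latticeNorm (M : Set (𝔹 a b)) :=
  exists_eq_mul_ratGcd (exists_nrd_denom hM) ⟨x, hx, rfl⟩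

/-- A rational whose powers have bounded denominators is an integer. -/
lemma eq_intCast_of_pow_denom {q : ℚ} {D : ℕ} (hD : D ≠ 0) (h : ∀ n : ℕ, ∃ k : ℤ, D * q ^ n = k) :
    ∃ k : ℤ, q = k := by
  have h1 : ∀ n : ℕ, q.den ^ n ∣ D := by
    intro n
    obtain ⟨k, hk⟩ := h n
    have hD' : (D : ℚ) ≠ 0 := by exact_mod_cast hD
    have : q ^ n = ((k : ℤ) : ℚ) / ((D : ℤ) : ℚ) := by rw [← hk]; push_cast; field_simp
    have h2 := Rat.den_dvd k D
    rw [Rat.divInt_eq_div, ← this, Rat.den_pow] at h2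
    exact_mod_cast h2
  have h2 : q.den = 1 := by
    by_contra hne
    have h3 : 2 ≤ q.den := by have := q.den_pos; omega
    have h4 := Nat.le_of_dvd (Nat.pos_of_ne_zero hD) (h1 D)
    have h5 : D < 2 ^ D := Nat.lt_two_pow_self
    have h6 : 2 ^ D ≤ q.den ^ D := Nat.pow_le_pow_left h3 D
    omega
  exact ⟨q.num, ((Rat.den_eq_one_iff q).1 h2).symm⟩

variable {O : Subring (𝔹 a b)}

lemma IsOrder.fg (hO : IsOrder O) : (subringLattice O).FG := by
  have : Submodule.IsLattice ℚ (subringLattice O) := hO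
  exact this.fg

lemma IsOrder.nrd_int (hO : IsOrder O) {x : 𝔹 a b} (hx : x ∈ O) : ∃ k : ℤ, nrd x = k := by
  obtain ⟨D, hD, h⟩ := exists_nrd_denom hO.fg
  refine eq_intCast_of_pow_denom hD fun n => ?_
  -- the powers of `x` lie in `O`, so that the powers of its norm have bounded denominators
  have h1 : nrd (x ^ n) = nrd x ^ n := by
    induction n with
    | zero => simp [nrd_one]
    | succ n ih => rw [pow_succ, nrd_mul, ih, pow_succ]
  rw [← h1]
  exact h _ ⟨x ^ n, O.pow_mem hx n, rfl⟩

lemma IsOrder.trd_int (hO : IsOrder O) {x : 𝔹 a b} (hx : x ∈ O) : ∃ k : ℤ, trd x = k := by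
  obtain ⟨k, hk⟩ := hO.nrd_int hx
  obtain ⟨l, hl⟩ := hO.nrd_int (O.add_mem hx O.one_mem)
  refine ⟨l - k - 1, ?_⟩
  have := nrd_add x 1
  rw [star_one, mul_one, nrd_one, hl, hk] at this
  push_cast
  linarith

lemma IsOrder.star_mem (hO : IsOrder O) {x : 𝔹 a b} (hx : x ∈ O) : star x ∈ O := by
  obtain ⟨k, hk⟩ := hO.trd_int hx
  rw [star_eq_sub, hk, Int.cast_smul_eq_zsmul]
  exact O.sub_mem (O.zsmul_mem O.one_mem k) hx

lemma IsOrder.nrd_pInt (hO : IsOrder O) {p : ℕ} {x : 𝔹 a b} (hx : x ∈ locRing p O) :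
    PInt p (nrd x) := by
  obtain ⟨m, hm, hx⟩ := hx
  obtain ⟨k, hk⟩ := hO.nrd_int hx
  rw [← Nat.cast_smul_eq_nsmul ℚ, nrd_smul] at hk
  exact pInt_of_mul_eq_intCast (hm.pow_left 2) (k := k) (by exact_mod_cast hk)

lemma IsOrder.star_mem_locRing (hO : IsOrder O) {p : ℕ} {x : 𝔹 a b} (hx : x ∈ locRing p O) :
    star x ∈ locRing p O := by
  obtain ⟨m, hm, hx⟩ := hx
  refine ⟨m, hm, ?_⟩
  have := hO.star_mem hx
  rwa [star_nsmul] at this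

/-- A unit of the localized order is an element whose norm is a unit at `p`. -/
lemma IsOrder.inv_mem_locRing (hO : IsOrder O) {p : ℕ} {y : (𝔹 a b)ˣ}
    (hy : (y : 𝔹 a b) ∈ locRing p O) (h : PInt p (nrd (y : 𝔹 a b))⁻¹) :
    (↑y⁻¹ : 𝔹 a b) ∈ locRing p O := by
  rw [unit_inv_eq]
  exact ratSmul_mem_locAt (hO.star_mem_locRing hy) h

section LocGen

variable {I : Submodule ℤ (𝔹 a b)} {p : ℕ} {y : (𝔹 a b)ˣ}

lemma IsLocGen.self_mem (h : IsLocGen p O I y) : (y : 𝔹 a b) ∈ locAt p I := by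
  simpa using h.mul_mem (one_mem _)

lemma IsLocGen.nrd_pInt (hO : IsOrder O) (h : IsLocGen p O I y) {x : 𝔹 a b}
    (hx : x ∈ I) : PInt p (nrd x / nrd (y : 𝔹 a b)) := by
  have h1 := hO.nrd_pInt ((h x).1 (le_locAt p I hx))
  rwa [nrd_mul, nrd_unit_inv, ← div_eq_mul_inv] at h1

lemma latticeNorm_pos (hI : I.FG) (h : IsLocGen p O I y) (hp : p.Prime) :
    0 < latticeNorm (I : Set (𝔹 a b)) := by
  refine lt_of_le_of_ne (ratGcd_spec (exists_nrd_denom hI)).1 ?_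
  intro h0
  obtain ⟨m, hm, hx⟩ := h.self_mem
  obtain ⟨k, hk⟩ := nrd_mem_latticeNorm hI hx
  rw [← h0, mul_zero, ← Nat.cast_smul_eq_nsmul ℚ, nrd_smul] at hk
  have hm0 : (m : ℚ) ≠ 0 := by
    rintro h1
    have : m = 0 := by exact_mod_cast h1
    subst this
    exact hp.one_lt.ne' (by simpa using hm)
  exact (mul_ne_zero (pow_ne_zero 2 hm0) (nrd_unit_ne_zero y)) hk

/-- The norm of a locally principal lattice is, up to units at `p`, the reduced norm of a local
generator. -/
lemma padicValRat_latticeNorm (hO : IsOrder O) (hI : I.FG) (h : IsLocGen p O I y) (hp : p.Prime) :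
    padicValRat p (latticeNorm (I : Set (𝔹 a b))) =
      padicValRat p (nrd (y : 𝔹 a b)) := by
  have := Fact.mk hp
  have hpos := latticeNorm_pos hI h hp
  have hy := nrd_unit_ne_zero y
  have h1 : PInt p (latticeNorm (I : Set (𝔹 a b)) / nrd (y : 𝔹 a b)) := by
    refine ratGcd_induction (P := fun g => PInt p (g / nrd (y : 𝔹 a b)))
      (exists_nrd_denom hI) ?_ ?_ ?_ ?_
    · rintro _ ⟨x, hx, rfl⟩
      exact h.nrd_pInt hO hx
    · simpa using pInt_intCast p 0
    · intro x z hx hz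
      rw [add_div]; exact hx.add hz
    · intro x hx
      rw [neg_div]; exact hx.neg
  have h2 : PInt p (latticeNorm (I : Set (𝔹 a b)) / nrd (y : 𝔹 a b))⁻¹ := by
    obtain ⟨m, hm, hx⟩ := h.self_mem
    obtain ⟨k, hk⟩ := nrd_mem_latticeNorm hI hx
    rw [← Nat.cast_smul_eq_nsmul ℚ, nrd_smul] at hk
    refine pInt_of_mul_eq_intCast (hm.pow_left 2) (k := k) ?_
    push_cast
    rw [inv_div]
    field_simp
    rw [hk, mul_comm]
  have := padicValRat_eq_zero hp h1 h2
  rw [padicValRat.div hpos.ne' hy] at this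
  omega

end LocGen

end Quat

/-! ### Local generators: from the completion to the localization -/

section Quat

variable {a b : ℚ}

section Bridge

variable (p : ℕ) [hp : Fact p.Prime]

/-- The embedding into the completion at `p` as a ring homomorphism. -/
def localEmbHom : 𝔹 a b →+* QuatAlg ℚ_[p] (a : ℚ_[p]) (b : ℚ_[p]) where
  toFun := localEmb p
  map_one' := by ext <;> simp [localEmb]
  map_zero' := by ext <;> simp [localEmb]
  map_add' x y := by ext <;> simp [localEmb]
  map_mul' x y := by ext <;> simp [localEmb]

lemma localEmbHom_apply (x : 𝔹 a b) : localEmbHom p x = localEmb p x := rfl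

lemma localEmbHom_mem {M : Submodule ℤ (𝔹 a b)} {x : 𝔹 a b} (hx : x ∈ M) :
    localEmbHom p x ∈ localization p M :=
  Submodule.subset_span ⟨x, hx, rfl⟩

lemma padic_smul_re (c : ℤ_[p]) (x : QuatAlg ℚ_[p] (a : ℚ_[p]) (b : ℚ_[p])) :
    (c • x).re = c * x.re := rfl

lemma padic_smul_imI (c : ℤ_[p]) (x : QuatAlg ℚ_[p] (a : ℚ_[p]) (b : ℚ_[p])) :
    (c • x).imI = c * x.imI := rfl

lemma padic_smul_imJ (c : ℤ_[p]) (x : QuatAlg ℚ_[p] (a : ℚ_[p]) (b : ℚ_[p])) :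
    (c • x).imJ = c * x.imJ := rfl

lemma padic_smul_imK (c : ℤ_[p]) (x : QuatAlg ℚ_[p] (a : ℚ_[p]) (b : ℚ_[p])) :
    (c • x).imK = c * x.imK := rfl

lemma natCast_smul_padic (n : ℕ) (x : QuatAlg ℚ_[p] (a : ℚ_[p]) (b : ℚ_[p])) :
    (n : ℤ_[p]) • x = n • x := by
  rw [Nat.cast_smul_eq_nsmul]

variable {p}

lemma localEmbHom_mem_of_mem_locAt {M : Submodule ℤ (𝔹 a b)} {x : 𝔹 a b}
    (hx : x ∈ locAt p M) : localEmbHom p x ∈ localization p M := by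
  obtain ⟨m, hm, hx⟩ := hx
  have h1 := localEmbHom_mem p hx
  rw [map_nsmul, ← natCast_smul_padic] at h1
  have hu : IsUnit (m : ℤ_[p]) := by
    rw [PadicInt.isUnit_iff]
    by_contra hne
    have hlt : ‖((m : ℤ) : ℤ_[p])‖ < 1 := lt_of_le_of_ne (PadicInt.norm_le_one _) (by simpa using hne)
    rw [PadicInt.norm_int_lt_one_iff_dvd] at hlt
    have h2 : p ∣ m := by exact_mod_cast hlt
    exact hp.out.one_lt.ne' (Nat.eq_one_of_dvd_coprimes hm h2 dvd_rfl)
  obtain ⟨u, hu⟩ := hu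
  rw [← hu] at h1
  have h3 := (localization p M).smul_mem (↑u⁻¹ : ℤ_[p]) h1
  rwa [smul_smul, Units.inv_mul, one_smul] at h3

/-- A linear functional that is integral on a lattice extends to one that is integral on its
localization. -/
lemma functional_integral {M : Submodule ℤ (𝔹 a b)} (c : Fin 4 → ℚ)
    (hc : ∀ x ∈ M, ∃ k : ℤ, c 0 * x.re + c 1 * x.imI + c 2 * x.imJ + c 3 * x.imK = k)
    {z : QuatAlg ℚ_[p] (a : ℚ_[p]) (b : ℚ_[p])} (hz : z ∈ localization p M) :
    ‖(c 0 : ℚ_[p]) * z.re + c 1 * z.imI + c 2 * z.imJ + c 3 * z.imK‖ ≤ 1 := by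
  suffices h : ∃ k : ℤ_[p], (c 0 : ℚ_[p]) * z.re + c 1 * z.imI + c 2 * z.imJ + c 3 * z.imK = k by
    obtain ⟨k, hk⟩ := h
    rw [hk]; exact k.2
  induction hz using Submodule.span_induction with
  | mem z h =>
    obtain ⟨x, hx, rfl⟩ := h
    obtain ⟨k, hk⟩ := hc x hx
    refine ⟨k, ?_⟩
    have : (((c 0 * x.re + c 1 * x.imI + c 2 * x.imJ + c 3 * x.imK : ℚ)) : ℚ_[p]) = ((k : ℚ) : ℚ_[p]) := by
      rw [hk]
    push_cast at this
    simpa [localEmb] using this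
  | zero => exact ⟨0, by simp⟩
  | add x y _ _ hx hy =>
    obtain ⟨k, hk⟩ := hx
    obtain ⟨l, hl⟩ := hy
    refine ⟨k + l, ?_⟩
    push_cast
    rw [← hk, ← hl]
    simp only [QuaternionAlgebra.re_add, QuaternionAlgebra.imI_add, QuaternionAlgebra.imJ_add,
      QuaternionAlgebra.imK_add]
    ring
  | smul r x _ hx =>
    obtain ⟨k, hk⟩ := hx
    refine ⟨r * k, ?_⟩
    push_cast
    rw [← hk, padic_smul_re, padic_smul_imI, padic_smul_imJ, padic_smul_imK]
    ring

/-- A `ℤ`-basis of a lattice in the quaternion algebra. -/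
lemma exists_basis (M : Submodule ℤ (𝔹 a b)) [Submodule.IsLattice ℚ M] :
    Nonempty (Module.Basis (Fin 4) ℤ M) := by
  have : Module.Free ℤ M := Submodule.IsLattice.free ℚ M
  have h1 : Module.finrank ℤ M = 4 := by
    have h2 := Submodule.IsLattice.rank' ℚ M
    have h3 : Module.finrank ℤ M = Module.finrank ℚ (𝔹 a b) := by
      rw [Module.finrank, Module.finrank, h2]
    rw [h3]
    exact QuaternionAlgebra.finrank_eq_four a 0 b
  exact ⟨Module.finBasisOfFinrankEq ℤ M h1⟩

lemma linearMap_eq_coord (f : 𝔹 a b →ₗ[ℚ] ℚ) :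
    ∃ c : Fin 4 → ℚ, ∀ x, f x = c 0 * x.re + c 1 * x.imI + c 2 * x.imJ + c 3 * x.imK := by
  refine ⟨![f ⟨1, 0, 0, 0⟩, f ⟨0, 1, 0, 0⟩, f ⟨0, 0, 1, 0⟩, f ⟨0, 0, 0, 1⟩], fun x => ?_⟩
  have : x = x.re • (⟨1, 0, 0, 0⟩ : 𝔹 a b) + x.imI • (⟨0, 1, 0, 0⟩ : 𝔹 a b)
      + x.imJ • (⟨0, 0, 1, 0⟩ : 𝔹 a b) + x.imK • (⟨0, 0, 0, 1⟩ : 𝔹 a b) := by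
    ext <;> simp
  conv_lhs => rw [this]
  simp only [map_add, map_smul, smul_eq_mul]
  simp [mul_comm]

/-- Membership in the localization can be tested in the completion. -/
lemma mem_locAt_of_localEmbHom_mem {M : Submodule ℤ (𝔹 a b)} [Submodule.IsLattice ℚ M]
    {x : 𝔹 a b} (hx : localEmbHom p x ∈ localization p M) : x ∈ locAt p M := by
  obtain ⟨B⟩ := exists_basis M
  let B' := B.extendOfIsLattice ℚ
  have hcoord : ∀ i, (B'.repr x i).den.Coprime p := by
    intro i
    obtain ⟨c, hc⟩ := linearMap_eq_coord (B'.coord i)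
    have h1 : ∀ v ∈ M, ∃ k : ℤ, c 0 * v.re + c 1 * v.imI + c 2 * v.imJ + c 3 * v.imK = k := by
      intro v hv
      refine ⟨B.repr ⟨v, hv⟩ i, ?_⟩
      rw [← hc]
      have h2 : v = ∑ j, (B.repr ⟨v, hv⟩ j : ℚ) • B' j := by
        have := congrArg (fun w : M => (w : 𝔹 a b)) (B.sum_repr ⟨v, hv⟩)
        simp only [Submodule.coe_sum, Submodule.coe_smul] at this
        refine this.symm.trans ?_
        simp [B', Int.cast_smul_eq_zsmul]
      conv_lhs => rw [h2]
      simp [Finsupp.single_apply]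
    have h2 := functional_integral c h1 hx
    have h3 : (c 0 : ℚ_[p]) * (localEmbHom p x).re + c 1 * (localEmbHom p x).imI
        + c 2 * (localEmbHom p x).imJ + c 3 * (localEmbHom p x).imK = ((B'.repr x i : ℚ) : ℚ_[p]) := by
      rw [← B'.coord_apply, hc]
      push_cast
      rfl
    rw [h3] at h2
    have h4 := PadicInt.isUnit_den _ h2
    rw [Nat.coprime_comm, Nat.Prime.coprime_iff_not_dvd hp.out]
    intro hd
    rw [PadicInt.isUnit_iff] at h4
    have h5 : ‖(((B'.repr x i).den : ℤ) : ℤ_[p])‖ < 1 := by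
      rw [PadicInt.norm_int_lt_one_iff_dvd]; exact_mod_cast hd
    rw [Int.cast_natCast, h4] at h5
    exact lt_irrefl _ h5
  rw [← B'.sum_repr x]
  refine Submodule.sum_mem _ fun i _ => ratSmul_mem_locAt ?_ (hcoord i)
  refine le_locAt p M ?_
  simp [B']

/-- Elements of the completion are congruent modulo `p` to elements of the lattice. -/
lemma exists_approx {M : Submodule ℤ (𝔹 a b)}
    {z : QuatAlg ℚ_[p] (a : ℚ_[p]) (b : ℚ_[p])} (hz : z ∈ localization p M) :
    ∃ y ∈ M, ∃ w ∈ localization p M, z = localEmbHom p y + (p : ℤ_[p]) • w := by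
  induction hz using Submodule.span_induction with
  | mem z h =>
    obtain ⟨x, hx, rfl⟩ := h
    exact ⟨x, hx, 0, zero_mem _, by simp [localEmbHom_apply]⟩
  | zero => exact ⟨0, zero_mem _, 0, zero_mem _, by simp⟩
  | add x y _ _ hx hy =>
    obtain ⟨k, hk, w, hw, rfl⟩ := hx
    obtain ⟨l, hl, v, hv, rfl⟩ := hy
    exact ⟨k + l, add_mem hk hl, w + v, add_mem hw hv, by rw [map_add, smul_add]; abel⟩
  | smul r x hx' hx =>
    obtain ⟨k, hk, w, hw, rfl⟩ := hx
    obtain ⟨n, hn⟩ : ∃ n : ℕ, r - n ∈ Ideal.span {(p : ℤ_[p])} :=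
      ⟨r.zmodRepr, by rw [← PadicInt.maximalIdeal_eq_span_p]; exact PadicInt.sub_zmodRepr_mem r⟩
    obtain ⟨c, hc⟩ := Ideal.mem_span_singleton.1 hn
    have hr : r = n + p * c := by rw [← hc]; ring
    refine ⟨n • k, M.smul_of_tower_mem n hk, c • localEmbHom p k + r • w,
      add_mem ((localization p M).smul_mem _ (localEmbHom_mem p hk))
        ((localization p M).smul_mem _ hw), ?_⟩
    rw [map_nsmul, ← natCast_smul_padic, smul_add, smul_add, ← add_assoc, smul_smul, smul_smul,
      smul_smul, ← add_smul, ← hr, mul_comm r]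

lemma localization_mul_mem {O : Subring (𝔹 a b)}
    {u v : QuatAlg ℚ_[p] (a : ℚ_[p]) (b : ℚ_[p])} (hu : u ∈ localization p (subringLattice O))
    (hv : v ∈ localization p (subringLattice O)) : u * v ∈ localization p (subringLattice O) := by
  induction hu using Submodule.span_induction with
  | mem u h =>
    obtain ⟨x, hx, rfl⟩ := h
    induction hv using Submodule.span_induction with
    | mem v h =>
      obtain ⟨y, hy, rfl⟩ := h
      rw [← localEmbHom_apply, ← localEmbHom_apply, ← map_mul]
      exact localEmbHom_mem p (O.mul_mem hx hy)
    | zero => simp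
    | add v w _ _ hv hw => rw [mul_add]; exact add_mem hv hw
    | smul r v _ hv => rw [mul_smul_comm]; exact Submodule.smul_mem _ _ hv
  | zero => simp
  | add v w _ _ hv hw => rw [add_mul]; exact add_mem hv hw
  | smul r v _ hv => rw [smul_mul_assoc]; exact Submodule.smul_mem _ _ hv

/-- A left ideal is generated, locally at `p`, by one of its elements: approximate a generator of
the completion modulo `p` and apply Nakayama's lemma. -/
lemma LeftIdeal.exists_isLocGen [Fact (a < 0)] [Fact (b < 0)] {O : Subring (𝔹 a b)}
    (hO : IsOrder O) (I : LeftIdeal O) (p : ℕ) (hp : p.Prime) :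
    ∃ y : (𝔹 a b)ˣ, (y : 𝔹 a b) ∈ I.lattice ∧ IsLocGen p O I.lattice y := by
  have := Fact.mk hp
  have := I.isLattice
  have hO' : Submodule.IsLattice ℚ (subringLattice O) := hO
  set M := I.lattice with hM
  set OP := localization p (subringLattice O) with hOP
  obtain ⟨x, hx⟩ := I.locally_principal p
  have hMx : ∀ z, z ∈ localization p M ↔ ∃ u ∈ OP, u * x = z := by
    intro z
    rw [← SetLike.mem_coe, hx]; rfl
  have hone : (1 : QuatAlg ℚ_[p] (a : ℚ_[p]) (b : ℚ_[p])) ∈ OP := by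
    rw [← map_one (localEmbHom p)]
    exact localEmbHom_mem p O.one_mem
  have hmul : ∀ u ∈ OP, ∀ z ∈ localization p M, u * z ∈ localization p M := by
    intro u hu z hz
    obtain ⟨v, hv, rfl⟩ := (hMx z).1 hz
    exact (hMx _).2 ⟨u * v, localization_mul_mem hu hv, by rw [mul_assoc]⟩
  obtain ⟨y, hy, w, hw, hxy⟩ := exists_approx ((hMx x).2 ⟨1, hone, one_mul _⟩)
  let N : Submodule ℤ (𝔹 a b) := latticeMul (subringLattice O) y
  have hN : ∀ z, z ∈ N ↔ ∃ o ∈ O, o * y = z := fun z => by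
    simp only [N, latticeMul, Submodule.mem_map, LinearMap.mulRight_apply, mem_subringLattice]
  have hNM : N ≤ locAt p M := by
    intro z hz
    obtain ⟨o, ho, rfl⟩ := (hN z).1 hz
    refine mem_locAt_of_localEmbHom_mem ?_
    rw [map_mul]
    exact hmul _ (localEmbHom_mem p ho) _ (localEmbHom_mem p hy)
  -- every element of `M` is congruent to an element of `O y` modulo `p`
  have hcong : ∀ v ∈ M, ∃ n ∈ N, ∃ v' ∈ locAt p M, v = n + p • v' := by
    intro v hv
    obtain ⟨u, hu, huv⟩ := (hMx _).1 (localEmbHom_mem p hv)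
    obtain ⟨o, ho, u', hu', rfl⟩ := exists_approx hu
    refine ⟨o * y, (hN _).2 ⟨o, ho, rfl⟩, ((p : ℚ)⁻¹) • (v - o * y), ?_, ?_⟩
    · refine mem_locAt_of_localEmbHom_mem ?_
      have h1 : localEmbHom p (v - o * y) = (p : ℤ_[p]) • (u' * x + localEmbHom p o * w) := by
        rw [map_sub, ← huv, map_mul]
        have h2 : localEmbHom p y = x - (p : ℤ_[p]) • w := by rw [hxy]; abel
        rw [h2, add_mul, mul_sub, smul_mul_assoc, mul_smul_comm, smul_add]
        abel
      have h3 : localEmbHom p ((p : ℚ)⁻¹ • (v - o * y)) = u' * x + localEmbHom p o * w := by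
        have h4 : (p : ℤ_[p]) • localEmbHom p ((p : ℚ)⁻¹ • (v - o * y))
            = (p : ℤ_[p]) • (u' * x + localEmbHom p o * w) := by
          rw [← h1, natCast_smul_padic, ← map_nsmul, ← Nat.cast_smul_eq_nsmul ℚ, smul_smul,
            mul_inv_cancel₀ (by exact_mod_cast hp.ne_zero), one_smul]
        have hp0 : (p : ℚ_[p]) ≠ 0 := by exact_mod_cast hp.ne_zero
        ext
        · have := congrArg QuaternionAlgebra.re h4
          simp only [padic_smul_re, PadicInt.coe_natCast] at this
          exact mul_left_cancel₀ hp0 this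
        · have := congrArg QuaternionAlgebra.imI h4
          simp only [padic_smul_imI, PadicInt.coe_natCast] at this
          exact mul_left_cancel₀ hp0 this
        · have := congrArg QuaternionAlgebra.imJ h4
          simp only [padic_smul_imJ, PadicInt.coe_natCast] at this
          exact mul_left_cancel₀ hp0 this
        · have := congrArg QuaternionAlgebra.imK h4
          simp only [padic_smul_imK, PadicInt.coe_natCast] at this
          exact mul_left_cancel₀ hp0 this
      rw [h3]
      exact add_mem ((hMx _).2 ⟨u', hu', rfl⟩) (hmul _ (localEmbHom_mem p ho) _ hw)
    · rw [← Nat.cast_smul_eq_nsmul ℚ, smul_smul, mul_inv_cancel₀ (by exact_mod_cast hp.ne_zero),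
        one_smul]
      abel
  -- Nakayama
  have hMfg : M.FG := Submodule.IsLattice.fg
  have hle : M ⊔ N ≤ N ⊔ (Ideal.span {(p : ℤ)}) • (M ⊔ N) := by
    refine sup_le (fun v hv => ?_) le_sup_left
    obtain ⟨n, hn, v', ⟨m, hm, hv'⟩, hvn⟩ := hcong v hv
    obtain ⟨s, t, hst⟩ := Nat.isCoprime_iff_coprime.2 hm
    have hvv : v = s • (m • n) + (p : ℤ) • (s • (m • v') + t • v) := by
      have h1 : m • v = m • n + p • (m • v') := by
        rw [hvn, smul_add, smul_comm m p]
      calc v = (s * m + t * p : ℤ) • v := by rw [hst, one_smul]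
        _ = s • (m • v) + (p : ℤ) • (t • v) := by
            rw [add_smul, mul_smul, mul_comm t, mul_smul, natCast_zsmul]
        _ = _ := by
            rw [h1, smul_add, smul_add, natCast_zsmul, natCast_zsmul, smul_comm s p, add_assoc]
    rw [hvv]
    refine Submodule.add_mem_sup (N.smul_mem s (N.smul_of_tower_mem m hn)) ?_
    exact Submodule.smul_mem_smul (Ideal.mem_span_singleton_self _)
      (add_mem (le_sup_left (a := M) (M.smul_mem _ hv')) (le_sup_left (a := M) (M.smul_mem _ hv)))
  obtain ⟨r, hr, hrN⟩ := Submodule.exists_sub_one_mem_and_smul_le_of_fg_of_le_sup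
    (hMfg.sup (hO.fg.map _)) le_rfl hle
  have hrp : IsCoprime r (p : ℤ) := by
    obtain ⟨c, hc⟩ := Ideal.mem_span_singleton.1 hr
    exact ⟨1, -c, by linarith⟩
  have hMN : M ≤ locAt p N := fun v hv => by
    refine mem_locAt_of_zsmul_mem hrp (le_locAt p N (hrN ?_))
    exact Submodule.smul_mem_pointwise_smul v r _ (le_sup_left (a := M) hv)
  have hy0 : y ≠ 0 := by
    rintro rfl
    have hN0 : N = ⊥ := by
      rw [eq_bot_iff]; intro z hz
      obtain ⟨o, -, rfl⟩ := (hN z).1 hz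
      simp
    have hM0 : M = ⊥ := by
      rw [eq_bot_iff]; intro z hz
      obtain ⟨m, hm, hz⟩ := hMN hz
      rw [hN0, Submodule.mem_bot, ← Nat.cast_smul_eq_nsmul ℚ] at hz
      rcases smul_eq_zero.1 hz with h | h
      · have : m = 0 := by exact_mod_cast h
        subst this
        exact absurd (by simpa using hm) hp.one_lt.ne'
      · exact h
    have h1 : Submodule.span ℚ (M : Set (𝔹 a b)) = ⊤ := Submodule.IsLattice.span_eq_top
    rw [hM0] at h1
    have h2 : (1 : 𝔹 a b) ∈ Submodule.span ℚ ((⊥ : Submodule ℤ (𝔹 a b)) : Set (𝔹 a b)) := by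
      rw [h1]; trivial
    simp at h2
  refine ⟨unitOfNrd y (nrd_ne_zero hy0), hy, fun z => ?_⟩
  have h1 : z ∈ locAt p M ↔ z ∈ locAt p N :=
    ⟨fun h => locAt_le_of_le_locAt hMN h, fun h => locAt_le_of_le_locAt hNM h⟩
  rw [h1, mem_locRing]
  constructor
  · rintro ⟨m, hm, hz⟩
    obtain ⟨o, ho, hoz⟩ := (hN _).1 hz
    refine ⟨m, hm, ?_⟩
    rw [← smul_mul_assoc, ← hoz]
    have : o * y = o * (unitOfNrd y (nrd_ne_zero hy0) : (𝔹 a b)ˣ) := rfl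
    rw [this, Units.mul_inv_cancel_right]
    exact ho
  · rintro ⟨m, hm, hz⟩
    refine ⟨m, hm, (hN _).2 ⟨_, hz, ?_⟩⟩
    have : ∀ o, o * y = o * (unitOfNrd y (nrd_ne_zero hy0) : (𝔹 a b)ˣ) := fun _ => rfl
    rw [this, smul_mul_assoc, Units.inv_mul_cancel_right]

/-- Conversely, a full lattice with local generators at all primes is a left ideal. -/
def LeftIdeal.ofLocGen {O : Subring (𝔹 a b)} (M : Submodule ℤ (𝔹 a b))
    (hM : Submodule.IsLattice ℚ M)
    (h : ∀ p : ℕ, p.Prime → ∃ y : (𝔹 a b)ˣ, IsLocGen p O M y) : LeftIdeal O where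
  lattice := M
  isLattice := hM
  locally_principal p hp := by
    obtain ⟨y, hy⟩ := h p hp.out
    refine ⟨Units.map (localEmbHom p).toMonoidHom y, ?_⟩
    ext z
    simp only [SetLike.mem_coe, Set.mem_image, Units.coe_map, RingHom.toMonoidHom_eq_coe,
      MonoidHom.coe_coe]
    constructor
    · intro hz
      induction hz using Submodule.span_induction with
      | mem z h =>
        obtain ⟨x, hx, rfl⟩ := h
        refine ⟨localEmbHom p (x * (↑y⁻¹ : 𝔹 a b)),
          localEmbHom_mem_of_mem_locAt ((hy x).1 (le_locAt p M hx)), ?_⟩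
        rw [← map_mul, Units.inv_mul_cancel_right]; rfl
      | zero => exact ⟨0, zero_mem _, by simp⟩
      | add u v _ _ hu hv =>
        obtain ⟨u, hu, rfl⟩ := hu
        obtain ⟨v, hv, rfl⟩ := hv
        exact ⟨u + v, add_mem hu hv, by rw [add_mul]⟩
      | smul r u _ hu =>
        obtain ⟨u, hu, rfl⟩ := hu
        exact ⟨r • u, Submodule.smul_mem _ _ hu, by rw [smul_mul_assoc]⟩
    · rintro ⟨u, hu, rfl⟩
      induction hu using Submodule.span_induction with
      | mem u h =>
        obtain ⟨x, hx, rfl⟩ := h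
        rw [← localEmbHom_apply, ← map_mul]
        exact localEmbHom_mem_of_mem_locAt (hy.mul_mem (le_locAt p _ hx))
      | zero => simp
      | add u v _ _ hu hv => rw [add_mul]; exact add_mem hu hv
      | smul r u _ hu => rw [smul_mul_assoc]; exact Submodule.smul_mem _ _ hu

end Bridge

end Quat

/-! ### Splitting of quaternion rings over a finite field -/

section Splitting

variable {K A : Type*} [Field K] [Ring A] [Algebra K A]

/-- A ring over a field with a standard involution `st`, its trace `tr` and its norm `nr`. -/
structure StdInvolution (K A : Type*) [Field K] [Ring A] [Algebra K A] where
  st : A →ₗ[K] A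
  tr : A →ₗ[K] K
  nr : A → K
  st_mul : ∀ x y, st (x * y) = st y * st x
  add_st : ∀ x, x + st x = algebraMap K A (tr x)
  mul_st : ∀ x, x * st x = algebraMap K A (nr x)
  tr_comm : ∀ x y, tr (x * y) = tr (y * x)
  tr_st : ∀ x, tr (st x) = tr x
  nr_add : ∀ x y, nr (x + y) = nr x + nr y + tr (x * st y)
  nr_smul : ∀ (c : K) x, nr (c • x) = c ^ 2 * nr x

namespace StdInvolution

variable (S : StdInvolution K A)

lemma nr_zero : S.nr 0 = 0 := by simpa using S.nr_smul 0 0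

lemma mul_self (x : A) : x * x = S.tr x • x - S.nr x • (1 : A) := by
  have h := S.mul_st x
  have h1 : S.st x = algebraMap K A (S.tr x) - x := eq_sub_of_add_eq' (S.add_st x)
  rw [h1, mul_sub, ← Algebra.commutes, ← Algebra.smul_def, Algebra.algebraMap_eq_smul_one] at h
  rw [← h]; abel

lemma st_idem {e : A} (h1 : S.tr e = 1) : S.st e = 1 - e := by
  rw [eq_sub_iff_add_eq', S.add_st, h1, map_one]

lemma idem {e : A} (h1 : S.tr e = 1) (h0 : S.nr e = 0) : e * e = e := by
  rw [S.mul_self, h1, h0]; simp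

/-- Since `st e = 1 - e`, the product of `e` with the conjugate of `e x e` vanishes. -/
lemma corner {e : A} (h1 : S.tr e = 1) (h0 : S.nr e = 0) (x : A) :
    e * x * e = S.tr (e * x) • e := by
  have he := S.idem h1 h0
  have h2 := congrArg (fun z => e * z) (S.add_st (e * x * e))
  simp only [S.st_mul, S.st_idem h1] at h2
  rw [mul_add, ← mul_assoc e (1 - e), mul_sub, mul_one, he, sub_self, zero_mul, add_zero,
    ← mul_assoc, ← mul_assoc, he, S.tr_comm, ← mul_assoc, he, ← Algebra.commutes,
    ← Algebra.smul_def] at h2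
  exact h2

/-- A non-degenerate algebra of dimension greater than two with a standard involution and a
primitive idempotent is a matrix algebra. -/
theorem exists_matrix (hnd : ∀ x, (∀ y, S.tr (x * y) = 0) → x = 0) {e : A} (h1 : S.tr e = 1)
    (h0 : S.nr e = 0) (hdim : ∃ c, e * c * (1 - e) ≠ 0) :
    ∃ φ : A →+* Matrix (Fin 2) (Fin 2) K, Function.Bijective φ ∧ (∀ x, (φ x).trace = S.tr x) ∧
      (∀ x, (φ x).det = S.nr x) := by
  have he := S.idem h1 h0
  set f := 1 - e with hf
  have hstf : S.st e = f := S.st_idem h1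
  have hff : f * f = f := by
    rw [hf, mul_sub, mul_one, sub_mul, one_mul, he, sub_self, sub_zero]
  have hef : e * f = 0 := by rw [hf, mul_sub, he, mul_one, sub_self]
  have hfe : f * e = 0 := by rw [hf, sub_mul, he, one_mul, sub_self]
  have hsum : e + f = 1 := by rw [hf]; abel
  have htf : S.tr f = 1 := by rw [← hstf, S.tr_st, h1]
  have hnf : S.nr f = 0 := by
    have h2 := S.mul_st f
    rw [S.st_idem htf] at h2
    have h3 : f * (1 - f) = 0 := by rw [mul_sub, hff, mul_one, sub_self]
    rw [h3] at h2
    have hA : Nontrivial A := by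
      obtain ⟨c, hc⟩ := hdim
      exact ⟨⟨_, _, hc⟩⟩
    exact ((map_eq_zero (algebraMap K A)).1 h2.symm)
  have ce : ∀ x, e * x * e = S.tr (e * x) • e := S.corner h1 h0
  have cf : ∀ x, f * x * f = S.tr (f * x) • f := S.corner htf hnf
  obtain ⟨c, hc⟩ := hdim
  -- elements `u` and `v` of the off-diagonal corners with `u v = e` and `v u = f`, so that `e`,
  -- `u`, `v`, `f` are matrix units
  set u := e * c * f with hu
  obtain ⟨v1, hv1⟩ : ∃ v1, S.tr (u * v1) ≠ 0 := by
    by_contra! h; exact hc (hnd u h)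
  obtain ⟨v0, hv0⟩ : ∃ v0, S.tr (u * v0) = 1 :=
    ⟨(S.tr (u * v1))⁻¹ • v1, by rw [mul_smul_comm, map_smul, smul_eq_mul, inv_mul_cancel₀ hv1]⟩
  set v := f * v0 * e with hv
  have huf : u * f = u := by rw [hu, mul_assoc, hff]
  have heu : e * u = u := by rw [hu, ← mul_assoc, ← mul_assoc, he]
  have hve : v * e = v := by rw [hv, mul_assoc, he]
  have hfv : f * v = v := by rw [hv, ← mul_assoc, ← mul_assoc, hff]
  have huv : u * v = e := by
    have : u * v = e * (c * f * v0) * e := by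
      rw [hu, hv]; simp only [mul_assoc]; rw [← mul_assoc f f, hff]
    rw [this, ce, ← mul_assoc, ← mul_assoc, ← hu, hv0, one_smul]
  have hvu : v * u = f := by
    have : v * u = f * (v0 * e * c) * f := by
      rw [hu, hv]; simp only [mul_assoc]; rw [← mul_assoc e e, he]
    rw [this, cf]
    have h2 : S.tr (f * (v0 * e * c)) = 1 := by
      rw [S.tr_comm, show v0 * e * c * f = v0 * u by rw [hu]; simp only [mul_assoc], S.tr_comm, hv0]
    rw [h2, one_smul]
  have hfu : f * u = 0 := by rw [← heu, ← mul_assoc, hfe, zero_mul]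
  have hue : u * e = 0 := by rw [← huf, mul_assoc, hfe, mul_zero]
  have hev : e * v = 0 := by rw [← hfv, ← mul_assoc, hef, zero_mul]
  have hvf : v * f = 0 := by rw [← hve, mul_assoc, hef, mul_zero]
  have huu : u * u = 0 := by
    have : u * u = u * f * u := by rw [huf]
    rw [this, mul_assoc, hfu, mul_zero]
  have hvv : v * v = 0 := by
    have : v * v = v * e * v := by rw [hve]
    rw [this, mul_assoc, hev, mul_zero]
  have htu : S.tr u = 0 := by rw [← heu, S.tr_comm, hue, map_zero]
  have htv : S.tr v = 0 := by rw [← hfv, S.tr_comm, hvf, map_zero]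
  have cef : ∀ x, e * x * f = S.tr (v * x) • u := fun x => by
    have : e * x * f = e * (x * v) * e * u := by
      rw [mul_assoc _ e u, heu, ← mul_assoc e x v, mul_assoc _ v u, hvu]
    rw [this, ce, smul_mul_assoc, heu, ← mul_assoc, S.tr_comm, ← mul_assoc, hve]
  have cfe : ∀ x, f * x * e = S.tr (u * x) • v := fun x => by
    have : f * x * e = f * (x * u) * f * v := by
      rw [mul_assoc _ f v, hfv, ← mul_assoc f x u, mul_assoc _ u v, huv]
    rw [this, cf, smul_mul_assoc, hfv, ← mul_assoc, S.tr_comm, ← mul_assoc, huf]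
  -- the Peirce decomposition; the coordinates are traces
  have hex : ∀ x, e * x = S.tr (e * x) • e + S.tr (v * x) • u := fun x => by
    rw [← ce, ← cef, ← mul_add, hsum, mul_one]
  have hfx : ∀ x, f * x = S.tr (u * x) • v + S.tr (f * x) • f := fun x => by
    rw [← cf, ← cfe, ← mul_add, hsum, mul_one]
  have hvx : ∀ x, v * x = S.tr (e * x) • v + S.tr (v * x) • f := fun x => by
    conv_lhs => rw [← hve, mul_assoc, hex, mul_add, mul_smul_comm, mul_smul_comm, hve, hvu]
  have hux : ∀ x, u * x = S.tr (u * x) • e + S.tr (f * x) • u := fun x => by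
    conv_lhs => rw [← huf, mul_assoc, hfx, mul_add, mul_smul_comm, mul_smul_comm, huf, huv]
  have hx : ∀ x, x = S.tr (e * x) • e + S.tr (v * x) • u + (S.tr (u * x) • v + S.tr (f * x) • f) :=
    fun x => by rw [← hex, ← hfx, ← add_mul, hsum, one_mul]
  let φ : A →+* Matrix (Fin 2) (Fin 2) K :=
    { toFun := fun x => !![S.tr (e * x), S.tr (v * x); S.tr (u * x), S.tr (f * x)]
      map_one' := by
        simp only [mul_one, h1, htf, htu, htv]
        exact Matrix.one_fin_two.symm
      map_zero' := by
        ext i j; fin_cases i <;> fin_cases j <;> simp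
      map_add' := fun x y => by
        ext i j; fin_cases i <;> fin_cases j <;> simp [mul_add]
      map_mul' := fun x y => by
        have key : ∀ w α β g h, w * x = α • g + β • h →
            S.tr (w * (x * y)) = α * S.tr (g * y) + β * S.tr (h * y) := by
          intro w α β g h hw
          rw [← mul_assoc, hw, add_mul, smul_mul_assoc, smul_mul_assoc, map_add, map_smul, map_smul,
            smul_eq_mul, smul_eq_mul]
        rw [key _ _ _ _ _ (hex x), key _ _ _ _ _ (hvx x), key _ _ _ _ _ (hux x),
          key _ _ _ _ _ (hfx x), Matrix.mul_fin_two] }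
  have hφ : ∀ x, φ x = !![S.tr (e * x), S.tr (v * x); S.tr (u * x), S.tr (f * x)] := fun _ => rfl
  have htr : ∀ x, (φ x).trace = S.tr x := fun x => by
    rw [hφ, Matrix.trace_fin_two_of, ← map_add, ← add_mul, hsum, one_mul]
  refine ⟨φ, ⟨?_, ?_⟩, htr, ?_⟩
  · rw [injective_iff_map_eq_zero]
    intro x h
    rw [hφ] at h
    have e1 := congrFun (congrFun h 0) 0
    have e2 := congrFun (congrFun h 0) 1
    have e3 := congrFun (congrFun h 1) 0
    have e4 := congrFun (congrFun h 1) 1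
    simp at e1 e2 e3 e4
    rw [hx x, e1, e2, e3, e4]; simp
  · intro m
    refine ⟨m 0 0 • e + m 0 1 • u + m 1 0 • v + m 1 1 • f, ?_⟩
    rw [hφ]
    simp only [mul_add, mul_smul_comm, he, heu, hev, hef, hve, hvu, hvv, hvf, hue, huu, huv, huf,
      hfe, hfu, hfv, hff, map_add, map_smul, h1, htu, htv, htf, map_zero, smul_eq_mul, mul_one,
      mul_zero, add_zero, zero_add]
    exact (Matrix.eta_fin_two m).symm
  · intro x
    -- the norm is the determinant because `x · st x = nr x` and `st x = tr x - x`
    have hst : φ (S.st x) = algebraMap K _ (S.tr x) - φ x := by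
      have h2 : ∀ k : K, φ (algebraMap K A k) = algebraMap K _ k := by
        intro k
        rw [hφ, Algebra.algebraMap_eq_smul_one, Algebra.algebraMap_eq_smul_one]
        simp only [mul_smul_comm, mul_one, map_smul, h1, htf, htu, htv, smul_eq_mul, mul_zero]
        ext i j; fin_cases i <;> fin_cases j <;> simp
      rw [← h2, ← S.add_st, map_add]; abel
    have h2 : φ (algebraMap K A (S.nr x)) = algebraMap K _ (S.nr x) := by
      rw [hφ, Algebra.algebraMap_eq_smul_one, Algebra.algebraMap_eq_smul_one]
      simp only [mul_smul_comm, mul_one, map_smul, h1, htf, htu, htv, smul_eq_mul, mul_zero]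
      ext i j; fin_cases i <;> fin_cases j <;> simp
    rw [← S.mul_st, map_mul, hst, ← htr] at h2
    have h3 := congrFun (congrFun h2 0) 0
    rw [Matrix.trace_fin_two] at h3
    simp [Matrix.mul_apply, Algebra.algebraMap_eq_smul_one] at h3
    rw [Matrix.det_fin_two, ← h3]
    ring

/-- A four-dimensional algebra over a finite field with a standard involution and non-degenerate
trace form is a matrix algebra: its norm form is isotropic by the Chevalley-Warning theorem. -/
theorem exists_matrix_of_finite [Finite K] (β : Fin 4 → A)
    (hspan : ∀ x, ∃ c : Fin 4 → K, x = ∑ i, c i • β i)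
    (hdet : (Matrix.of fun i j : Fin 4 => S.tr (β i * S.st (β j))).det ≠ 0) :
    ∃ φ : A →+* Matrix (Fin 2) (Fin 2) K, Function.Bijective φ ∧ (∀ x, (φ x).trace = S.tr x) ∧
      (∀ x, (φ x).det = S.nr x) := by
  classical
  have := Fintype.ofFinite K
  set G := Matrix.of fun i j : Fin 4 => S.tr (β i * S.st (β j)) with hG
  have hzero : ∀ c : Fin 4 → K, (∀ j, S.tr ((∑ i, c i • β i) * S.st (β j)) = 0) → c = 0 := by
    intro c hc
    refine Matrix.eq_zero_of_vecMul_eq_zero hdet (funext fun j => ?_)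
    have := hc j
    simpa [Matrix.vecMul, dotProduct, Finset.sum_mul, map_sum, hG] using this
  have hnd : ∀ x, (∀ y, S.tr (x * y) = 0) → x = 0 := by
    intro x h
    obtain ⟨c, rfl⟩ := hspan x
    rw [hzero c fun j => h _]; simp
  have hli : LinearIndependent K β := by
    rw [Fintype.linearIndependent_iff]
    intro c hc i
    rw [hzero c (fun j => by rw [hc]; simp)]; rfl
  -- an isotropic vector
  obtain ⟨x, hx0, hx⟩ : ∃ x, x ≠ 0 ∧ S.nr x = 0 := by
    let g : Fin 4 → Fin 4 → K := fun i j =>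
      if i = j then S.nr (β i) else if i < j then S.tr (β i * S.st (β j)) else 0
    let F : MvPolynomial (Fin 4) K :=
      ∑ i, ∑ j, MvPolynomial.C (g i j) * (MvPolynomial.X i * MvPolynomial.X j)
    have hF : ∀ c : Fin 4 → K, MvPolynomial.eval c F = S.nr (∑ i, c i • β i) := by
      intro c
      simp only [F, map_mul, MvPolynomial.eval_C, MvPolynomial.eval_X, g,
        Fin.sum_univ_four, S.nr_add, S.nr_smul, map_smul, smul_mul_assoc, mul_smul_comm, smul_eq_mul,
        add_mul, map_add]
      simp [Fin.lt_def]
      ring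
    have hdeg : F.totalDegree < Fintype.card (Fin 4) := by
      have : F.totalDegree ≤ 2 := by
        refine MvPolynomial.totalDegree_finsetSum_le fun i _ =>
          MvPolynomial.totalDegree_finsetSum_le fun j _ => ?_
        refine (MvPolynomial.totalDegree_mul _ _).trans ?_
        rw [MvPolynomial.totalDegree_C, zero_add]
        refine (MvPolynomial.totalDegree_mul _ _).trans ?_
        simp [MvPolynomial.totalDegree_X]
      simp; omega
    obtain ⟨p, hp⟩ := CharP.exists K
    have hpp : p.Prime := (CharP.char_is_prime_or_zero K p).resolve_right fun h => by
      subst h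
      have := CharP.charP_to_charZero K
      exact not_finite K
    have h2 := char_dvd_card_solutions p hdeg
    have h3 : 1 < Fintype.card {x : Fin 4 → K // MvPolynomial.eval x F = 0} := by
      refine lt_of_lt_of_le hpp.one_lt (Nat.le_of_dvd (Fintype.card_pos_iff.2 ?_) h2)
      exact ⟨⟨0, by rw [hF]; simp [S.nr_zero]⟩⟩
    obtain ⟨⟨c, hc⟩, hne⟩ := Fintype.exists_ne_of_one_lt_card h3 ⟨0, by rw [hF]; simp [S.nr_zero]⟩
    refine ⟨∑ i, c i • β i, fun h => hne ?_, by rw [← hF, hc]⟩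
    apply Subtype.ext
    exact hzero c fun j => by rw [h]; simp
  obtain ⟨y, hy⟩ : ∃ y, S.tr (x * y) ≠ 0 := by
    by_contra! h; exact hx0 (hnd x h)
  set e := (S.tr (x * y))⁻¹ • (x * y) with he
  have he1 : S.tr e = 1 := by rw [he, map_smul, smul_eq_mul, inv_mul_cancel₀ hy]
  have hA : Nontrivial A := ⟨⟨_, _, hx0⟩⟩
  have he0 : S.nr e = 0 := by
    have h2 : S.nr (x * y) = 0 := by
      have h3 := S.mul_st (x * y)
      rw [S.st_mul, mul_assoc, ← mul_assoc y, S.mul_st, ← mul_assoc, ← Algebra.commutes, mul_assoc,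
        S.mul_st, hx, map_zero, mul_zero] at h3
      exact (map_eq_zero (algebraMap K A)).1 h3.symm
    rw [he, S.nr_smul, h2, mul_zero]
  refine S.exists_matrix hnd he1 he0 ?_
  by_contra! hno
  have hee := S.idem he1 he0
  -- otherwise the algebra is spanned by two elements
  have hno' : ∀ c, (1 - e) * c * e = 0 := by
    intro c
    refine hnd _ fun z => ?_
    have hff : (1 - e) * (1 - e) = 1 - e := by
      rw [mul_sub, mul_one, sub_mul, one_mul, hee, sub_self, sub_zero]
    have : S.tr ((1 - e) * c * e * z) = S.tr ((1 - e) * c * (e * z * (1 - e))) := by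
      rw [← mul_assoc, S.tr_comm _ (1 - e)]
      simp only [← mul_assoc]
      rw [hff]
    rw [this, hno, mul_zero, map_zero]
  have htf : S.tr (1 - e) = 1 := by rw [← S.st_idem he1, S.tr_st, he1]
  have hnf : S.nr (1 - e) = 0 := by
    have h2 := S.mul_st (1 - e)
    rw [S.st_idem htf] at h2
    have h3 : (1 - e) * (1 - (1 - e)) = 0 := by noncomm_ring; rw [hee]; simp
    rw [h3] at h2
    exact ((map_eq_zero (algebraMap K A)).1 h2.symm)
  have hsp : ⊤ ≤ Submodule.span K (Set.range ![e, 1 - e]) := by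
    intro z _
    have hz : z = S.tr (e * z) • e + S.tr ((1 - e) * z) • (1 - e) := by
      rw [← S.corner he1 he0, ← S.corner htf hnf]
      have h2 := hno z
      have h3 := hno' z
      have : z = e * z * e + (1 - e) * z * (1 - e) + (e * z * (1 - e) + (1 - e) * z * e) := by
        noncomm_ring
      rw [h2, h3, add_zero, add_zero] at this
      exact this
    rw [hz]
    exact add_mem (Submodule.smul_mem _ _ (Submodule.subset_span ⟨0, rfl⟩))
      (Submodule.smul_mem _ _ (Submodule.subset_span ⟨1, rfl⟩))
  have h4 := linearIndependent_le_span β hli (Set.range ![e, 1 - e]) (top_le_iff.1 hsp)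
  have h5 : 4 ≤ ({1 - e, e} : Finset A).card := by simpa using h4
  have h6 : ({1 - e, e} : Finset A).card ≤ 2 := Finset.card_le_two
  omega

end StdInvolution

end Splitting

/-! ### Splitting of an order at a prime not dividing its discriminant -/

section Quat

variable {a b : ℚ} {O : Subring (𝔹 a b)}

namespace IsOrder

lemma num_trd (hO : IsOrder O) {x : 𝔹 a b} (hx : x ∈ O) : ((trd x).num : ℚ) = trd x := by
  obtain ⟨k, hk⟩ := hO.trd_int hx
  rw [hk, Rat.num_intCast]

/-- The reduced trace as a map to the integers. -/
def trdZ (hO : IsOrder O) : O →+ ℤ where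
  toFun x := (trd (x : 𝔹 a b)).num
  map_zero' := by simp [trd_eq]
  map_add' x y := by
    have : ((trd ((x + y : O) : 𝔹 a b)).num : ℚ)
        = (trd (x : 𝔹 a b)).num + (trd (y : 𝔹 a b)).num := by
      rw [hO.num_trd x.2, hO.num_trd y.2, hO.num_trd (x + y).2, Subring.coe_add, trd_add]
    exact_mod_cast this

lemma trdZ_spec (hO : IsOrder O) (x : O) : (hO.trdZ x : ℚ) = trd (x : 𝔹 a b) :=
  hO.num_trd x.2

/-- The reduced norm as a map to the integers. -/
def nrdZ (_ : IsOrder O) (x : O) : ℤ := (nrd (x : 𝔹 a b)).num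

lemma nrdZ_spec (hO : IsOrder O) (x : O) : (hO.nrdZ x : ℚ) = nrd (x : 𝔹 a b) := by
  obtain ⟨k, hk⟩ := hO.nrd_int x.2
  rw [nrdZ, hk, Rat.num_intCast]

/-- The standard involution of an order. -/
def starO (hO : IsOrder O) : O →+ O where
  toFun x := ⟨star (x : 𝔹 a b), hO.star_mem x.2⟩
  map_zero' := by ext1; simp
  map_add' x y := by ext1; simp

lemma starO_coe (hO : IsOrder O) (x : O) : (hO.starO x : 𝔹 a b) = star (x : 𝔹 a b) := rfl

end IsOrder

/-- The two-sided ideal `m O`. -/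
def modIdeal (m : ℕ) (O : Subring (𝔹 a b)) : Ideal O := Ideal.span {(m : O)}

lemma mem_modIdeal {m : ℕ} {x : O} : x ∈ modIdeal m O ↔ ∃ y : O, x = m • y := by
  rw [modIdeal, Ideal.mem_span_singleton']
  constructor
  · rintro ⟨y, rfl⟩; exact ⟨y, by rw [nsmul_eq_mul, Nat.cast_comm]⟩
  · rintro ⟨y, rfl⟩; exact ⟨y, by rw [nsmul_eq_mul, Nat.cast_comm]⟩

instance (m : ℕ) : (modIdeal m O).IsTwoSided := ⟨fun {x} z hx => by
  obtain ⟨y, rfl⟩ := mem_modIdeal.1 hx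
  exact mem_modIdeal.2 ⟨y * z, by rw [smul_mul_assoc]⟩⟩

instance (m : ℕ) : Algebra (ZMod m) (O ⧸ modIdeal m O) :=
  ZMod.algebra' _ (ringChar (O ⧸ modIdeal m O)) (ringChar.dvd (by
    have : ((m : O) : O ⧸ modIdeal m O) = 0 :=
      Ideal.Quotient.eq_zero_iff_mem.2 (Ideal.mem_span_singleton_self _)
    simpa using this))

section Mod

variable (m : ℕ) (hO : IsOrder O)

lemma nrdZ_congr {x y : O} (h : Ideal.Quotient.mk (modIdeal m O) x = Ideal.Quotient.mk (modIdeal m O) y) :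
    (hO.nrdZ x : ZMod m) = hO.nrdZ y := by
  rw [Ideal.Quotient.eq] at h
  obtain ⟨z, hz⟩ := mem_modIdeal.1 h
  have hx : x = y + m • z := by rw [← hz]; abel
  have h1 : (hO.nrdZ x : ℚ) = hO.nrdZ y + m * (m * hO.nrdZ z + hO.trdZ (y * hO.starO z)) := by
    rw [hO.nrdZ_spec, hO.nrdZ_spec, hO.nrdZ_spec, hO.trdZ_spec, hx, Subring.coe_add, nrd_add,
      Subring.coe_mul, IsOrder.starO_coe]
    have h2 : ((m • z : O) : 𝔹 a b) = (m : ℚ) • (z : 𝔹 a b) := by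
      rw [Nat.cast_smul_eq_nsmul]; rfl
    rw [h2, nrd_smul, star_smul, mul_smul_comm, trd_smul]
    simp only [star_trivial]
    ring
  have h2 : hO.nrdZ x = hO.nrdZ y + m * (m * hO.nrdZ z + hO.trdZ (y * hO.starO z)) := by
    exact_mod_cast h1
  rw [h2]; simp

lemma modIdeal_le_ker_trd : ∀ x ∈ modIdeal m O, ((Int.castAddHom (ZMod m)).comp hO.trdZ) x = 0 := by
  intro x hx
  obtain ⟨y, rfl⟩ := mem_modIdeal.1 hx
  rw [map_nsmul]
  simp

/-- Trace, norm and standard involution of the reduction of an order modulo a prime. -/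
def modInvolution [Fact m.Prime] : StdInvolution (ZMod m) (O ⧸ modIdeal m O) where
  st := AddMonoidHom.toZModLinearMap m (QuotientAddGroup.lift (modIdeal m O).toAddSubgroup
    ((Ideal.Quotient.mk (modIdeal m O)).toAddMonoidHom.comp hO.starO) (by
      intro x hx
      obtain ⟨y, rfl⟩ := mem_modIdeal.1 hx
      refine Ideal.Quotient.eq_zero_iff_mem.2 (mem_modIdeal.2 ⟨hO.starO y, ?_⟩)
      rw [map_nsmul]))
  tr := AddMonoidHom.toZModLinearMap m (QuotientAddGroup.lift (modIdeal m O).toAddSubgroup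
    ((Int.castAddHom (ZMod m)).comp hO.trdZ) (modIdeal_le_ker_trd m hO))
  -- the norm of an arbitrary lift, see `nrdZ_congr`
  nr x := hO.nrdZ (Function.surjInv (Ideal.Quotient.mk_surjective (I := modIdeal m O)) x)
  st_mul x y := by
    obtain ⟨x, rfl⟩ := Ideal.Quotient.mk_surjective x
    obtain ⟨y, rfl⟩ := Ideal.Quotient.mk_surjective y
    change Ideal.Quotient.mk _ (hO.starO (x * y))
      = Ideal.Quotient.mk _ (hO.starO y) * Ideal.Quotient.mk _ (hO.starO x)
    rw [← map_mul]; congr 1; ext1; simp [IsOrder.starO_coe]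
  add_st x := by
    obtain ⟨x, rfl⟩ := Ideal.Quotient.mk_surjective x
    change Ideal.Quotient.mk _ x + Ideal.Quotient.mk _ (hO.starO x)
      = algebraMap _ _ ((hO.trdZ x : ZMod m))
    rw [map_intCast, ← map_add, ← map_intCast (Ideal.Quotient.mk (modIdeal m O))]
    congr 1; ext1
    rw [Subring.coe_add, IsOrder.starO_coe, add_star_eq, ← hO.trdZ_spec, Int.cast_smul_eq_zsmul]
    simp
  mul_st x := by
    obtain ⟨x, rfl⟩ := Ideal.Quotient.mk_surjective x
    rw [nrdZ_congr m hO (Function.surjInv_eq Ideal.Quotient.mk_surjective (Ideal.Quotient.mk _ x))]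
    change Ideal.Quotient.mk _ x * Ideal.Quotient.mk _ (hO.starO x)
      = algebraMap _ _ ((hO.nrdZ x : ZMod m))
    rw [map_intCast, ← map_mul, ← map_intCast (Ideal.Quotient.mk (modIdeal m O))]
    congr 1; ext1
    rw [Subring.coe_mul, IsOrder.starO_coe, mul_star_eq, ← hO.nrdZ_spec, Int.cast_smul_eq_zsmul]
    simp
  tr_comm x y := by
    obtain ⟨x, rfl⟩ := Ideal.Quotient.mk_surjective x
    obtain ⟨y, rfl⟩ := Ideal.Quotient.mk_surjective y
    change ((hO.trdZ (x * y) : ℤ) : ZMod m) = ((hO.trdZ (y * x) : ℤ) : ZMod m)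
    congr 1
    have : (hO.trdZ (x * y) : ℚ) = hO.trdZ (y * x) := by
      rw [hO.trdZ_spec, hO.trdZ_spec, Subring.coe_mul, Subring.coe_mul, trd_mul_comm]
    exact_mod_cast this
  tr_st x := by
    obtain ⟨x, rfl⟩ := Ideal.Quotient.mk_surjective x
    change ((hO.trdZ (hO.starO x) : ℤ) : ZMod m) = ((hO.trdZ x : ℤ) : ZMod m)
    congr 1
    have : (hO.trdZ (hO.starO x) : ℚ) = hO.trdZ x := by
      rw [hO.trdZ_spec, hO.trdZ_spec, IsOrder.starO_coe, trd_star]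
    exact_mod_cast this
  nr_add x y := by
    obtain ⟨x, rfl⟩ := Ideal.Quotient.mk_surjective x
    obtain ⟨y, rfl⟩ := Ideal.Quotient.mk_surjective y
    rw [← map_add,
      nrdZ_congr m hO (Function.surjInv_eq Ideal.Quotient.mk_surjective (Ideal.Quotient.mk _ x)),
      nrdZ_congr m hO (Function.surjInv_eq Ideal.Quotient.mk_surjective (Ideal.Quotient.mk _ y)),
      nrdZ_congr m hO (Function.surjInv_eq Ideal.Quotient.mk_surjective (Ideal.Quotient.mk _ (x + y)))]
    change _ = _ + _ + ((hO.trdZ (x * hO.starO y) : ℤ) : ZMod m)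
    have : (hO.nrdZ (x + y) : ℚ) = hO.nrdZ x + hO.nrdZ y + hO.trdZ (x * hO.starO y) := by
      rw [hO.nrdZ_spec, hO.nrdZ_spec, hO.nrdZ_spec, hO.trdZ_spec, Subring.coe_add, nrd_add]
      rfl
    have h2 : hO.nrdZ (x + y) = hO.nrdZ x + hO.nrdZ y + hO.trdZ (x * hO.starO y) := by
      exact_mod_cast this
    rw [h2]; push_cast; rfl
  nr_smul c x := by
    obtain ⟨x, rfl⟩ := Ideal.Quotient.mk_surjective x
    obtain ⟨n, rfl⟩ := ZMod.intCast_surjective c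
    have h0 : (n : ZMod m) • Ideal.Quotient.mk (modIdeal m O) x = Ideal.Quotient.mk _ (n • x) := by
      rw [Int.cast_smul_eq_zsmul, map_zsmul]
    rw [h0,
      nrdZ_congr m hO (Function.surjInv_eq Ideal.Quotient.mk_surjective (Ideal.Quotient.mk _ x)),
      nrdZ_congr m hO (Function.surjInv_eq Ideal.Quotient.mk_surjective (Ideal.Quotient.mk _ (n • x)))]
    have : (hO.nrdZ (n • x) : ℚ) = n ^ 2 * hO.nrdZ x := by
      rw [hO.nrdZ_spec, hO.nrdZ_spec, ← nrd_smul, Int.cast_smul_eq_zsmul]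
      rfl
    have h2 : hO.nrdZ (n • x) = n ^ 2 * hO.nrdZ x := by exact_mod_cast this
    rw [h2]; push_cast; rfl

end Mod

/-- The Gram determinant of four quaternions for the norm form. -/
lemma gram_det (v : Fin 4 → 𝔹 a b) :
    (Matrix.of fun i j : Fin 4 => trd (v i * star (v j))).det =
      (4 * a * b * (Matrix.of fun i : Fin 4 => ![(v i).re, (v i).imI, (v i).imJ, (v i).imK]).det) ^ 2 := by
  set P := Matrix.of fun i : Fin 4 => ![(v i).re, (v i).imI, (v i).imJ, (v i).imK]
  have h : (Matrix.of fun i j : Fin 4 => trd (v i * star (v j)))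
      = P * Matrix.diagonal ![2, -2 * a, -2 * b, 2 * a * b] * P.transpose := by
    ext i j
    rw [Matrix.mul_apply, Fin.sum_univ_four]
    simp only [Matrix.mul_diagonal, Matrix.transpose_apply, P, Matrix.of_apply]
    simp [trd_eq]
    ring
  rw [h, Matrix.det_mul, Matrix.det_mul, Matrix.det_transpose, Matrix.det_diagonal,
    Fin.prod_univ_four]
  simp
  ring

/-- At a prime not dividing the reduced discriminant the Gram determinant of a suitable basis is
a unit. -/
lemma exists_basis_gram (hO : IsOrder O) {p : ℕ} (hp : p.Prime) (h : p.Coprime (reducedDisc O)) :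
    ∃ B : Module.Basis (Fin 4) ℤ (subringLattice O), ∃ G : Matrix (Fin 4) (Fin 4) ℤ,
      (∀ i j, (G i j : ℚ) = trd ((B i : 𝔹 a b) * star (B j : 𝔹 a b))) ∧
      ¬ (p : ℤ) ∣ G.det := by
  have hO' : Submodule.IsLattice ℚ (subringLattice O) := hO
  have hne : Nonempty (Module.Basis (Fin 4) ℤ (subringLattice O)) := exists_basis _
  refine ⟨hne.some, Matrix.of fun i j => hO.trdZ (⟨_, (hne.some i).2⟩ * hO.starO ⟨_, (hne.some j).2⟩),
    fun i j => by rw [Matrix.of_apply, hO.trdZ_spec]; rfl, ?_⟩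
  set G : Matrix (Fin 4) (Fin 4) ℤ :=
    Matrix.of fun i j => hO.trdZ (⟨_, (hne.some i).2⟩ * hO.starO ⟨_, (hne.some j).2⟩) with hG
  have h1 : (Matrix.of fun i j : Fin 4 =>
      trd ((hne.some i : 𝔹 a b) * star (hne.some j : 𝔹 a b))).det = ((G.det : ℤ) : ℚ) := by
    rw [Int.cast_det]
    congr 1
    ext i j
    rw [Matrix.map_apply, hG, Matrix.of_apply, Matrix.of_apply, hO.trdZ_spec]; rfl
  rw [reducedDisc, dif_pos hne, h1, Rat.num_intCast] at h
  obtain ⟨s, hs⟩ : IsSquare G.det := by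
    rw [← Rat.isSquare_intCast_iff, ← h1, gram_det]
    exact ⟨_, sq _⟩
  rw [hs, Int.natAbs_mul, Nat.sqrt_eq] at h
  rw [hs]
  intro hd
  have h2 : p ∣ s.natAbs := by
    rcases (Nat.prime_iff_prime_int.1 hp).dvd_or_dvd hd with h3 | h3 <;> simpa using Int.natAbs_dvd_natAbs.2 h3
  exact hp.one_lt.ne' (Nat.eq_one_of_dvd_coprimes h dvd_rfl h2)

/-- An isomorphism of `O / p O` with the ring of `2 × 2` matrices, viewed as a homomorphism from
the localization of `O` at `p` and compatible with traces and norms. -/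
structure LocalSplitting (p : ℕ) (O : Subring (𝔹 a b)) where
  φ : locRing p O →+* Matrix (Fin 2) (Fin 2) (ZMod p)
  surj : ∀ m, ∃ x : locRing p O, (x : 𝔹 a b) ∈ O ∧ φ x = m
  ker : ∀ x, φ x = 0 → ∃ y : locRing p O, x = p • y
  trace : ∀ (x : locRing p O) (k : ℤ), trd (x : 𝔹 a b) = k → (φ x).trace = k
  det : ∀ (x : locRing p O) (k : ℤ), nrd (x : 𝔹 a b) = k → (φ x).det = k

/-- The reduction of `O` modulo `p` is a matrix algebra by `exists_matrix_of_finite`. -/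
lemma exists_ringHom_matrix (hO : IsOrder O) {p : ℕ} [hp : Fact p.Prime]
    (h : p.Coprime (reducedDisc O)) :
    ∃ φ : O →+* Matrix (Fin 2) (Fin 2) (ZMod p), Function.Surjective φ ∧
      (∀ x, φ x = 0 ↔ ∃ y, x = p • y) ∧ (∀ x, (φ x).trace = hO.trdZ x) ∧
      (∀ x, (φ x).det = hO.nrdZ x) := by
  obtain ⟨B, G, hG, hdet⟩ := exists_basis_gram hO hp.out h
  let S := modInvolution p hO
  have hSst : ∀ x, S.st (Ideal.Quotient.mk _ x) = Ideal.Quotient.mk _ (hO.starO x) := fun _ => rfl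
  have hStr : ∀ x, S.tr (Ideal.Quotient.mk _ x) = hO.trdZ x := fun _ => rfl
  have hSnr : ∀ x, S.nr (Ideal.Quotient.mk _ x) = hO.nrdZ x := fun x =>
    nrdZ_congr p hO (Function.surjInv_eq Ideal.Quotient.mk_surjective (Ideal.Quotient.mk _ x))
  let β : Fin 4 → O := fun i => ⟨_, (B i).2⟩
  obtain ⟨φ, hφ, htr, hnr⟩ := S.exists_matrix_of_finite (fun i => Ideal.Quotient.mk _ (β i)) (by
    intro x
    obtain ⟨x, rfl⟩ := Ideal.Quotient.mk_surjective x
    refine ⟨fun i => (B.repr ⟨x, x.2⟩ i : ℤ), ?_⟩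
    have h1 : x = ∑ i, (B.repr ⟨x, x.2⟩ i) • β i := by
      have := congrArg (fun w : subringLattice O => (w : 𝔹 a b)) (B.sum_repr ⟨x, x.2⟩)
      simp only [Submodule.coe_sum, Submodule.coe_smul] at this
      ext1
      rw [AddSubmonoidClass.coe_finsetSum]
      exact this.symm
    conv_lhs => rw [h1]
    rw [map_sum]
    refine Finset.sum_congr rfl fun i _ => ?_
    rw [map_zsmul, Int.cast_smul_eq_zsmul]) (by
    have h1 : (Matrix.of fun i j : Fin 4 => S.tr (Ideal.Quotient.mk _ (β i) * S.st (Ideal.Quotient.mk _ (β j))))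
        = G.map (Int.castRingHom (ZMod p)) := by
      ext i j
      rw [Matrix.of_apply, hSst, ← map_mul, hStr, Matrix.map_apply]
      change ((hO.trdZ _ : ℤ) : ZMod p) = ((G i j : ℤ) : ZMod p)
      congr 1
      have : ((hO.trdZ (β i * hO.starO (β j)) : ℤ) : ℚ) = G i j := by
        rw [hG, hO.trdZ_spec]; rfl
      exact_mod_cast this
    rw [h1, ← RingHom.mapMatrix_apply, ← RingHom.map_det]
    intro h0
    exact hdet ((ZMod.intCast_zmod_eq_zero_iff_dvd _ _).1 h0))
  refine ⟨φ.comp (Ideal.Quotient.mk _), hφ.2.comp Ideal.Quotient.mk_surjective, fun x => ?_,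
    fun x => by rw [RingHom.comp_apply, htr, hStr], fun x => by rw [RingHom.comp_apply, hnr, hSnr]⟩
  rw [RingHom.comp_apply, map_eq_zero_iff φ hφ.1, Ideal.Quotient.eq_zero_iff_mem, mem_modIdeal]

lemma zmod_natCast_ne_zero {p m : ℕ} [hp : Fact p.Prime] (hm : m.Coprime p) : (m : ZMod p) ≠ 0 := by
  intro h
  rw [ZMod.natCast_eq_zero_iff] at h
  exact hp.out.one_lt.ne' (Nat.eq_one_of_dvd_coprimes hm h dvd_rfl)

/-- The value at `x` does not depend on the integer `m` by which it is multiplied into `O`. -/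
lemma exists_extension_fun {p : ℕ} [hp : Fact p.Prime] (φ₀ : O →+* Matrix (Fin 2) (Fin 2) (ZMod p)) :
    ∃ f : locRing p O → Matrix (Fin 2) (Fin 2) (ZMod p),
      ∀ (x : locRing p O) (m : ℕ) (_ : m.Coprime p) (hx : m • (x : 𝔹 a b) ∈ O),
        f x = (m : ZMod p)⁻¹ • φ₀ ⟨_, hx⟩ := by
  choose d hd hdO using fun x : locRing p O => mem_locAt.1 (mem_locRing.1 x.2)
  let f : locRing p O → Matrix (Fin 2) (Fin 2) (ZMod p) := fun x =>
    (d x : ZMod p)⁻¹ • φ₀ ⟨d x • (x : 𝔹 a b), hdO x⟩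
  have key' : ∀ (x : locRing p O) (m : ℕ) (_ : m.Coprime p) (hx : m • (x : 𝔹 a b) ∈ O),
      f x = (m : ZMod p)⁻¹ • φ₀ ⟨_, hx⟩ := by
    intro x m hm hx
    have hn0 := zmod_natCast_ne_zero (hd x)
    have h1 : m • (⟨d x • (x : 𝔹 a b), hdO x⟩ : O) = d x • (⟨_, hx⟩ : O) := by
      ext1; exact smul_comm _ _ _
    have h2 : (m : ZMod p) • φ₀ ⟨d x • (x : 𝔹 a b), hdO x⟩ = (d x : ZMod p) • φ₀ ⟨_, hx⟩ := by
      rw [Nat.cast_smul_eq_nsmul, Nat.cast_smul_eq_nsmul, ← map_nsmul, ← map_nsmul, h1]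
    rw [eq_inv_smul_iff₀ (zmod_natCast_ne_zero hm), smul_comm, h2, smul_smul, inv_mul_cancel₀ hn0,
      one_smul]
  exact ⟨f, key'⟩

/-- A homomorphism from an order to matrices over `ZMod p` extends to the localization at `p`. -/
lemma exists_extension {p : ℕ} [hp : Fact p.Prime] (φ₀ : O →+* Matrix (Fin 2) (Fin 2) (ZMod p)) :
    ∃ φ : locRing p O →+* Matrix (Fin 2) (Fin 2) (ZMod p),
      ∀ (x : locRing p O) (m : ℕ) (_ : m.Coprime p) (hx : m • (x : 𝔹 a b) ∈ O),
        φ x = (m : ZMod p)⁻¹ • φ₀ ⟨_, hx⟩ := by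
  obtain ⟨f, key'⟩ := exists_extension_fun φ₀
  have keyO : ∀ (x : locRing p O) (hx : (x : 𝔹 a b) ∈ O), f x = φ₀ ⟨_, hx⟩ := by
    intro x hx
    rw [key' x 1 (by simp) (by simpa using hx)]
    simp
  have hadd : ∀ x y, f (x + y) = f x + f y := fun x y => by
    obtain ⟨m, hm, hx⟩ := x.2
    obtain ⟨n, hn, hy⟩ := y.2
    have hx' : (m * n) • (x : 𝔹 a b) ∈ O := by
      rw [mul_comm, mul_smul]; exact O.nsmul_mem hx n
    have hy' : (m * n) • (y : 𝔹 a b) ∈ O := by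
      rw [mul_smul]; exact O.nsmul_mem hy m
    have hmn : (m * n).Coprime p := hm.mul_left hn
    have hxy : (m * n) • ((x + y : locRing p O) : 𝔹 a b) ∈ O := by
      rw [Subring.coe_add, smul_add]; exact O.add_mem hx' hy'
    have h1 : (⟨_, hxy⟩ : O) = ⟨_, hx'⟩ + ⟨_, hy'⟩ := Subtype.ext
      (smul_add (m * n) (x : 𝔹 a b) (y : 𝔹 a b))
    rw [key' x _ hmn hx', key' y _ hmn hy', key' (x + y) _ hmn hxy, h1, map_add, smul_add]
  have hmul : ∀ x y, f (x * y) = f x * f y := fun x y => by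
    obtain ⟨m, hm, hx⟩ := x.2
    obtain ⟨n, hn, hy⟩ := y.2
    have h1 : (m * n) • ((x * y : locRing p O) : 𝔹 a b)
        = (m • (x : 𝔹 a b)) * (n • (y : 𝔹 a b)) := by
      rw [smul_mul_smul_comm, Subring.coe_mul]
    have hxy : (m * n) • ((x * y : locRing p O) : 𝔹 a b) ∈ O := by
      rw [h1]; exact O.mul_mem hx hy
    have h2 : (⟨_, hxy⟩ : O) = ⟨_, hx⟩ * ⟨_, hy⟩ := Subtype.ext h1
    rw [key' x _ hm hx, key' y _ hn hy, key' (x * y) _ (hm.mul_left hn) hxy, h2, map_mul,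
      smul_mul_smul_comm, Nat.cast_mul, mul_inv]
  have hone : f 1 = 1 := (keyO 1 O.one_mem).trans (map_one φ₀)
  have hzero : f 0 = 0 := (keyO 0 O.zero_mem).trans (map_zero φ₀)
  exact ⟨⟨⟨⟨f, hone⟩, hmul⟩, hzero, hadd⟩, key'⟩

/-- At a prime that does not divide the discriminant the order splits modulo `p`. -/
theorem exists_localSplitting (hO : IsOrder O) {p : ℕ} [hp : Fact p.Prime]
    (h : p.Coprime (reducedDisc O)) : Nonempty (LocalSplitting p O) := by
  obtain ⟨φ₀, hsurj, hker, htr, hnr⟩ := exists_ringHom_matrix hO h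
  obtain ⟨φ, key'⟩ := exists_extension φ₀
  refine ⟨⟨φ, fun m => ?_, fun x hx => ?_, fun x k hk => ?_, fun x k hk => ?_⟩⟩
  · obtain ⟨x, rfl⟩ := hsurj m
    refine ⟨⟨x, le_locAt p _ x.2⟩, x.2, ?_⟩
    rw [key' _ 1 (by simp) (by simp [x.2])]
    simp
  · obtain ⟨m, hm, hmx⟩ := x.2
    have h1 := key' x m hm hmx
    rw [hx, eq_comm, smul_eq_zero_iff_right (inv_ne_zero (zmod_natCast_ne_zero hm))] at h1
    obtain ⟨y, hy⟩ := (hker _).1 h1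
    have hp0 : (p : ℚ) ≠ 0 := by exact_mod_cast hp.out.ne_zero
    have hz : m • ((p : ℚ)⁻¹ • (x : 𝔹 a b)) = y := by
      have h2 : m • (x : 𝔹 a b) = p • (y : 𝔹 a b) := congrArg Subtype.val hy
      rw [smul_comm, h2, ← Nat.cast_smul_eq_nsmul ℚ, smul_smul, inv_mul_cancel₀ hp0, one_smul]
    refine ⟨⟨(p : ℚ)⁻¹ • (x : 𝔹 a b), ⟨m, hm, ?_⟩⟩, ?_⟩
    · rw [hz]; exact y.2
    · ext1
      change (x : 𝔹 a b) = p • ((p : ℚ)⁻¹ • (x : 𝔹 a b))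
      rw [← Nat.cast_smul_eq_nsmul ℚ, smul_smul, mul_inv_cancel₀ hp0, one_smul]
  · obtain ⟨m, hm, hmx⟩ := x.2
    rw [key' x m hm hmx, Matrix.trace_smul, htr]
    have h1 : hO.trdZ ⟨_, hmx⟩ = m * k := by
      have : (hO.trdZ ⟨_, hmx⟩ : ℚ) = m * k := by
        rw [hO.trdZ_spec, ← hk, ← trd_smul, Nat.cast_smul_eq_nsmul]
      exact_mod_cast this
    rw [h1]; push_cast
    rw [smul_eq_mul, ← mul_assoc, inv_mul_cancel₀ (zmod_natCast_ne_zero hm), one_mul]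
  · obtain ⟨m, hm, hmx⟩ := x.2
    rw [key' x m hm hmx, Matrix.det_smul, hnr]
    have h1 : hO.nrdZ ⟨_, hmx⟩ = m ^ 2 * k := by
      have : (hO.nrdZ ⟨_, hmx⟩ : ℚ) = m ^ 2 * k := by
        rw [hO.nrdZ_spec, ← hk, ← nrd_smul, Nat.cast_smul_eq_nsmul]
      exact_mod_cast this
    rw [h1]; push_cast
    rw [Fintype.card_fin, ← mul_assoc, ← mul_pow, inv_mul_cancel₀ (zmod_natCast_ne_zero hm), one_pow,
      one_mul]

end Quat

/-! ### Left ideals: inclusions, norms, right orders -/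

section Quat

variable {a b : ℚ}

lemma exists_nsmul_mem_of_mem_span {N : Submodule ℤ (𝔹 a b)} {x : 𝔹 a b}
    (hx : x ∈ Submodule.span ℚ (N : Set (𝔹 a b))) : ∃ k : ℕ, k ≠ 0 ∧ k • x ∈ N := by
  induction hx using Submodule.span_induction with
  | mem x h => exact ⟨1, one_ne_zero, by simpa using h⟩
  | zero => exact ⟨1, one_ne_zero, by simp⟩
  | add x y _ _ hx hy =>
    obtain ⟨k, hk, hx⟩ := hx
    obtain ⟨l, hl, hy⟩ := hy
    refine ⟨k * l, mul_ne_zero hk hl, ?_⟩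
    rw [smul_add]
    refine N.add_mem ?_ ?_
    · rw [mul_comm, mul_smul]; exact N.smul_of_tower_mem l hx
    · rw [mul_smul]; exact N.smul_of_tower_mem k hy
  | smul q x _ hx =>
    obtain ⟨k, hk, hx⟩ := hx
    refine ⟨q.den * k, mul_ne_zero q.den_ne_zero hk, ?_⟩
    have : (q.den * k) • q • x = q.num • (k • x) := by
      rw [← Nat.cast_smul_eq_nsmul ℚ, smul_smul, ← Int.cast_smul_eq_zsmul ℚ,
        ← Nat.cast_smul_eq_nsmul ℚ k, smul_smul, ← Rat.den_mul_eq_num q]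
      congr 1; push_cast; ring
    rw [this]
    exact N.smul_mem _ hx

lemma exists_nsmul_le {M N : Submodule ℤ (𝔹 a b)} (hM : M.FG)
    (hN : Submodule.span ℚ (N : Set (𝔹 a b)) = ⊤) :
    ∃ k : ℕ, k ≠ 0 ∧ ∀ x ∈ M, k • x ∈ N := by
  induction M, hM using Submodule.fg_induction with
  | singleton x =>
    obtain ⟨k, hk, hx⟩ := exists_nsmul_mem_of_mem_span (N := N) (x := x) (by rw [hN]; trivial)
    refine ⟨k, hk, fun y hy => ?_⟩
    obtain ⟨c, rfl⟩ := Submodule.mem_span_singleton.1 hy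
    rw [smul_comm]; exact N.smul_mem c hx
  | sup N₁ N₂ _ _ h₁ h₂ =>
    obtain ⟨m, hm, hx⟩ := h₁
    obtain ⟨n, hn, hy⟩ := h₂
    refine ⟨m * n, mul_ne_zero hm hn, fun z hz => ?_⟩
    obtain ⟨x, hx', y, hy', rfl⟩ := Submodule.mem_sup.1 hz
    rw [smul_add]
    refine N.add_mem ?_ ?_
    · rw [mul_comm, mul_smul]; exact N.smul_of_tower_mem n (hx x hx')
    · rw [mul_smul]; exact N.smul_of_tower_mem m (hy y hy')

lemma fg_of_le {M N : Submodule ℤ (𝔹 a b)} (hM : M.FG) (h : N ≤ M) : N.FG := by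
  have : Module.Finite ℤ M := Module.Finite.iff_fg.2 hM
  have : IsNoetherian ℤ M := isNoetherian_of_isNoetherianRing_of_finite ℤ M
  have : IsNoetherian ℤ N := isNoetherian_of_le h
  exact Module.Finite.iff_fg.1 inferInstance

lemma span_eq_top_of_nsmul_mem {M N : Submodule ℤ (𝔹 a b)}
    (hM : Submodule.span ℚ (M : Set (𝔹 a b)) = ⊤) (h : ∀ x ∈ M, ∃ k : ℕ, k ≠ 0 ∧ k • x ∈ N) :
    Submodule.span ℚ (N : Set (𝔹 a b)) = ⊤ := by
  rw [eq_top_iff, ← hM, Submodule.span_le]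
  intro x hx
  obtain ⟨k, hk, hx⟩ := h x hx
  have hk' : (k : ℚ) ≠ 0 := by exact_mod_cast hk
  have h1 := Submodule.smul_mem _ ((k : ℚ)⁻¹) (Submodule.subset_span (R := ℚ) hx)
  rwa [← Nat.cast_smul_eq_nsmul ℚ, smul_smul, inv_mul_cancel₀ hk', one_smul] at h1

/-- A lattice between `m M` and the lattice `M`. -/
lemma isLattice_of_nsmul_mem {M N : Submodule ℤ (𝔹 a b)} (hM : Submodule.IsLattice ℚ M)
    (hle : N ≤ M) {m : ℕ} (hm : m ≠ 0) (h : ∀ x ∈ M, m • x ∈ N) : Submodule.IsLattice ℚ N where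
  fg := fg_of_le hM.fg hle
  span_eq_top := span_eq_top_of_nsmul_mem hM.span_eq_top fun x hx => ⟨m, hm, h x hx⟩

/-- Only finitely many subgroups lie between `m M` and the lattice `M`. -/
lemma finite_sublattices {M : Submodule ℤ (𝔹 a b)} (hM : Submodule.IsLattice ℚ M) {m : ℕ}
    (hm : m ≠ 0) : {N : Submodule ℤ (𝔹 a b) | N ≤ M ∧ ∀ x ∈ M, m • x ∈ N}.Finite := by
  obtain ⟨B⟩ := exists_basis M
  have : NeZero m := ⟨hm⟩
  let f : Submodule ℤ (𝔹 a b) → Set (Fin 4 → ZMod m) := fun N =>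
    {c | ∑ i, (c i).val • (B i : 𝔹 a b) ∈ N}
  refine Set.Finite.of_injOn (f := f) (t := Set.univ) (fun _ _ => Set.mem_univ _) ?_ Set.finite_univ
  have key : ∀ N : Submodule ℤ (𝔹 a b), N ≤ M → (∀ x ∈ M, m • x ∈ N) →
      ∀ x (hx : x ∈ M), x ∈ N ↔ (fun i => (B.repr ⟨x, hx⟩ i : ZMod m)) ∈ f N := by
    intro N hN hmN x hx
    have h1 : x = ∑ i, B.repr ⟨x, hx⟩ i • (B i : 𝔹 a b) := by
      have := congrArg (fun w : M => (w : 𝔹 a b)) (B.sum_repr ⟨x, hx⟩)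
      simp only [Submodule.coe_sum, Submodule.coe_smul] at this
      exact this.symm
    have h2 : x - ∑ i, ((B.repr ⟨x, hx⟩ i : ZMod m)).val • (B i : 𝔹 a b) ∈ N := by
      conv in x - _ => enter [1]; rw [h1]
      rw [← Finset.sum_sub_distrib]
      refine N.sum_mem fun i _ => ?_
      have h3 : (m : ℤ) ∣ B.repr ⟨x, hx⟩ i - (((B.repr ⟨x, hx⟩ i : ZMod m)).val : ℤ) := by
        rw [← ZMod.intCast_zmod_eq_zero_iff_dvd]
        push_cast
        rw [ZMod.natCast_zmod_val, sub_self]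
      obtain ⟨t, ht⟩ := h3
      rw [← natCast_zsmul, ← sub_smul, ht, mul_comm, mul_smul, natCast_zsmul]
      exact N.smul_mem t (hmN _ (B i).2)
    change _ ↔ ∑ i, ((B.repr ⟨x, hx⟩ i : ZMod m)).val • (B i : 𝔹 a b) ∈ N
    constructor
    · intro h; simpa using N.sub_mem h h2
    · intro h; simpa using N.add_mem h h2
  rintro N ⟨hN, hmN⟩ N' ⟨hN', hmN'⟩ h
  ext x
  constructor
  · intro hx
    rw [key N' hN' hmN' x (hN hx), ← h, ← key N hN hmN]; exact hx
  · intro hx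
    rw [key N hN hmN x (hN' hx), h, ← key N' hN' hmN']; exact hx

lemma mem_latticeMul {M : Submodule ℤ (𝔹 a b)} {x z : 𝔹 a b} :
    z ∈ latticeMul M x ↔ ∃ v ∈ M, v * x = z := by
  simp only [latticeMul, Submodule.mem_map, LinearMap.mulRight_apply]

lemma mem_latticeMul_unit {M : Submodule ℤ (𝔹 a b)} {x : (𝔹 a b)ˣ} {z : 𝔹 a b} :
    z ∈ latticeMul M x ↔ z * (↑x⁻¹ : 𝔹 a b) ∈ M := by
  rw [mem_latticeMul]
  constructor
  · rintro ⟨v, hv, rfl⟩; rwa [Units.mul_inv_cancel_right]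
  · intro h; exact ⟨_, h, by rw [Units.inv_mul_cancel_right]⟩

/-- The right order of a lattice as a subring. -/
def rightRing (M : Submodule ℤ (𝔹 a b)) : Subring (𝔹 a b) where
  carrier := rightOrder M
  zero_mem' := fun y _ => by simp
  one_mem' := fun y hy => by simpa using hy
  add_mem' := fun hx hx' y hy => by rw [mul_add]; exact M.add_mem (hx y hy) (hx' y hy)
  neg_mem' := fun hx y hy => by rw [mul_neg]; exact M.neg_mem (hx y hy)
  mul_mem' := fun hx hx' y hy => by rw [← mul_assoc]; exact hx' _ (hx y hy)

lemma mem_rightRing {M : Submodule ℤ (𝔹 a b)} {x : 𝔹 a b} :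
    x ∈ rightRing M ↔ ∀ y ∈ M, y * x ∈ M := Iff.rfl

lemma eq_of_zmultiples_eq {s t : ℚ} (hs : 0 ≤ s) (ht : 0 ≤ t)
    (h : AddSubgroup.zmultiples s = AddSubgroup.zmultiples t) : s = t := by
  obtain ⟨k, hk⟩ := AddSubgroup.mem_zmultiples_iff.1 (h ▸ AddSubgroup.mem_zmultiples s)
  obtain ⟨l, hl⟩ := AddSubgroup.mem_zmultiples_iff.1 (h.symm ▸ AddSubgroup.mem_zmultiples t)
  rw [zsmul_eq_mul] at hk hl
  rcases hs.eq_or_lt with h0 | h0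
  · rw [← hl, ← h0, mul_zero]
  rcases ht.eq_or_lt with h1 | h1
  · rw [← hk, ← h1, mul_zero]
  have hk0 : 0 < k := by
    by_contra hneg
    have : (k : ℚ) ≤ 0 := by exact_mod_cast not_lt.1 hneg
    nlinarith
  have hkl : k * l = 1 := by
    have h2 : ((k : ℚ) * l) * s = 1 * s := by rw [mul_assoc, hl, hk, one_mul]
    exact_mod_cast mul_right_cancel₀ h0.ne' h2
  rcases Int.mul_eq_one_iff_eq_one_or_neg_one.1 hkl with h2 | h2
  · rw [← hk, h2.1]; simp
  · omega

variable [Fact (a < 0)] [Fact (b < 0)] {O : Subring (𝔹 a b)}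

namespace LeftIdeal

omit [Fact (a < 0)] [Fact (b < 0)] in
lemma ext_lattice {I J : LeftIdeal O} (h : I.lattice = J.lattice) : I = J := by
  cases I; cases J; simp only at h; subst h; rfl

omit [Fact (a < 0)] [Fact (b < 0)] in
lemma fg (I : LeftIdeal O) : I.lattice.FG := I.isLattice.fg

variable (hO : IsOrder O) (I J : LeftIdeal O)

include hO in
lemma mul_mem {o v : 𝔹 a b} (ho : o ∈ O) (hv : v ∈ I.lattice) : o * v ∈ I.lattice := by
  refine mem_of_forall_mem_locAt fun p hp => ?_
  obtain ⟨y, -, hy⟩ := I.exists_isLocGen hO p hp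
  rw [hy, mul_assoc]
  exact (locRing p O).mul_mem (le_locAt p _ ho) ((hy v).1 (le_locAt p _ hv))

include hO in
lemma norm_pos : 0 < latticeNorm (I.lattice : Set (𝔹 a b)) := by
  obtain ⟨y, -, hy⟩ := I.exists_isLocGen hO 2 Nat.prime_two
  exact latticeNorm_pos I.fg hy Nat.prime_two

variable {I J}

omit [Fact (a < 0)] [Fact (b < 0)] in
/-- For `J ⊆ I`, generators differ by an element of the localized order. -/
lemma quot_mem {p : ℕ} {y z : (𝔹 a b)ˣ} (hle : J.lattice ≤ I.lattice)
    (hy : IsLocGen p O I.lattice y) (hz : IsLocGen p O J.lattice z) :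
    ((z * y⁻¹ : (𝔹 a b)ˣ) : 𝔹 a b) ∈ locRing p O :=
  (hy _).1 (locAt_mono hle hz.self_mem)

omit [Fact (a < 0)] [Fact (b < 0)] in
include hO in
lemma padicValRat_quot {p : ℕ} (hp : p.Prime) {y z : (𝔹 a b)ˣ}
    (hy : IsLocGen p O I.lattice y) (hz : IsLocGen p O J.lattice z) {m : ℕ} (hm : m ≠ 0)
    (h : latticeNorm (J.lattice : Set (𝔹 a b)) = m * latticeNorm (I.lattice : Set (𝔹 a b))) :
    padicValRat p (nrd ((z * y⁻¹ : (𝔹 a b)ˣ) : 𝔹 a b)) = padicValRat p m := by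
  have := Fact.mk hp
  have h1 := padicValRat_latticeNorm hO I.fg hy hp
  have h2 := padicValRat_latticeNorm hO J.fg hz hp
  have hm' : (m : ℚ) ≠ 0 := by exact_mod_cast hm
  rw [h, padicValRat.mul hm' (latticeNorm_pos I.fg hy hp).ne', h1] at h2
  rw [Units.val_mul, nrd_mul, nrd_unit_inv, padicValRat.mul (nrd_unit_ne_zero z)
    (inv_ne_zero (nrd_unit_ne_zero y)), padicValRat.inv]
  omega

include hO in
/-- If `N(J) = m N(I)` and `J ⊆ I`, then `m I ⊆ J`. -/
lemma nsmul_mem_of_norm_eq {m : ℕ} (hm : m ≠ 0) (hle : J.lattice ≤ I.lattice)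
    (h : latticeNorm (J.lattice : Set (𝔹 a b)) = m * latticeNorm (I.lattice : Set (𝔹 a b)))
    {x : 𝔹 a b} (hx : x ∈ I.lattice) : m • x ∈ J.lattice := by
  refine mem_of_forall_mem_locAt fun p hp => ?_
  have := Fact.mk hp
  obtain ⟨y, -, hy⟩ := I.exists_isLocGen hO p hp
  obtain ⟨z, -, hz⟩ := J.exists_isLocGen hO p hp
  have hu := quot_mem hle hy hz
  have hv := padicValRat_quot hO hp hy hz hm h
  have hm' : (m : ℚ) ≠ 0 := by exact_mod_cast hm
  set u := z * y⁻¹ with hu_def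
  rw [hz]
  have h1 : m • x * (↑z⁻¹ : 𝔹 a b)
      = (x * (↑y⁻¹ : 𝔹 a b)) * ((m / nrd (u : 𝔹 a b)) • star (u : 𝔹 a b)) := by
    have h2 : (↑z⁻¹ : 𝔹 a b) = (↑y⁻¹ : 𝔹 a b) * (↑u⁻¹ : 𝔹 a b) := by
      rw [← Units.val_mul, hu_def]; congr 1; group
    rw [h2, unit_inv_eq u, div_eq_mul_inv, mul_smul, ← mul_assoc, ← Nat.cast_smul_eq_nsmul ℚ,
      smul_mul_assoc, smul_mul_assoc, mul_smul_comm, mul_smul_comm, mul_smul_comm]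
  rw [h1]
  refine (locRing p O).mul_mem ((hy x).1 (le_locAt p _ hx)) ?_
  refine ratSmul_mem_locAt (hO.star_mem_locRing hu) ?_
  refine (pInt_iff_padicValRat hp).2 ?_
  rw [padicValRat.div hm' (nrd_unit_ne_zero u), hv, sub_self]

variable (I)

include hO in
lemma finite_heckeSet {m : ℕ} (hm : m ≠ 0) : (heckeSet m I).Finite := by
  refine Set.Finite.of_finite_image (f := LeftIdeal.lattice)
    ((finite_sublattices I.isLattice hm).subset ?_) (fun J _ K _ h => ext_lattice h)
  rintro _ ⟨J, ⟨hle, hn⟩, rfl⟩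
  exact ⟨hle, fun x hx => nsmul_mem_of_norm_eq hO hm hle hn hx⟩

/-- Two lattices with the same positive valuations of norms have the same norm. -/
lemma norm_eq_of_padicValRat {s t : ℚ} (hs : 0 < s) (ht : 0 < t)
    (h : ∀ p : ℕ, p.Prime → padicValRat p s = padicValRat p t) : s = t := by
  have h1 : s / t = 1 := by
    refine eq_one_of_forall_pInt (div_pos hs ht) (fun p hp => ?_) (fun p hp => ?_)
    · have := Fact.mk hp
      rw [pInt_iff_padicValRat hp, padicValRat.div hs.ne' ht.ne', h p hp, sub_self]
    · have := Fact.mk hp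
      rw [pInt_iff_padicValRat hp, inv_div, padicValRat.div ht.ne' hs.ne', h p hp, sub_self]
  rwa [div_eq_one_iff_eq ht.ne'] at h1

/-- The left ideal `I x`. -/
def mulUnit (x : (𝔹 a b)ˣ) : LeftIdeal O :=
  ofLocGen (latticeMul I.lattice x) ⟨I.fg.map _, by
    refine eq_top_iff.2 fun z _ => ?_
    obtain ⟨k, hk, hz⟩ := exists_nsmul_mem_of_mem_span (N := I.lattice)
      (x := z * (↑x⁻¹ : 𝔹 a b)) (by rw [I.isLattice.span_eq_top]; trivial)
    have h1 : k • z ∈ latticeMul I.lattice x := by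
      rw [mem_latticeMul_unit, smul_mul_assoc]; exact hz
    have hk' : (k : ℚ) ≠ 0 := by exact_mod_cast hk
    have h2 := Submodule.smul_mem _ ((k : ℚ)⁻¹) (Submodule.subset_span (R := ℚ) h1)
    rwa [← Nat.cast_smul_eq_nsmul ℚ, smul_smul, inv_mul_cancel₀ hk', one_smul] at h2⟩
  (fun p hp => by
    obtain ⟨y, -, hy⟩ := I.exists_isLocGen hO p hp
    refine ⟨y * x, fun z => ?_⟩
    have h1 : z ∈ locAt p (latticeMul I.lattice x) ↔ z * (↑x⁻¹ : 𝔹 a b) ∈ locAt p I.lattice := by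
      simp only [mem_locAt, mem_latticeMul_unit, smul_mul_assoc]
    rw [h1, hy, mul_inv_rev, Units.val_mul, mul_assoc])

lemma mulUnit_lattice (x : (𝔹 a b)ˣ) : (I.mulUnit hO x).lattice = latticeMul I.lattice x := rfl

omit [Fact (a < 0)] [Fact (b < 0)] in
/-- The hypothesis on the sign is needed because a gcd is non-negative. -/
lemma norm_latticeMul (M : Submodule ℤ (𝔹 a b)) (hM : M.FG) (x : (𝔹 a b)ˣ)
    (hx : 0 < nrd (x : 𝔹 a b)) :
    latticeNorm (latticeMul M x : Set (𝔹 a b)) =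
      nrd (x : 𝔹 a b) * latticeNorm (M : Set (𝔹 a b)) := by
  have h1 : nrd '' (latticeMul M x : Set (𝔹 a b))
      = (AddMonoidHom.mulLeft (nrd (x : 𝔹 a b))) '' (nrd '' (M : Set (𝔹 a b))) := by
    rw [Set.image_image]
    ext q
    simp only [Set.mem_image, SetLike.mem_coe, mem_latticeMul]
    constructor
    · rintro ⟨_, ⟨v, hv, rfl⟩, rfl⟩; exact ⟨v, hv, by simp [nrd_mul, mul_comm]⟩
    · rintro ⟨v, hv, rfl⟩; exact ⟨_, ⟨v, hv, rfl⟩, by simp [nrd_mul, mul_comm]⟩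
  obtain ⟨h2, h3⟩ := ratGcd_spec (exists_nrd_denom (hM.map (LinearMap.mulRight ℤ (x : 𝔹 a b))))
  obtain ⟨h4, h5⟩ := ratGcd_spec (exists_nrd_denom hM)
  change 0 ≤ latticeNorm (latticeMul M x : Set (𝔹 a b)) at h2
  change AddSubgroup.closure (nrd '' (latticeMul M x : Set (𝔹 a b)))
    = AddSubgroup.zmultiples (latticeNorm (latticeMul M x : Set (𝔹 a b))) at h3
  change 0 ≤ latticeNorm (M : Set (𝔹 a b)) at h4
  rw [h1, ← AddMonoidHom.map_closure, h5, AddMonoidHom.map_zmultiples] at h3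
  change AddSubgroup.zmultiples (nrd (x : 𝔹 a b) * latticeNorm (M : Set (𝔹 a b))) = _ at h3
  have h6 : 0 ≤ nrd (x : 𝔹 a b) * latticeNorm (M : Set (𝔹 a b)) := mul_nonneg hx.le h4
  exact (eq_of_zmultiples_eq h6 h2 h3).symm

lemma norm_mulUnit (x : (𝔹 a b)ˣ) :
    latticeNorm ((I.mulUnit hO x).lattice : Set (𝔹 a b)) =
      nrd (x : 𝔹 a b) * latticeNorm (I.lattice : Set (𝔹 a b)) :=
  norm_latticeMul _ I.fg x (nrd_unit_pos x)

lemma mulUnit_mul (x y : (𝔹 a b)ˣ) : (I.mulUnit hO x).mulUnit hO y = I.mulUnit hO (x * y) :=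
  ext_lattice (by simp only [mulUnit_lattice, latticeMul_mul, Units.val_mul])

lemma mulUnit_one : I.mulUnit hO 1 = I :=
  ext_lattice (by simp only [mulUnit_lattice, Units.val_one, latticeMul_one])

variable {I}

section RightOrder

omit [Fact (a < 0)] [Fact (b < 0)] in
/-- Locally at `p` the right order of `O y` is `y⁻¹ O y`. -/
lemma mem_locRing_rightRing {p : ℕ} {y : (𝔹 a b)ˣ} (hy : IsLocGen p O I.lattice y)
    {x : 𝔹 a b} :
    x ∈ locRing p (rightRing I.lattice) ↔ (y : 𝔹 a b) * x * (↑y⁻¹ : 𝔹 a b) ∈ locRing p O := by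
  constructor
  · rintro ⟨m, hm, hx⟩
    obtain ⟨n, hn, hny⟩ := hy.self_mem
    have h1 := mem_rightRing.1 (mem_subringLattice.1 hx) _ hny
    refine (hy _).1 ⟨n * m, hn.mul_left hm, ?_⟩
    rwa [← smul_mul_smul_comm]
  · intro h
    have h1 : latticeMul I.lattice x ≤ locAt p I.lattice := by
      intro z hz
      obtain ⟨v, hv, rfl⟩ := mem_latticeMul.1 hz
      have h2 := (locRing p O).mul_mem ((hy v).1 (le_locAt p _ hv)) h
      rw [hy]
      rwa [← mul_assoc, ← mul_assoc, Units.inv_mul_cancel_right] at h2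
    obtain ⟨m, hm, h2⟩ := exists_nsmul_mem_of_fg (I.fg.map _) h1
    refine ⟨m, hm, fun v hv => ?_⟩
    rw [mul_smul_comm]
    exact h2 _ (mem_latticeMul.2 ⟨v, hv, rfl⟩)

include hO in
lemma rightRing_isOrder : IsOrder (rightRing I.lattice) := by
  obtain ⟨y, hyI, -⟩ := I.exists_isLocGen hO 2 Nat.prime_two
  -- the right order is contained in `y⁻¹ I` for `y ∈ I`
  refine ⟨fg_of_le (I.fg.map (LinearMap.mulLeft ℤ (↑y⁻¹ : 𝔹 a b))) fun x hx => ?_, ?_⟩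
  · exact ⟨y * x, hx _ hyI, by simp⟩
  · refine eq_top_iff.2 fun x _ => ?_
    obtain ⟨k, hk, h⟩ := exists_nsmul_le (M := latticeMul I.lattice x) (I.fg.map _)
      I.isLattice.span_eq_top
    have h1 : k • x ∈ subringLattice (rightRing I.lattice) := fun v hv => by
      rw [mul_smul_comm]; exact h _ (mem_latticeMul.2 ⟨v, hv, rfl⟩)
    have hk' : (k : ℚ) ≠ 0 := by exact_mod_cast hk
    have h2 := Submodule.smul_mem _ ((k : ℚ)⁻¹) (Submodule.subset_span (R := ℚ) h1)
    rwa [← Nat.cast_smul_eq_nsmul ℚ, smul_smul, inv_mul_cancel₀ hk', one_smul] at h2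

end RightOrder

end LeftIdeal

end Quat

/-! ### Ideals of prime norm and lines over the residue field -/

section TwoByTwo

variable {F : Type*} [Field F]

lemma exists_smul_of_dotProduct_eq_zero {w r : Fin 2 → F} (hw : w ≠ 0)
    (h : r 0 * w 0 + r 1 * w 1 = 0) : ∃ c, r 0 = c * -w 1 ∧ r 1 = c * w 0 := by
  by_cases h0 : w 0 = 0
  · have h1 : w 1 ≠ 0 := fun h1 => hw (by ext i; fin_cases i <;> simp [h0, h1])
    refine ⟨-r 0 / w 1, by field_simp, ?_⟩
    rw [h0] at h ⊢
    simp [h1] at h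
    simp [h]
  · refine ⟨r 1 / w 0, ?_, by field_simp⟩
    field_simp
    linear_combination h

/-- A `2 × 2` matrix that kills the kernel of a non-zero singular matrix is a left multiple of
it. -/
lemma exists_mul_eq_of_mulVec_eq_zero {A X : Matrix (Fin 2) (Fin 2) F} {w : Fin 2 → F} (hw : w ≠ 0)
    (hA : A ≠ 0) (hAw : A.mulVec w = 0) (hXw : X.mulVec w = 0) : ∃ Y, X = Y * A := by
  have hA' : ∀ i, ∃ c, A i 0 = c * -w 1 ∧ A i 1 = c * w 0 := fun i =>
    exists_smul_of_dotProduct_eq_zero hw (by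
      have := congrFun hAw i; simpa [Matrix.mulVec, dotProduct, Fin.sum_univ_two] using this)
  have hX' : ∀ i, ∃ c, X i 0 = c * -w 1 ∧ X i 1 = c * w 0 := fun i =>
    exists_smul_of_dotProduct_eq_zero hw (by
      have := congrFun hXw i; simpa [Matrix.mulVec, dotProduct, Fin.sum_univ_two] using this)
  choose α hα0 hα1 using hA'
  choose ξ hξ0 hξ1 using hX'
  obtain ⟨i, hi⟩ : ∃ i, α i ≠ 0 := by
    by_contra! h
    apply hA
    ext i j
    fin_cases j
    · simp [hα0, h]
    · simp [hα1, h]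
  refine ⟨Matrix.of fun k j => if j = i then ξ k / α i else 0, ?_⟩
  ext k j
  rw [Matrix.mul_apply]
  simp only [Matrix.of_apply, ite_mul, zero_mul, Finset.sum_ite_eq', Finset.mem_univ, if_true]
  fin_cases j
  · simp only [Fin.zero_eta, hξ0, hα0]; field_simp
  · simp only [Fin.mk_one, hξ1, hα1]; field_simp

/-- The kernel of a non-zero `2 × 2` matrix is at most a line. -/
lemma exists_smul_eq_of_mulVec_eq_zero {A : Matrix (Fin 2) (Fin 2) F} {w v : Fin 2 → F} (hw : w ≠ 0)
    (hA : A ≠ 0) (hAw : A.mulVec w = 0) (hAv : A.mulVec v = 0) : ∃ c : F, v = c • w := by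
  obtain ⟨i, hi⟩ : ∃ i, A i ≠ 0 := by
    by_contra! h; exact hA (by ext i j; rw [h i]; rfl)
  have key : ∀ u : Fin 2 → F, A.mulVec u = 0 → ∃ c, u 0 = c * -A i 1 ∧ u 1 = c * A i 0 := fun u hu =>
    exists_smul_of_dotProduct_eq_zero hi (by
      have := congrFun hu i
      simp only [Matrix.mulVec, dotProduct, Fin.sum_univ_two, Pi.zero_apply] at this
      linear_combination this)
  obtain ⟨c, hc0, hc1⟩ := key w hAw
  obtain ⟨d, hd0, hd1⟩ := key v hAv
  have hc : c ≠ 0 := by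
    rintro rfl
    exact hw (by ext i; fin_cases i <;> simp [hc0, hc1])
  refine ⟨d / c, ?_⟩
  ext j
  fin_cases j
  · simp [hc0, hd0]; field_simp
  · simp [hc1, hd1]; field_simp

end TwoByTwo

section Quat

variable {a b : ℚ} {O : Subring (𝔹 a b)}

namespace LocalSplitting

variable {p : ℕ} (S : LocalSplitting p O)

/-- The reduction map extended by zero to the whole algebra. -/
def red (x : 𝔹 a b) : Matrix (Fin 2) (Fin 2) (ZMod p) :=
  open Classical in if h : x ∈ locRing p O then S.φ ⟨x, h⟩ else 0

variable {x y : 𝔹 a b}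

lemma red_eq (hx : x ∈ locRing p O) : S.red x = S.φ ⟨x, hx⟩ := dif_pos hx

lemma red_add (hx : x ∈ locRing p O) (hy : y ∈ locRing p O) : S.red (x + y) = S.red x + S.red y := by
  rw [S.red_eq hx, S.red_eq hy, S.red_eq (add_mem hx hy), ← map_add]; rfl

lemma red_mul (hx : x ∈ locRing p O) (hy : y ∈ locRing p O) : S.red (x * y) = S.red x * S.red y := by
  rw [S.red_eq hx, S.red_eq hy, S.red_eq (mul_mem hx hy), ← map_mul]; rfl

lemma red_one : S.red 1 = 1 := by rw [S.red_eq (one_mem _)]; exact map_one _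

lemma red_zero : S.red 0 = 0 := by rw [S.red_eq (zero_mem _)]; exact map_zero _

lemma red_sub (hx : x ∈ locRing p O) (hy : y ∈ locRing p O) : S.red (x - y) = S.red x - S.red y := by
  rw [S.red_eq hx, S.red_eq hy, S.red_eq (sub_mem hx hy), ← map_sub]; rfl

lemma red_nsmul (hx : x ∈ locRing p O) (n : ℕ) : S.red (n • x) = n • S.red x := by
  rw [S.red_eq hx, S.red_eq (nsmul_mem hx n), ← map_nsmul]; rfl

lemma red_zsmul (hx : x ∈ locRing p O) (n : ℤ) : S.red (n • x) = n • S.red x := by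
  rw [S.red_eq hx, S.red_eq (zsmul_mem hx n), ← map_zsmul]; rfl

lemma red_p_smul (hx : x ∈ locRing p O) : S.red (p • x) = 0 := by
  rw [S.red_nsmul hx]
  ext i j
  simp

lemma red_surj (m : Matrix (Fin 2) (Fin 2) (ZMod p)) : ∃ x ∈ O, S.red x = m := by
  obtain ⟨x, hx, rfl⟩ := S.surj m
  exact ⟨x, hx, by rw [S.red_eq x.2]⟩

lemma exists_of_red_eq_zero (hx : x ∈ locRing p O) (h : S.red x = 0) :
    ∃ y ∈ locRing p O, x = p • y := by
  rw [S.red_eq hx] at h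
  obtain ⟨y, hy⟩ := S.ker _ h
  exact ⟨y, y.2, congrArg Subtype.val hy⟩

lemma trace_red (hx : x ∈ locRing p O) {k : ℤ} (h : trd x = k) : (S.red x).trace = k := by
  rw [S.red_eq hx]; exact S.trace _ k h

lemma det_red (hx : x ∈ locRing p O) {k : ℤ} (h : nrd x = k) : (S.red x).det = k := by
  rw [S.red_eq hx]; exact S.det _ k h

variable [hp : Fact p.Prime]

lemma det_red_eq_zero (hO : IsOrder O) {u : (𝔹 a b)ˣ}
    (hu : (u : 𝔹 a b) ∈ locRing p O) (h : 1 ≤ padicValRat p (nrd (u : 𝔹 a b))) :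
    (S.red u).det = 0 := by
  obtain ⟨m, hm, hmu⟩ := hu
  obtain ⟨k, hk⟩ := hO.nrd_int hmu
  have h1 := S.det_red (le_locAt p _ hmu) hk
  rw [S.red_nsmul ⟨m, hm, hmu⟩, ← Nat.cast_smul_eq_nsmul (ZMod p), Matrix.det_smul] at h1
  have hdvd : (p : ℤ) ∣ k := by
    have h2 : nrd (m • (u : 𝔹 a b)) = m ^ 2 * nrd (u : 𝔹 a b) := by
      rw [← nrd_smul, Nat.cast_smul_eq_nsmul]
    have hm0 : (m : ℚ) ≠ 0 := by
      intro h0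
      have : m = 0 := by exact_mod_cast h0
      subst this
      exact hp.out.one_lt.ne' (by simpa using hm)
    have h3 : PInt p ((k : ℚ) / p) := by
      rw [pInt_iff_padicValRat hp.out, ← hk, h2, padicValRat.div (mul_ne_zero (pow_ne_zero 2 hm0)
        (nrd_unit_ne_zero u)) (by exact_mod_cast hp.out.ne_zero), padicValRat.mul (pow_ne_zero 2 hm0)
        (nrd_unit_ne_zero u), padicValRat.self hp.out.one_lt, padicValRat.pow]
      have : (0 : ℤ) ≤ padicValRat p (m : ℚ) := by rw [padicValRat.of_nat]; positivity
      push_cast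
      linarith
    obtain ⟨n, hn, l, hl⟩ := h3.exists_mul_eq
    have hp0 : (p : ℚ) ≠ 0 := by exact_mod_cast hp.out.ne_zero
    have h4 : (n : ℤ) * k = p * l := by
      have : (n : ℚ) * k = p * l := by rw [← hl]; field_simp
      exact_mod_cast this
    exact IsCoprime.dvd_of_dvd_mul_left (Nat.isCoprime_iff_coprime.2 hn.symm) (Dvd.intro _ h4.symm)
  rw [(ZMod.intCast_zmod_eq_zero_iff_dvd k p).2 hdvd] at h1
  simpa [zmod_natCast_ne_zero hm] using h1

lemma red_ne_zero (hO : IsOrder O) {u : (𝔹 a b)ˣ} (hu : (u : 𝔹 a b) ∈ locRing p O)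
    (h : padicValRat p (nrd (u : 𝔹 a b)) < 2) : S.red u ≠ 0 := by
  intro h0
  obtain ⟨y, hy, hyu⟩ := S.exists_of_red_eq_zero hu h0
  have h1 : nrd (u : 𝔹 a b) = p ^ 2 * nrd y := by
    rw [hyu, ← nrd_smul, Nat.cast_smul_eq_nsmul]
  have hy0 : nrd y ≠ 0 := fun h2 => nrd_unit_ne_zero u (by rw [h1, h2, mul_zero])
  have hp0 : (p : ℚ) ≠ 0 := by exact_mod_cast hp.out.ne_zero
  rw [h1, padicValRat.mul (pow_ne_zero 2 hp0) hy0, padicValRat.pow,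
    padicValRat.self hp.out.one_lt] at h
  have h2 := (pInt_iff_padicValRat hp.out).1 (hO.nrd_pInt hy)
  push_cast at h
  linarith

/-- The left ideal of the localized order generated by an element of norm `p`, as the annihilator
of a line. -/
lemma mul_inv_mem_iff (hO : IsOrder O) {u : (𝔹 a b)ˣ}
    (hu : (u : 𝔹 a b) ∈ locRing p O) (h : padicValRat p (nrd (u : 𝔹 a b)) = 1)
    {w : Fin 2 → ZMod p} (hw : w ≠ 0) (huw : (S.red u).mulVec w = 0) {x : 𝔹 a b} :
    x * (↑u⁻¹ : 𝔹 a b) ∈ locRing p O ↔ x ∈ locRing p O ∧ (S.red x).mulVec w = 0 := by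
  constructor
  · intro hx
    have h1 : x = x * (↑u⁻¹ : 𝔹 a b) * u := by rw [Units.inv_mul_cancel_right]
    rw [h1]
    refine ⟨mul_mem hx hu, ?_⟩
    rw [S.red_mul hx hu, ← Matrix.mulVec_mulVec, huw, Matrix.mulVec_zero]
  · rintro ⟨hx, hxw⟩
    -- the reduction of `x` is a left multiple of that of `u`; lift the quotient and use `p u⁻¹ = (p
    -- / nrd u) ū`, which is integral at `p`
    obtain ⟨Y, hY⟩ := exists_mul_eq_of_mulVec_eq_zero hw (S.red_ne_zero hO hu (by rw [h]; norm_num))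
      huw hxw
    obtain ⟨o, ho, rfl⟩ := S.red_surj Y
    have ho' : o ∈ locRing p O := le_locAt p _ ho
    obtain ⟨z, hz, hzx⟩ := S.exists_of_red_eq_zero (x := x - o * u) (sub_mem hx (mul_mem ho' hu))
      (by rw [S.red_sub hx (mul_mem ho' hu), S.red_mul ho' hu, hY, sub_self])
    have h1 : x * (↑u⁻¹ : 𝔹 a b)
        = o + z * ((p / nrd (u : 𝔹 a b)) • star (u : 𝔹 a b)) := by
      have h2 : x = o * u + p • z := by rw [← hzx]; abel
      rw [h2, add_mul, Units.mul_inv_cancel_right, unit_inv_eq, ← Nat.cast_smul_eq_nsmul ℚ,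
        smul_mul_assoc, mul_smul_comm, mul_smul_comm, smul_smul, div_eq_mul_inv]
    rw [h1]
    refine add_mem ho' (mul_mem hz (ratSmul_mem_locAt (hO.star_mem_locRing hu) ?_))
    refine (pInt_iff_padicValRat hp.out).2 ?_
    rw [padicValRat.div (by exact_mod_cast hp.out.ne_zero) (nrd_unit_ne_zero u), h,
      padicValRat.self hp.out.one_lt, sub_self]

variable [Fact (a < 0)] [Fact (b < 0)]

omit [Fact (a < 0)] [Fact (b < 0)] in
/-- Every line is the kernel of the reduction of an element whose norm is exactly divisible by
`p`. -/
lemma exists_unit (hO : IsOrder O) {w : Fin 2 → ZMod p} (hw : w ≠ 0) :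
    ∃ u : (𝔹 a b)ˣ, (u : 𝔹 a b) ∈ locRing p O ∧
      padicValRat p (nrd (u : 𝔹 a b)) = 1 ∧ (S.red u).mulVec w = 0 := by
  -- the rank one matrix whose kernel is spanned by `w`
  obtain ⟨u₀, hu₀, hred⟩ := S.red_surj !![-w 1, w 0; 0, 0]
  have hu₀' : u₀ ∈ locRing p O := le_locAt p _ hu₀
  have hker : (S.red u₀).mulVec w = 0 := by
    rw [hred]; ext i; fin_cases i <;> simp [Matrix.mulVec, dotProduct, Fin.sum_univ_two]; ring
  have hp0 : (p : ℚ) ≠ 0 := by exact_mod_cast hp.out.ne_zero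
  -- it is enough to find a lift whose norm is not divisible by `p ^ 2`
  suffices h : ∃ u ∈ O, S.red u = S.red u₀ ∧ ∃ k : ℤ, nrd u = p * k ∧ ¬ (p : ℤ) ∣ k by
    obtain ⟨u, hu, hr, k, hk, hpk⟩ := h
    have hk0 : (k : ℚ) ≠ 0 := by
      intro h0
      have : k = 0 := by exact_mod_cast h0
      exact hpk (by simp [this])
    have hn : nrd u ≠ 0 := by rw [hk]; exact mul_ne_zero hp0 hk0
    refine ⟨unitOfNrd u hn, le_locAt p _ hu, ?_, ?_⟩
    · change padicValRat p (nrd u) = 1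
      rw [hk, padicValRat.mul hp0 hk0, padicValRat.self hp.out.one_lt, padicValRat.of_int,
        padicValInt.eq_zero_of_not_dvd hpk]
      simp
    · change (S.red u).mulVec w = 0
      rw [hr, hker]
  obtain ⟨N, hN⟩ := hO.nrd_int hu₀
  have hpN : (p : ℤ) ∣ N := by
    rw [← ZMod.intCast_zmod_eq_zero_iff_dvd, ← S.det_red hu₀' hN, hred]
    simp
  obtain ⟨k, rfl⟩ := hpN
  by_cases hpk : (p : ℤ) ∣ k
  -- adding `p s̄` to `u₀` changes `nrd u₀ / p` by `tr (u₀ s)` modulo `p`, which can be made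
  -- non-zero
  · obtain ⟨s, hs, hsT⟩ : ∃ s ∈ O, (S.red u₀ * S.red s).trace ≠ 0 := by
      by_cases h1 : w 1 = 0
      · have h0 : w 0 ≠ 0 := fun h0 => hw (by ext i; fin_cases i <;> simp [h0, h1])
        obtain ⟨s, hs, hr⟩ := S.red_surj !![0, 0; 1, 0]
        refine ⟨s, hs, ?_⟩
        rw [hr, hred, Matrix.mul_fin_two, Matrix.trace_fin_two_of]
        simpa using h0
      · obtain ⟨s, hs, hr⟩ := S.red_surj !![1, 0; 0, 0]
        refine ⟨s, hs, ?_⟩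
        rw [hr, hred, Matrix.mul_fin_two, Matrix.trace_fin_two_of]
        simpa using h1
    obtain ⟨t, ht⟩ := hO.trd_int (O.mul_mem hu₀ hs)
    obtain ⟨n, hn⟩ := hO.nrd_int hs
    have hst : star s ∈ O := hO.star_mem hs
    refine ⟨u₀ + p • star s, add_mem hu₀ (nsmul_mem hst p), ?_, k + p * n + t, ?_, ?_⟩
    · rw [S.red_add hu₀' (nsmul_mem (le_locAt p _ hst) p), S.red_p_smul (le_locAt p _ hst), add_zero]
    · rw [nrd_add, hN, ← Nat.cast_smul_eq_nsmul ℚ, nrd_smul, nrd_star, star_smul, star_star,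
        mul_smul_comm, trd_smul, ht, hn]
      simp only [star_trivial]
      push_cast; ring
    · intro hd
      have h2 : (p : ℤ) ∣ t := by
        have h3 : (p : ℤ) ∣ k + p * n := dvd_add hpk (Dvd.intro _ rfl)
        exact (dvd_add_right h3).1 hd
      have h4 := S.trace_red (le_locAt p _ (mem_subringLattice.2 (O.mul_mem hu₀ hs))) ht
      rw [S.red_mul hu₀' (le_locAt p _ hs), (ZMod.intCast_zmod_eq_zero_iff_dvd _ _).2 h2] at h4
      exact hsT h4
  · exact ⟨u₀, hu₀, rfl, k, by rw [hN]; push_cast; rfl, hpk⟩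

end LocalSplitting

/-- The elements of `I` whose reduction (with respect to the generator `y`) kills the vector `w`. -/
def LeftIdeal.lineLattice {p : ℕ} (S : LocalSplitting p O) (I : LeftIdeal O) (y : (𝔹 a b)ˣ)
    (hy : IsLocGen p O I.lattice y) (w : Fin 2 → ZMod p) : Submodule ℤ (𝔹 a b) where
  carrier := {v | v ∈ I.lattice ∧ (S.red (v * (↑y⁻¹ : 𝔹 a b))).mulVec w = 0}
  zero_mem' := ⟨zero_mem _, by rw [zero_mul, S.red_zero, Matrix.zero_mulVec]⟩
  add_mem' := by
    rintro v v' ⟨h1, h2⟩ ⟨h3, h4⟩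
    refine ⟨add_mem h1 h3, ?_⟩
    rw [add_mul, S.red_add ((hy v).1 (le_locAt p _ h1)) ((hy v').1 (le_locAt p _ h3)),
      Matrix.add_mulVec, h2, h4, add_zero]
  smul_mem' := by
    rintro c v ⟨h1, h2⟩
    refine ⟨Submodule.smul_mem _ c h1, ?_⟩
    rw [smul_mul_assoc, S.red_zsmul ((hy v).1 (le_locAt p _ h1)), Matrix.smul_mulVec, h2, smul_zero]

variable [Fact (a < 0)] [Fact (b < 0)]

namespace LeftIdeal

variable {p : ℕ} (S : LocalSplitting p O) (hO : IsOrder O) (I : LeftIdeal O)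
  (y : (𝔹 a b)ˣ) (hy : IsLocGen p O I.lattice y)

variable {I y} {w : Fin 2 → ZMod p}

omit [Fact (a < 0)] [Fact (b < 0)] in
lemma lineLattice_le : lineLattice S I y hy w ≤ I.lattice := fun _ h => h.1

omit [Fact (a < 0)] [Fact (b < 0)] in
lemma p_smul_mem_lineLattice {v : 𝔹 a b} (hv : v ∈ I.lattice) :
    p • v ∈ lineLattice S I y hy w := by
  refine ⟨I.lattice.smul_of_tower_mem p hv, ?_⟩
  rw [smul_mul_assoc, S.red_p_smul ((hy v).1 (le_locAt p _ hv)), Matrix.zero_mulVec]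

variable [hp : Fact p.Prime]

omit [Fact (a < 0)] [Fact (b < 0)] in
lemma mem_locAt_lineLattice {v : 𝔹 a b} : v ∈ locAt p (lineLattice S I y hy w) ↔
    v ∈ locAt p I.lattice ∧ (S.red (v * (↑y⁻¹ : 𝔹 a b))).mulVec w = 0 := by
  have key : ∀ m : ℕ, m.Coprime p → v ∈ locAt p I.lattice →
      ((S.red (m • v * (↑y⁻¹ : 𝔹 a b))).mulVec w = 0 ↔
        (S.red (v * (↑y⁻¹ : 𝔹 a b))).mulVec w = 0) := by
    intro m hm hv
    rw [smul_mul_assoc, S.red_nsmul ((hy v).1 hv), ← Nat.cast_smul_eq_nsmul (ZMod p),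
      Matrix.smul_mulVec, smul_eq_zero_iff_right (zmod_natCast_ne_zero hm)]
  constructor
  · rintro ⟨m, hm, h1, h2⟩
    have hv : v ∈ locAt p I.lattice := ⟨m, hm, h1⟩
    exact ⟨hv, (key m hm hv).1 h2⟩
  · rintro ⟨⟨m, hm, h1⟩, h2⟩
    exact ⟨m, hm, h1, (key m hm ⟨m, hm, h1⟩).2 h2⟩

omit [Fact (a < 0)] [Fact (b < 0)] in
lemma isLocGen_lineLattice (hw : w ≠ 0) {u : (𝔹 a b)ˣ} (hO : IsOrder O)
    (hu : (u : 𝔹 a b) ∈ locRing p O)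
    (h : padicValRat p (nrd (u : 𝔹 a b)) = 1) (huw : (S.red u).mulVec w = 0) :
    IsLocGen p O (lineLattice S I y hy w) (u * y) := by
  intro x
  rw [mem_locAt_lineLattice, mul_inv_rev, Units.val_mul, ← mul_assoc, S.mul_inv_mem_iff hO hu h hw huw,
    hy]

omit [Fact (a < 0)] [Fact (b < 0)] in
lemma locAt_eq_of_prime_ne {q m : ℕ} {M N : Submodule ℤ (𝔹 a b)} (hq : m.Coprime q)
    (hle : N ≤ M) (h : ∀ x ∈ M, m • x ∈ N) : locAt q N = locAt q M :=
  le_antisymm (locAt_mono hle) (locAt_le_of_le_locAt fun x hx => ⟨m, hq, h x hx⟩)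

/-- The left ideal of norm `p N(I)` attached to a line. -/
def lineIdeal (hw : w ≠ 0) : LeftIdeal O :=
  ofLocGen (lineLattice S I y hy w)
    (isLattice_of_nsmul_mem I.isLattice (lineLattice_le S hy) hp.out.ne_zero
      fun _ hx => p_smul_mem_lineLattice S hy hx)
    (fun q hq => by
      by_cases hqp : q = p
      · subst hqp
        obtain ⟨u, hu, h1, h2⟩ := S.exists_unit hO hw
        exact ⟨_, isLocGen_lineLattice S hy hw hO hu h1 h2⟩
      · obtain ⟨z, -, hz⟩ := I.exists_isLocGen hO q hq
        refine ⟨z, fun x => ?_⟩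
        rw [locAt_eq_of_prime_ne ((Nat.coprime_primes hp.out hq).2 (Ne.symm hqp))
          (lineLattice_le S hy) (fun _ hx => p_smul_mem_lineLattice S hy hx), hz])

lemma lineIdeal_lattice (hw : w ≠ 0) : (lineIdeal S hO hy hw).lattice = lineLattice S I y hy w := rfl

/-- The norm is computed at each prime from local generators. -/
lemma lineIdeal_mem (hw : w ≠ 0) : lineIdeal S hO hy hw ∈ heckeSet p I := by
  refine ⟨lineLattice_le S hy, ?_⟩
  have hp0 : (p : ℚ) ≠ 0 := by exact_mod_cast hp.out.ne_zero
  have hpos : (0 : ℚ) < p := by exact_mod_cast hp.out.pos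
  refine norm_eq_of_padicValRat (norm_pos hO _) (mul_pos hpos (norm_pos hO _)) fun q hq => ?_
  have := Fact.mk hq
  rw [padicValRat.mul hp0 (norm_pos hO I).ne']
  by_cases hqp : q = p
  · subst hqp
    obtain ⟨u, hu, h1, h2⟩ := S.exists_unit hO hw
    rw [padicValRat_latticeNorm hO (fg _) (isLocGen_lineLattice S hy hw hO hu h1 h2) hq,
      padicValRat_latticeNorm hO I.fg hy hq, Units.val_mul, nrd_mul,
      padicValRat.mul (nrd_unit_ne_zero u) (nrd_unit_ne_zero y), h1, padicValRat.self hq.one_lt]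
  · obtain ⟨z, -, hz⟩ := I.exists_isLocGen hO q hq
    have hz' : IsLocGen q O (lineIdeal S hO hy hw).lattice z := fun x => by
      rw [lineIdeal_lattice, locAt_eq_of_prime_ne ((Nat.coprime_primes hp.out hq).2 (Ne.symm hqp))
          (lineLattice_le S hy) (fun _ hx => p_smul_mem_lineLattice S hy hx), hz]
    rw [padicValRat_latticeNorm hO (fg _) hz' hq, padicValRat_latticeNorm hO I.fg hz hq]
    have : padicValRat q (p : ℚ) = 0 := by
      rw [padicValRat.of_nat, padicValNat_primes hqp]; rfl
    rw [this, zero_add]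

include hO in
/-- An ideal of norm `p N(I)` inside `I` is the ideal of any line killed by the quotient of
generators. -/
lemma lattice_eq_lineLattice {J : LeftIdeal O} (hJ : J ∈ heckeSet p I) {z : (𝔹 a b)ˣ}
    (hz : IsLocGen p O J.lattice z) (hw : w ≠ 0)
    (hzw : (S.red ((z * y⁻¹ : (𝔹 a b)ˣ) : 𝔹 a b)).mulVec w = 0) :
    J.lattice = lineLattice S I y hy w := by
  have hu := quot_mem hJ.1 hy hz
  have hv : padicValRat p (nrd ((z * y⁻¹ : (𝔹 a b)ˣ) : 𝔹 a b)) = 1 := by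
    rw [padicValRat_quot hO hp.out hy hz hp.out.ne_zero hJ.2]
    exact padicValRat.self hp.out.one_lt
  have hgen := isLocGen_lineLattice S hy hw hO hu hv hzw
  rw [inv_mul_cancel_right] at hgen
  have key : ∀ q : ℕ, q.Prime → locAt q J.lattice = locAt q (lineLattice S I y hy w) := by
    intro q hq
    by_cases hqp : q = p
    · subst hqp
      ext x; rw [hz x, hgen x]
    · have hc := (Nat.coprime_primes hp.out hq).2 (Ne.symm hqp)
      rw [locAt_eq_of_prime_ne hc (lineLattice_le S hy) (fun _ hx => p_smul_mem_lineLattice S hy hx),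
        locAt_eq_of_prime_ne hc hJ.1
          (fun _ hx => nsmul_mem_of_norm_eq hO hp.out.ne_zero hJ.1 hJ.2 hx)]
  refine le_antisymm (le_of_forall_locAt_le fun q hq => ?_) (le_of_forall_locAt_le fun q hq => ?_)
  · rw [← key q hq]; exact le_locAt q _
  · rw [key q hq]; exact le_locAt q _

include hO in
lemma exists_lineIdeal_eq {J : LeftIdeal O} (hJ : J ∈ heckeSet p I) :
    ∃ (w : Fin 2 → ZMod p) (hw : w ≠ 0), lineIdeal S hO hy hw = J := by
  obtain ⟨z, -, hz⟩ := J.exists_isLocGen hO p hp.out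
  have hu := quot_mem hJ.1 hy hz
  have hv := padicValRat_quot hO hp.out hy hz hp.out.ne_zero hJ.2
  rw [padicValRat.self hp.out.one_lt] at hv
  obtain ⟨w, hw, hzw⟩ := Matrix.exists_mulVec_eq_zero_iff.2 (S.det_red_eq_zero hO hu hv.ge)
  exact ⟨w, hw, ext_lattice (lattice_eq_lineLattice S hO hy hJ hz hw hzw).symm⟩

include hO in
lemma exists_mem_red_eq (hy : IsLocGen p O I.lattice y) (m : Matrix (Fin 2) (Fin 2) (ZMod p)) :
    ∃ v ∈ I.lattice, S.red (v * (↑y⁻¹ : 𝔹 a b)) = m := by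
  obtain ⟨k, hk, hky⟩ := hy.self_mem
  obtain ⟨o, ho, hom⟩ := S.red_surj ((k : ZMod p)⁻¹ • m)
  refine ⟨o * (k • (y : 𝔹 a b)), mul_mem hO I ho hky, ?_⟩
  rw [mul_smul_comm, smul_mul_assoc, Units.mul_inv_cancel_right, S.red_nsmul (le_locAt p _ ho), hom,
    ← Nat.cast_smul_eq_nsmul (ZMod p), smul_smul, mul_inv_cancel₀ (zmod_natCast_ne_zero hk), one_smul]

include hO in
lemma lineLattice_le_iff {w' : Fin 2 → ZMod p} (hw : w ≠ 0) :
    lineLattice S I y hy w ≤ lineLattice S I y hy w' ↔ ∃ c : ZMod p, w' = c • w := by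
  constructor
  · intro h
    -- an element of `I` whose reduction has kernel spanned by `w`
    obtain ⟨v, hv, hvm⟩ := exists_mem_red_eq S hO hy !![-w 1, w 0; 0, 0]
    have h1 : !![-w 1, w 0; 0, 0].mulVec w = 0 := by
      ext i; fin_cases i <;> simp [Matrix.mulVec, dotProduct, Fin.sum_univ_two]; ring
    have h2 := (h (show v ∈ lineLattice S I y hy w from ⟨hv, by rw [hvm, h1]⟩)).2
    rw [hvm] at h2
    refine exists_smul_eq_of_mulVec_eq_zero hw (fun h0 => hw ?_) h1 h2
    have e1 := congrFun (congrFun h0 0) 0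
    have e2 := congrFun (congrFun h0 0) 1
    simp at e1 e2
    ext i; fin_cases i <;> simp [e1, e2]
  · rintro ⟨c, rfl⟩ v ⟨h1, h2⟩
    exact ⟨h1, by rw [Matrix.mulVec_smul, h2, smul_zero]⟩

end LeftIdeal

end Quat

/-! ### The recursion for the Hecke operators on ideals -/

section Lines

variable {p : ℕ} [hp : Fact p.Prime]

/-- Representatives of the lines in the plane over `ℤ/p`: `(0, 1)` and `(1, t)`. -/
def lineVec : Option (ZMod p) → Fin 2 → ZMod p
  | none => ![0, 1]
  | some t => ![1, t]

lemma lineVec_ne_zero (o : Option (ZMod p)) : lineVec o ≠ 0 := by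
  cases o with
  | none => exact fun h => one_ne_zero (congrFun h 1)
  | some t => exact fun h => one_ne_zero (congrFun h 0)

lemma exists_eq_smul_lineVec {w : Fin 2 → ZMod p} (hw : w ≠ 0) :
    ∃ o : Option (ZMod p), ∃ c : ZMod p, c ≠ 0 ∧ w = c • lineVec o := by
  by_cases h0 : w 0 = 0
  · refine ⟨none, w 1, fun h1 => hw (by ext i; fin_cases i <;> simp [h0, h1]), ?_⟩
    ext i; fin_cases i <;> simp [lineVec, h0]
  · refine ⟨some (w 1 / w 0), w 0, h0, ?_⟩
    ext i; fin_cases i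
    · simp [lineVec]
    · simp [lineVec]; field_simp

lemma eq_of_lineVec_eq_smul {o o' : Option (ZMod p)} {c : ZMod p} (h : lineVec o' = c • lineVec o) :
    o' = o := by
  cases o with
  | none => cases o' with
    | none => rfl
    | some t => simpa [lineVec] using congrFun h 0
  | some s => cases o' with
    | none =>
      have h0 := congrFun h 0
      have h1 := congrFun h 1
      simp [lineVec] at h0 h1
      simp [← h0] at h1
    | some t =>
      have h0 := congrFun h 0
      have h1 := congrFun h 1
      simp [lineVec] at h0 h1
      simp [h1, ← h0]

/-- The number of lines in the kernel of a singular matrix. -/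
lemma card_lineVec_kernel {M : Matrix (Fin 2) (Fin 2) (ZMod p)} [DecidableEq (Fin 2 → ZMod p)]
    [Decidable (M = 0)] (h : M.det = 0) :
    (Finset.univ.filter fun o : Option (ZMod p) => M.mulVec (lineVec o) = 0).card
      = if M = 0 then p + 1 else 1 := by
  split_ifs with hM
  · subst hM
    simp [ZMod.card]
  · obtain ⟨w, hw, hMw⟩ := Matrix.exists_mulVec_eq_zero_iff.2 h
    obtain ⟨o, c, hc, rfl⟩ := exists_eq_smul_lineVec hw
    have hMo : M.mulVec (lineVec o) = 0 := by
      rw [Matrix.mulVec_smul] at hMw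
      exact (smul_eq_zero.1 hMw).resolve_left hc
    rw [Finset.card_eq_one]
    refine ⟨o, Finset.eq_singleton_iff_unique_mem.2 ⟨by simpa using hMo, fun o' ho' => ?_⟩⟩
    obtain ⟨d, hd⟩ := exists_smul_eq_of_mulVec_eq_zero (lineVec_ne_zero o) hM hMo
      (Finset.mem_filter.1 ho').2
    exact eq_of_lineVec_eq_smul hd

end Lines

section Quat

variable {a b : ℚ} {O : Subring (𝔹 a b)} [Fact (a < 0)] [Fact (b < 0)]

namespace LeftIdeal

section Prime

variable {p : ℕ} [hp : Fact p.Prime] (S : LocalSplitting p O) (hO : IsOrder O) {I : LeftIdeal O}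
  {y : (𝔹 a b)ˣ} (hy : IsLocGen p O I.lattice y)

/-- The elements of `T_p(I)` correspond to the lines over the residue field. -/
lemma bijective_lineIdeal : Function.Bijective fun o : Option (ZMod p) =>
    (⟨lineIdeal S hO hy (lineVec_ne_zero o), lineIdeal_mem S hO hy _⟩ : heckeSet p I) := by
  constructor
  · intro o o' h
    have h1 : lineLattice S I y hy (lineVec o) = lineLattice S I y hy (lineVec o') :=
      congrArg (fun J : heckeSet p I => J.1.lattice) h
    obtain ⟨c, hc⟩ := (lineLattice_le_iff S hO hy (lineVec_ne_zero o)).1 h1.le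
    exact (eq_of_lineVec_eq_smul hc).symm
  · rintro ⟨J, hJ⟩
    obtain ⟨w, hw, rfl⟩ := exists_lineIdeal_eq S hO hy hJ
    obtain ⟨o, c, hc, rfl⟩ := exists_eq_smul_lineVec hw
    refine ⟨o, Subtype.ext (ext_lattice ?_)⟩
    refine le_antisymm ((lineLattice_le_iff S hO hy (lineVec_ne_zero o)).2 ⟨c, rfl⟩)
      ((lineLattice_le_iff S hO hy hw).2 ⟨c⁻¹, ?_⟩)
    rw [smul_smul, inv_mul_cancel₀ hc, one_smul]

lemma finsum_heckeSet_prime {V : Type*} [AddCommMonoid V] (F : LeftIdeal O → V) :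
    ∑ᶠ J ∈ heckeSet p I, F J
      = ∑ o : Option (ZMod p), F (lineIdeal S hO hy (lineVec_ne_zero o)) := by
  rw [← finsum_subtype_eq_finsum_cond, ← finsum_eq_sum_of_fintype]
  exact (finsum_eq_of_bijective _ (bijective_lineIdeal S hO hy) fun _ => rfl).symm

omit [Fact (a < 0)] [Fact (b < 0)] in
/-- The ideal `J` is contained in the ideal of the line of `w` if and only if the quotient of the
generators kills `w`. -/
lemma le_lineLattice_iff {J : LeftIdeal O} (hle : J.lattice ≤ I.lattice) {z : (𝔹 a b)ˣ}
    (hz : IsLocGen p O J.lattice z) {w : Fin 2 → ZMod p} :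
    J.lattice ≤ lineLattice S I y hy w ↔
      (S.red ((z * y⁻¹ : (𝔹 a b)ˣ) : 𝔹 a b)).mulVec w = 0 := by
  have hu := quot_mem hle hy hz
  constructor
  · intro h
    exact ((mem_locAt_lineLattice S hy).1 (locAt_mono h hz.self_mem)).2
  · intro h v hv
    refine ⟨hle hv, ?_⟩
    have h1 : v * (↑y⁻¹ : 𝔹 a b) = (v * (↑z⁻¹ : 𝔹 a b)) *
        ((z * y⁻¹ : (𝔹 a b)ˣ) : 𝔹 a b) := by
      rw [Units.val_mul, ← mul_assoc, Units.inv_mul_cancel_right]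
    rw [h1, S.red_mul ((hz v).1 (le_locAt p _ hv)) hu, ← Matrix.mulVec_mulVec, h, Matrix.mulVec_zero]

/-- A positive integer as a unit of the quaternion algebra. -/
def natUnit (a b : ℚ) {n : ℕ} (hn : n ≠ 0) : (𝔹 a b)ˣ :=
  Units.map (algebraMap ℚ (𝔹 a b)).toMonoidHom (Units.mk0 (n : ℚ) (by exact_mod_cast hn))

omit [Fact (a < 0)] [Fact (b < 0)] in
lemma mul_natUnit {n : ℕ} (hn : n ≠ 0) (x : 𝔹 a b) : x * natUnit a b hn = n • x := by
  change x * algebraMap ℚ (𝔹 a b) (n : ℚ) = _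
  rw [← Algebra.commutes, ← Algebra.smul_def, Nat.cast_smul_eq_nsmul]

omit [Fact (a < 0)] [Fact (b < 0)] in
lemma nrd_natUnit {n : ℕ} (hn : n ≠ 0) : nrd (natUnit a b hn : 𝔹 a b) = (n : ℚ) ^ 2 := by
  have h := mul_natUnit (a := a) (b := b) hn 1
  rw [one_mul, ← Nat.cast_smul_eq_nsmul ℚ] at h
  rw [h, nrd_smul, nrd_one, mul_one]

omit [Fact (a < 0)] [Fact (b < 0)] in
lemma mem_latticeMul_natUnit {n : ℕ} (hn : n ≠ 0) {M : Submodule ℤ (𝔹 a b)}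
    {x : 𝔹 a b} : x ∈ latticeMul M (natUnit a b hn) ↔ ∃ v ∈ M, x = n • v := by
  rw [mem_latticeMul]
  simp only [mul_natUnit, eq_comm]

omit [Fact (a < 0)] [Fact (b < 0)] in
/-- The quotient of the generators of `J` and `I` is zero modulo `p` if and only if `J ⊆ p I`. -/
lemma red_quot_eq_zero_iff {k : ℕ} {J : LeftIdeal O} (hJ : J ∈ heckeSet (p ^ k) I)
    {z : (𝔹 a b)ˣ} (hy : IsLocGen p O I.lattice y) (hz : IsLocGen p O J.lattice z) :
    S.red ((z * y⁻¹ : (𝔹 a b)ˣ) : 𝔹 a b) = 0 ↔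
      J.lattice ≤ latticeMul I.lattice (natUnit a b hp.out.ne_zero) := by
  have hu := quot_mem hJ.1 hy hz
  have hp0 : (p : ℚ) ≠ 0 := by exact_mod_cast hp.out.ne_zero
  constructor
  · intro h
    obtain ⟨s, hs, hsu⟩ := S.exists_of_red_eq_zero hu h
    intro v hv
    rw [mem_latticeMul_natUnit]
    refine ⟨(p : ℚ)⁻¹ • v, mem_of_forall_mem_locAt fun q hq => ?_, ?_⟩
    · by_cases hqp : q = p
      · subst hqp
        rw [hy]
        have h1 : ((q : ℚ)⁻¹ • v) * (↑y⁻¹ : 𝔹 a b) = (v * (↑z⁻¹ : 𝔹 a b)) * s := by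
          have h2 : v * (↑y⁻¹ : 𝔹 a b) = (v * (↑z⁻¹ : 𝔹 a b)) *
              ((z * y⁻¹ : (𝔹 a b)ˣ) : 𝔹 a b) := by
            rw [Units.val_mul, ← mul_assoc, Units.inv_mul_cancel_right]
          rw [smul_mul_assoc, h2, hsu, mul_smul_comm, ← Nat.cast_smul_eq_nsmul ℚ, smul_smul,
            inv_mul_cancel₀ hp0, one_smul]
        rw [h1]
        exact (locRing q O).mul_mem ((hz v).1 (le_locAt q _ hv)) hs
      · refine mem_locAt_of_nsmul_mem ((Nat.coprime_primes hp.out hq).2 (Ne.symm hqp)) ?_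
        rw [← Nat.cast_smul_eq_nsmul ℚ, smul_smul, mul_inv_cancel₀ hp0, one_smul]
        exact le_locAt q _ (hJ.1 hv)
    · rw [← Nat.cast_smul_eq_nsmul ℚ, smul_smul, mul_inv_cancel₀ hp0, one_smul]
  · intro h
    obtain ⟨m, hm, hmz⟩ := hz.self_mem
    obtain ⟨v, hv, hvz⟩ := (mem_latticeMul_natUnit _).1 (h hmz)
    have h1 : m • ((z * y⁻¹ : (𝔹 a b)ˣ) : 𝔹 a b) = p • (v * (↑y⁻¹ : 𝔹 a b)) := by
      rw [Units.val_mul, ← smul_mul_assoc, hvz, smul_mul_assoc]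
    have h2 := congrArg S.red h1
    rw [S.red_nsmul hu, S.red_p_smul ((hy v).1 (le_locAt p _ hv)), ← Nat.cast_smul_eq_nsmul (ZMod p)]
      at h2
    exact (smul_eq_zero.1 h2).resolve_left (zmod_natCast_ne_zero hm)

end Prime

variable (hO : IsOrder O) {V : Type*} [AddCommGroup V]

/-- The Hecke operator on functions of ideals: the sum of `F` over `T_m(I)`. -/
def heckeSum (m : ℕ) (F : LeftIdeal O → V) (I : LeftIdeal O) : V := ∑ᶠ J ∈ heckeSet m I, F J

variable {I : LeftIdeal O}

include hO in
lemma heckeSum_eq_sum {m : ℕ} (hm : m ≠ 0) (F : LeftIdeal O → V) :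
    heckeSum m F I = ∑ J ∈ (finite_heckeSet hO I hm).toFinset, F J :=
  finsum_mem_eq_finite_toFinset_sum _ _

include hO in
lemma map_heckeSum {W : Type*} [AddCommGroup W] (T : V →+ W) {m : ℕ} (hm : m ≠ 0)
    (F : LeftIdeal O → V) : T (heckeSum m F I) = heckeSum m (fun J => T (F J)) I := by
  rw [heckeSum_eq_sum hO hm, heckeSum_eq_sum hO hm, map_sum]

include hO in
lemma heckeSum_one (F : LeftIdeal O → V) : heckeSum 1 F I = F I := by
  have : heckeSet 1 I = {I} := by
    ext J
    rw [Set.mem_singleton_iff]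
    constructor
    · rintro ⟨h1, h2⟩
      refine ext_lattice (le_antisymm h1 fun x hx => ?_)
      simpa using nsmul_mem_of_norm_eq hO one_ne_zero h1 h2 hx
    · rintro rfl
      exact ⟨le_rfl, by simp⟩
  rw [heckeSum, this, finsum_mem_singleton]

omit [Fact (a < 0)] [Fact (b < 0)] in
lemma mem_heckeSet_of_le {m n : ℕ} {J J₁ : LeftIdeal O} (h₁ : J₁ ∈ heckeSet m I)
    (h : J ∈ heckeSet (m * n) I) (hle : J.lattice ≤ J₁.lattice) : J ∈ heckeSet n J₁ := by
  refine ⟨hle, ?_⟩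
  rw [h.2, h₁.2]; push_cast; ring

omit [Fact (a < 0)] [Fact (b < 0)] in
lemma mem_heckeSet_trans {m n : ℕ} {J J₁ : LeftIdeal O} (h₁ : J₁ ∈ heckeSet m I)
    (h : J ∈ heckeSet n J₁) : J ∈ heckeSet (m * n) I :=
  ⟨h.1.trans h₁.1, by rw [h.2, h₁.2]; push_cast; ring⟩

open Classical in
include hO in
/-- A composite of two Hecke operators, as a sum over the ideals `J ⊆ I` weighted by the number of
intermediate ideals. -/
lemma heckeSum_heckeSum {m n : ℕ} (hm : m ≠ 0) (hn : n ≠ 0) (F : LeftIdeal O → V) :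
    heckeSum m (heckeSum n F) I = ∑ J ∈ (finite_heckeSet hO I (mul_ne_zero hm hn)).toFinset,
      ((finite_heckeSet hO I hm).toFinset.filter fun J₁ => J.lattice ≤ J₁.lattice).card • F J := by
  rw [heckeSum_eq_sum hO hm]
  simp only [heckeSum_eq_sum hO hn]
  rw [Finset.sum_comm' (t' := (finite_heckeSet hO I (mul_ne_zero hm hn)).toFinset)
    (s' := fun J => (finite_heckeSet hO I hm).toFinset.filter fun J₁ => J.lattice ≤ J₁.lattice)]
  · simp only [Finset.sum_const]
  · intro J₁ J
    simp only [Set.Finite.mem_toFinset, Finset.mem_filter]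
    constructor
    · rintro ⟨h1, h2⟩
      exact ⟨⟨h1, h2.1⟩, mem_heckeSet_trans h1 h2⟩
    · rintro ⟨⟨h1, h2⟩, h3⟩
      exact ⟨h1, mem_heckeSet_of_le h1 h3 h2⟩

include hO in
/-- The recursion `t_p t_{p^{k+1}} = t_{p^{k+2}} + p t_{p^k}` on functions of ideal classes. -/
lemma heckeSum_prime_pow {p : ℕ} [hp : Fact p.Prime] (S : LocalSplitting p O) (k : ℕ)
    (F : LeftIdeal O → V) (hF : ∀ I x, F (mulUnit hO I x) = F I) :
    heckeSum (p ^ (k + 2)) F I = heckeSum p (heckeSum (p ^ (k + 1)) F) I - p • heckeSum (p ^ k) F I := by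
  classical
  obtain ⟨y, -, hy⟩ := I.exists_isLocGen hO p hp.out
  have hp0 := hp.out.ne_zero
  have hpQ : (p : ℚ) ≠ 0 := by exact_mod_cast hp0
  have hpow : p * p ^ (k + 1) = p ^ (k + 2) := by ring
  rw [heckeSum_heckeSum hO hp0 (pow_ne_zero _ hp0), eq_sub_iff_add_eq]
  simp only [hpow]
  -- an ideal `J` of norm `p ^ (k + 2)` lies in one ideal of norm `p`, or in all `p + 1` of them if
  -- `J ⊆ p I`
  have hcard : ∀ J ∈ (finite_heckeSet hO I (pow_ne_zero (k + 2) hp0)).toFinset,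
      ((finite_heckeSet hO I hp0).toFinset.filter fun J₁ => J.lattice ≤ J₁.lattice).card
        = 1 + if J.lattice ≤ latticeMul I.lattice (natUnit a b hp0) then p else 0 := by
    intro J hJ
    rw [Set.Finite.mem_toFinset] at hJ
    obtain ⟨z, -, hz⟩ := J.exists_isLocGen hO p hp.out
    have hu := quot_mem hJ.1 hy hz
    have hdet := S.det_red_eq_zero hO hu (by
      rw [padicValRat_quot hO hp.out hy hz (pow_ne_zero _ hp0) hJ.2, padicValRat.of_nat,
        padicValNat.prime_pow]
      push_cast; omega)
    have h1 : (finite_heckeSet hO I hp0).toFinset.filter (fun J₁ => J.lattice ≤ J₁.lattice)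
        = (Finset.univ.filter fun o : Option (ZMod p) =>
          (S.red ((z * y⁻¹ : (𝔹 a b)ˣ) : 𝔹 a b)).mulVec (lineVec o) = 0).map
          ⟨fun o => lineIdeal S hO hy (lineVec_ne_zero o), fun o o' h =>
            (bijective_lineIdeal S hO hy).1 (Subtype.ext h)⟩ := by
      ext J₁
      simp only [Finset.mem_filter, Set.Finite.mem_toFinset, Finset.mem_map, Finset.mem_univ, true_and]
      constructor
      · rintro ⟨h2, h3⟩
        obtain ⟨o, ho⟩ := (bijective_lineIdeal S hO hy).2 ⟨J₁, h2⟩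
        have ho' : lineIdeal S hO hy (lineVec_ne_zero o) = J₁ := congrArg Subtype.val ho
        subst ho'
        exact ⟨o, (le_lineLattice_iff S hy hJ.1 hz).1 h3, rfl⟩
      · rintro ⟨o, ho, rfl⟩
        exact ⟨lineIdeal_mem S hO hy (lineVec_ne_zero o), (le_lineLattice_iff S hy hJ.1 hz).2 ho⟩
    rw [h1, Finset.card_map, card_lineVec_kernel hdet]
    simp only [red_quot_eq_zero_iff S hJ hy hz]
    split_ifs <;> omega
  rw [Finset.sum_congr rfl fun J hJ => by rw [hcard J hJ, add_smul, one_smul], Finset.sum_add_distrib,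
    heckeSum_eq_sum hO (pow_ne_zero (k + 2) hp0), heckeSum_eq_sum hO (pow_ne_zero k hp0)]
  congr 1
  simp only [ite_smul, zero_smul]
  rw [← Finset.sum_filter, Finset.smul_sum]
  -- the ideals `J ⊆ p I` are the `p J₀` with `J₀` of norm `p ^ k`, which is equivalent to `p J₀`
  refine Finset.sum_bij (fun J _ => mulUnit hO J (natUnit a b hp0)) ?_ ?_ ?_ ?_
  · intro J hJ
    rw [Set.Finite.mem_toFinset] at hJ
    rw [Finset.mem_filter, Set.Finite.mem_toFinset]
    have h1 : (mulUnit hO J (natUnit a b hp0)).lattice ≤ latticeMul I.lattice (natUnit a b hp0) :=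
      Submodule.map_mono hJ.1
    refine ⟨⟨h1.trans ?_, ?_⟩, h1⟩
    · intro x hx
      obtain ⟨v, hv, rfl⟩ := (mem_latticeMul_natUnit _).1 hx
      exact I.lattice.smul_of_tower_mem p hv
    · rw [norm_mulUnit, nrd_natUnit, hJ.2]; push_cast; ring
  · intro J _ J' _ h
    have h1 := congrArg (fun K => mulUnit hO K (natUnit a b hp0)⁻¹) h
    simpa only [mulUnit_mul, mul_inv_cancel, mulUnit_one] using h1
  · intro J hJ
    rw [Finset.mem_filter, Set.Finite.mem_toFinset] at hJ
    refine ⟨mulUnit hO J (natUnit a b hp0)⁻¹, ?_, by rw [mulUnit_mul, inv_mul_cancel, mulUnit_one]⟩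
    rw [Set.Finite.mem_toFinset]
    refine ⟨?_, ?_⟩
    · have h1 := Submodule.map_mono (f := LinearMap.mulRight ℤ
        (↑(natUnit a b hp0)⁻¹ : 𝔹 a b)) hJ.2
      change latticeMul _ _ ≤ latticeMul _ _ at h1
      rwa [latticeMul_mul, Units.mul_inv, latticeMul_one] at h1
    · rw [norm_mulUnit, nrd_unit_inv, nrd_natUnit, hJ.1.2]
      push_cast; field_simp; ring
  · intro J _
    rw [hF]

/-- For coprime `m`, `n` and `J ⊆ I` of relative norm `m n`, the unique ideal between `J` and `I` of
norm `n` relative to `I`. -/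
def interIdeal {m n : ℕ} (hm : m ≠ 0) (hn : n ≠ 0) (hmn : m.Coprime n) {J : LeftIdeal O}
    (hJ : J ∈ heckeSet (n * m) I) : LeftIdeal O :=
  ofLocGen (I.lattice ⊓ J.lattice.comap (m • LinearMap.id))
    (isLattice_of_nsmul_mem I.isLattice inf_le_left hn fun x hx =>
      ⟨I.lattice.smul_of_tower_mem n hx, by
        have := nsmul_mem_of_norm_eq hO (mul_ne_zero hn hm) hJ.1 hJ.2 hx
        rw [mul_comm, mul_smul] at this
        exact this⟩)
    -- locally at `q` the lattice is `I` if `q ∣ m` and `J` otherwise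
    (fun q hq => by
      have hle : J.lattice ≤ I.lattice ⊓ J.lattice.comap (m • LinearMap.id) :=
        le_inf hJ.1 fun x hx => J.lattice.smul_of_tower_mem m hx
      by_cases hqm : q ∣ m
      · obtain ⟨z, -, hz⟩ := I.exists_isLocGen hO q hq
        refine ⟨z, fun x => ?_⟩
        rw [locAt_eq_of_prime_ne (m := n) (M := I.lattice) _ inf_le_left, hz]
        · exact fun x hx => ⟨I.lattice.smul_of_tower_mem n hx, by
            have := nsmul_mem_of_norm_eq hO (mul_ne_zero hn hm) hJ.1 hJ.2 hx
            rw [mul_comm, mul_smul] at this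
            exact this⟩
        · exact (Nat.Coprime.coprime_dvd_left hqm hmn).symm
      · obtain ⟨z, -, hz⟩ := J.exists_isLocGen hO q hq
        refine ⟨z, fun x => ?_⟩
        rw [← locAt_eq_of_prime_ne (m := m) (N := J.lattice) _ hle fun x hx => hx.2, hz]
        exact ((Nat.Prime.coprime_iff_not_dvd hq).2 hqm).symm)

include hO in
lemma interIdeal_mem {m n : ℕ} (hm : m ≠ 0) (hn : n ≠ 0) (hmn : m.Coprime n) {J : LeftIdeal O}
    (hJ : J ∈ heckeSet (n * m) I) : interIdeal hO hm hn hmn hJ ∈ heckeSet n I := by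
  have hn0 : (n : ℚ) ≠ 0 := by exact_mod_cast hn
  have hm0 : (m : ℚ) ≠ 0 := by exact_mod_cast hm
  have hnpos : (0 : ℚ) < n := by exact_mod_cast Nat.pos_of_ne_zero hn
  have hle : J.lattice ≤ (interIdeal hO hm hn hmn hJ).lattice :=
    le_inf hJ.1 fun x hx => J.lattice.smul_of_tower_mem m hx
  refine ⟨inf_le_left, norm_eq_of_padicValRat (norm_pos hO _) (mul_pos hnpos (norm_pos hO _))
    fun q hq => ?_⟩
  have := Fact.mk hq
  rw [padicValRat.mul hn0 (norm_pos hO I).ne']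
  by_cases hqm : q ∣ m
  · obtain ⟨z, -, hz⟩ := I.exists_isLocGen hO q hq
    have hqn : q.Coprime n := Nat.Coprime.coprime_dvd_left hqm hmn
    have hz' : IsLocGen q O (interIdeal hO hm hn hmn hJ).lattice z := fun x => by
      change x ∈ locAt q (I.lattice ⊓ J.lattice.comap (m • LinearMap.id)) ↔ _
      rw [locAt_eq_of_prime_ne (m := n) (M := I.lattice) hqn.symm inf_le_left, hz]
      exact fun x hx => ⟨I.lattice.smul_of_tower_mem n hx, by
        have := nsmul_mem_of_norm_eq hO (mul_ne_zero hn hm) hJ.1 hJ.2 hx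
        rw [mul_comm, mul_smul] at this
        exact this⟩
    rw [padicValRat_latticeNorm hO (fg _) hz' hq, padicValRat_latticeNorm hO I.fg hz hq,
      padicValRat.of_nat, padicValNat.eq_zero_of_not_dvd ((Nat.Prime.coprime_iff_not_dvd hq).1 hqn)]
    simp
  · obtain ⟨z, -, hz⟩ := J.exists_isLocGen hO q hq
    have hz' : IsLocGen q O (interIdeal hO hm hn hmn hJ).lattice z := fun x => by
      rw [← locAt_eq_of_prime_ne (m := m) (N := J.lattice)
        ((Nat.Prime.coprime_iff_not_dvd hq).2 hqm).symm hle fun x hx => hx.2, hz]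
    rw [padicValRat_latticeNorm hO (fg _) hz' hq, ← padicValRat_latticeNorm hO J.fg hz hq, hJ.2]
    push_cast
    rw [padicValRat.mul (mul_ne_zero hn0 hm0) (norm_pos hO I).ne', padicValRat.mul hn0 hm0,
      padicValRat.of_nat (n := m), padicValNat.eq_zero_of_not_dvd hqm]
    simp

include hO in
/-- Hecke operators of coprime index compose multiplicatively. -/
lemma heckeSum_mul {m n : ℕ} (hm : m ≠ 0) (hn : n ≠ 0) (hmn : m.Coprime n) (F : LeftIdeal O → V) :
    heckeSum (n * m) F I = heckeSum n (heckeSum m F) I := by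
  classical
  rw [heckeSum_heckeSum hO hn hm, heckeSum_eq_sum hO (mul_ne_zero hn hm)]
  refine Finset.sum_congr rfl fun J hJ => ?_
  rw [Set.Finite.mem_toFinset] at hJ
  rw [Finset.card_eq_one.2, one_smul]
  refine ⟨interIdeal hO hm hn hmn hJ, Finset.eq_singleton_iff_unique_mem.2 ⟨?_, ?_⟩⟩
  · rw [Finset.mem_filter, Set.Finite.mem_toFinset]
    exact ⟨interIdeal_mem hO hm hn hmn hJ, le_inf hJ.1 fun x hx => J.lattice.smul_of_tower_mem m hx⟩
  · intro J₁ h₁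
    rw [Finset.mem_filter, Set.Finite.mem_toFinset] at h₁
    obtain ⟨h₁, hle⟩ := h₁
    have hJ₁ := mem_heckeSet_of_le h₁ hJ hle
    refine ext_lattice (le_antisymm (fun x hx => ⟨h₁.1 hx, nsmul_mem_of_norm_eq hO hm hle hJ₁.2 hx⟩) ?_)
    rintro x ⟨hxI, hxm⟩
    have h2 : (m : ℤ) • x ∈ J₁.lattice := by
      rw [natCast_zsmul]; exact hle hxm
    have h3 : (n : ℤ) • x ∈ J₁.lattice := by
      rw [natCast_zsmul]; exact nsmul_mem_of_norm_eq hO hn h₁.1 h₁.2 hxI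
    obtain ⟨u, v, huv⟩ := Nat.isCoprime_iff_coprime.2 hmn
    have h4 : x = u • (m : ℤ) • x + v • (n : ℤ) • x := by
      rw [smul_smul, smul_smul, ← add_smul, huv, one_smul]
    rw [h4]
    exact add_mem (Submodule.smul_mem _ _ h2) (Submodule.smul_mem _ _ h3)

end LeftIdeal

end Quat

/-! ### Invariant lines of a matrix over the residue field -/

lemma kroneckerSymbol_two (n : ℤ) : kroneckerSymbol n 2 = ZMod.χ₈ (n : ZMod 8) := by
  have h : (2 : ℕ).factorization 2 = 1 := by simp [Nat.Prime.factorization Nat.prime_two]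
  rw [kroneckerSymbol, h]
  simp

lemma kroneckerSymbol_odd_prime {p : ℕ} [hp : Fact p.Prime] (h2 : p ≠ 2) (n : ℤ) :
    kroneckerSymbol n p = quadraticChar (ZMod p) n := by
  have h : p.factorization 2 = 0 := by
    simp [Nat.Prime.factorization hp.out, h2]
  rw [kroneckerSymbol, h, pow_zero, one_mul, pow_zero, Nat.div_one, ← jacobiSym.legendreSym.to_jacobiSym]
  rfl

lemma chi_eight_sq_sub : ∀ τ ν : ZMod 8, ZMod.χ₈ (τ ^ 2 - 4 * ν) =
    if ZMod.castHom (show 2 ∣ 8 by norm_num) (ZMod 2) τ = 0 then 0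
    else if ZMod.castHom (show 2 ∣ 8 by norm_num) (ZMod 2) ν = 0 then 1 else -1 := by
  decide

lemma card_roots_mod_two : ∀ x y z w : ZMod 2, (((if y = 0 then 1 else 0) + (Finset.univ.filter fun t : ZMod 2 =>
        y * t ^ 2 + (x - w) * t - z = 0).card : ℕ) : ℤ)
        = 1 + (if x + w = 0 then 0 else if x * w - y * z = 0 then 1 else -1)
          + if y = 0 ∧ z = 0 ∧ x = w then ((2 : ℕ) : ℤ) else 0 := by
      decide

section Lines

variable {p : ℕ} [hp : Fact p.Prime]

lemma isInvariant_lineVec_none (X : Matrix (Fin 2) (Fin 2) (ZMod p)) :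
    (∃ c : ZMod p, X.mulVec (lineVec none) = c • lineVec none) ↔ X 0 1 = 0 := by
  constructor
  · rintro ⟨c, h⟩
    simpa [lineVec, Matrix.mulVec, dotProduct, Fin.sum_univ_two] using congrFun h 0
  · intro h
    refine ⟨X 1 1, ?_⟩
    ext i; fin_cases i <;> simp [lineVec, Matrix.mulVec, dotProduct, Fin.sum_univ_two, h]

lemma isInvariant_lineVec_some (X : Matrix (Fin 2) (Fin 2) (ZMod p)) (t : ZMod p) :
    (∃ c : ZMod p, X.mulVec (lineVec (some t)) = c • lineVec (some t)) ↔
      X 0 1 * t ^ 2 + (X 0 0 - X 1 1) * t - X 1 0 = 0 := by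
  constructor
  · rintro ⟨c, h⟩
    have h0 := congrFun h 0
    have h1 := congrFun h 1
    simp [lineVec, Matrix.mulVec, dotProduct, Fin.sum_univ_two] at h0 h1
    linear_combination t * h0 - h1
  · intro h
    refine ⟨X 0 0 + X 0 1 * t, ?_⟩
    ext i; fin_cases i
    · simp [lineVec, Matrix.mulVec, dotProduct, Fin.sum_univ_two]
    · simp [lineVec, Matrix.mulVec, dotProduct, Fin.sum_univ_two]
      linear_combination -h

lemma exists_eq_smul_one_iff (X : Matrix (Fin 2) (Fin 2) (ZMod p)) :
    (∃ k : ZMod p, X = k • (1 : Matrix (Fin 2) (Fin 2) (ZMod p))) ↔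
      X 0 1 = 0 ∧ X 1 0 = 0 ∧ X 0 0 = X 1 1 := by
  constructor
  · rintro ⟨k, rfl⟩; simp
  · rintro ⟨h1, h2, h3⟩
    refine ⟨X 1 1, ?_⟩
    ext i j; fin_cases i <;> fin_cases j <;> simp [h1, h2, h3]

open Classical in
lemma card_invariant_lines_eq (X : Matrix (Fin 2) (Fin 2) (ZMod p)) :
    (Finset.univ.filter fun o : Option (ZMod p) => ∃ c : ZMod p, X.mulVec (lineVec o) = c • lineVec o).card
      = (if X 0 1 = 0 then 1 else 0) + (Finset.univ.filter fun t : ZMod p =>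
        X 0 1 * t ^ 2 + (X 0 0 - X 1 1) * t - X 1 0 = 0).card := by
  rw [Finset.card_filter, Fintype.sum_option, Finset.card_filter]
  simp only [isInvariant_lineVec_none, isInvariant_lineVec_some]

open Classical in
lemma card_invariant_lines_odd (h2 : p ≠ 2) (X : Matrix (Fin 2) (Fin 2) (ZMod p)) :
    ((Finset.univ.filter fun o : Option (ZMod p) =>
        ∃ c : ZMod p, X.mulVec (lineVec o) = c • lineVec o).card : ℤ)
      = 1 + quadraticChar (ZMod p) (X.trace ^ 2 - 4 * X.det)
        + if ∃ k : ZMod p, X = k • (1 : Matrix (Fin 2) (Fin 2) (ZMod p)) then (p : ℤ) else 0 := by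
  have hchar : ringChar (ZMod p) ≠ 2 := by rw [ZMod.ringChar_zmod_n]; exact h2
  have h20 : (2 : ZMod p) ≠ 0 := Ring.two_ne_zero hchar
  rw [card_invariant_lines_eq]
  simp only [exists_eq_smul_one_iff]
  have hdisc : X.trace ^ 2 - 4 * X.det = (X 0 0 - X 1 1) ^ 2 + 4 * X 0 1 * X 1 0 := by
    rw [Matrix.trace_fin_two, Matrix.det_fin_two]; ring
  rw [hdisc]
  -- count the roots of `X₀₁ t² + (X₀₀ - X₁₁) t - X₁₀`: the line `(0, 1)` is invariant if `X₀₁ = 0`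
  by_cases h01 : X 0 1 = 0
  · rw [h01]
    by_cases h : X 0 0 = X 1 1
    · rw [h, sub_self]
      by_cases h10 : X 1 0 = 0
      · simp [h10, ZMod.card]
      · simp [h10]
    · have hd : X 0 0 - X 1 1 ≠ 0 := sub_ne_zero.2 h
      have h1 : (Finset.univ.filter fun t : ZMod p =>
          0 * t ^ 2 + (X 0 0 - X 1 1) * t - X 1 0 = 0) = {X 1 0 / (X 0 0 - X 1 1)} := by
        ext t
        simp only [Finset.mem_filter, Finset.mem_univ, true_and, Finset.mem_singleton]
        rw [eq_div_iff hd]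
        constructor <;> intro h <;> linear_combination h
      rw [h1]
      have h2 : quadraticChar (ZMod p) ((X 0 0 - X 1 1) ^ 2) = 1 := quadraticChar_sq_one' hd
      simp only [mul_zero, zero_mul, add_zero, h2, Finset.card_singleton, if_true, h, and_false, if_false]
      norm_num
  · have h1 : (Finset.univ.filter fun t : ZMod p =>
        X 0 1 * t ^ 2 + (X 0 0 - X 1 1) * t - X 1 0 = 0).card
        = (Finset.univ.filter fun s : ZMod p =>
          s ^ 2 = (X 0 0 - X 1 1) ^ 2 + 4 * X 0 1 * X 1 0).card := by
      -- complete the square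
      refine Finset.card_bij (fun t _ => 2 * X 0 1 * t + (X 0 0 - X 1 1)) ?_ ?_ ?_
      · intro t ht
        simp only [Finset.mem_filter, Finset.mem_univ, true_and] at ht ⊢
        linear_combination 4 * X 0 1 * ht
      · intro t _ t' _ h
        have := add_right_cancel h
        exact mul_left_cancel₀ (mul_ne_zero h20 h01) this
      · intro s hs
        simp only [Finset.mem_filter, Finset.mem_univ, true_and] at hs
        refine ⟨(s - (X 0 0 - X 1 1)) / (2 * X 0 1), ?_, by field_simp; ring⟩
        simp only [Finset.mem_filter, Finset.mem_univ, true_and]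
        field_simp
        linear_combination hs
    have h3 := quadraticChar_card_sqrts hchar ((X 0 0 - X 1 1) ^ 2 + 4 * X 0 1 * X 1 0)
    have h4 : ({x | x ^ 2 = (X 0 0 - X 1 1) ^ 2 + 4 * X 0 1 * X 1 0} : Set (ZMod p)).toFinset
        = (Finset.univ.filter fun s : ZMod p =>
          s ^ 2 = (X 0 0 - X 1 1) ^ 2 + 4 * X 0 1 * X 1 0) := by
      ext; simp
    rw [h4] at h3
    rw [h1, if_neg h01, if_neg (fun h => h01 h.1)]
    push_cast
    linarith

open Classical in
/-- The number of invariant lines of a matrix, in terms of its characteristic polynomial. -/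
lemma card_invariant_lines {X : Matrix (Fin 2) (Fin 2) (ZMod p)} {t n : ℤ} (ht : X.trace = t)
    (hn : X.det = n) :
    ((Finset.univ.filter fun o : Option (ZMod p) =>
        ∃ c : ZMod p, X.mulVec (lineVec o) = c • lineVec o).card : ℤ)
      = 1 + kroneckerSymbol (t ^ 2 - 4 * n) p
        + if ∃ k : ZMod p, X = k • (1 : Matrix (Fin 2) (Fin 2) (ZMod p)) then (p : ℤ) else 0 := by
  by_cases h2 : p = 2
  · subst h2
    have h3 := chi_eight_sq_sub t n
    rw [map_intCast, map_intCast, ← ht, ← hn, Matrix.trace_fin_two, Matrix.det_fin_two] at h3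
    rw [kroneckerSymbol_two]
    push_cast
    rw [h3, card_invariant_lines_eq]
    simp only [exists_eq_smul_one_iff]
    generalize X 0 0 = x
    generalize X 0 1 = y
    generalize X 1 0 = z
    generalize X 1 1 = w
    convert card_roots_mod_two x y z w
    norm_num
  · rw [kroneckerSymbol_odd_prime h2, card_invariant_lines_odd h2, ht, hn]
    push_cast
    rfl

end Lines

/-! ### The ternary lattice attached to an order -/

section Quat

variable {a b : ℚ}

/-- The map `x ↦ x - x̄ = 2 x - tr x` onto quaternions of trace zero. -/
def pureMap : 𝔹 a b →ₗ[ℤ] 𝔹 a b where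
  toFun x := x - star x
  map_add' x y := by rw [star_add]; abel
  map_smul' n x := by rw [star_zsmul, ← smul_sub]; rfl

lemma pureMap_apply (x : 𝔹 a b) : pureMap x = x - star x := rfl

lemma pureMap_eq (x : 𝔹 a b) : pureMap x = (2 : ℚ) • x - trd x • (1 : 𝔹 a b) := by
  rw [pureMap_apply, star_eq_sub, two_smul]; abel

lemma pureMap_ratSmul (q : ℚ) (x : 𝔹 a b) : pureMap (q • x) = q • pureMap x := by
  rw [pureMap_eq, pureMap_eq, trd_smul, smul_sub, smul_smul, smul_smul, smul_smul, mul_comm]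

lemma pureMap_ratSmul_one (q : ℚ) : pureMap (q • (1 : 𝔹 a b)) = 0 := by
  rw [pureMap_ratSmul, pureMap_apply, star_one, sub_self, smul_zero]

lemma trd_pureMap (x : 𝔹 a b) : trd (pureMap x) = 0 := by
  rw [pureMap_apply, trd_sub, trd_star, sub_self]

lemma nrd_pureMap (x : 𝔹 a b) : nrd (pureMap x) = -charDisc x := by
  rw [pureMap_apply, charDisc_eq, nrd_eq]; simp; ring

lemma pureMap_eq_iff {x x' : 𝔹 a b} :
    pureMap x = pureMap x' ↔ ∃ q : ℚ, x = x' + q • (1 : 𝔹 a b) := by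
  constructor
  · intro h
    refine ⟨(trd x - trd x') / 2, ?_⟩
    rw [pureMap_eq, pureMap_eq] at h
    have h1 : (2 : ℚ) • x = (2 : ℚ) • (x' + ((trd x - trd x') / 2) • (1 : 𝔹 a b)) := by
      rw [smul_add, smul_smul, mul_div_cancel₀ _ two_ne_zero, sub_smul]
      rw [sub_eq_iff_eq_add] at h
      rw [h]; abel
    exact smul_right_injective _ (two_ne_zero (α := ℚ)) h1
  · rintro ⟨q, rfl⟩
    rw [map_add, pureMap_ratSmul_one, add_zero]

/-- Integral quaternions that differ by a rational number differ by an integer. -/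
lemma exists_int_of_integral {x x' : 𝔹 a b} {q : ℚ} (h : x = x' + q • (1 : 𝔹 a b))
    {t t' n n' : ℤ} (ht : trd x = t) (ht' : trd x' = t') (hn : nrd x = n) (hn' : nrd x' = n') :
    ∃ k : ℤ, q = k := by
  have h1 : 2 * q = t - t' := by
    rw [h, trd_add, trd_smul, trd_one, ht'] at ht; linarith
  have h2 : q * t' + q ^ 2 = n - n' := by
    rw [h, nrd_add, hn', nrd_smul, nrd_one, star_smul, star_one, mul_smul_comm, trd_smul, mul_one x',
      ht'] at hn
    simp only [star_trivial] at hn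
    linarith
  have h3 : (t - t') * t' * 2 + (t - t') ^ 2 = 4 * (n - n') := by
    have : ((t - t') * t' * 2 + (t - t') ^ 2 : ℚ) = 4 * (n - n') := by
      rw [← h1, ← h2]; ring
    exact_mod_cast this
  have h4 : (2 : ℤ) ∣ t - t' := by
    have : (2 : ℤ) ∣ (t - t') ^ 2 := ⟨2 * (n - n') - (t - t') * t', by linarith⟩
    exact Int.prime_two.dvd_of_dvd_pow this
  obtain ⟨k, hk⟩ := h4
  refine ⟨k, ?_⟩
  have : ((t - t' : ℤ) : ℚ) = ((2 * k : ℤ) : ℚ) := by rw [hk]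
  push_cast at this
  linarith

/-- The ternary lattice `{x - x̄ : x ∈ R}` of an order `R`. Its elements of norm `d` are the orbits
of the elements of `R` of discriminant `-d` under translation by integers. -/
def pureLattice (R : Subring (𝔹 a b)) : Submodule ℤ (𝔹 a b) :=
  (subringLattice R).map pureMap

variable {R : Subring (𝔹 a b)}

lemma mem_pureLattice {s : 𝔹 a b} : s ∈ pureLattice R ↔ ∃ x ∈ R, pureMap x = s := Iff.rfl

lemma pureMap_mem_iff (hR : IsOrder R) {x : 𝔹 a b} {t n : ℤ} (ht : trd x = t)
    (hn : nrd x = n) : pureMap x ∈ pureLattice R ↔ x ∈ R := by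
  refine ⟨?_, fun h => ⟨x, h, rfl⟩⟩
  rintro ⟨x', hx', h⟩
  obtain ⟨q, hq⟩ := pureMap_eq_iff.1 h.symm
  obtain ⟨t', ht'⟩ := hR.trd_int hx'
  obtain ⟨n', hn'⟩ := hR.nrd_int hx'
  obtain ⟨k, rfl⟩ := exists_int_of_integral hq ht ht' hn hn'
  rw [hq, Int.cast_smul_eq_zsmul]
  exact R.add_mem hx' (R.zsmul_mem R.one_mem k)

/-- The vectors of norm `d` in the ternary lattice of `R`. -/
def pureSet (d : ℕ) (R : Subring (𝔹 a b)) : Set (𝔹 a b) :=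
  {s | s ∈ pureLattice R ∧ nrd s = d}

/-- The number of orbits of special points of discriminant `-d`. -/
def specialNum (d : ℕ) (M : Submodule ℤ (𝔹 a b)) : ℕ := (pureSet d (rightRing M)).ncard

/-- Two integral elements with the same image under `x ↦ x - x̄` differ by an integer, so that the
orbits of special points correspond to vectors of the ternary lattice. -/
lemma ncard_specialPoints (d : ℕ) (M : Submodule ℤ (𝔹 a b)) (hM : IsOrder (rightRing M)) :
    Set.ncard ((QuotientAddGroup.mk :
      𝔹 a b → 𝔹 a b ⧸ AddSubgroup.zmultiples (1 : 𝔹 a b)) ''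
      specialPoints d M) = specialNum d M := by
  have hker : AddSubgroup.zmultiples (1 : 𝔹 a b) ≤
      (pureMap (a := a) (b := b)).toAddMonoidHom.ker := by
    rw [AddSubgroup.zmultiples_le]
    simpa using pureMap_ratSmul_one (a := a) (b := b) 1
  have h1 : pureSet d (rightRing M) = (QuotientAddGroup.lift _ _ hker) ''
      ((QuotientAddGroup.mk :
      𝔹 a b → 𝔹 a b ⧸ AddSubgroup.zmultiples (1 : 𝔹 a b)) ''
      specialPoints d M) := by
    rw [Set.image_image]
    ext s
    constructor
    · rintro ⟨⟨x, hx, rfl⟩, h⟩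
      refine ⟨x, ⟨hx, ?_⟩, rfl⟩
      rw [nrd_pureMap] at h; linarith
    · rintro ⟨x, ⟨hx, h⟩, rfl⟩
      refine ⟨⟨x, hx, rfl⟩, ?_⟩
      change nrd (pureMap x) = _
      rw [nrd_pureMap, h, neg_neg]
  rw [specialNum, h1]
  refine (Set.InjOn.ncard_image ?_).symm
  rintro _ ⟨x, ⟨hx, -⟩, rfl⟩ _ ⟨x', ⟨hx', -⟩, rfl⟩ h
  change pureMap x = pureMap x' at h
  obtain ⟨q, hq⟩ := pureMap_eq_iff.1 h
  obtain ⟨t, ht⟩ := hM.trd_int hx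
  obtain ⟨n, hn⟩ := hM.nrd_int hx
  obtain ⟨t', ht'⟩ := hM.trd_int hx'
  obtain ⟨n', hn'⟩ := hM.nrd_int hx'
  obtain ⟨k, rfl⟩ := exists_int_of_integral hq ht ht' hn hn'
  refine (QuotientAddGroup.eq.2 (AddSubgroup.mem_zmultiples_iff.2 ⟨k, ?_⟩)).symm
  simp only [Int.cast_smul_eq_zsmul] at hq ⊢
  rw [hq]; abel

lemma rightRing_latticeMul (M : Submodule ℤ (𝔹 a b)) (x : (𝔹 a b)ˣ)
    {z : 𝔹 a b} :
    z ∈ rightRing (latticeMul M x) ↔ (x : 𝔹 a b) * z * (↑x⁻¹ : 𝔹 a b) ∈ rightRing M := by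
  simp only [mem_rightRing]
  constructor
  · intro h v hv
    have := h _ (mem_latticeMul.2 ⟨v, hv, rfl⟩)
    rw [mem_latticeMul_unit] at this
    simpa only [mul_assoc] using this
  · intro h v hv
    rw [mem_latticeMul_unit] at hv ⊢
    have := h _ hv
    simpa only [← mul_assoc, Units.inv_mul_cancel_right] using this

lemma pureMap_conj (x : (𝔹 a b)ˣ) (z : 𝔹 a b) :
    pureMap ((x : 𝔹 a b) * z * (↑x⁻¹ : 𝔹 a b))
      = (x : 𝔹 a b) * pureMap z * (↑x⁻¹ : 𝔹 a b) := by
  rw [pureMap_eq, pureMap_eq, trd_conj, mul_sub, sub_mul, mul_smul_comm, mul_smul_comm, smul_mul_assoc,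
    smul_mul_assoc, mul_one, Units.mul_inv]

/-- The right orders of equivalent ideals are conjugate. -/
lemma specialNum_latticeMul (d : ℕ) (M : Submodule ℤ (𝔹 a b)) (x : (𝔹 a b)ˣ) :
    specialNum d (latticeMul M x) = specialNum d M := by
  have h : pureSet d (rightRing M) =
      (fun z => (x : 𝔹 a b) * z * (↑x⁻¹ : 𝔹 a b)) '' pureSet d (rightRing (latticeMul M x)) := by
    ext s
    constructor
    · rintro ⟨⟨r, hr, rfl⟩, h⟩
      refine ⟨pureMap ((↑x⁻¹ : 𝔹 a b) * r * x), ⟨⟨_, ?_, rfl⟩, ?_⟩, ?_⟩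
      · exact (rightRing_latticeMul M x).2 (by
          simpa [mul_assoc] using (mem_subringLattice.1 hr))
      · rw [nrd_pureMap] at h ⊢
        rw [charDisc_conj', h]
      · simp only
        rw [← pureMap_conj]; simp [mul_assoc]
    · rintro ⟨_, ⟨⟨r, hr, rfl⟩, h⟩, rfl⟩
      simp only
      refine ⟨⟨_, (rightRing_latticeMul M x).1 hr, pureMap_conj x r⟩, by rw [nrd_conj, h]⟩
  rw [specialNum, specialNum, h, Set.ncard_image_of_injective]
  intro z z' hz
  simpa using hz

end Quat

/-! ### The Eichler relation for the numbers of special points -/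

section Quat

variable {a b : ℚ}

/-- An element of trace `t` and norm `n` with discriminant `-p² d` becomes `p` times an integral
element after translation by an integer `k`. -/
lemma exists_shift {p : ℕ} (hp : p.Prime) {t n d : ℤ} (h : t ^ 2 - 4 * n = -(p ^ 2 * d))
    (h2 : p = 2 → -d % 4 = 0 ∨ -d % 4 = 1) :
    ∃ k : ℤ, (p : ℤ) ∣ t - 2 * k ∧ (p : ℤ) ^ 2 ∣ n - k * t + k ^ 2 := by
  by_cases hp2 : p = 2
  · subst hp2
    have ht : (2 : ℤ) ∣ t := by
      have : (2 : ℤ) ∣ t ^ 2 := ⟨2 * n - 2 * d, by push_cast at h; linarith⟩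
      exact Int.prime_two.dvd_of_dvd_pow this
    obtain ⟨s, rfl⟩ := ht
    have hn : n = s ^ 2 + d := by push_cast at h; linarith
    subst hn
    rcases h2 rfl with h3 | h3
    · refine ⟨s, ⟨0, by push_cast; ring⟩, ?_⟩
      have : (4 : ℤ) ∣ d := by omega
      obtain ⟨e, rfl⟩ := this
      exact ⟨e, by push_cast; ring⟩
    · refine ⟨s - 1, ⟨1, by push_cast; ring⟩, ?_⟩
      have : (4 : ℤ) ∣ d + 1 := by omega
      obtain ⟨e, he⟩ := this
      exact ⟨e, by push_cast; linear_combination he⟩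
  · obtain ⟨g, hg⟩ := hp.odd_of_ne_two hp2
    have hg' : (p : ℤ) = 2 * g + 1 := by exact_mod_cast hg
    -- with `p = 2 g + 1`, this `k` is `t (p² + 1) / 2`
    refine ⟨t * (2 * g ^ 2 + 2 * g + 1), ⟨-(t * p), by rw [hg']; ring⟩, ?_⟩
    have h4 : IsCoprime ((p : ℤ) ^ 2) 4 := by
      have : IsCoprime (p : ℤ) 2 := by
        rw [hg']; exact ⟨1, -g, by ring⟩
      have h5 := (this.pow (m := 2) (n := 2))
      norm_num at h5
      exact h5
    refine h4.dvd_of_dvd_mul_left ⟨t ^ 2 * p ^ 2 + d, ?_⟩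
    have h6 : (4 * n : ℤ) = t ^ 2 + p ^ 2 * d := by linarith
    have h7 : (4 : ℤ) * (n - t * (2 * g ^ 2 + 2 * g + 1) * t + (t * (2 * g ^ 2 + 2 * g + 1)) ^ 2)
      = 4 * n - t ^ 2 + (t * (2 * g + 1) ^ 2) ^ 2 := by ring
    rw [h7, h6, ← hg']
    ring

section Definite

variable [ha : Fact (a < 0)] [hb : Fact (b < 0)]

/-- A lattice contains finitely many elements of a given norm. -/
lemma finite_nrd_eq {M : Submodule ℤ (𝔹 a b)} (hM : M.FG) (c : ℚ) :
    {x | x ∈ M ∧ nrd x = c}.Finite := by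
  obtain ⟨D, hD, h⟩ := exists_coord_denom hM
  have hD' : (D : ℚ) ≠ 0 := by exact_mod_cast hD
  have h1 := ha.out
  have h2 := hb.out
  have hab : 0 < a * b := mul_pos_of_neg_of_neg h1 h2
  -- every coordinate `u` of an element of norm `c` satisfies `e u ^ 2 ≤ c` for a constant `e > 0`
  have key : ∀ e : ℚ, 0 < e → ∃ B : ℤ, ∀ u : ℚ, e * u ^ 2 ≤ c → (D : ℚ) * u ≤ B ∧ -B ≤ (D : ℚ) * u := by
    intro e he
    refine ⟨⌈(D : ℚ) ^ 2 * (c / e) + 1⌉, fun u hu => ?_⟩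
    have h3 : (D * u) ^ 2 ≤ (D : ℚ) ^ 2 * (c / e) := by
      rw [mul_pow]
      exact mul_le_mul_of_nonneg_left (by rw [le_div_iff₀ he]; linarith) (sq_nonneg _)
    have h4 := Int.le_ceil ((D : ℚ) ^ 2 * (c / e) + 1)
    constructor <;> nlinarith [sq_nonneg (D * u - 1), sq_nonneg (D * u + 1)]
  obtain ⟨B0, hB0⟩ := key 1 one_pos
  obtain ⟨B1, hB1⟩ := key (-a) (by linarith)
  obtain ⟨B2, hB2⟩ := key (-b) (by linarith)
  obtain ⟨B3, hB3⟩ := key (a * b) hab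
  refine Set.Finite.of_injOn (f := fun x : 𝔹 a b => (⌊(D : ℚ) * x.re⌋, ⌊(D : ℚ) * x.imI⌋,
      ⌊(D : ℚ) * x.imJ⌋, ⌊(D : ℚ) * x.imK⌋))
    (t := Set.Icc (-B0, -B1, -B2, -B3) (B0, B1, B2, B3)) ?_ ?_ (Set.finite_Icc _ _)
  · rintro x ⟨hx, hc⟩
    rw [nrd_eq] at hc
    have e0 := sq_nonneg x.re
    have e1 := mul_nonneg (by linarith : (0 : ℚ) ≤ -a) (sq_nonneg x.imI)
    have e2 := mul_nonneg (by linarith : (0 : ℚ) ≤ -b) (sq_nonneg x.imJ)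
    have e3 := mul_nonneg hab.le (sq_nonneg x.imK)
    have f0 := hB0 x.re (by linarith)
    have f1 := hB1 x.imI (by linarith)
    have f2 := hB2 x.imJ (by linarith)
    have f3 := hB3 x.imK (by linarith)
    obtain ⟨⟨k0, g0⟩, ⟨k1, g1⟩, ⟨k2, g2⟩, ⟨k3, g3⟩⟩ := h x hx
    rw [g0] at f0; rw [g1] at f1; rw [g2] at f2; rw [g3] at f3
    simp only [g0, g1, g2, g3, Int.floor_intCast, Set.mem_Icc, Prod.mk_le_mk]
    norm_cast at f0 f1 f2 f3
    exact ⟨⟨f0.2, f1.2, f2.2, f3.2⟩, f0.1, f1.1, f2.1, f3.1⟩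
  · rintro x ⟨hx, -⟩ x' ⟨hx', -⟩ heq
    obtain ⟨⟨k0, g0⟩, ⟨k1, g1⟩, ⟨k2, g2⟩, ⟨k3, g3⟩⟩ := h x hx
    obtain ⟨⟨l0, m0⟩, ⟨l1, m1⟩, ⟨l2, m2⟩, ⟨l3, m3⟩⟩ := h x' hx'
    simp only [g0, g1, g2, g3, m0, m1, m2, m3, Int.floor_intCast, Prod.mk.injEq] at heq
    obtain ⟨rfl, rfl, rfl, rfl⟩ := heq
    ext
    · exact mul_left_cancel₀ hD' (g0.trans m0.symm)
    · exact mul_left_cancel₀ hD' (g1.trans m1.symm)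
    · exact mul_left_cancel₀ hD' (g2.trans m2.symm)
    · exact mul_left_cancel₀ hD' (g3.trans m3.symm)

lemma finite_pureSet {R : Subring (𝔹 a b)} (hR : IsOrder R) (d : ℕ) : (pureSet d R).Finite :=
  finite_nrd_eq (hR.fg.map _) _

end Definite

variable {O : Subring (𝔹 a b)} [Fact (a < 0)] [Fact (b < 0)]

namespace LeftIdeal

variable {p : ℕ} (S : LocalSplitting p O) {I : LeftIdeal O}
  {y : (𝔹 a b)ˣ} (hy : IsLocGen p O I.lattice y)

include hy

omit [Fact (a < 0)] [Fact (b < 0)] in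
lemma conj_mem {x : 𝔹 a b} (hx : x ∈ rightRing I.lattice) :
    (y : 𝔹 a b) * x * (↑y⁻¹ : 𝔹 a b) ∈ locRing p O :=
  (mem_locRing_rightRing hy).1 (le_locAt p _ (mem_subringLattice.2 hx))

omit [Fact (a < 0)] [Fact (b < 0)] in
lemma red_mul_conj {v x : 𝔹 a b} (hv : v ∈ I.lattice) (hx : x ∈ rightRing I.lattice) :
    S.red (v * x * (↑y⁻¹ : 𝔹 a b)) = S.red (v * (↑y⁻¹ : 𝔹 a b)) *
      S.red ((y : 𝔹 a b) * x * (↑y⁻¹ : 𝔹 a b)) := by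
  rw [← S.red_mul ((hy v).1 (le_locAt p _ hv)) (conj_mem hy hx), ← mul_assoc, ← mul_assoc,
    Units.inv_mul_cancel_right]

omit [Fact (a < 0)] [Fact (b < 0)] in
lemma trace_red_conj {x : 𝔹 a b} (hx : x ∈ rightRing I.lattice) {t : ℤ} (ht : trd x = t) :
    (S.red ((y : 𝔹 a b) * x * (↑y⁻¹ : 𝔹 a b))).trace = t :=
  S.trace_red (conj_mem hy hx) (by rw [trd_conj, ht])

omit [Fact (a < 0)] [Fact (b < 0)] in
lemma det_red_conj {x : 𝔹 a b} (hx : x ∈ rightRing I.lattice) {n : ℤ} (hn : nrd x = n) :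
    (S.red ((y : 𝔹 a b) * x * (↑y⁻¹ : 𝔹 a b))).det = n :=
  S.det_red (conj_mem hy hx) (by rw [nrd_conj, hn])

variable [hp : Fact p.Prime] (hO : IsOrder O)

include hO

/-- An element of the right order of `I` belongs to the right order of the ideal of a line if and
only if it preserves the line. -/
lemma mem_rightRing_lineIdeal {x : 𝔹 a b} (hx : x ∈ rightRing I.lattice)
    {w : Fin 2 → ZMod p} (hw : w ≠ 0) :
    x ∈ rightRing (lineIdeal S hO hy hw).lattice ↔
      ∃ c : ZMod p, (S.red ((y : 𝔹 a b) * x * (↑y⁻¹ : 𝔹 a b))).mulVec w = c • w := by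
  rw [lineIdeal_lattice]
  constructor
  · intro h
    have h1 : !![-w 1, w 0; 0, 0].mulVec w = 0 := by
      ext i; fin_cases i <;> simp [Matrix.mulVec, dotProduct, Fin.sum_univ_two]; ring
    have h0 : !![-w 1, w 0; 0, 0] ≠ (0 : Matrix (Fin 2) (Fin 2) (ZMod p)) := by
      intro h0
      have e1 := congrFun (congrFun h0 0) 0
      have e2 := congrFun (congrFun h0 0) 1
      simp at e1 e2
      exact hw (by ext i; fin_cases i <;> simp [e1, e2])
    obtain ⟨v, hv, hvm⟩ := exists_mem_red_eq S hO hy !![-w 1, w 0; 0, 0]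
    have h2 := (h v ⟨hv, by rw [hvm, h1]⟩).2
    rw [red_mul_conj S hy hv hx, hvm, ← Matrix.mulVec_mulVec] at h2
    exact exists_smul_eq_of_mulVec_eq_zero hw h0 h1 h2
  · rintro ⟨c, hc⟩ v ⟨hv, hvw⟩
    refine ⟨hx v hv, ?_⟩
    rw [red_mul_conj S hy hv hx, ← Matrix.mulVec_mulVec, hc, Matrix.mulVec_smul, hvw, smul_zero]

/-- An element of the right order reduces to a scalar if and only if it is congruent to an integer
modulo `p`. -/
lemma red_conj_eq_smul_iff {x : 𝔹 a b} (hx : x ∈ rightRing I.lattice) :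
    (∃ k : ZMod p, S.red ((y : 𝔹 a b) * x * (↑y⁻¹ : 𝔹 a b))
        = k • (1 : Matrix (Fin 2) (Fin 2) (ZMod p))) ↔
      ∃ g ∈ pureLattice (rightRing I.lattice), pureMap x = p • g := by
  have hR := rightRing_isOrder hO (I := I)
  have hp0 : (p : ℚ) ≠ 0 := by exact_mod_cast hp.out.ne_zero
  constructor
  · rintro ⟨k, hk⟩
    obtain ⟨k, rfl⟩ := ZMod.intCast_surjective k
    have hxk : x - k • (1 : 𝔹 a b) ∈ rightRing I.lattice :=
      (rightRing _).sub_mem hx ((rightRing _).zsmul_mem (rightRing _).one_mem k)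
    have h1 : (y : 𝔹 a b) * (x - k • (1 : 𝔹 a b)) * (↑y⁻¹ : 𝔹 a b)
        = (y : 𝔹 a b) * x * (↑y⁻¹ : 𝔹 a b) - k • (1 : 𝔹 a b) := by
      rw [mul_sub, sub_mul, mul_smul_comm, smul_mul_assoc, mul_one, Units.mul_inv]
    have h2 : S.red ((y : 𝔹 a b) * (x - k • (1 : 𝔹 a b)) * (↑y⁻¹ : 𝔹 a b)) = 0 := by
      rw [h1, S.red_sub (conj_mem hy hx) ((locRing p O).zsmul_mem (locRing p O).one_mem k),
        S.red_zsmul (locRing p O).one_mem, S.red_one, hk, ← Int.cast_smul_eq_zsmul (ZMod p), sub_self]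
    obtain ⟨z, hz, hzx⟩ := S.exists_of_red_eq_zero (conj_mem hy hxk) h2
    have hw : (p : ℚ)⁻¹ • (x - k • (1 : 𝔹 a b)) ∈ subringLattice (rightRing I.lattice) := by
      refine mem_of_forall_mem_locAt fun q hq => ?_
      by_cases hqp : q = p
      · subst hqp
        rw [← mem_locRing, mem_locRing_rightRing hy, mul_smul_comm, smul_mul_assoc, hzx,
          ← Nat.cast_smul_eq_nsmul ℚ, smul_smul, inv_mul_cancel₀ hp0, one_smul]
        exact hz
      · refine mem_locAt_of_nsmul_mem ((Nat.coprime_primes hp.out hq).2 (Ne.symm hqp)) ?_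
        rw [← Nat.cast_smul_eq_nsmul ℚ, smul_smul, mul_inv_cancel₀ hp0, one_smul]
        exact le_locAt q _ hxk
    refine ⟨_, ⟨_, hw, rfl⟩, ?_⟩
    rw [pureMap_ratSmul, ← Nat.cast_smul_eq_nsmul ℚ, smul_smul, mul_inv_cancel₀ hp0, one_smul, map_sub,
      ← Int.cast_smul_eq_zsmul ℚ, pureMap_ratSmul_one, sub_zero]
  · rintro ⟨_, ⟨w, hw, rfl⟩, h⟩
    rw [← map_nsmul] at h
    obtain ⟨q, hq⟩ := pureMap_eq_iff.1 h
    have hpw : p • w ∈ rightRing I.lattice := (rightRing _).nsmul_mem hw p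
    obtain ⟨t, ht⟩ := hR.trd_int hx
    obtain ⟨n, hn⟩ := hR.nrd_int hx
    obtain ⟨t', ht'⟩ := hR.trd_int hpw
    obtain ⟨n', hn'⟩ := hR.nrd_int hpw
    obtain ⟨k, rfl⟩ := exists_int_of_integral hq ht ht' hn hn'
    refine ⟨k, ?_⟩
    have h1 : (y : 𝔹 a b) * x * (↑y⁻¹ : 𝔹 a b)
        = p • ((y : 𝔹 a b) * w * (↑y⁻¹ : 𝔹 a b)) + k • (1 : 𝔹 a b) := by
      rw [hq, Int.cast_smul_eq_zsmul, mul_add, add_mul, mul_smul_comm, mul_smul_comm, smul_mul_assoc,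
        smul_mul_assoc, mul_one, Units.mul_inv]
    have hk := (locRing p O).zsmul_mem (locRing p O).one_mem k
    rw [h1, S.red_add ((locRing p O).nsmul_mem (conj_mem hy hw) p) hk, S.red_p_smul (conj_mem hy hw),
      zero_add, S.red_zsmul (locRing p O).one_mem, S.red_one, Int.cast_smul_eq_zsmul]

open Classical in
/-- If `s = x - x̄` with `x` in the right order of `I`, the ideals of lines whose ternary lattices
contain `s` correspond to the lines preserved by `x`. -/
lemma card_lines_of_mem {d : ℕ} {s : 𝔹 a b} (hs : s ∈ pureLattice (rightRing I.lattice))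
    (hd : nrd s = d) :
    ((Finset.univ.filter fun o : Option (ZMod p) =>
        s ∈ pureLattice (rightRing (lineIdeal S hO hy (lineVec_ne_zero o)).lattice)).card : ℤ)
      = 1 + kroneckerSymbol (-d) p
        + if ∃ g ∈ pureLattice (rightRing I.lattice), s = p • g then (p : ℤ) else 0 := by
  obtain ⟨x, hx, rfl⟩ := hs
  have hx' : x ∈ rightRing I.lattice := hx
  obtain ⟨t, ht⟩ := (rightRing_isOrder hO (I := I)).trd_int hx'
  obtain ⟨n, hn⟩ := (rightRing_isOrder hO (I := I)).nrd_int hx'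
  have hdisc : -(d : ℤ) = t ^ 2 - 4 * n := by
    rw [nrd_pureMap, charDisc, ht, hn] at hd
    have : -(d : ℚ) = t ^ 2 - 4 * n := by linarith
    exact_mod_cast this
  simp only [pureMap_mem_iff (rightRing_isOrder hO) ht hn, mem_rightRing_lineIdeal S hy hO hx',
    hdisc, ← red_conj_eq_smul_iff S hy hO hx']
  exact card_invariant_lines (trace_red_conj S hy hx' ht) (det_red_conj S hy hx' hn)

/-- If `p x` belongs to the right order of `I`, where `x` is integral, but `x` does not, then the
ideals of lines whose right order contains `x` are those of the lines killed by `p x`. -/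
lemma mem_rightRing_lineIdeal_of_smul {x : 𝔹 a b} (hpx : p • x ∈ rightRing I.lattice)
    {t n : ℤ} (ht : trd x = t) (hn : nrd x = n)
    (hne : S.red ((y : 𝔹 a b) * (p • x) * (↑y⁻¹ : 𝔹 a b)) ≠ 0)
    {w : Fin 2 → ZMod p} (hw : w ≠ 0) :
    x ∈ rightRing (lineIdeal S hO hy hw).lattice ↔
      (S.red ((y : 𝔹 a b) * (p • x) * (↑y⁻¹ : 𝔹 a b))).mulVec w = 0 := by
  rw [lineIdeal_lattice]
  have he := conj_mem hy hpx
  constructor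
  · intro h
    obtain ⟨v, hv, hvm⟩ := exists_mem_red_eq S hO hy 1
    have h1 := (h _ (p_smul_mem_lineLattice S hy (w := w) hv)).2
    rw [smul_mul_assoc, ← mul_smul_comm, red_mul_conj S hy hv hpx, hvm, one_mul] at h1
    exact h1
  · rintro h v ⟨hv, hvw⟩
    obtain ⟨Y, hY⟩ := exists_mul_eq_of_mulVec_eq_zero hw hne h hvw
    obtain ⟨o, ho, rfl⟩ := S.red_surj Y
    have ho' : o ∈ locRing p O := le_locAt p _ ho
    have hvy := (hy v).1 (le_locAt p _ hv)
    obtain ⟨r, hr, hvr⟩ := S.exists_of_red_eq_zero ((locRing p O).sub_mem hvy ((locRing p O).mul_mem ho' he))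
      (by rw [S.red_sub hvy ((locRing p O).mul_mem ho' he), S.red_mul ho' he, hY, sub_self])
    -- the element `v x` of the completed ideal, computed with `x ^ 2 = t x - n`
    have hz : v * x * (↑y⁻¹ : 𝔹 a b)
        = o * (t • ((y : 𝔹 a b) * (p • x) * (↑y⁻¹ : 𝔹 a b)) - n • p • (1 : 𝔹 a b))
          + r * ((y : 𝔹 a b) * (p • x) * (↑y⁻¹ : 𝔹 a b)) := by
      have h1 : v * (↑y⁻¹ : 𝔹 a b) = p • r +
          o * ((y : 𝔹 a b) * (p • x) * (↑y⁻¹ : 𝔹 a b)) := by rw [← hvr]; abel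
      have h2 : v * x * (↑y⁻¹ : 𝔹 a b) = (v * (↑y⁻¹ : 𝔹 a b)) *
          ((y : 𝔹 a b) * x * (↑y⁻¹ : 𝔹 a b)) := by
        rw [← mul_assoc, ← mul_assoc, Units.inv_mul_cancel_right]
      have h3 : ((y : 𝔹 a b) * (p • x) * (↑y⁻¹ : 𝔹 a b)) *
          ((y : 𝔹 a b) * x * (↑y⁻¹ : 𝔹 a b))
          = t • ((y : 𝔹 a b) * (p • x) * (↑y⁻¹ : 𝔹 a b)) - n • p • (1 : 𝔹 a b) := by
        have h4 : ((y : 𝔹 a b) * (p • x) * (↑y⁻¹ : 𝔹 a b)) *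
            ((y : 𝔹 a b) * x * (↑y⁻¹ : 𝔹 a b))
            = p • ((y : 𝔹 a b) * (x * x) * (↑y⁻¹ : 𝔹 a b)) := by
          simp only [mul_smul_comm, smul_mul_assoc, mul_assoc, Units.inv_mul_cancel_left]
        rw [h4, mul_self_eq, ht, hn, Int.cast_smul_eq_zsmul, Int.cast_smul_eq_zsmul, mul_sub, sub_mul,
          mul_smul_comm, mul_smul_comm, mul_smul_comm, smul_mul_assoc, smul_mul_assoc, smul_mul_assoc,
          mul_one, Units.mul_inv, smul_sub, smul_comm p t, smul_comm p n]
      rw [h2, h1, add_mul, mul_assoc o, h3, add_comm]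
      congr 1
      simp only [mul_smul_comm, smul_mul_assoc]
    have hp1 : n • p • (1 : 𝔹 a b) ∈ locRing p O :=
      (locRing p O).zsmul_mem ((locRing p O).nsmul_mem (locRing p O).one_mem p) n
    have hm := (locRing p O).sub_mem ((locRing p O).zsmul_mem he t) hp1
    have hmem : v * x * (↑y⁻¹ : 𝔹 a b) ∈ locRing p O := by
      rw [hz]
      exact (locRing p O).add_mem ((locRing p O).mul_mem ho' hm) ((locRing p O).mul_mem hr he)
    refine ⟨mem_of_forall_mem_locAt fun q hq => ?_, ?_⟩
    · by_cases hqp : q = p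
      · subst hqp
        exact (hy _).2 hmem
      · refine mem_locAt_of_nsmul_mem ((Nat.coprime_primes hp.out hq).2 (Ne.symm hqp)) ?_
        rw [← mul_smul_comm]
        exact le_locAt q _ (hpx v hv)
    · rw [hz, S.red_add ((locRing p O).mul_mem ho' hm) ((locRing p O).mul_mem hr he), S.red_mul ho' hm,
        S.red_mul hr he, S.red_sub ((locRing p O).zsmul_mem he t) hp1, S.red_zsmul he,
        S.red_zsmul ((locRing p O).nsmul_mem (locRing p O).one_mem p),
        S.red_p_smul (locRing p O).one_mem, smul_zero, sub_zero, Matrix.add_mulVec,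
        ← Matrix.mulVec_mulVec, ← Matrix.mulVec_mulVec, h, Matrix.mulVec_zero, add_zero,
        Matrix.smul_mulVec, h, smul_zero, Matrix.mulVec_zero]

open Classical in
/-- If `p s` belongs to the ternary lattice of `I` but `s` does not, then `s` belongs to that of
exactly one line: `s = x - x̄` with `p x` in the right order of `I`, and the line is the kernel of
the reduction of `p x`, a matrix of rank one. -/
lemma card_lines_of_not_mem {d : ℕ} {s : 𝔹 a b}
    (hps : p • s ∈ pureLattice (rightRing I.lattice)) (hs : s ∉ pureLattice (rightRing I.lattice))
    (hd : nrd s = d) (h2 : p = 2 → -(d : ℤ) % 4 = 0 ∨ -(d : ℤ) % 4 = 1) :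
    (Finset.univ.filter fun o : Option (ZMod p) =>
        s ∈ pureLattice (rightRing (lineIdeal S hO hy (lineVec_ne_zero o)).lattice)).card = 1 := by
  have hR := rightRing_isOrder hO (I := I)
  have hp0 : (p : ℚ) ≠ 0 := by exact_mod_cast hp.out.ne_zero
  obtain ⟨z, hz, hzs⟩ := mem_pureLattice.1 hps
  obtain ⟨t, ht⟩ := hR.trd_int hz
  obtain ⟨n, hn⟩ := hR.nrd_int hz
  have hdisc : t ^ 2 - 4 * n = -(p ^ 2 * d : ℤ) := by
    have h1 : nrd (pureMap z) = p ^ 2 * d := by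
      rw [hzs, ← Nat.cast_smul_eq_nsmul ℚ, nrd_smul, hd]
    rw [nrd_pureMap, charDisc, ht, hn] at h1
    have : (t : ℚ) ^ 2 - 4 * n = -(p ^ 2 * d) := by linarith
    exact_mod_cast this
  obtain ⟨k, ⟨t', ht'⟩, n', hn'⟩ := exists_shift hp.out hdisc h2
  have hmem : z - k • (1 : 𝔹 a b) ∈ rightRing I.lattice :=
    (rightRing _).sub_mem hz ((rightRing _).zsmul_mem (rightRing _).one_mem k)
  set x : 𝔹 a b := (p : ℚ)⁻¹ • (z - k • (1 : 𝔹 a b)) with hx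
  have hpx : p • x = z - k • (1 : 𝔹 a b) := by
    rw [hx, ← Nat.cast_smul_eq_nsmul ℚ, smul_smul, mul_inv_cancel₀ hp0, one_smul]
  rw [← hpx] at hmem
  have hxs : pureMap x = s := by
    have h3 : (p : ℚ) • pureMap x = (p : ℚ) • s := by
      rw [Nat.cast_smul_eq_nsmul, Nat.cast_smul_eq_nsmul, ← map_nsmul, hpx, map_sub, hzs,
        ← Int.cast_smul_eq_zsmul ℚ, pureMap_ratSmul_one, sub_zero]
    exact smul_right_injective _ hp0 h3
  have htx : trd x = t' := by
    rw [hx, trd_smul, trd_sub, ht, ← Int.cast_smul_eq_zsmul ℚ, trd_smul, trd_one]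
    field_simp
    have : ((t - 2 * k : ℤ) : ℚ) = ((p * t' : ℤ) : ℚ) := by rw [ht']
    push_cast at this
    linarith
  have hnx : nrd x = n' := by
    have h4 : nrd (z - k • (1 : 𝔹 a b)) = n - k * t + k ^ 2 := by
      rw [sub_eq_add_neg, ← neg_smul, ← Int.cast_smul_eq_zsmul ℚ, nrd_add, hn, nrd_smul, nrd_one, star_smul,
        star_one, mul_smul_comm, mul_one z, trd_smul, ht]
      simp only [star_trivial]
      push_cast; ring
    rw [hx, nrd_smul, h4]
    field_simp
    have : ((n - k * t + k ^ 2 : ℤ) : ℚ) = ((p ^ 2 * n' : ℤ) : ℚ) := by rw [hn']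
    push_cast at this
    linarith
  have hne : S.red ((y : 𝔹 a b) * (p • x) * (↑y⁻¹ : 𝔹 a b)) ≠ 0 := by
    intro h0
    obtain ⟨g, hg, hgx⟩ := (red_conj_eq_smul_iff S hy hO hmem).1 ⟨0, by rw [h0, zero_smul]⟩
    rw [map_nsmul, hxs, ← Nat.cast_smul_eq_nsmul ℚ, ← Nat.cast_smul_eq_nsmul ℚ] at hgx
    rw [smul_right_injective _ hp0 hgx] at hs
    exact hs hg
  have hdet : (S.red ((y : 𝔹 a b) * (p • x) * (↑y⁻¹ : 𝔹 a b))).det = 0 := by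
    rw [det_red_conj S hy hmem (n := p ^ 2 * n') (by
      rw [← Nat.cast_smul_eq_nsmul ℚ, nrd_smul, hnx]; push_cast; ring)]
    push_cast
    rw [CharP.cast_eq_zero, zero_pow two_ne_zero, zero_mul]
  rw [← hxs]
  simp only [pureMap_mem_iff (rightRing_isOrder hO) htx hnx,
    mem_rightRing_lineIdeal_of_smul S hy hO hmem htx hnx hne (lineVec_ne_zero _)]
  rw [card_lineVec_kernel hdet, if_neg hne]

lemma p_smul_mem_pureLattice {w : Fin 2 → ZMod p} (hw : w ≠ 0) {s : 𝔹 a b}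
    (hs : s ∈ pureLattice (rightRing (lineIdeal S hO hy hw).lattice)) :
    p • s ∈ pureLattice (rightRing I.lattice) := by
  obtain ⟨x, hx, rfl⟩ := mem_pureLattice.1 hs
  refine ⟨p • x, fun v hv => ?_, map_nsmul _ _ _⟩
  rw [mul_smul_comm, ← smul_mul_assoc]
  exact lineLattice_le S hy (hx _ (p_smul_mem_lineLattice S hy (w := w) hv))

end LeftIdeal

end Quat

/-! ### Hecke operators on sequences of special point numbers -/

section Kronecker

lemma kroneckerSymbol_prime_mul {p : ℕ} [hp : Fact p.Prime] (m n : ℤ) :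
    kroneckerSymbol (m * n) p = kroneckerSymbol m p * kroneckerSymbol n p := by
  by_cases h2 : p = 2
  · subst h2
    rw [kroneckerSymbol_two, kroneckerSymbol_two, kroneckerSymbol_two, Int.cast_mul, map_mul]
  · rw [kroneckerSymbol_odd_prime h2, kroneckerSymbol_odd_prime h2, kroneckerSymbol_odd_prime h2,
      Int.cast_mul, map_mul]

lemma chi_eight_sq : ∀ x : ZMod 8, ZMod.castHom (show 2 ∣ 8 by norm_num) (ZMod 2) x ≠ 0 →
    ZMod.χ₈ x ^ 2 = 1 := by
  decide

lemma kroneckerSymbol_prime_sq {p : ℕ} [hp : Fact p.Prime] {n : ℤ} (h : ¬ (p : ℤ) ∣ n) :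
    kroneckerSymbol n p ^ 2 = 1 := by
  by_cases h2 : p = 2
  · subst h2
    rw [kroneckerSymbol_two]
    refine chi_eight_sq _ ?_
    rw [map_intCast, Ne, ZMod.intCast_zmod_eq_zero_iff_dvd]
    exact h
  · rw [kroneckerSymbol_odd_prime h2]
    refine quadraticChar_sq_one ?_
    rwa [Ne, ZMod.intCast_zmod_eq_zero_iff_dvd]

end Kronecker

section Squarefree

lemma squarefreePart_mul_sq (n : ℕ) (hn : n ≠ 0) : ∃ f : ℕ, n = squarefreePart n * f ^ 2 := by
  refine ⟨∏ p ∈ n.primeFactors, p ^ (n.factorization p / 2), ?_⟩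
  conv_lhs => rw [← Nat.prod_factorization_pow_eq_self hn]
  rw [squarefreePart, Finset.prod_filter, ← Finset.prod_pow, ← Finset.prod_mul_distrib,
    Finsupp.prod, Nat.support_factorization]
  refine Finset.prod_congr rfl fun p _ => ?_
  split_ifs with h
  · obtain ⟨k, hk⟩ := h
    rw [hk, ← pow_mul, ← pow_succ']
    congr 1; omega
  · rw [one_mul, ← pow_mul]
    congr 1
    rw [Nat.not_odd_iff_even] at h
    obtain ⟨k, hk⟩ := h
    omega

end Squarefree

section Quat

variable {a b : ℚ} {O : Subring (𝔹 a b)} 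

namespace IsOrder

lemma charDisc_int (hO : IsOrder O) {x : 𝔹 a b} (hx : x ∈ O) : ∃ k : ℤ, charDisc x = k := by
  obtain ⟨t, ht⟩ := hO.trd_int hx
  obtain ⟨n, hn⟩ := hO.nrd_int hx
  exact ⟨t ^ 2 - 4 * n, by rw [charDisc, ht, hn]; push_cast; ring⟩

variable [ha : Fact (a < 0)] [hb : Fact (b < 0)]

lemma exists_charDisc_ne_zero (hO : IsOrder O) : ∃ x ∈ O, charDisc x ≠ 0 := by
  by_contra! h
  have h1 : ∀ x ∈ Submodule.span ℚ (subringLattice O : Set (𝔹 a b)), x.imI = 0 := by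
    intro x hx
    induction hx using Submodule.span_induction with
    | mem x hx => exact (im_eq_zero_of_charDisc_eq_zero (h x hx)).1
    | zero => rfl
    | add x y _ _ hx hy => rw [QuaternionAlgebra.imI_add, hx, hy, add_zero]
    | smul c x _ hx => rw [QuaternionAlgebra.imI_smul, hx, smul_zero]
  have h2 := h1 ⟨0, 1, 0, 0⟩ (by rw [Submodule.IsLattice.span_eq_top (self := hO)]; trivial)
  exact one_ne_zero h2

/-- `ω(O)` is the greatest common divisor of the discriminants. -/
lemma omega_spec (hO : IsOrder O) : orderOmega O ≠ 0 ∧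
    (∀ x ∈ O, ∃ k : ℤ, charDisc x = orderOmega O * k) ∧
    ∀ m : ℤ, (∀ x ∈ O, ∃ k : ℤ, charDisc x = m * k) → m ∣ orderOmega O := by
  obtain ⟨x₀, hx₀, hne⟩ := hO.exists_charDisc_ne_zero
  obtain ⟨k₀, hk₀⟩ := hO.charDisc_int hx₀
  have hk₀' : k₀ ≠ 0 := by rintro rfl; exact hne (by simpa using hk₀)
  set T := {m : ℕ | ∀ x ∈ O, ∃ k : ℤ, charDisc x = m * k} with hT
  have hdvd : ∀ m ∈ T, m ∣ k₀.natAbs := by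
    intro m hm
    obtain ⟨k, hk⟩ := hm x₀ hx₀
    rw [hk₀] at hk
    have : k₀ = m * k := by exact_mod_cast hk
    rw [← Int.natCast_dvd]
    exact ⟨k, this⟩
  have hbdd : BddAbove T := ⟨k₀.natAbs, fun m hm =>
    Nat.le_of_dvd (Int.natAbs_pos.2 hk₀') (hdvd m hm)⟩
  have h1T : 1 ∈ T := fun x hx => by
    obtain ⟨k, hk⟩ := hO.charDisc_int hx
    exact ⟨k, by simpa using hk⟩
  have hmem : orderOmega O ∈ T := Nat.sSup_mem ⟨1, h1T⟩ hbdd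
  have hle : ∀ m ∈ T, m ≤ orderOmega O := fun m hm => le_csSup hbdd hm
  refine ⟨(Nat.one_le_iff_ne_zero.1 (hle 1 h1T)), hmem, fun m hm => ?_⟩
  have hl : Nat.lcm (orderOmega O) m.natAbs ∈ T := by
    intro x hx
    obtain ⟨k, hk⟩ := hmem x hx
    obtain ⟨l, hl⟩ := hm x hx
    obtain ⟨c, hc⟩ := hO.charDisc_int hx
    rw [hc] at hk hl
    have h1 : c = orderOmega O * k := by exact_mod_cast hk
    have h2 : c = m * l := by exact_mod_cast hl
    have h3 : Nat.lcm (orderOmega O) m.natAbs ∣ c.natAbs :=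
      Nat.lcm_dvd (Int.natCast_dvd.1 ⟨k, h1⟩) (Int.natAbs_dvd_natAbs.2 ⟨l, h2⟩)
    obtain ⟨e, he⟩ := Int.natCast_dvd.2 h3
    exact ⟨e, by rw [hc, he]; push_cast; ring⟩
  have h4 := hle _ hl
  have h5 : Nat.lcm (orderOmega O) m.natAbs = orderOmega O :=
    le_antisymm h4 (Nat.le_of_dvd (Nat.pos_of_ne_zero fun h0 => by
      obtain ⟨k, hk⟩ := hl x₀ hx₀
      rw [h0] at hk
      exact hne (by simpa using hk)) (Nat.dvd_lcm_left _ _))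
  rw [← Int.natAbs_dvd, Int.natCast_dvd_natCast, ← h5]
  exact Nat.dvd_lcm_right _ _

end IsOrder

/-- `ω(O)` is prime to the primes where the order splits. -/
lemma LocalSplitting.not_dvd_omega [Fact (a < 0)] [Fact (b < 0)] {p : ℕ} [hp : Fact p.Prime]
    (S : LocalSplitting p O) (hO : IsOrder O) : ¬ p ∣ orderOmega O := by
  rintro ⟨c, hc⟩
  obtain ⟨x, hx, hxm⟩ := S.red_surj !![1, 0; 0, 0]
  obtain ⟨t, ht⟩ := hO.trd_int hx
  obtain ⟨n, hn⟩ := hO.nrd_int hx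
  have h1 := S.trace_red (le_locAt p _ hx) ht
  have h2 := S.det_red (le_locAt p _ hx) hn
  rw [hxm] at h1 h2
  simp [Matrix.trace_fin_two] at h1 h2
  obtain ⟨k, hk⟩ := hO.omega_spec.2.1 x hx
  rw [charDisc, ht, hn, hc] at hk
  have h3 : t ^ 2 - 4 * n = p * c * k := by exact_mod_cast hk
  have h4 : ((t ^ 2 - 4 * n : ℤ) : ZMod p) = 0 := by rw [h3]; push_cast; simp
  push_cast at h4
  rw [← h1, ← h2] at h4
  simp at h4

variable [Fact (a < 0)] [Fact (b < 0)]

namespace LeftIdeal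

section Eichler

variable {p : ℕ} [hp : Fact p.Prime] (S : LocalSplitting p O) (hO : IsOrder O) (I : LeftIdeal O)

include hO in
lemma specialNum_eq_zero {d : ℕ} (h : ¬ (-(d : ℤ) % 4 = 0 ∨ -(d : ℤ) % 4 = 1)) :
    specialNum d I.lattice = 0 := by
  rw [specialNum, Set.ncard_eq_zero (finite_pureSet (rightRing_isOrder hO) d)]
  refine Set.eq_empty_iff_forall_notMem.2 ?_
  rintro _ ⟨⟨x, hx, rfl⟩, hd⟩
  obtain ⟨t, ht⟩ := (rightRing_isOrder hO (I := I)).trd_int hx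
  obtain ⟨n, hn⟩ := (rightRing_isOrder hO (I := I)).nrd_int hx
  rw [nrd_pureMap, charDisc, ht, hn] at hd
  have h1 : t ^ 2 - 4 * n = -d := by
    have : (t : ℚ) ^ 2 - 4 * n = -d := by linarith
    exact_mod_cast this
  rcases Int.even_or_odd' t with ⟨c, rfl | rfl⟩
  · exact h (Or.inl (by rw [← h1]; ring_nf; omega))
  · exact h (Or.inr (by rw [← h1]; ring_nf; omega))

include S hO in
/-- The Eichler relation between the numbers of special points of the ideals in `T_p(I)` and those
of `I`. -/
lemma heckeSum_specialNum (d : ℕ) (h2 : p = 2 → -(d : ℤ) % 4 = 0 ∨ -(d : ℤ) % 4 = 1) :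
    heckeSum p (fun J => (specialNum d J.lattice : ℤ)) I
      = specialNum (p ^ 2 * d) I.lattice + kroneckerSymbol (-d) p * specialNum d I.lattice
        + p * if p ^ 2 ∣ d then (specialNum (d / p ^ 2) I.lattice : ℤ) else 0 := by
  classical
  obtain ⟨y, -, hy⟩ := I.exists_isLocGen hO p hp.out
  have hR := rightRing_isOrder hO (I := I)
  have hp0 : (p : ℚ) ≠ 0 := by exact_mod_cast hp.out.ne_zero
  have hinj : Function.Injective fun s : 𝔹 a b => p • s := by
    intro s s' h
    simp only [← Nat.cast_smul_eq_nsmul ℚ] at h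
    exact smul_right_injective _ hp0 h
  have hnrd : ∀ s : 𝔹 a b, nrd (p • s) = p ^ 2 * nrd s := fun s => by
    rw [← Nat.cast_smul_eq_nsmul ℚ, nrd_smul]
  -- every vector of norm `d` of the lattice of a line belongs to `P`; count the pairs of a vector
  -- in `P` and a line whose lattice contains it
  set P : Set (𝔹 a b) := {s | p • s ∈ pureLattice (rightRing I.lattice) ∧ nrd s = d} with hP
  have hPimage : (fun s : 𝔹 a b => p • s) '' P = pureSet (p ^ 2 * d) (rightRing I.lattice) := by
    ext s
    constructor
    · rintro ⟨s, ⟨h1, h3⟩, rfl⟩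
      exact ⟨h1, by simp only; rw [hnrd, h3]; push_cast; ring⟩
    · rintro ⟨h1, h3⟩
      have h4 : p • ((p : ℚ)⁻¹ • s) = s := by
        rw [← Nat.cast_smul_eq_nsmul ℚ, smul_smul, mul_inv_cancel₀ hp0, one_smul]
      refine ⟨(p : ℚ)⁻¹ • s, ⟨by rwa [h4], ?_⟩, h4⟩
      rw [nrd_smul, h3]; push_cast; field_simp
  have hPfin : P.Finite := Set.Finite.of_finite_image
    (by rw [hPimage]; exact finite_pureSet hR _) hinj.injOn
  have hPcard : (hPfin.toFinset.card : ℤ) = specialNum (p ^ 2 * d) I.lattice := by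
    rw [specialNum, ← hPimage, Set.ncard_image_of_injective _ hinj, Set.ncard_eq_toFinset_card _ hPfin]
  have hG : (hPfin.toFinset.filter fun s => s ∈ pureLattice (rightRing I.lattice)).card
      = specialNum d I.lattice := by
    rw [specialNum, ← Set.ncard_coe_finset]
    congr 1
    ext s
    simp only [Finset.coe_filter, Set.Finite.mem_toFinset, Set.mem_ofPred_eq]
    constructor
    · rintro ⟨⟨-, h1⟩, h3⟩; exact ⟨h3, h1⟩
    · rintro ⟨h1, h3⟩
      exact ⟨⟨(pureLattice _).smul_of_tower_mem p h1, h3⟩, h1⟩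
  have hpG : ((hPfin.toFinset.filter fun s => s ∈ pureLattice (rightRing I.lattice) ∧
      ∃ g ∈ pureLattice (rightRing I.lattice), s = p • g).card : ℤ)
      = if p ^ 2 ∣ d then (specialNum (d / p ^ 2) I.lattice : ℤ) else 0 := by
    have himage : (↑(hPfin.toFinset.filter fun s => s ∈ pureLattice (rightRing I.lattice) ∧
        ∃ g ∈ pureLattice (rightRing I.lattice), s = p • g) : Set (𝔹 a b))
        = (fun s : 𝔹 a b => p • s) ''
          {g | g ∈ pureLattice (rightRing I.lattice) ∧ p ^ 2 * nrd g = d} := by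
      ext s
      simp only [Finset.coe_filter, Set.Finite.mem_toFinset, Set.mem_ofPred_eq, Set.mem_image]
      constructor
      · rintro ⟨⟨-, h1⟩, -, g, hg, rfl⟩
        exact ⟨g, ⟨hg, by rw [← hnrd, h1]⟩, rfl⟩
      · rintro ⟨g, ⟨hg, h1⟩, rfl⟩
        have h3 := (pureLattice (rightRing I.lattice)).smul_of_tower_mem p hg
        exact ⟨⟨(pureLattice (rightRing I.lattice)).smul_of_tower_mem p h3, by rw [hnrd, h1]⟩, h3, g, hg, rfl⟩
    rw [← Set.ncard_coe_finset, himage, Set.ncard_image_of_injective _ hinj]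
    split_ifs with hd
    · obtain ⟨e, rfl⟩ := hd
      rw [Nat.mul_div_cancel_left _ (pow_pos hp.out.pos 2), specialNum, pureSet]
      congr 3
      ext g
      push_cast
      rw [mul_right_inj' (pow_ne_zero 2 hp0)]
    · rw [Nat.cast_eq_zero]
      convert Set.ncard_empty (𝔹 a b)
      refine Set.eq_empty_iff_forall_notMem.2 ?_
      rintro _ ⟨⟨x, hx, rfl⟩, h1⟩
      obtain ⟨k, hk⟩ := hR.charDisc_int hx
      rw [nrd_pureMap, hk] at h1
      refine hd (Int.natCast_dvd_natCast.1 ⟨-k, ?_⟩)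
      have : ((d : ℤ) : ℚ) = ((p ^ 2 * -k : ℤ) : ℚ) := by push_cast; exact h1.symm
      exact_mod_cast this
  rw [heckeSum, finsum_heckeSet_prime S hO hy]
  have h1 : ∀ o : Option (ZMod p), (specialNum d (lineIdeal S hO hy (lineVec_ne_zero o)).lattice : ℤ)
      = ∑ s ∈ hPfin.toFinset, if s ∈ pureLattice
        (rightRing (lineIdeal S hO hy (lineVec_ne_zero o)).lattice) then 1 else 0 := by
    intro o
    rw [Finset.sum_boole, specialNum, ← Set.ncard_coe_finset]
    congr 2
    ext s
    simp only [Finset.coe_filter, Set.Finite.mem_toFinset, Set.mem_ofPred_eq]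
    constructor
    · rintro ⟨h1, h3⟩
      exact ⟨⟨p_smul_mem_pureLattice S hy hO _ h1, h3⟩, h1⟩
    · rintro ⟨⟨-, h1⟩, h3⟩; exact ⟨h3, h1⟩
  rw [Finset.sum_congr rfl fun o _ => h1 o, Finset.sum_comm]
  -- the number of lines for a given vector
  have h3 : ∀ s ∈ hPfin.toFinset, (∑ o : Option (ZMod p), if s ∈ pureLattice
        (rightRing (lineIdeal S hO hy (lineVec_ne_zero o)).lattice) then (1 : ℤ) else 0)
      = 1 + (if s ∈ pureLattice (rightRing I.lattice) then kroneckerSymbol (-d) p else 0)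
        + (if s ∈ pureLattice (rightRing I.lattice) ∧
          ∃ g ∈ pureLattice (rightRing I.lattice), s = p • g then (p : ℤ) else 0) := by
    intro s hs
    rw [Set.Finite.mem_toFinset] at hs
    rw [Finset.sum_boole]
    by_cases hsG : s ∈ pureLattice (rightRing I.lattice)
    · rw [card_lines_of_mem S hy hO hsG hs.2]
      simp [hsG]
    · rw [card_lines_of_not_mem S hy hO hs.1 hsG hs.2 h2]
      simp [hsG]
  rw [Finset.sum_congr rfl h3, Finset.sum_add_distrib, Finset.sum_add_distrib, Finset.sum_const,
    ← Finset.sum_filter, ← Finset.sum_filter, Finset.sum_const, Finset.sum_const, hG]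
  rw [nsmul_eq_mul, nsmul_eq_mul, nsmul_eq_mul, mul_one, hPcard, hpG]
  ring

end Eichler

section Coeff

variable (hO : IsOrder O) (I : LeftIdeal O)

/-- The sequence of the numbers of special points of discriminant `-ω(O) m`. -/
def specialSeq (I : LeftIdeal O) (m : ℕ) : ℂ := specialNum (orderOmega O * m) I.lattice

include hO in
lemma specialSeq_mulUnit (x : (𝔹 a b)ˣ) : specialSeq (mulUnit hO I x) = specialSeq I := by
  funext m
  rw [specialSeq, mulUnit_lattice, specialNum_latticeMul, specialSeq]

lemma kroneckerSymbol_omega {p : ℕ} [hp : Fact p.Prime] (S : LocalSplitting p O) (hO : IsOrder O)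
    (m : ℤ) : kroneckerSymbol (orderOmega O * m) p
      = kroneckerSymbol (squarefreePart (orderOmega O)) p * kroneckerSymbol m p := by
  obtain ⟨f, hf⟩ := squarefreePart_mul_sq _ hO.omega_spec.1
  have hpf : ¬ (p : ℤ) ∣ f := by
    intro h
    refine S.not_dvd_omega hO ?_
    rw [hf]
    exact Dvd.dvd.mul_left (Dvd.dvd.pow (Int.natCast_dvd_natCast.1 h) two_ne_zero) _
  have h1 : (orderOmega O : ℤ) * m = squarefreePart (orderOmega O) * (f * f) * m := by
    conv_lhs => rw [hf]
    push_cast; ring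
  rw [h1, kroneckerSymbol_prime_mul, kroneckerSymbol_prime_mul, kroneckerSymbol_prime_mul, ← sq,
    kroneckerSymbol_prime_sq hpf, mul_one]

include hO in
/-- The Eichler relation with `d = ω m`, where `(-d / p) = (ω₀ / p) (-m / p)`. -/
lemma heckeSum_specialSeq_prime {p : ℕ} [hp : Fact p.Prime] (S : LocalSplitting p O) :
    heckeSum p specialSeq I = heckeCoeffPrime (squarefreePart (orderOmega O)) p (specialSeq I) := by
  have hω := S.not_dvd_omega hO
  set D := squarefreePart (orderOmega O) with hD
  have hpD : ¬ (p : ℤ) ∣ D := by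
    intro h
    obtain ⟨f, hf⟩ := squarefreePart_mul_sq _ hO.omega_spec.1
    refine hω ?_
    rw [hf]
    exact Dvd.dvd.mul_right (Int.natCast_dvd_natCast.1 h) _
  funext m
  have h0 : heckeSum p specialSeq I m = heckeSum p (fun J => specialSeq J m) I :=
    map_heckeSum hO (Pi.evalAddMonoidHom (fun _ : ℕ => ℂ) m) hp.out.ne_zero specialSeq
  have h1 : heckeSum p (fun J => specialSeq J m) I
      = ((heckeSum p (fun J => (specialNum (orderOmega O * m) J.lattice : ℤ)) I : ℤ) : ℂ) := by
    have := map_heckeSum hO (I := I) (Int.castAddHom ℂ) hp.out.ne_zero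
      (fun J => (specialNum (orderOmega O * m) J.lattice : ℤ))
    simp only [Int.coe_castAddHom, Int.cast_natCast] at this
    exact this.symm
  -- for `p = 2` the congruence conditions on `d = ω m` and `D m` agree
  have hmod : p = 2 → ((-(D * m : ℤ) % 4 = 0 ∨ -(D * m : ℤ) % 4 = 1) ↔
      (-((orderOmega O * m : ℕ) : ℤ) % 4 = 0 ∨ -((orderOmega O * m : ℕ) : ℤ) % 4 = 1)) := by
    intro h2
    obtain ⟨f, hf⟩ := squarefreePart_mul_sq _ hO.omega_spec.1
    have hfo : Odd (f : ℤ) := by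
      rw [← Int.not_even_iff_odd]
      intro he
      refine hω ?_
      rw [hf, h2]
      exact Dvd.dvd.mul_left (Dvd.dvd.pow (Int.natCast_dvd_natCast.1 he.two_dvd) two_ne_zero) _
    obtain ⟨g, hg⟩ := hfo
    have h3 : ((orderOmega O * m : ℕ) : ℤ) = D * m + 4 * (D * m * (g ^ 2 + g)) := by
      conv_lhs => rw [hf]
      push_cast
      rw [hg]; ring
    rw [h3]
    generalize (D * m * (g ^ 2 + g) : ℤ) = e
    omega
  rw [h0, h1]
  simp only [heckeCoeffPrime, LinearMap.coe_mk, AddHom.coe_mk]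
  split_ifs with hc hdvd
  · have hall : ∀ J : LeftIdeal O, specialNum (orderOmega O * m) J.lattice = 0 := fun J =>
      specialNum_eq_zero hO J fun h => hc.2 ((hmod hc.1).2 h)
    simp [heckeSum, hall]
  all_goals
    have h4 : p = 2 → -((orderOmega O * m : ℕ) : ℤ) % 4 = 0 ∨ -((orderOmega O * m : ℕ) : ℤ) % 4 = 1 :=
      fun h2 => (hmod h2).1 (by by_contra h; exact hc ⟨h2, h⟩)
    have hcop : (p ^ 2).Coprime (orderOmega O) :=
      Nat.Coprime.pow_left 2 ((Nat.Prime.coprime_iff_not_dvd hp.out).2 hω)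
    have hk : kroneckerSymbol (-((orderOmega O * m : ℕ) : ℤ)) p
        = kroneckerSymbol D p * kroneckerSymbol (-(m : ℤ)) p := by
      rw [← kroneckerSymbol_omega S hO]; congr 1; push_cast; ring
    rw [heckeSum_specialNum S hO I _ h4, hk, kroneckerSymbol_prime_sq hpD]
  · have h5 : p ^ 2 ∣ orderOmega O * m := Dvd.dvd.mul_left hdvd _
    rw [if_pos h5, Nat.mul_div_assoc _ hdvd]
    have h6 : p ^ 2 * (orderOmega O * m) = orderOmega O * (p ^ 2 * m) := by ring
    simp only [specialSeq, h6]
    push_cast; ring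
  · have h5 : ¬ p ^ 2 ∣ orderOmega O * m := fun h => hdvd (hcop.dvd_of_dvd_mul_left h)
    rw [if_neg h5]
    have h6 : p ^ 2 * (orderOmega O * m) = orderOmega O * (p ^ 2 * m) := by ring
    simp only [specialSeq, h6]
    push_cast; ring

lemma heckeCoeffPrimePow_commute (D p k : ℕ) :
    Commute (heckeCoeffPrimePow D p k) (heckeCoeffPrime D p) := by
  induction k using Nat.strong_induction_on with
  | _ k ih =>
    match k with
    | 0 => exact Commute.one_left _
    | 1 => exact Commute.refl _
    | k + 2 =>
      rw [heckeCoeffPrimePow]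
      exact (((Commute.refl _).mul_left (ih (k + 1) (by omega)))).sub_left
        ((ih k (by omega)).smul_left _)

include hO in
/-- Both families of operators satisfy the same recursion. -/
lemma heckeSum_specialSeq_primePow {p : ℕ} [hp : Fact p.Prime] (S : LocalSplitting p O) (k : ℕ)
    (I : LeftIdeal O) : heckeSum (p ^ k) specialSeq I
      = heckeCoeffPrimePow (squarefreePart (orderOmega O)) p k (specialSeq I) := by
  set D := squarefreePart (orderOmega O) with hD
  have hpD : ¬ (p : ℤ) ∣ D := by
    intro h
    obtain ⟨f, hf⟩ := squarefreePart_mul_sq _ hO.omega_spec.1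
    refine S.not_dvd_omega hO ?_
    rw [hf]
    exact Dvd.dvd.mul_right (Int.natCast_dvd_natCast.1 h) _
  induction k using Nat.strong_induction_on generalizing I with
  | _ k ih =>
    match k with
    | 0 => rw [pow_zero, heckeSum_one hO]; rfl
    | 1 => rw [pow_one, heckeSum_specialSeq_prime hO I S]; rfl
    | k + 2 =>
      have h1 : heckeSum (p ^ (k + 1)) (specialSeq (O := O))
          = fun J => heckeCoeffPrimePow D p (k + 1) (specialSeq J) :=
        funext fun J => ih (k + 1) (by omega) J
      rw [heckeSum_prime_pow hO S k _ (specialSeq_mulUnit hO), h1, ih k (by omega)]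
      have h2 := map_heckeSum hO (I := I) (heckeCoeffPrimePow D p (k + 1)).toAddMonoidHom hp.out.ne_zero
        specialSeq
      simp only [LinearMap.toAddMonoidHom_coe] at h2
      rw [← h2, heckeSum_specialSeq_prime hO I S, heckeCoeffPrimePow, kroneckerSymbol_prime_sq hpD,
        LinearMap.sub_apply, LinearMap.smul_apply, one_mul, ← Module.End.mul_apply,
        (heckeCoeffPrimePow_commute D p (k + 1)).eq]
      congr 1
      rw [Int.cast_natCast, Nat.cast_smul_eq_nsmul]

include hO in
lemma heckeSum_specialSeq_list (l : List ℕ) (f : ℕ → ℕ) (hl : l.Nodup) (hp : ∀ p ∈ l, p.Prime)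
    (hs : ∀ p ∈ l, Nonempty (LocalSplitting p O)) (I : LeftIdeal O) :
    heckeSum (l.map fun p => p ^ f p).prod specialSeq I
      = (l.map fun p => heckeCoeffPrimePow (squarefreePart (orderOmega O)) p (f p)).prod
        (specialSeq I) := by
  induction l generalizing I with
  | nil => simp [heckeSum_one hO]
  | cons p l ih =>
    have := Fact.mk (hp p (by simp))
    obtain ⟨S⟩ := hs p (by simp)
    rw [List.nodup_cons] at hl
    have ih' := ih hl.2 (fun q hq => hp q (by simp [hq])) (fun q hq => hs q (by simp [hq]))
    have hn : (l.map fun p => p ^ f p).prod ≠ 0 := by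
      rw [Ne, List.prod_eq_zero_iff, List.mem_map]
      rintro ⟨q, hq, h0⟩
      exact pow_ne_zero _ (hp q (by simp [hq])).ne_zero h0
    have hcop : (p ^ f p).Coprime (l.map fun p => p ^ f p).prod := by
      refine Nat.Coprime.pow_left _ (Nat.coprime_list_prod_right_iff.2 ?_)
      intro m hm
      obtain ⟨q, hq, rfl⟩ := List.mem_map.1 hm
      refine Nat.Coprime.pow_right _ ((Nat.coprime_primes (hp p (by simp)) (hp q (by simp [hq]))).2 ?_)
      rintro rfl
      exact hl.1 hq
    rw [List.map_cons, List.prod_cons, List.map_cons, List.prod_cons, mul_comm,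
      heckeSum_mul hO (pow_ne_zero _ (hp p (by simp)).ne_zero) hn hcop, Module.End.mul_apply, ← ih']
    have h1 : heckeSum (p ^ f p) (specialSeq (O := O)) = fun J =>
        heckeCoeffPrimePow (squarefreePart (orderOmega O)) p (f p) (specialSeq J) :=
      funext fun J => heckeSum_specialSeq_primePow hO S _ J
    rw [h1]
    exact (map_heckeSum hO (I := I)
      (heckeCoeffPrimePow (squarefreePart (orderOmega O)) p (f p)).toAddMonoidHom hn specialSeq).symm

include hO in
/-- The Hecke operators on ideal classes act on the numbers of special points as the Hecke operators
of weight `3/2` on Fourier coefficients. -/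
lemma heckeSum_specialSeq {n : ℕ} (hn : n ≠ 0) (hcop : n.Coprime (reducedDisc O)) (I : LeftIdeal O) :
    heckeSum n specialSeq I = heckeCoeff (squarefreePart (orderOmega O)) n (specialSeq I) := by
  have h := heckeSum_specialSeq_list hO n.primeFactorsList.dedup n.factorization (List.nodup_dedup _)
    (fun p hp => Nat.prime_of_mem_primeFactorsList (List.mem_dedup.1 hp))
    (fun p hp => by
      have hp' := List.mem_dedup.1 hp
      have := Fact.mk (Nat.prime_of_mem_primeFactorsList hp')
      exact exists_localSplitting hO (Nat.Coprime.coprime_dvd_left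
        (Nat.dvd_of_mem_primeFactorsList hp') hcop)) I
  have h1 : (n.primeFactorsList.dedup.map fun p => p ^ n.factorization p).prod = n := by
    conv_rhs => rw [← Nat.prod_factorization_pow_eq_self hn]
    have h2 : n.primeFactorsList.toFinset = n.primeFactorsList.dedup.toFinset := by ext; simp
    rw [Finsupp.prod, Nat.support_factorization, Nat.primeFactors, h2,
      List.prod_toFinset _ (List.nodup_dedup _)]
  rw [h1] at h
  exact h

end Coeff

end LeftIdeal

end Quat

/-! ### Poisson summation for ternary quadratic forms -/

section Poisson

open Complex Real

/-- Poisson summation for the one-dimensional Gaussian with a shift and a character. -/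
lemma tsum_gaussian_one_dim (τ : ℂ) (α β : ℝ) (hτ : 0 < τ.im) :
    ∑' n : ℤ, cexp (π * I * τ * (n + α) ^ 2 + 2 * π * I * (n + α) * β)
      = 1 / (-I * τ) ^ (1 / 2 : ℂ) *
        ∑' k : ℤ, cexp (-π * I * (k - β) ^ 2 / τ + 2 * π * I * k * α) := by
  have hτ0 : τ ≠ 0 := by rintro rfl; simp at hτ
  have h1 : ∀ n : ℤ, cexp (π * I * τ * (n + α) ^ 2 + 2 * π * I * (n + α) * β)
      = cexp (π * I * τ * α ^ 2 + 2 * π * I * α * β) * jacobiTheta₂_term n (τ * α + β) τ := by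
    intro n
    rw [jacobiTheta₂_term, ← Complex.exp_add]
    congr 1; ring
  have h2 : ∀ k : ℤ, cexp (-π * I * (k - β) ^ 2 / τ + 2 * π * I * k * α)
      = cexp (-π * I * β ^ 2 / τ) * jacobiTheta₂_term k ((τ * α + β) / τ) (-1 / τ) := by
    intro k
    rw [jacobiTheta₂_term, ← Complex.exp_add]
    congr 1; field_simp; ring
  simp only [h1, h2]
  rw [tsum_mul_left, tsum_mul_left]
  change _ * jacobiTheta₂ _ _ = _ * (_ * jacobiTheta₂ _ _)
  rw [jacobiTheta₂_functional_equation, mul_left_comm, mul_assoc, mul_assoc, ← mul_assoc (cexp _),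
    ← Complex.exp_add]
  congr 3
  field_simp; ring

lemma summable_exp_neg_sq {c : ℝ} (hc : 0 < c) : Summable fun n : ℤ => rexp (-c * n ^ 2) := by
  have h := (summable_jacobiTheta₂_term_iff 0 (I * (c / π : ℝ))).2 (by
    rw [Complex.I_mul_im, Complex.ofReal_re]; positivity)
  refine h.norm.congr fun n => ?_
  rw [jacobiTheta₂_term, Complex.norm_exp]
  congr 1
  have : (2 * π * I * n * 0 + π * I * n ^ 2 * (I * (c / π : ℝ)) : ℂ) = ((-c * n ^ 2 : ℝ) : ℂ) := by
    push_cast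
    have : (π : ℂ) ≠ 0 := by exact_mod_cast pi_ne_zero
    field_simp
    linear_combination ((n : ℂ) ^ 2 * c) * Complex.I_sq
  rw [this, Complex.ofReal_re]

/-- One-dimensional Gaussian sums are bounded uniformly in the shift. -/
lemma exists_tsum_gaussian_le {c : ℝ} (hc : 0 < c) : ∃ C : ℝ, ∀ β : ℝ,
    (Summable fun n : ℤ => rexp (-c * (n + β) ^ 2)) ∧ ∑' n : ℤ, rexp (-c * (n + β) ^ 2) ≤ C := by
  have hs := (summable_exp_neg_sq (half_pos hc)).mul_left (rexp c)
  have key : ∀ β : ℝ, 0 ≤ β → β ≤ 1 → ∀ n : ℤ,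
      rexp (-c * (n + β) ^ 2) ≤ rexp c * rexp (-(c / 2) * n ^ 2) := by
    intro β h0 h1 n
    rw [← Real.exp_add]
    refine Real.exp_le_exp.2 ?_
    have : β ^ 2 ≤ 1 := by nlinarith
    nlinarith [mul_nonneg hc.le (sq_nonneg ((n : ℝ) + 2 * β)), mul_nonneg hc.le (sub_nonneg.2 this)]
  refine ⟨∑' n : ℤ, rexp c * rexp (-(c / 2) * n ^ 2), fun β => ?_⟩
  have h1 := key (Int.fract β) (Int.fract_nonneg β) (Int.fract_lt_one β).le
  have h2 : Summable fun n : ℤ => rexp (-c * (n + Int.fract β) ^ 2) :=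
    Summable.of_nonneg_of_le (fun _ => (Real.exp_pos _).le) h1 hs
  have h3 : (fun n : ℤ => rexp (-c * (n + β) ^ 2))
      = (fun n : ℤ => rexp (-c * (n + Int.fract β) ^ 2)) ∘ (Equiv.addRight ⌊β⌋) := by
    funext n
    simp only [Function.comp, Equiv.coe_addRight]
    congr 3
    push_cast
    rw [add_assoc, Int.floor_add_fract]
  rw [h3]
  refine ⟨(Equiv.summable_iff _).2 h2, ?_⟩
  rw [Function.comp_def, Equiv.tsum_eq (Equiv.addRight ⌊β⌋) fun n : ℤ => rexp (-c * (n + Int.fract β) ^ 2)]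
  exact h2.tsum_le_tsum h1 hs

/-- Summability of functions bounded by a Gaussian in triangular form. -/
lemma summable_of_gaussian_bound {f : ℤ × ℤ × ℤ → ℂ} {c₁ c₂ c₃ : ℝ} (h₁ : 0 < c₁) (h₂ : 0 < c₂)
    (h₃ : 0 < c₃) (l₁ : ℤ × ℤ → ℝ) (l₂ : ℤ → ℝ) (l₃ : ℝ)
    (hf : ∀ x y z, ‖f (x, y, z)‖ ≤ rexp (-c₁ * (x + l₁ (y, z)) ^ 2) *
      (rexp (-c₂ * (y + l₂ z) ^ 2) * rexp (-c₃ * (z + l₃) ^ 2))) : Summable f := by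
  have step : ∀ {ι : Type} {g : ι → ℝ} (c : ℝ) (l : ι → ℝ), 0 < c → (∀ i, 0 ≤ g i) → Summable g →
      Summable fun p : ℤ × ι => rexp (-c * (p.1 + l p.2) ^ 2) * g p.2 := by
    intro ι g c l hc hg0 hg
    obtain ⟨C, hC⟩ := exists_tsum_gaussian_le hc
    rw [← (Equiv.prodComm ι ℤ).summable_iff]
    refine (summable_prod_of_nonneg (fun p => mul_nonneg (Real.exp_pos _).le (hg0 _))).2 ⟨fun i => ?_, ?_⟩
    · exact (hC (l i)).1.mul_right (g i)
    · refine Summable.of_nonneg_of_le (fun i => tsum_nonneg fun n => mul_nonneg (Real.exp_pos _).le (hg0 _))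
        (fun i => ?_) (hg.mul_left C)
      change ∑' n : ℤ, rexp (-c * (n + l i) ^ 2) * g i ≤ _
      rw [tsum_mul_right]
      exact mul_le_mul_of_nonneg_right (hC (l i)).2 (hg0 i)
  have s3 : Summable fun z : ℤ => rexp (-c₃ * (z + l₃) ^ 2) := (exists_tsum_gaussian_le h₃).choose_spec l₃ |>.1
  have s2 := step c₂ l₂ h₂ (fun z => (Real.exp_pos _).le) s3
  have s1 := step c₁ l₁ h₁ (fun p => mul_nonneg (Real.exp_pos _).le (Real.exp_pos _).le) s2
  exact Summable.of_norm_bounded s1 fun ⟨x, y, z⟩ => hf x y z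

lemma tsum_eq_mul_tsum_of_fiber {ι κ : Type*} {F E : ι × κ → ℂ} (hF : Summable F) (hE : Summable E)
    (r : ℂ) (h : ∀ b, ∑' a, F (a, b) = r * ∑' a, E (a, b)) : ∑' p, F p = r * ∑' p, E p := by
  have key : ∀ {G : ι × κ → ℂ}, Summable G → ∑' p, G p = ∑' b, ∑' a, G (a, b) := fun {G} hG => by
    rw [← (Equiv.prodComm κ ι).tsum_eq G]
    exact ((Equiv.prodComm κ ι).summable_iff.2 hG).tsum_prod
  rw [key hF, key hE, ← tsum_mul_left]
  exact tsum_congr h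

lemma norm_cexp_gaussian (t : ℝ) (τ : ℂ) (r : ℝ) :
    ‖cexp (π * I * τ * t + 2 * π * I * r)‖ = rexp (-(π * τ.im * t)) := by
  rw [Complex.norm_exp]
  congr 1
  have : (π * I * τ * t + 2 * π * I * r : ℂ) = ((π * t : ℝ) : ℂ) * (I * τ) + ((2 * π * r : ℝ) : ℂ) * I := by
    push_cast; ring
  rw [this, Complex.add_re, Complex.re_ofReal_mul, Complex.re_ofReal_mul, Complex.I_mul_re, Complex.I_re]
  ring

/-- Poisson summation for a ternary quadratic form in triangular form. -/
lemma tsum_gaussian_triangular {a₁ a₂ a₃ : ℝ} (h₁ : 0 < a₁) (h₂ : 0 < a₂) (h₃ : 0 < a₃) (u v w : ℝ)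
    (α₁ α₂ α₃ : ℝ) {τ : ℂ} (hτ : 0 < τ.im) :
    ∑' x : ℤ × ℤ × ℤ, cexp (π * I * τ * (a₁ * ((x.1 + α₁) + u * (x.2.1 + α₂) + v * (x.2.2 + α₃)) ^ 2
        + a₂ * ((x.2.1 + α₂) + w * (x.2.2 + α₃)) ^ 2 + a₃ * (x.2.2 + α₃) ^ 2 : ℝ))
      = (1 / (-I * (a₁ * τ)) ^ (1 / 2 : ℂ) * (1 / (-I * (a₂ * τ)) ^ (1 / 2 : ℂ) *
          (1 / (-I * (a₃ * τ)) ^ (1 / 2 : ℂ)))) *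
        ∑' y : ℤ × ℤ × ℤ, cexp (π * I * (-1 / τ) * (y.1 ^ 2 / a₁ + (y.2.1 - u * y.1) ^ 2 / a₂
          + (y.2.2 - v * y.1 - w * (y.2.1 - u * y.1)) ^ 2 / a₃ : ℝ)
          + 2 * π * I * (y.1 * α₁ + y.2.1 * α₂ + y.2.2 * α₃ : ℝ)) := by
  have hτ0 : τ ≠ 0 := by rintro rfl; simp at hτ
  have hτ' : 0 < (-1 / τ).im := by
    rw [neg_div, Complex.neg_im, one_div, Complex.inv_im]
    have := Complex.normSq_pos.2 hτ0
    rw [neg_div, neg_neg]; positivity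
  have hmul : ∀ {r : ℝ}, 0 < r → 0 < (r * τ).im := fun hr => by
    rw [Complex.im_ofReal_mul]; positivity
  have ha₁ : (a₁ : ℂ) ≠ 0 := by exact_mod_cast h₁.ne'
  have ha₂ : (a₂ : ℂ) ≠ 0 := by exact_mod_cast h₂.ne'
  have ha₃ : (a₃ : ℂ) ≠ 0 := by exact_mod_cast h₃.ne'
  -- the variables are transformed one at a time
  set F₀ : ℤ × ℤ × ℤ → ℂ := fun x => cexp (π * I * τ * (a₁ * ((x.1 + α₁) + u * (x.2.1 + α₂) + v * (x.2.2 + α₃)) ^ 2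
        + a₂ * ((x.2.1 + α₂) + w * (x.2.2 + α₃)) ^ 2 + a₃ * (x.2.2 + α₃) ^ 2 : ℝ)) with hF₀
  set F₁ : ℤ × ℤ × ℤ → ℂ := fun x => cexp (π * I * (-1 / τ) * (x.1 ^ 2 / a₁ : ℝ)
        + (π * I * τ * (a₂ * ((x.2.1 + α₂) + w * (x.2.2 + α₃)) ^ 2 + a₃ * (x.2.2 + α₃) ^ 2 : ℝ)
        + 2 * π * I * (x.1 * (α₁ + u * (x.2.1 + α₂) + v * (x.2.2 + α₃)) : ℝ))) with hF₁
  set F₂ : ℤ × ℤ × ℤ → ℂ := fun x => cexp (π * I * (-1 / τ) * (x.1 ^ 2 / a₁ + (x.2.1 - u * x.1) ^ 2 / a₂ : ℝ)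
        + (π * I * τ * (a₃ * (x.2.2 + α₃) ^ 2 : ℝ)
        + 2 * π * I * (x.1 * (α₁ + v * (x.2.2 + α₃)) + x.2.1 * (α₂ + w * (x.2.2 + α₃))
          - x.1 * u * w * (x.2.2 + α₃) : ℝ))) with hF₂
  set F₃ : ℤ × ℤ × ℤ → ℂ := fun y => cexp (π * I * (-1 / τ) * (y.1 ^ 2 / a₁ + (y.2.1 - u * y.1) ^ 2 / a₂
          + (y.2.2 - v * y.1 - w * (y.2.1 - u * y.1)) ^ 2 / a₃ : ℝ)
          + 2 * π * I * (y.1 * α₁ + y.2.1 * α₂ + y.2.2 * α₃ : ℝ)) with hF₃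
  have hnorm₂ : ∀ (t t' r : ℝ), ‖cexp (π * I * (-1 / τ) * t + (π * I * τ * t' + 2 * π * I * r))‖
      = rexp (-(π * (-1 / τ).im * t)) * rexp (-(π * τ.im * t')) := by
    intro t t' r
    have e1 := norm_cexp_gaussian t (-1 / τ) 0
    rw [Complex.ofReal_zero, mul_zero, add_zero] at e1
    rw [Complex.exp_add, norm_mul, e1, norm_cexp_gaussian]
  have e₁ : 0 < π * τ.im := by positivity
  have e₂ : 0 < π * (-1 / τ).im := by positivity
  have s₀ : Summable F₀ := by
    refine summable_of_gaussian_bound (mul_pos e₁ h₁) (mul_pos e₁ h₂) (mul_pos e₁ h₃)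
      (fun p => α₁ + u * (p.1 + α₂) + v * (p.2 + α₃)) (fun z => α₂ + w * (z + α₃)) α₃ fun x y z => ?_
    have := norm_cexp_gaussian (a₁ * ((x + α₁) + u * (y + α₂) + v * (z + α₃)) ^ 2
        + a₂ * ((y + α₂) + w * (z + α₃)) ^ 2 + a₃ * (z + α₃) ^ 2) τ 0
    rw [Complex.ofReal_zero, mul_zero, add_zero] at this
    simp only [hF₀]
    rw [this, ← Real.exp_add, ← Real.exp_add]
    refine Real.exp_le_exp.2 (le_of_eq ?_)
    ring
  have s₁ : Summable F₁ := by
    refine summable_of_gaussian_bound (div_pos e₂ h₁) (mul_pos e₁ h₂) (mul_pos e₁ h₃)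
      (fun p => 0) (fun z => α₂ + w * (z + α₃)) α₃ fun x y z => ?_
    simp only [hF₁]
    rw [hnorm₂, ← Real.exp_add, ← Real.exp_add, ← Real.exp_add]
    refine Real.exp_le_exp.2 (le_of_eq ?_)
    field_simp; ring
  have s₂ : Summable F₂ := by
    rw [← ((Equiv.prodAssoc ℤ ℤ ℤ).symm.trans ((Equiv.prodComm ℤ ℤ).prodCongr (Equiv.refl ℤ)) |>.trans
      (Equiv.prodAssoc ℤ ℤ ℤ)).summable_iff]
    refine summable_of_gaussian_bound (div_pos e₂ h₂) (div_pos e₂ h₁) (mul_pos e₁ h₃)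
      (fun p => -(u * p.1)) (fun z => 0) α₃ fun y x z => ?_
    change ‖F₂ (x, y, z)‖ ≤ _
    simp only [hF₂]
    rw [hnorm₂, ← Real.exp_add, ← Real.exp_add, ← Real.exp_add]
    refine Real.exp_le_exp.2 (le_of_eq ?_)
    field_simp; ring
  let rev : ℤ × ℤ × ℤ ≃ ℤ × ℤ × ℤ := ⟨fun p => (p.2.2, p.2.1, p.1), fun p => (p.2.2, p.2.1, p.1),
    fun _ => rfl, fun _ => rfl⟩
  have s₃ : Summable F₃ := by
    rw [← rev.summable_iff]
    refine summable_of_gaussian_bound (div_pos e₂ h₃) (div_pos e₂ h₂) (div_pos e₂ h₁)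
      (fun p => -(v * p.2) - w * (p.1 - u * p.2)) (fun z => -(u * z)) 0 fun z y x => ?_
    change ‖F₃ (x, y, z)‖ ≤ _
    simp only [hF₃]
    rw [norm_cexp_gaussian, ← Real.exp_add, ← Real.exp_add]
    refine Real.exp_le_exp.2 (le_of_eq ?_)
    field_simp; ring
  have t₁ : ∑' x, F₀ x = 1 / (-I * (a₁ * τ)) ^ (1 / 2 : ℂ) * ∑' x, F₁ x := by
    refine tsum_eq_mul_tsum_of_fiber s₀ s₁ _ fun b => ?_
    have := tsum_gaussian_one_dim (a₁ * τ) (α₁ + u * (b.1 + α₂) + v * (b.2 + α₃)) 0 (hmul h₁)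
    have f₀ : ∀ n : ℤ, F₀ (n, b) = cexp (π * I * τ * (a₂ * ((b.1 + α₂) + w * (b.2 + α₃)) ^ 2
        + a₃ * (b.2 + α₃) ^ 2 : ℝ)) * cexp (π * I * (a₁ * τ) *
        (n + (α₁ + u * (b.1 + α₂) + v * (b.2 + α₃) : ℝ)) ^ 2 +
        2 * π * I * (n + (α₁ + u * (b.1 + α₂) + v * (b.2 + α₃) : ℝ)) * (0 : ℝ)) := by
      intro n
      rw [← Complex.exp_add]; simp only [hF₀]; congr 1; push_cast; ring
    have f₁ : ∀ n : ℤ, F₁ (n, b) = cexp (π * I * τ * (a₂ * ((b.1 + α₂) + w * (b.2 + α₃)) ^ 2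
        + a₃ * (b.2 + α₃) ^ 2 : ℝ)) * cexp (-π * I * (n - (0 : ℝ)) ^ 2 / (a₁ * τ) +
        2 * π * I * n * (α₁ + u * (b.1 + α₂) + v * (b.2 + α₃) : ℝ)) := by
      intro n
      rw [← Complex.exp_add]; simp only [hF₁]; congr 1; push_cast; field_simp; ring
    simp only [f₀, f₁]
    rw [tsum_mul_left, tsum_mul_left, this, mul_left_comm]
  have t₂ : ∑' x, F₁ x = 1 / (-I * (a₂ * τ)) ^ (1 / 2 : ℂ) * ∑' x, F₂ x := by
    let ex : ℤ × ℤ × ℤ ≃ ℤ × ℤ × ℤ := ⟨fun p => (p.2.1, p.1, p.2.2), fun p => (p.2.1, p.1, p.2.2),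
      fun _ => rfl, fun _ => rfl⟩
    rw [← ex.tsum_eq F₁, ← ex.tsum_eq F₂]
    refine tsum_eq_mul_tsum_of_fiber (ex.summable_iff.2 s₁) (ex.summable_iff.2 s₂) _ fun b => ?_
    have := tsum_gaussian_one_dim (a₂ * τ) (α₂ + w * (b.2 + α₃)) (b.1 * u) (hmul h₂)
    have f₁ : ∀ n : ℤ, F₁ (ex (n, b)) = cexp (π * I * (-1 / τ) * (b.1 ^ 2 / a₁ : ℝ)
        + (π * I * τ * (a₃ * (b.2 + α₃) ^ 2 : ℝ) + 2 * π * I * (b.1 * (α₁ + v * (b.2 + α₃))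
          - b.1 * u * w * (b.2 + α₃) : ℝ))) *
        cexp (π * I * (a₂ * τ) * (n + (α₂ + w * (b.2 + α₃) : ℝ)) ^ 2 +
        2 * π * I * (n + (α₂ + w * (b.2 + α₃) : ℝ)) * (b.1 * u : ℝ)) := by
      intro n
      rw [← Complex.exp_add]; simp only [hF₁, ex, Equiv.coe_fn_mk]; congr 1; push_cast; ring
    have f₂ : ∀ n : ℤ, F₂ (ex (n, b)) = cexp (π * I * (-1 / τ) * (b.1 ^ 2 / a₁ : ℝ)
        + (π * I * τ * (a₃ * (b.2 + α₃) ^ 2 : ℝ) + 2 * π * I * (b.1 * (α₁ + v * (b.2 + α₃))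
          - b.1 * u * w * (b.2 + α₃) : ℝ))) *
        cexp (-π * I * (n - (b.1 * u : ℝ)) ^ 2 / (a₂ * τ) +
        2 * π * I * n * (α₂ + w * (b.2 + α₃) : ℝ)) := by
      intro n
      rw [← Complex.exp_add]; simp only [hF₂, ex, Equiv.coe_fn_mk]; congr 1; push_cast; field_simp; ring
    change ∑' n, F₁ (ex (n, b)) = _ * ∑' n, F₂ (ex (n, b))
    simp only [f₁, f₂]
    rw [tsum_mul_left, tsum_mul_left, this, mul_left_comm]
  have t₃ : ∑' x, F₂ x = 1 / (-I * (a₃ * τ)) ^ (1 / 2 : ℂ) * ∑' x, F₃ x := by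
    rw [← rev.tsum_eq F₂, ← rev.tsum_eq F₃]
    refine tsum_eq_mul_tsum_of_fiber (rev.summable_iff.2 s₂) (rev.summable_iff.2 s₃) _ fun b => ?_
    have := tsum_gaussian_one_dim (a₃ * τ) α₃ (b.2 * v + b.1 * w - b.2 * u * w) (hmul h₃)
    have f₂ : ∀ n : ℤ, F₂ (rev (n, b)) = cexp (π * I * (-1 / τ) * (b.2 ^ 2 / a₁ + (b.1 - u * b.2) ^ 2 / a₂ : ℝ)
        + 2 * π * I * (b.2 * α₁ + b.1 * α₂ : ℝ)) *
        cexp (π * I * (a₃ * τ) * (n + α₃) ^ 2 +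
        2 * π * I * (n + α₃) * (b.2 * v + b.1 * w - b.2 * u * w : ℝ)) := by
      intro n
      rw [← Complex.exp_add]; simp only [hF₂, rev, Equiv.coe_fn_mk]; congr 1; push_cast; ring
    have f₃ : ∀ n : ℤ, F₃ (rev (n, b)) = cexp (π * I * (-1 / τ) * (b.2 ^ 2 / a₁ + (b.1 - u * b.2) ^ 2 / a₂ : ℝ)
        + 2 * π * I * (b.2 * α₁ + b.1 * α₂ : ℝ)) *
        cexp (-π * I * (n - (b.2 * v + b.1 * w - b.2 * u * w : ℝ)) ^ 2 / (a₃ * τ) +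
        2 * π * I * n * α₃) := by
      intro n
      rw [← Complex.exp_add]; simp only [hF₃, rev, Equiv.coe_fn_mk]; congr 1; push_cast; field_simp; ring
    change ∑' n, F₂ (rev (n, b)) = _ * ∑' n, F₃ (rev (n, b))
    simp only [f₂, f₃]
    rw [tsum_mul_left, tsum_mul_left, this, mul_left_comm]
  rw [t₁, t₂, t₃, mul_assoc, mul_assoc]

end Poisson

/-! ### Ternary quadratic forms and their theta series -/

/-- The integral ternary quadratic form `a x² + b y² + c z² + d y z + e x z + f x y`. -/
structure TernaryForm where
  (a b c d e f : ℤ)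

namespace TernaryForm

/-- The value of the form in a commutative ring. -/
def eval (Q : TernaryForm) {R : Type*} [CommRing R] (x : R × R × R) : R :=
  Q.a * x.1 ^ 2 + Q.b * x.2.1 ^ 2 + Q.c * x.2.2 ^ 2 + Q.d * x.2.1 * x.2.2 + Q.e * x.1 * x.2.2
    + Q.f * x.1 * x.2.1

/-- The determinant of the Gram matrix `(2a, f, e; f, 2b, d; e, d, 2c)`. -/
def det (Q : TernaryForm) : ℤ :=
  8 * Q.a * Q.b * Q.c + 2 * Q.d * Q.e * Q.f - 2 * Q.a * Q.d ^ 2 - 2 * Q.b * Q.e ^ 2 - 2 * Q.c * Q.f ^ 2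

/-- The form `y ↦ yᵗ adj(A) y`, where `A` is the Gram matrix. The dual form is its quotient by
`2 det A`. -/
def adj (Q : TernaryForm) : TernaryForm :=
  ⟨4 * Q.b * Q.c - Q.d ^ 2, 4 * Q.a * Q.c - Q.e ^ 2, 4 * Q.a * Q.b - Q.f ^ 2,
    2 * (Q.e * Q.f - 2 * Q.a * Q.d), 2 * (Q.d * Q.f - 2 * Q.b * Q.e), 2 * (Q.d * Q.e - 2 * Q.c * Q.f)⟩

/-- Positive definiteness, by the minors of the Gram matrix. -/
structure IsPos (Q : TernaryForm) : Prop where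
  a_pos : 0 < Q.a
  minor_pos : 0 < 4 * Q.a * Q.b - Q.f ^ 2
  det_pos : 0 < Q.det

variable {Q : TernaryForm}

/-- The minors are values of the form, up to positive factors. -/
lemma isPos_of_eval_pos (h : ∀ x : ℤ × ℤ × ℤ, x ≠ 0 → 0 < Q.eval x) : Q.IsPos := by
  have h1 : 0 < Q.a := by simpa [eval] using h (1, 0, 0) (by simp)
  have h2 : 0 < 4 * Q.a * Q.b - Q.f ^ 2 := by
    have h3 := h (-Q.f, 2 * Q.a, 0) (by simp [h1.ne'])
    have h4 : Q.eval (-Q.f, 2 * Q.a, 0) = Q.a * (4 * Q.a * Q.b - Q.f ^ 2) := by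
      simp [eval]; ring
    rw [h4] at h3
    exact pos_of_mul_pos_right h3 h1.le
  refine ⟨h1, h2, ?_⟩
  have h3 := h (Q.d * Q.f - 2 * Q.b * Q.e, Q.e * Q.f - 2 * Q.a * Q.d, 4 * Q.a * Q.b - Q.f ^ 2)
    (by simp [h2.ne'])
  have h4 : 2 * Q.eval (Q.d * Q.f - 2 * Q.b * Q.e, Q.e * Q.f - 2 * Q.a * Q.d, 4 * Q.a * Q.b - Q.f ^ 2)
      = (4 * Q.a * Q.b - Q.f ^ 2) * Q.det := by
    simp [eval, det]; ring
  have h5 : 0 < (4 * Q.a * Q.b - Q.f ^ 2) * Q.det := by rw [← h4]; linarith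
  exact pos_of_mul_pos_right h5 h2.le

namespace IsPos

variable (hQ : Q.IsPos)

include hQ

lemma eval_pos {x : ℤ × ℤ × ℤ} (hx : x ≠ 0) : 0 < Q.eval x := by
  obtain ⟨x, y, z⟩ := x
  have key : 4 * Q.a * (4 * Q.a * Q.b - Q.f ^ 2) * Q.eval (x, y, z)
      = (4 * Q.a * Q.b - Q.f ^ 2) * (2 * Q.a * x + Q.f * y + Q.e * z) ^ 2
        + ((4 * Q.a * Q.b - Q.f ^ 2) * y + (2 * Q.a * Q.d - Q.e * Q.f) * z) ^ 2
        + 2 * Q.a * Q.det * z ^ 2 := by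
    simp [eval, det]; ring
  have h1 := hQ.a_pos
  have h2 := hQ.minor_pos
  have h3 := hQ.det_pos
  have hm : 0 < 4 * Q.a * (4 * Q.a * Q.b - Q.f ^ 2) := by positivity
  by_contra hle
  have hle' : 4 * Q.a * (4 * Q.a * Q.b - Q.f ^ 2) * Q.eval (x, y, z) ≤ 0 :=
    mul_nonpos_of_nonneg_of_nonpos hm.le (not_lt.1 hle)
  rw [key] at hle'
  have e1 := mul_nonneg h2.le (sq_nonneg (2 * Q.a * x + Q.f * y + Q.e * z))
  have e2 := sq_nonneg ((4 * Q.a * Q.b - Q.f ^ 2) * y + (2 * Q.a * Q.d - Q.e * Q.f) * z)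
  have e3 : 0 ≤ 2 * Q.a * Q.det * z ^ 2 := by positivity
  have hz : z = 0 := by
    have : 2 * Q.a * Q.det * z ^ 2 = 0 := by linarith
    simpa [h1.ne', h3.ne'] using this
  subst hz
  have hy : y = 0 := by
    have : ((4 * Q.a * Q.b - Q.f ^ 2) * y + (2 * Q.a * Q.d - Q.e * Q.f) * 0) ^ 2 = 0 := by linarith
    simpa [h2.ne'] using this
  subst hy
  have hx' : x = 0 := by
    have : (4 * Q.a * Q.b - Q.f ^ 2) * (2 * Q.a * x + Q.f * 0 + Q.e * 0) ^ 2 = 0 := by linarith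
    simpa [h2.ne', h1.ne'] using this
  exact hx (by rw [hx']; rfl)

/-- The diagonal minors are positive because their products with the leading minor are sums of
positive terms. -/
lemma adj_isPos : Q.adj.IsPos := by
  have h1 := hQ.a_pos
  have h2 := hQ.minor_pos
  have h3 := hQ.det_pos
  have hb : 0 < Q.b := by
    have : 0 < Q.a * Q.b := by nlinarith [sq_nonneg Q.f]
    exact pos_of_mul_pos_right this h1.le
  have hB : 0 < 4 * Q.a * Q.c - Q.e ^ 2 := by
    have : (4 * Q.a * Q.b - Q.f ^ 2) * (4 * Q.a * Q.c - Q.e ^ 2)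
      = 2 * Q.a * Q.det + (Q.e * Q.f - 2 * Q.a * Q.d) ^ 2 := by rw [det]; ring
    refine pos_of_mul_pos_right (a := 4 * Q.a * Q.b - Q.f ^ 2) ?_ h2.le
    rw [this]; positivity
  have hc : 0 < Q.c := by
    have : 0 < Q.a * Q.c := by nlinarith [sq_nonneg Q.e]
    exact pos_of_mul_pos_right this h1.le
  refine ⟨?_, ?_, ?_⟩
  · have : (4 * Q.a * Q.b - Q.f ^ 2) * (4 * Q.b * Q.c - Q.d ^ 2)
      = 2 * Q.b * Q.det + (Q.d * Q.f - 2 * Q.b * Q.e) ^ 2 := by rw [det]; ring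
    refine pos_of_mul_pos_right (a := 4 * Q.a * Q.b - Q.f ^ 2) ?_ h2.le
    change 0 < (4 * Q.a * Q.b - Q.f ^ 2) * (4 * Q.b * Q.c - Q.d ^ 2)
    rw [this]; positivity
  · have : 4 * Q.adj.a * Q.adj.b - Q.adj.f ^ 2 = 8 * Q.c * Q.det := by simp only [adj, det]; ring
    rw [this]; positivity
  · have : Q.adj.det = 8 * Q.det ^ 2 := by simp only [adj, det]; ring
    rw [this]; positivity

end IsPos

open Complex Real

/-- The theta series `∑ exp(2πi Q(x) z)` of a ternary form. -/
def theta (Q : TernaryForm) (z : ℂ) : ℂ := ∑' x : ℤ × ℤ × ℤ, cexp (2 * π * I * z * (Q.eval x : ℤ))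

/-- The factor `(-iτ)^(-3/2)` of the inversion formula. -/
def invFactor (τ : ℂ) : ℂ := (1 / (-I * τ) ^ (1 / 2 : ℂ)) ^ 3

lemma invFactor_ne_zero {τ : ℂ} (hτ : 0 < τ.im) : invFactor τ ≠ 0 := by
  have hτ0 : τ ≠ 0 := by rintro rfl; simp at hτ
  exact pow_ne_zero 3 (one_div_ne_zero (by simp [Complex.cpow_eq_zero_iff, hτ0]))

lemma norm_invFactor {τ : ℂ} (hτ : 0 < τ.im) : ‖invFactor τ‖ = ‖τ‖ ^ (-(3 / 2) : ℝ) := by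
  have hτ0 : τ ≠ 0 := by rintro rfl; simp at hτ
  have h1 : ‖(-I * τ) ^ (1 / 2 : ℂ)‖ = ‖τ‖ ^ (1 / 2 : ℝ) := by
    have h := Complex.norm_cpow_real (-I * τ) (1 / 2)
    push_cast at h
    rw [h]; simp
  rw [invFactor, norm_pow, norm_div, norm_one, h1, one_div, ← Real.rpow_neg (norm_nonneg _),
    ← Real.rpow_natCast, ← Real.rpow_mul (norm_nonneg _)]
  norm_num

lemma cpow_half_real_mul {r : ℝ} (hr : 0 < r) {τ : ℂ} (hτ : 0 < τ.im) :
    (-I * (r * τ)) ^ (1 / 2 : ℂ) = (√r : ℂ) * (-I * τ) ^ (1 / 2 : ℂ) := by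
  have hτ0 : -I * τ ≠ 0 := by
    have : τ ≠ 0 := by rintro rfl; simp at hτ
    simp [this]
  have h1 : -I * (r * τ) = r * (-I * τ) := by ring
  have hr0 : (r : ℂ) ≠ 0 := by exact_mod_cast hr.ne'
  rw [h1, Complex.cpow_def_of_ne_zero (mul_ne_zero hr0 hτ0), Complex.cpow_def_of_ne_zero hτ0,
    Complex.log_ofReal_mul hr hτ0, add_mul, Complex.exp_add, Real.sqrt_eq_rpow]
  congr 1
  rw [Complex.ofReal_cpow hr.le, Complex.cpow_def_of_ne_zero hr0, Complex.ofReal_log hr.le]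
  norm_num

section Analytic

variable (hQ : Q.IsPos)

include hQ

/-- The inversion formula (Poisson summation) for a ternary form. -/
lemma tsum_shift (α : ℝ × ℝ × ℝ) {τ : ℂ} (hτ : 0 < τ.im) :
    ∑' x : ℤ × ℤ × ℤ, cexp (2 * π * I * τ * (Q.eval (((x.1 : ℝ), (x.2.1 : ℝ), (x.2.2 : ℝ)) + α) : ℝ))
      = (1 / √(Q.det : ℝ) : ℝ) * invFactor τ * ∑' y : ℤ × ℤ × ℤ,
        cexp (2 * π * I * (-1 / τ) * ((Q.adj.eval y : ℤ) / (2 * Q.det : ℝ) : ℝ)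
          + 2 * π * I * (y.1 * α.1 + y.2.1 * α.2.1 + y.2.2 * α.2.2 : ℝ)) := by
  have h1 : 0 < (Q.a : ℝ) := by exact_mod_cast hQ.a_pos
  have h2 : 0 < 4 * (Q.a : ℝ) * Q.b - Q.f ^ 2 := by exact_mod_cast hQ.minor_pos
  have h3 : 0 < (Q.det : ℝ) := by exact_mod_cast hQ.det_pos
  have hdet : (Q.det : ℝ) = 8 * Q.a * Q.b * Q.c + 2 * Q.d * Q.e * Q.f - 2 * Q.a * Q.d ^ 2
      - 2 * Q.b * Q.e ^ 2 - 2 * Q.c * Q.f ^ 2 := by rw [det]; push_cast; ring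
  have k1 : 0 < 2 * (Q.a : ℝ) := by positivity
  set m : ℝ := 4 * (Q.a : ℝ) * Q.b - Q.f ^ 2 with hm
  have k2 : 0 < m / (2 * Q.a) := by positivity
  have k3 : 0 < (Q.det : ℝ) / m := by positivity
  have key := tsum_gaussian_triangular k1 k2 k3 (Q.f / (2 * Q.a)) (Q.e / (2 * Q.a))
    ((2 * Q.a * Q.d - Q.e * Q.f) / m) α.1 α.2.1 α.2.2 hτ
  -- the triangular form of `2 Q`, and that of the dual form
  have e1 : ∀ X Y Z : ℝ, 2 * Q.eval (X, Y, Z) = 2 * (Q.a : ℝ) * (X + Q.f / (2 * Q.a) * Y + Q.e / (2 * Q.a) * Z) ^ 2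
      + m / (2 * Q.a) * (Y + (2 * Q.a * Q.d - Q.e * Q.f) / m * Z) ^ 2 + Q.det / m * Z ^ 2 := by
    intro X Y Z
    have hd : (Q.det : ℝ) / m = 2 * Q.c - Q.e ^ 2 / (2 * Q.a) - (2 * Q.a * Q.d - Q.e * Q.f) ^ 2 / (2 * Q.a * m) := by
      rw [hdet]; field_simp; rw [hm]; ring
    have hb : (Q.b : ℝ) = (m + Q.f ^ 2) / (4 * Q.a) := by rw [hm]; field_simp; ring
    rw [hd]
    simp only [eval]
    rw [hb]
    field_simp
    ring
  have e2 : ∀ X Y Z : ℝ, X ^ 2 / (2 * (Q.a : ℝ)) + (Y - Q.f / (2 * Q.a) * X) ^ 2 / (m / (2 * Q.a))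
      + (Z - Q.e / (2 * Q.a) * X - (2 * Q.a * Q.d - Q.e * Q.f) / m * (Y - Q.f / (2 * Q.a) * X)) ^ 2 / (Q.det / m)
      = Q.adj.eval (X, Y, Z) / Q.det := by
    intro X Y Z
    have hc : (Q.c : ℝ) = (Q.det / m + Q.e ^ 2 / (2 * Q.a)
        + (2 * Q.a * Q.d - Q.e * Q.f) ^ 2 / (2 * Q.a * m)) / 2 := by
      rw [hdet]; field_simp; rw [hm]; ring
    have hb : (Q.b : ℝ) = (m + Q.f ^ 2) / (4 * Q.a) := by rw [hm]; field_simp; ring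
    simp only [eval, adj]
    push_cast
    rw [hc, hb]
    field_simp
    ring
  have hprod : (1 / (-I * ((2 * (Q.a : ℝ) : ℝ) * τ)) ^ (1 / 2 : ℂ) *
      (1 / (-I * ((m / (2 * Q.a) : ℝ) * τ)) ^ (1 / 2 : ℂ) *
      (1 / (-I * ((Q.det / m : ℝ) * τ)) ^ (1 / 2 : ℂ)))) = (1 / √(Q.det : ℝ) : ℝ) * invFactor τ := by
    have hs : √(Q.det : ℝ) = √(2 * (Q.a : ℝ)) * (√(m / (2 * Q.a)) * √(Q.det / m)) := by
      rw [← Real.sqrt_mul k2.le, ← Real.sqrt_mul k1.le]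
      congr 1; field_simp
    rw [cpow_half_real_mul k1 hτ, cpow_half_real_mul k2 hτ, cpow_half_real_mul k3 hτ, invFactor, hs]
    push_cast
    simp only [one_div, mul_inv, inv_pow]
    ring
  rw [← hprod]
  refine Eq.trans (tsum_congr fun x => ?_) (key.trans ?_)
  · congr 1
    have := e1 (x.1 + α.1) (x.2.1 + α.2.1) (x.2.2 + α.2.2)
    have h4 : ((x.1 : ℝ), (x.2.1 : ℝ), (x.2.2 : ℝ)) + α = (x.1 + α.1, x.2.1 + α.2.1, x.2.2 + α.2.2) := rfl
    rw [h4, ← this]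
    push_cast; ring
  · congr 1
    refine tsum_congr fun y => ?_
    rw [e2]
    have h4 : (Q.adj.eval ((y.1 : ℝ), (y.2.1 : ℝ), (y.2.2 : ℝ)) : ℝ) = ((Q.adj.eval y : ℤ) : ℝ) := by
      simp only [eval]; push_cast; ring
    rw [h4]
    congr 2
    push_cast
    field_simp

/-- By completing squares the sum is bounded by a product of one-dimensional Gaussian sums. -/
lemma summable_gaussian {t : ℝ} (ht : 0 < t) :
    Summable fun x : ℤ × ℤ × ℤ => rexp (-t * (Q.eval x : ℤ)) := by
  have h1 : 0 < (Q.a : ℝ) := by exact_mod_cast hQ.a_pos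
  have h2 : 0 < 4 * (Q.a : ℝ) * Q.b - Q.f ^ 2 := by exact_mod_cast hQ.minor_pos
  have h3 : 0 < (Q.det : ℝ) := by exact_mod_cast hQ.det_pos
  have hdet : (Q.det : ℝ) = 8 * Q.a * Q.b * Q.c + 2 * Q.d * Q.e * Q.f - 2 * Q.a * Q.d ^ 2
      - 2 * Q.b * Q.e ^ 2 - 2 * Q.c * Q.f ^ 2 := by rw [det]; push_cast; ring
  set m : ℝ := 4 * (Q.a : ℝ) * Q.b - Q.f ^ 2 with hm
  have hs : Summable fun x : ℤ × ℤ × ℤ => ((rexp (-t * (Q.eval x : ℤ)) : ℝ) : ℂ) := by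
    refine summable_of_gaussian_bound (c₁ := t * Q.a) (c₂ := t * (m / (4 * Q.a)))
      (c₃ := t * (Q.det / (2 * m))) (by positivity) (by positivity) (by positivity)
      (fun p => Q.f / (2 * Q.a) * p.1 + Q.e / (2 * Q.a) * p.2)
      (fun z => (2 * Q.a * Q.d - Q.e * Q.f) / m * z) 0 fun x y z => ?_
    rw [Complex.norm_real, Real.norm_of_nonneg (Real.exp_pos _).le, ← Real.exp_add, ← Real.exp_add]
    refine Real.exp_le_exp.2 (le_of_eq ?_)
    have hd : (Q.det : ℝ) = (2 * Q.c - Q.e ^ 2 / (2 * Q.a)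
        - (2 * Q.a * Q.d - Q.e * Q.f) ^ 2 / (2 * Q.a * m)) * m := by
      rw [hdet]; field_simp; rw [hm]; ring
    have hb : (Q.b : ℝ) = (m + Q.f ^ 2) / (4 * Q.a) := by rw [hm]; field_simp; ring
    rw [hd]
    simp only [eval]
    push_cast
    rw [hb]
    field_simp
    ring
  have := hs.norm
  simpa only [Complex.norm_real, Real.norm_of_nonneg (Real.exp_pos _).le] using this

lemma summable_theta {z : ℂ} (hz : 0 < z.im) :
    Summable fun x : ℤ × ℤ × ℤ => cexp (2 * π * I * z * (Q.eval x : ℤ)) := by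
  refine Summable.of_norm_bounded (summable_gaussian hQ (t := 2 * π * z.im) (by positivity)) fun x => ?_
  rw [Complex.norm_exp]
  refine Real.exp_le_exp.2 (le_of_eq ?_)
  have : (2 * π * I * z * (Q.eval x : ℤ) : ℂ) = ((2 * π * (Q.eval x : ℤ) : ℝ) : ℂ) * (I * z) := by
    push_cast; ring
  rw [this, Complex.re_ofReal_mul, Complex.I_mul_re]
  ring

end Analytic

end TernaryForm

/-! ### Behaviour of theta series near rational points -/

namespace TernaryForm

open Complex Real

section Residues

variable (n : ℕ) [NeZero n]

/-- An integer is a residue plus a multiple of the modulus. -/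
def residueEquiv : ZMod n × ℤ ≃ ℤ where
  toFun p := p.1.val + n * p.2
  invFun x := ((x : ZMod n), x / n)
  left_inv := by
    rintro ⟨g, m⟩
    have hn : (n : ℤ) ≠ 0 := by exact_mod_cast NeZero.ne n
    refine Prod.ext ?_ ?_
    · simp
    · have h1 : ((g.val : ℤ)) / (n : ℤ) = 0 :=
        Int.ediv_eq_zero_of_lt (by positivity) (by exact_mod_cast ZMod.val_lt g)
      change ((g.val : ℤ) + n * m) / n = m
      rw [Int.add_mul_ediv_left _ _ hn, h1, zero_add]
  right_inv x := by
    change ((((x : ZMod n)).val : ℕ) : ℤ) + n * (x / n) = x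
    rw [ZMod.val_intCast, Int.emod_add_mul_ediv]

lemma residueEquiv_apply (g : ZMod n) (m : ℤ) : residueEquiv n (g, m) = g.val + n * m := rfl

lemma intCast_residueEquiv (g : ZMod n) (m : ℤ) : ((residueEquiv n (g, m) : ℤ) : ZMod n) = g := by
  rw [residueEquiv_apply]; simp

/-- The decomposition of triples of integers by residues. -/
def residueEquiv₃ : (ZMod n × ZMod n × ZMod n) × (ℤ × ℤ × ℤ) ≃ ℤ × ℤ × ℤ where
  toFun p := (residueEquiv n (p.1.1, p.2.1), residueEquiv n (p.1.2.1, p.2.2.1),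
    residueEquiv n (p.1.2.2, p.2.2.2))
  invFun x := ((((residueEquiv n).symm x.1).1, ((residueEquiv n).symm x.2.1).1,
    ((residueEquiv n).symm x.2.2).1), (((residueEquiv n).symm x.1).2, ((residueEquiv n).symm x.2.1).2,
    ((residueEquiv n).symm x.2.2).2))
  left_inv p := by simp
  right_inv x := by simp

lemma tsum_residues {F : ℤ × ℤ × ℤ → ℂ} (hF : Summable F) :
    ∑' x, F x = ∑ g : ZMod n × ZMod n × ZMod n, ∑' m : ℤ × ℤ × ℤ, F (residueEquiv₃ n (g, m)) := by
  rw [← (residueEquiv₃ n).tsum_eq F]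
  exact (((residueEquiv₃ n).summable_iff.2 hF).tsum_prod).trans (tsum_fintype _)

end Residues

/-- Reduction of a vector of integers. -/
def castVec (n : ℕ) (y : ℤ × ℤ × ℤ) : ZMod n × ZMod n × ZMod n := (y.1, y.2.1, y.2.2)

/-- The standard pairing. -/
def dot {R : Type*} [CommRing R] (x y : R × R × R) : R := x.1 * y.1 + x.2.1 * y.2.1 + x.2.2 * y.2.2

lemma eval_castVec (Q : TernaryForm) (n : ℕ) (x : ℤ × ℤ × ℤ) :
    Q.eval (castVec n x) = ((Q.eval x : ℤ) : ZMod n) := by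
  simp only [eval, castVec]; push_cast; ring

/-- The Gauss sum of a form, with a linear term. -/
def gaussSum (Q : TernaryForm) (n : ℕ) [NeZero n] (r : ℤ) (y : ℤ × ℤ × ℤ) : ℂ :=
  ∑ g : ZMod n × ZMod n × ZMod n, ZMod.stdAddChar ((r : ZMod n) * Q.eval g + dot (castVec n y) g)

lemma norm_gaussSum_le (Q : TernaryForm) (n : ℕ) [NeZero n] (r : ℤ) (y : ℤ × ℤ × ℤ) :
    ‖Q.gaussSum n r y‖ ≤ Fintype.card (ZMod n × ZMod n × ZMod n) := by
  refine (norm_sum_le _ _).trans ?_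
  simp only [ZMod.stdAddChar_apply, Circle.norm_coe, Finset.sum_const, Finset.card_univ, nsmul_eq_mul,
    mul_one, le_refl]

variable {Q : TernaryForm} (hQ : Q.IsPos)

include hQ in
/-- The behaviour of the theta series near the rational number `r / n`. -/
lemma theta_add_rat (n : ℕ) [NeZero n] (r : ℤ) {w : ℂ} (hw : 0 < w.im) :
    Q.theta (r / n + w) = (1 / √(Q.det : ℝ) : ℝ) * invFactor (n ^ 2 * w) *
      ∑' y : ℤ × ℤ × ℤ, cexp (2 * π * I * (-1 / (n ^ 2 * w)) * ((Q.adj.eval y : ℤ) / (2 * Q.det : ℝ) : ℝ)) *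
        Q.gaussSum n r y := by
  have hn : (n : ℂ) ≠ 0 := by exact_mod_cast NeZero.ne n
  have hnR : (n : ℝ) ≠ 0 := by exact_mod_cast NeZero.ne n
  have him : 0 < (r / n + w : ℂ).im := by
    have : (r / n : ℂ) = ((r / n : ℝ) : ℂ) := by push_cast; rfl
    rw [this, Complex.add_im, Complex.ofReal_im, zero_add]; exact hw
  have him' : 0 < ((n : ℂ) ^ 2 * w).im := by
    have : (n : ℂ) ^ 2 = ((n ^ 2 : ℝ) : ℂ) := by push_cast; rfl
    rw [this, Complex.im_ofReal_mul]; positivity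
  rw [theta, tsum_residues n (summable_theta hQ him)]
  -- on a class modulo `n` the factor `exp (2πi r Q(x) / n)` is constant, and the inversion formula
  -- applies to the class, shifted by `g / n`
  have h1 : ∀ g : ZMod n × ZMod n × ZMod n, ∑' m : ℤ × ℤ × ℤ,
      cexp (2 * π * I * (r / n + w) * (Q.eval (residueEquiv₃ n (g, m)) : ℤ))
      = (1 / √(Q.det : ℝ) : ℝ) * invFactor (n ^ 2 * w) * ∑' y : ℤ × ℤ × ℤ,
        cexp (2 * π * I * (-1 / (n ^ 2 * w)) * ((Q.adj.eval y : ℤ) / (2 * Q.det : ℝ) : ℝ)) *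
          ZMod.stdAddChar ((r : ZMod n) * Q.eval g + dot (castVec n y) g) := by
    intro g
    have key := tsum_shift hQ ((g.1.val / n : ℝ), (g.2.1.val / n : ℝ), (g.2.2.val / n : ℝ)) him'
    have h2 : ∀ m : ℤ × ℤ × ℤ, cexp (2 * π * I * (r / n + w) * (Q.eval (residueEquiv₃ n (g, m)) : ℤ))
        = ZMod.stdAddChar ((r : ZMod n) * Q.eval g) * cexp (2 * π * I * (n ^ 2 * w) *
          (Q.eval (((m.1 : ℝ), (m.2.1 : ℝ), (m.2.2 : ℝ)) +
            ((g.1.val / n : ℝ), (g.2.1.val / n : ℝ), (g.2.2.val / n : ℝ))) : ℝ)) := by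
      intro m
      have h3 : (r : ZMod n) * Q.eval g = ((r * Q.eval (residueEquiv₃ n (g, m)) : ℤ) : ZMod n) := by
        push_cast
        rw [← eval_castVec]
        congr 2
        simp only [castVec, residueEquiv₃, Equiv.coe_fn_mk, intCast_residueEquiv]
      have h4 : ((Q.eval (residueEquiv₃ n (g, m)) : ℤ) : ℂ) = (n : ℂ) ^ 2 *
          (Q.eval (((m.1 : ℝ), (m.2.1 : ℝ), (m.2.2 : ℝ)) +
            ((g.1.val / n : ℝ), (g.2.1.val / n : ℝ), (g.2.2.val / n : ℝ))) : ℝ) := by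
        simp only [eval, residueEquiv₃, Equiv.coe_fn_mk, residueEquiv_apply, Prod.fst_add, Prod.snd_add]
        push_cast
        field_simp
        ring
      rw [h3, ZMod.stdAddChar_coe, ← Complex.exp_add]
      congr 1
      rw [mul_assoc (2 * π * I) (n ^ 2 * w), mul_right_comm ((n : ℂ) ^ 2), ← h4]
      push_cast
      field_simp
    have h5 : ∀ y : ℤ × ℤ × ℤ,
        cexp (2 * π * I * (-1 / (n ^ 2 * w)) * ((Q.adj.eval y : ℤ) / (2 * Q.det : ℝ) : ℝ)) *
          ZMod.stdAddChar ((r : ZMod n) * Q.eval g + dot (castVec n y) g)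
        = ZMod.stdAddChar ((r : ZMod n) * Q.eval g) *
          cexp (2 * π * I * (-1 / (n ^ 2 * w)) * ((Q.adj.eval y : ℤ) / (2 * Q.det : ℝ) : ℝ)
          + 2 * π * I * (y.1 * (g.1.val / n) + y.2.1 * (g.2.1.val / n) + y.2.2 * (g.2.2.val / n) : ℝ)) := by
      intro y
      have h6 : dot (castVec n y) g = ((y.1 * g.1.val + y.2.1 * g.2.1.val + y.2.2 * g.2.2.val : ℤ) : ZMod n) := by
        simp [dot, castVec]
      rw [AddChar.map_add_eq_mul, h6, ZMod.stdAddChar_coe, Complex.exp_add, mul_left_comm]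
      congr 3
      push_cast
      field_simp
    simp only [h2, h5]
    rw [tsum_mul_left, key, tsum_mul_left, mul_left_comm]
  rw [Finset.sum_congr rfl fun g _ => h1 g, ← Finset.mul_sum]
  congr 1
  rw [← Summable.tsum_finsetSum]
  · simp only [gaussSum, Finset.mul_sum]
  · intro g _
    have hadj := hQ.adj_isPos
    have hdet : (0 : ℝ) < Q.det := by exact_mod_cast hQ.det_pos
    have him'' : 0 < ((-1 / ((n : ℂ) ^ 2 * w)) / ((2 * Q.det : ℝ) : ℂ)).im := by
      rw [Complex.div_ofReal_im]
      have h0 : (n : ℂ) ^ 2 * w ≠ 0 := by intro h; rw [h] at him'; simp at him'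
      have : 0 < (-1 / ((n : ℂ) ^ 2 * w)).im := by
        rw [neg_div, Complex.neg_im, one_div, Complex.inv_im, neg_div, neg_neg]
        have := Complex.normSq_pos.2 h0
        positivity
      positivity
    have hs := summable_theta hadj him''
    refine Summable.of_norm_bounded hs.norm fun y => ?_
    rw [norm_mul, ZMod.stdAddChar_apply, Circle.norm_coe, mul_one]
    refine le_of_eq ?_
    congr 2
    push_cast
    field_simp

/-- The dual form of `Q` multiplied by `L` is integral. -/
def HasLevel (Q : TernaryForm) (L : ℤ) : Prop := ∀ y : ℤ × ℤ × ℤ, 2 * Q.det ∣ L * Q.adj.eval y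

include hQ in
/-- For a modulus `d` prime to the level the linear term of the Gauss sum is removed by completing
the square. -/
lemma gaussSum_complete_square {L : ℤ} (hL : Q.HasLevel L) {b c : ℤ} (hc : L ∣ c) (d : ℕ) [NeZero d]
    (hbc : (b * c : ZMod d) = -1) (y : ℤ × ℤ × ℤ) {k : ℤ} (hk : c * Q.adj.eval y = 2 * Q.det * k) :
    Q.gaussSum d b y = ZMod.stdAddChar (k : ZMod d) * Q.gaussSum d b 0 := by
  have hdet := hQ.det_pos
  have hLc : Q.HasLevel c := fun y => (hL y).trans (mul_dvd_mul_right hc _)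
  -- the integral vector `h = c A⁻¹ y`
  have hpol : ∀ e : ℤ × ℤ × ℤ, 2 * Q.det ∣ c * (Q.adj.eval (y + e) - Q.adj.eval y - Q.adj.eval e) := by
    intro e
    rw [mul_sub, mul_sub]
    exact dvd_sub (dvd_sub (hLc _) (hLc _)) (hLc _)
  obtain ⟨h₁, e₁⟩ := hpol (1, 0, 0)
  obtain ⟨h₂, e₂⟩ := hpol (0, 1, 0)
  obtain ⟨h₃, e₃⟩ := hpol (0, 0, 1)
  obtain ⟨y₁, y₂, y₃⟩ := y
  simp only [eval, adj, Prod.mk_add_mk] at e₁ e₂ e₃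
  simp only [eval, adj] at hk
  have hdet' := hdet.ne'
  simp only [Int.cast_id] at e₁ e₂ e₃ hk
  have f₁ : 2 * Q.a * h₁ + Q.f * h₂ + Q.e * h₃ = c * y₁ := by
    refine mul_left_cancel₀ (mul_ne_zero two_ne_zero hdet') ?_
    have e₁' := e₁; have e₂' := e₂; have e₃' := e₃
    rw [det] at e₁' e₂' e₃' ⊢
    linear_combination -2 * Q.a * e₁' - Q.f * e₂' - Q.e * e₃'
  have f₂ : Q.f * h₁ + 2 * Q.b * h₂ + Q.d * h₃ = c * y₂ := by
    refine mul_left_cancel₀ (mul_ne_zero two_ne_zero hdet') ?_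
    have e₁' := e₁; have e₂' := e₂; have e₃' := e₃
    rw [det] at e₁' e₂' e₃' ⊢
    linear_combination -Q.f * e₁' - 2 * Q.b * e₂' - Q.d * e₃'
  have f₃ : Q.e * h₁ + Q.d * h₂ + 2 * Q.c * h₃ = c * y₃ := by
    refine mul_left_cancel₀ (mul_ne_zero two_ne_zero hdet') ?_
    have e₁' := e₁; have e₂' := e₂; have e₃' := e₃
    rw [det] at e₁' e₂' e₃' ⊢
    linear_combination -Q.e * e₁' - Q.d * e₂' - 2 * Q.c * e₃'
  have fk : Q.eval (h₁, h₂, h₃) = c * k := by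
    have g1 : 2 * Q.eval (h₁, h₂, h₃) = c * (y₁ * h₁ + y₂ * h₂ + y₃ * h₃) := by
      simp only [eval, Int.cast_id]
      linear_combination h₁ * f₁ + h₂ * f₂ + h₃ * f₃
    have g2 : y₁ * h₁ + y₂ * h₂ + y₃ * h₃ = 2 * k := by
      refine mul_left_cancel₀ (mul_ne_zero two_ne_zero hdet') ?_
      linear_combination -y₁ * e₁ - y₂ * e₂ - y₃ * e₃ + 2 * hk
    rw [g2] at g1
    linarith
  rw [gaussSum, gaussSum, Finset.mul_sum,
    ← (Equiv.subRight (castVec d (h₁, h₂, h₃))).sum_comp fun g =>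
      ZMod.stdAddChar (k : ZMod d) * ZMod.stdAddChar ((b : ZMod d) * Q.eval g + dot (castVec d 0) g)]
  refine Finset.sum_congr rfl fun g _ => ?_
  rw [← AddChar.map_add_eq_mul]
  congr 1
  have F₁ := congrArg (Int.cast : ℤ → ZMod d) f₁
  have F₂ := congrArg (Int.cast : ℤ → ZMod d) f₂
  have F₃ := congrArg (Int.cast : ℤ → ZMod d) f₃
  have Fk := congrArg (Int.cast : ℤ → ZMod d) fk
  simp only [eval, Int.cast_id] at Fk
  push_cast at F₁ F₂ F₃ Fk
  simp only [Equiv.subRight_apply, dot, castVec, eval, Prod.fst_sub, Prod.snd_sub, Prod.fst_zero,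
    Prod.snd_zero, Int.cast_zero, zero_mul, add_zero]
  linear_combination b * (g.1 * F₁ + g.2.1 * F₂ + g.2.2 * F₃) - b * Fk
    + (g.1 * y₁ + g.2.1 * y₂ + g.2.2 * y₃ - k) * hbc

include hQ in
/-- The transformation of the theta series under an element of `Γ₀(L)` with positive lower right
entry `d`. The factor that relates the two sides depends on the form only through its Gauss sum. -/
lemma theta_transform {L : ℤ} (hL : Q.HasLevel L) {b c : ℤ} (hc : L ∣ c) (d : ℕ) [NeZero d]
    (hbc : (b * c : ZMod d) = -1) {z w : ℂ} (hz : 0 < z.im) (hw : 0 < w.im)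
    (hzw : -1 / ((d : ℂ) ^ 2 * w) = -c / d - 1 / z) :
    Q.theta (b / d + w) * invFactor z = invFactor (d ^ 2 * w) * Q.gaussSum d b 0 * Q.theta z := by
  have hdet := hQ.det_pos
  have hdetR : (Q.det : ℝ) ≠ 0 := by exact_mod_cast hdet.ne'
  have hd : (d : ℂ) ≠ 0 := by exact_mod_cast NeZero.ne d
  have hz0 : z ≠ 0 := by rintro rfl; simp at hz
  have h1 := tsum_shift hQ 0 hz
  have h2 : Q.theta z = (1 / √(Q.det : ℝ) : ℝ) * invFactor z * ∑' y : ℤ × ℤ × ℤ,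
        cexp (2 * π * I * (-1 / z) * ((Q.adj.eval y : ℤ) / (2 * Q.det : ℝ) : ℝ)) := by
    have e1 : Q.theta z = ∑' x : ℤ × ℤ × ℤ, cexp (2 * π * I * z * (Q.eval (((x.1 : ℝ), (x.2.1 : ℝ), (x.2.2 : ℝ)) + 0) : ℝ)) := by
      refine tsum_congr fun x => ?_
      congr 2
      simp only [add_zero, eval]; push_cast; ring
    rw [e1, h1]
    congr 1
    refine tsum_congr fun y => ?_
    congr 1
    simp
  have h3 : ∀ y : ℤ × ℤ × ℤ, cexp (2 * π * I * (-1 / ((d : ℂ) ^ 2 * w)) * ((Q.adj.eval y : ℤ) / (2 * Q.det : ℝ) : ℝ)) *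
        Q.gaussSum d b y = Q.gaussSum d b 0 * cexp (2 * π * I * (-1 / z) * ((Q.adj.eval y : ℤ) / (2 * Q.det : ℝ) : ℝ)) := by
    intro y
    obtain ⟨k, hk⟩ := (hL y).trans (mul_dvd_mul_right hc _)
    rw [gaussSum_complete_square hQ hL hc d hbc y hk, ZMod.stdAddChar_coe, hzw, ← mul_assoc,
      ← Complex.exp_add, mul_comm]
    congr 2
    have hkR : (c : ℂ) * (Q.adj.eval y : ℤ) = 2 * Q.det * k := by exact_mod_cast hk
    have hdetC : (Q.det : ℂ) ≠ 0 := by exact_mod_cast hdet.ne'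
    have : (k : ℂ) = c * (Q.adj.eval y : ℤ) / (2 * Q.det) := by rw [hkR]; field_simp
    rw [this]
    push_cast
    field_simp
    ring
  rw [theta_add_rat hQ d b hw, h2]
  simp only [h3]
  rw [tsum_mul_left]
  ring

end TernaryForm

/-! ### Non-vanishing of the Jacobi theta function -/

section JacobiTheta

open Complex Real

lemma jacobiTheta₂_add_one_right (z τ : ℂ) : jacobiTheta₂ z (τ + 1) = jacobiTheta₂ (z + 1 / 2) τ := by
  refine tsum_congr fun n => ?_
  obtain ⟨k, hk⟩ := Int.even_mul_succ_self (n - 1)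
  have hk' : (n : ℂ) ^ 2 = n + 2 * k := by
    have : n ^ 2 = n + 2 * k := by linear_combination hk
    exact_mod_cast this
  have h := Complex.exp_int_mul_two_pi_mul_I k
  have e : 2 * π * I * n * z + π * I * n ^ 2 * (τ + 1)
      = (2 * π * I * n * (z + 1 / 2) + π * I * n ^ 2 * τ) + k * (2 * π * I) := by
    linear_combination (π * I) * hk'
  rw [jacobiTheta₂_term, jacobiTheta₂_term, e, Complex.exp_add, h, mul_one]

/-- The three even theta constants do not vanish at `τ`. The modular group permutes them up to
non-zero factors. -/
def ThetaConstantsNonzero (τ : ℂ) : Prop :=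
  jacobiTheta₂ 0 τ ≠ 0 ∧ jacobiTheta₂ (1 / 2) τ ≠ 0 ∧ jacobiTheta₂ (τ / 2) τ ≠ 0

lemma thetaConstantsNonzero_add_one (τ : ℂ) :
    ThetaConstantsNonzero (τ + 1) ↔ ThetaConstantsNonzero τ := by
  have h1 : jacobiTheta₂ 0 (τ + 1) = jacobiTheta₂ (1 / 2) τ := by
    rw [jacobiTheta₂_add_one_right, zero_add]
  have h2 : jacobiTheta₂ (1 / 2) (τ + 1) = jacobiTheta₂ 0 τ := by
    rw [jacobiTheta₂_add_one_right, ← jacobiTheta₂_add_left 0 τ]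
    norm_num
  have h3 : jacobiTheta₂ ((τ + 1) / 2) (τ + 1) = jacobiTheta₂ (τ / 2) τ := by
    rw [jacobiTheta₂_add_one_right, ← jacobiTheta₂_add_left (τ / 2) τ]
    congr 1; ring
  rw [ThetaConstantsNonzero, ThetaConstantsNonzero, h1, h2, h3]
  tauto

lemma thetaConstantsNonzero_inv {τ : ℂ} (hτ : τ ≠ 0) :
    ThetaConstantsNonzero (-1 / τ) ↔ ThetaConstantsNonzero τ := by
  have key : ∀ z, jacobiTheta₂ z τ ≠ 0 ↔ jacobiTheta₂ (z / τ) (-1 / τ) ≠ 0 := by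
    intro z
    rw [jacobiTheta₂_functional_equation z τ, mul_ne_zero_iff, and_iff_right]
    refine mul_ne_zero (one_div_ne_zero ?_) (Complex.exp_ne_zero _)
    simp [Complex.cpow_eq_zero_iff, hτ]
  have h3 : jacobiTheta₂ (1 / 2 / τ) (-1 / τ) = jacobiTheta₂ (-1 / τ / 2) (-1 / τ) := by
    rw [← jacobiTheta₂_neg_left]
    congr 1; ring
  have h2 : τ / 2 / τ = 1 / 2 := by field_simp
  rw [ThetaConstantsNonzero, ThetaConstantsNonzero, key 0, key (1 / 2), key (τ / 2), h2, h3, zero_div]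
  tauto

/-- The imaginary part is at least `√3 / 2`, and each theta constant is close to its leading term.
-/
lemma thetaConstantsNonzero_of_im {τ : ℂ} (h0 : 0 < τ.im) (h : 3 ≤ 4 * τ.im ^ 2) :
    ThetaConstantsNonzero τ := by
  have hexp : ∀ σ : ℂ, σ.im = τ.im → rexp (-π * σ.im) < 1 / 3 := by
    intro σ hσ
    rw [hσ]
    have h1 : (2 : ℝ) < π * τ.im := by
      have : (0.8 : ℝ) ≤ τ.im := by nlinarith
      nlinarith [Real.pi_gt_three]
    have h2 : (3 : ℝ) < rexp 2 := by
      have := Real.add_one_lt_exp (x := 2) (by norm_num)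
      linarith
    calc rexp (-π * τ.im) ≤ rexp (-2) := Real.exp_le_exp.2 (by linarith)
      _ = (rexp 2)⁻¹ := Real.exp_neg 2
      _ < 1 / 3 := by rw [one_div]; exact inv_strictAnti₀ (by norm_num) h2
  have hmain : ∀ σ : ℂ, σ.im = τ.im → jacobiTheta₂ 0 σ ≠ 0 := by
    intro σ hσ h1
    have h2 := norm_jacobiTheta_sub_one_le (hσ ▸ h0 : 0 < σ.im)
    have h3 := hexp σ hσ
    rw [jacobiTheta_eq_jacobiTheta₂, h1, zero_sub, norm_neg, norm_one, div_mul_eq_mul_div,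
      le_div_iff₀ (by linarith)] at h2
    linarith
  refine ⟨hmain τ rfl, ?_, ?_⟩
  · have := hmain (τ + 1) (by simp)
    rwa [jacobiTheta₂_add_one_right, zero_add] at this
  -- the third constant is a sum of `exp (πi n (n + 1) τ)`, in which `n` and `-n - 1` give equal
  -- terms
  · intro h1
    set r := rexp (-π * τ.im) with hr
    have hr3 := hexp τ rfl
    have hr0 : 0 < r := Real.exp_pos _
    have hs := (hasSum_jacobiTheta₂_term (τ / 2) h0)
    rw [h1] at hs
    have hterm : ∀ n : ℤ, jacobiTheta₂_term n (τ / 2) τ = cexp (π * I * (n * (n + 1)) * τ) := by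
      intro n; rw [jacobiTheta₂_term]; congr 1; ring
    have hs2 := HasSum.nat_add_neg_add_one hs
    have hsym : ∀ n : ℕ, jacobiTheta₂_term n (τ / 2) τ + jacobiTheta₂_term (-(n + 1 : ℤ)) (τ / 2) τ
        = 2 * cexp (π * I * (n * (n + 1)) * τ) := by
      intro n
      rw [hterm, hterm, two_mul]
      congr 2; push_cast; ring
    simp only [hsym] at hs2
    have hs3 := (hasSum_mul_left_iff (two_ne_zero : (2 : ℂ) ≠ 0) (a₁ := 0)).1 (by simpa using hs2)
    rw [← hasSum_nat_add_iff' 1] at hs3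
    simp only [Finset.sum_range_one, Nat.cast_zero, zero_mul, mul_zero, Complex.exp_zero, zero_sub] at hs3
    have hb : ∀ n : ℕ, ‖cexp (π * I * (((n + 1 : ℕ) : ℂ) * (((n + 1 : ℕ) : ℂ) + 1)) * τ)‖ ≤ r ^ (n + 1) := by
      intro n
      rw [Complex.norm_exp, hr, ← Real.exp_nat_mul]
      refine Real.exp_le_exp.2 ?_
      have : (π * I * (((n + 1 : ℕ) : ℂ) * (((n + 1 : ℕ) : ℂ) + 1)) * τ) =
        ((π * (((n + 1 : ℕ) : ℝ) * (((n + 1 : ℕ) : ℝ) + 1)) : ℝ) : ℂ) * (I * τ) := by push_cast; ring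
      rw [this, Complex.re_ofReal_mul, Complex.I_mul_re]
      have h5 : (0 : ℝ) ≤ π * τ.im := by positivity
      have h6 : (((n + 1 : ℕ) : ℝ)) ≤ (((n + 1 : ℕ) : ℝ) * (((n + 1 : ℕ) : ℝ) + 1)) := by
        have : (0 : ℝ) ≤ ((n + 1 : ℕ) : ℝ) := by positivity
        nlinarith
      nlinarith
    have hg : HasSum (fun n : ℕ => r ^ (n + 1)) (r / (1 - r)) := by
      simp_rw [pow_succ', div_eq_mul_inv, hasSum_mul_left_iff hr0.ne']
      exact hasSum_geometric_of_lt_one hr0.le (by linarith)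
    have := hs3.norm_le_of_bounded hg hb
    rw [norm_neg, norm_one, le_div_iff₀ (by linarith)] at this
    linarith

/-- Every point is equivalent to one in the fundamental domain, where the theta constants do not
vanish. -/
lemma thetaConstantsNonzero (z : UpperHalfPlane) : ThetaConstantsNonzero z := by
  have key : ∀ g : SL(2, ℤ), ∀ z : UpperHalfPlane,
      ThetaConstantsNonzero (g • z : UpperHalfPlane) ↔ ThetaConstantsNonzero z := by
    intro g
    have : g ∈ Subgroup.closure {ModularGroup.S, ModularGroup.T} := by
      simp [SpecialLinearGroup.SL2Z_generators]
    induction this using Subgroup.closure_induction with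
    | one => simp
    | mem g hg =>
      rcases hg with rfl | hg
      · intro z
        rw [UpperHalfPlane.modular_S_smul]
        have : ((UpperHalfPlane.mk (-(z : ℂ))⁻¹ z.im_inv_neg_coe_pos : UpperHalfPlane) : ℂ) = -1 / (z : ℂ) := by
          change (-(z : ℂ))⁻¹ = _
          rw [inv_neg, neg_div, one_div]
        rw [this, thetaConstantsNonzero_inv z.ne_zero]
      · rw [Set.mem_singleton_iff] at hg
        subst hg
        intro z
        rw [UpperHalfPlane.modular_T_smul, UpperHalfPlane.coe_vadd, add_comm]
        exact_mod_cast thetaConstantsNonzero_add_one z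
    | mul g h _ _ ig ih => intro z; rw [mul_smul, ig, ih]
    | inv g _ ig => intro z; rw [← ig, smul_inv_smul]
  obtain ⟨g, hg⟩ := ModularGroup.exists_smul_mem_fd z
  exact (key g z).1 (thetaConstantsNonzero_of_im (g • z).im_pos
    (ModularGroup.three_le_four_mul_im_sq_of_mem_fd hg))

lemma shimuraTheta_ne_zero (z : UpperHalfPlane) : shimuraTheta z ≠ 0 := by
  rw [shimuraTheta, jacobiTheta_eq_jacobiTheta₂]
  exact (thetaConstantsNonzero ⟨2 * (z : ℂ), by simpa using z.im_pos⟩).1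

end JacobiTheta

/-! ### Transformation of ternary theta series under congruence subgroups -/

namespace TernaryForm

open Complex Real

/-- The form `x² + y² + z²`, whose theta series is the cube of Shimura's theta series. -/
def sumThreeSquares : TernaryForm := ⟨1, 1, 1, 0, 0, 0⟩

lemma sumThreeSquares_isPos : sumThreeSquares.IsPos :=
  ⟨by decide, by decide, by decide⟩

lemma sumThreeSquares_hasLevel : sumThreeSquares.HasLevel 4 := by
  rintro ⟨x, y, z⟩
  have h1 : sumThreeSquares.det = 8 := by decide
  have h2 : sumThreeSquares.adj = ⟨4, 4, 4, 0, 0, 0⟩ := by rfl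
  rw [h1, h2]
  exact ⟨x ^ 2 + y ^ 2 + z ^ 2, by simp only [eval, Int.cast_id]; ring⟩

lemma tsum_mul_mul {f : ℤ → ℂ} (hs : Summable fun n => ‖f n‖) :
    ∑' x : ℤ × ℤ × ℤ, f x.1 * (f x.2.1 * f x.2.2) = (∑' n, f n) ^ 3 := by
  have hs2 : Summable fun x : ℤ × ℤ => ‖f x.1 * f x.2‖ := Summable.mul_norm hs hs
  have h1 := tsum_mul_tsum_of_summable_norm hs hs2
  have h2 := tsum_mul_tsum_of_summable_norm hs hs
  rw [← h2] at h1
  rw [← h1]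
  ring

lemma theta_sumThreeSquares (z : UpperHalfPlane) : sumThreeSquares.theta z = shimuraTheta z ^ 3 := by
  have hs : Summable fun n : ℤ => ‖cexp (π * I * (n : ℂ) ^ 2 * (2 * z))‖ := by
    have h := (hasSum_jacobiTheta₂_term 0 (τ := 2 * (z : ℂ)) (by simpa using z.im_pos)).summable.norm
    refine h.congr fun n => ?_
    rw [jacobiTheta₂_term, mul_zero, zero_add]
  rw [theta, shimuraTheta, jacobiTheta, ← tsum_mul_mul hs]
  refine tsum_congr fun x => ?_
  rw [← Complex.exp_add, ← Complex.exp_add]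
  congr 1
  simp only [sumThreeSquares, eval]
  push_cast
  ring

variable {Q : TernaryForm} (hQ : Q.IsPos)

/-- The point `γ z` near the rational number `b / d`. -/
lemma exists_smul_eq_add (γ : SL(2, ℤ)) (z : UpperHalfPlane) (hd : γ 1 1 ≠ 0) :
    ∃ w : ℂ, 0 < w.im ∧ ((γ • z : UpperHalfPlane) : ℂ) = γ 0 1 / γ 1 1 + w ∧
      -1 / ((γ 1 1 : ℂ) ^ 2 * w) = -γ 1 0 / γ 1 1 - 1 / z := by
  have hd' : ((γ 1 1 : ℤ) : ℂ) ≠ 0 := by exact_mod_cast hd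
  have hdet : (γ 0 0 : ℂ) * γ 1 1 - γ 0 1 * γ 1 0 = 1 := by
    have := γ.det_coe
    rw [Matrix.det_fin_two] at this
    exact_mod_cast this
  have hden : (γ 1 0 : ℂ) * z + γ 1 1 ≠ 0 := by
    have := UpperHalfPlane.denom_ne_zero γ z
    simpa [UpperHalfPlane.denom] using this
  have hcoe : ((γ • z : UpperHalfPlane) : ℂ) = (γ 0 0 * z + γ 0 1) / (γ 1 0 * z + γ 1 1) := by
    rw [UpperHalfPlane.coe_specialLinearGroup_apply]; simp
  have hz := z.ne_zero
  have hadd : ((γ • z : UpperHalfPlane) : ℂ) = γ 0 1 / γ 1 1 + z / (γ 1 1 * (γ 1 0 * z + γ 1 1)) := by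
    rw [hcoe, div_add_div _ _ hd' (mul_ne_zero hd' hden), div_eq_div_iff hden (mul_ne_zero hd' (mul_ne_zero hd' hden))]
    linear_combination (γ 1 1 : ℂ) * (z : ℂ) * (γ 1 0 * z + γ 1 1) * hdet
  refine ⟨z / (γ 1 1 * (γ 1 0 * z + γ 1 1)), ?_, hadd, ?_⟩
  · have h1 := (γ • z).im_pos
    have h2 : (γ 0 1 / γ 1 1 : ℂ) = ((γ 0 1 / γ 1 1 : ℝ) : ℂ) := by push_cast; rfl
    rw [← UpperHalfPlane.coe_im, hadd, Complex.add_im, h2, Complex.ofReal_im, zero_add] at h1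
    exact h1
  · field_simp
    ring

include hQ in
/-- The transformation formula of a ternary theta series under `Γ₀(L)`, with an automorphy factor
expressed through Gauss sums. -/
lemma theta_smul {L : ℤ} (hL4 : 4 ∣ L) (hL : Q.HasLevel L) (γ : SL(2, ℤ)) (hc : L ∣ γ 1 0)
    (d : ℕ) [NeZero d] (hd : γ 1 1 = d) (z : UpperHalfPlane) :
    Q.theta (γ • z : UpperHalfPlane) * sumThreeSquares.gaussSum d (γ 0 1) 0
      = Q.gaussSum d (γ 0 1) 0 * thetaFactor γ z ^ 3 * Q.theta z := by
  obtain ⟨w, hw, hγ, hzw⟩ := exists_smul_eq_add γ z (by rw [hd]; exact_mod_cast NeZero.ne d)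
  have hbc : ((γ 0 1 : ℤ) * (γ 1 0 : ℤ) : ZMod d) = -1 := by
    have := γ.det_coe
    rw [Matrix.det_fin_two, hd] at this
    have h2 := congrArg (Int.cast : ℤ → ZMod d) this
    push_cast at h2
    rw [ZMod.natCast_self, mul_zero, zero_sub] at h2
    rw [← h2, neg_neg]
  rw [hd] at hγ hzw
  push_cast at hγ hzw
  have e1 := theta_transform hQ hL hc d hbc z.im_pos hw hzw
  have e2 := theta_transform sumThreeSquares_isPos sumThreeSquares_hasLevel (hL4.trans hc) d hbc z.im_pos hw hzw
  rw [← hγ] at e1 e2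
  rw [theta_sumThreeSquares, theta_sumThreeSquares] at e2
  have hθ := shimuraTheta_ne_zero z
  have hfac : shimuraTheta (γ • z) = thetaFactor γ z * shimuraTheta z := by
    rw [thetaFactor]; field_simp
  rw [hfac, mul_pow] at e2
  -- comparison with the sum of three squares eliminates the branches of the square roots
  have e3 : thetaFactor γ z ^ 3 * invFactor z = invFactor (d ^ 2 * w) * sumThreeSquares.gaussSum d (γ 0 1) 0 := by
    refine mul_right_cancel₀ (pow_ne_zero 3 hθ) ?_
    linear_combination e2
  refine mul_right_cancel₀ (invFactor_ne_zero z.im_pos) ?_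
  linear_combination (sumThreeSquares.gaussSum d (γ 0 1) 0) * e1 - Q.gaussSum d (γ 0 1) 0 * Q.theta z * e3

end TernaryForm

/-! ### The ternary form of an order -/

section NormForm

variable {a b : ℚ}

/-- The values of the norm form on a combination of three quaternions. -/
lemma nrd_combination (s₁ s₂ s₃ : 𝔹 a b) (x y z : ℚ) :
    nrd (x • s₁ + y • s₂ + z • s₃) = x ^ 2 * nrd s₁ + y ^ 2 * nrd s₂ + z ^ 2 * nrd s₃
      + y * z * (nrd (s₂ + s₃) - nrd s₂ - nrd s₃) + x * z * (nrd (s₁ + s₃) - nrd s₁ - nrd s₃)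
      + x * y * (nrd (s₁ + s₂) - nrd s₁ - nrd s₂) := by
  simp only [nrd_eq, QuaternionAlgebra.re_add, QuaternionAlgebra.imI_add, QuaternionAlgebra.imJ_add,
    QuaternionAlgebra.imK_add, QuaternionAlgebra.re_smul, QuaternionAlgebra.imI_smul,
    QuaternionAlgebra.imJ_smul, QuaternionAlgebra.imK_smul, smul_eq_mul]
  ring

variable {R : Subring (𝔹 a b)}

lemma IsOrder.pureLattice_fg (hR : IsOrder R) : (pureLattice R).FG := hR.fg.map pureMap

/-- The lattice of the `x - x̄`, `x` in an order, has rank three. -/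
lemma IsOrder.exists_pureLattice_equiv (hR : IsOrder R) :
    Nonempty ((ℤ × ℤ × ℤ) ≃ₗ[ℤ] pureLattice R) := by
  have : Submodule.IsLattice ℚ (subringLattice R) := hR
  obtain ⟨B⟩ := exists_basis (subringLattice R)
  have : Module.Finite ℤ (subringLattice R) := Module.Finite.of_basis B
  have : Module.Finite ℤ (pureLattice R) := Module.Finite.iff_fg.2 hR.pureLattice_fg
  set f := pureMap.domRestrict (subringLattice R) with hf
  have hrange : LinearMap.range f = pureLattice R := by
    rw [hf, LinearMap.range_domRestrict]; rfl
  have hker : Module.finrank ℤ (LinearMap.ker f) = 1 := by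
    have h1 : (⟨1, one_mem R⟩ : subringLattice R) ∈ LinearMap.ker f := by
      rw [LinearMap.mem_ker, hf, LinearMap.domRestrict_apply, pureMap_apply, star_one, sub_self]
    refine finrank_eq_one (⟨_, h1⟩ : LinearMap.ker f) ?_ ?_
    · intro h
      have := congrArg (fun t : LinearMap.ker f => ((t : subringLattice R) : 𝔹 a b)) h
      exact one_ne_zero this
    · rintro ⟨⟨x, hx⟩, hx'⟩
      rw [LinearMap.mem_ker, hf, LinearMap.domRestrict_apply] at hx'
      have hx0 : pureMap x = pureMap 0 := by rw [map_zero]; exact hx'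
      obtain ⟨q, hq⟩ := pureMap_eq_iff.1 hx0
      obtain ⟨t, ht⟩ := hR.trd_int (mem_subringLattice.1 hx)
      obtain ⟨n, hn⟩ := hR.nrd_int (mem_subringLattice.1 hx)
      obtain ⟨k, hk⟩ := exists_int_of_integral hq ht (t' := 0) (by simp [trd_eq]) hn (n' := 0)
        (by simp [nrd_zero])
      refine ⟨k, Subtype.ext (Subtype.ext ?_)⟩
      change k • (1 : 𝔹 a b) = x
      rw [hq, zero_add, hk, Int.cast_smul_eq_zsmul]
  have hsum := Submodule.finrank_quotient_add_finrank (LinearMap.ker f)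
  rw [f.quotKerEquivRange.finrank_eq] at hsum
  rw [hker, hrange, Module.finrank_eq_card_basis B, Fintype.card_fin] at hsum
  have h3 : Module.finrank ℤ (pureLattice R) = 3 := by omega
  have := Module.IsTorsionFree.trans_faithfulSMul ℤ ℚ (𝔹 a b)
  have e := (Module.finBasisOfFinrankEq ℤ (pureLattice R) h3).equivFun
  let g : (ℤ × ℤ × ℤ) ≃ₗ[ℤ] (Fin 3 → ℤ) :=
    { toFun := fun x => ![x.1, x.2.1, x.2.2]
      invFun := fun v => (v 0, v 1, v 2)
      map_add' := fun x y => by ext i; fin_cases i <;> simp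
      map_smul' := fun c x => by ext i; fin_cases i <;> simp
      left_inv := fun x => by simp
      right_inv := fun v => by ext i; fin_cases i <;> simp }
  exact ⟨g.trans e.symm⟩

/-- The form `Q` is the norm form of the lattice `{x - x̄ : x ∈ R}`, divided by `ω`, in some basis. -/
def IsNormForm (ω : ℕ) (R : Subring (𝔹 a b)) (Q : TernaryForm) : Prop :=
  ∃ e : (ℤ × ℤ × ℤ) ≃ₗ[ℤ] pureLattice R, ∀ x, nrd (e x : 𝔹 a b) = ω * (Q.eval x : ℤ)

lemma pureLattice_equiv_apply (e : (ℤ × ℤ × ℤ) ≃ₗ[ℤ] pureLattice R) (x : ℤ × ℤ × ℤ) :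
    (e x : 𝔹 a b) = (x.1 : ℚ) • (e (1, 0, 0) : 𝔹 a b)
      + (x.2.1 : ℚ) • (e (0, 1, 0) : 𝔹 a b) + (x.2.2 : ℚ) • (e (0, 0, 1) : 𝔹 a b) := by
  obtain ⟨x, y, z⟩ := x
  have h : (x, y, z) = x • ((1, 0, 0) : ℤ × ℤ × ℤ) + y • ((0, 1, 0) : ℤ × ℤ × ℤ)
      + z • ((0, 0, 1) : ℤ × ℤ × ℤ) := by simp
  rw [h, map_add, map_add, map_smul, map_smul, map_smul]
  simp only [Submodule.coe_add, Submodule.coe_smul, Int.cast_smul_eq_zsmul]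
  simp

lemma exists_isNormForm (hR : IsOrder R) {ω : ℕ} (h : ∀ s ∈ pureLattice R, ∃ k : ℤ, nrd s = ω * k) :
    ∃ Q, IsNormForm ω R Q := by
  obtain ⟨e⟩ := hR.exists_pureLattice_equiv
  have h' : ∀ x, ∃ k : ℤ, nrd (e x : 𝔹 a b) = ω * k := fun x => h _ (e x).2
  choose q hq using h'
  refine ⟨⟨q (1, 0, 0), q (0, 1, 0), q (0, 0, 1), q (0, 1, 1) - q (0, 1, 0) - q (0, 0, 1),
    q (1, 0, 1) - q (1, 0, 0) - q (0, 0, 1), q (1, 1, 0) - q (1, 0, 0) - q (0, 1, 0)⟩, e, fun x => ?_⟩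
  have hadd : ∀ x y : ℤ × ℤ × ℤ, (e x : 𝔹 a b) + e y = e (x + y) := fun x y => by
    rw [map_add]; rfl
  rw [pureLattice_equiv_apply, nrd_combination, hadd, hadd, hadd]
  simp only [hq, Prod.mk_add_mk, add_zero, zero_add, TernaryForm.eval]
  push_cast
  ring

/-- The determinant of a norm form equals `ω` up to twice a square. -/
lemma IsNormForm.det_eq {ω : ℕ} {Q : TernaryForm} (h : IsNormForm ω R Q) :
    ∃ (M : Fin 3 → Fin 3 → ℚ) (m : ℚ), (∀ x : ℤ × ℤ × ℤ, (ω : ℚ) * (Q.eval x : ℤ) =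
        -a * (M 0 0 * x.1 + M 0 1 * x.2.1 + M 0 2 * x.2.2) ^ 2
        - b * (M 1 0 * x.1 + M 1 1 * x.2.1 + M 1 2 * x.2.2) ^ 2
        + a * b * (M 2 0 * x.1 + M 2 1 * x.2.1 + M 2 2 * x.2.2) ^ 2) ∧
      m = M 0 0 * (M 1 1 * M 2 2 - M 1 2 * M 2 1) - M 0 1 * (M 1 0 * M 2 2 - M 1 2 * M 2 0)
        + M 0 2 * (M 1 0 * M 2 1 - M 1 1 * M 2 0) ∧
      (Q.det : ℚ) * ω ^ 3 = 8 * (a * b * m) ^ 2 := by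
  obtain ⟨e, he⟩ := h
  have hre : ∀ x, (e x : 𝔹 a b).re = 0 := by
    intro x
    obtain ⟨r, -, hr⟩ := mem_pureLattice.1 (e x).2
    have := trd_pureMap r
    rw [hr, trd_eq] at this
    linarith
  set s₁ := (e (1, 0, 0) : 𝔹 a b) with hs₁
  set s₂ := (e (0, 1, 0) : 𝔹 a b) with hs₂
  set s₃ := (e (0, 0, 1) : 𝔹 a b) with hs₃
  refine ⟨![![s₁.imI, s₂.imI, s₃.imI], ![s₁.imJ, s₂.imJ, s₃.imJ], ![s₁.imK, s₂.imK, s₃.imK]], _, ?_, rfl, ?_⟩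
  · intro x
    rw [← he x, nrd_eq, hre x, pureLattice_equiv_apply]
    simp only [QuaternionAlgebra.imI_add, QuaternionAlgebra.imJ_add,
      QuaternionAlgebra.imK_add, QuaternionAlgebra.imI_smul,
      QuaternionAlgebra.imJ_smul, QuaternionAlgebra.imK_smul, smul_eq_mul]
    simp
    ring
  · have key : ∀ x : ℤ × ℤ × ℤ, (Q.eval x : ℤ) * (ω : ℚ) = nrd ((x.1 : ℚ) • s₁ + (x.2.1 : ℚ) • s₂ + (x.2.2 : ℚ) • s₃) := by
      intro x; rw [← pureLattice_equiv_apply, he x]; ring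
    have r1 : s₁.re = 0 := hre _
    have r2 : s₂.re = 0 := hre _
    have r3 : s₃.re = 0 := hre _
    have k1 := key (1, 0, 0)
    have k2 := key (0, 1, 0)
    have k3 := key (0, 0, 1)
    have k4 := key (0, 1, 1)
    have k5 := key (1, 0, 1)
    have k6 := key (1, 1, 0)
    simp [TernaryForm.eval, nrd_eq, r1, r2, r3] at k1 k2 k3 k4 k5 k6
    have c4 : (Q.d : ℚ) * ω = (-(2 * a * (s₂.imI * s₃.imI)) - 2 * b * (s₂.imJ * s₃.imJ) + 2 * a * b * (s₂.imK * s₃.imK)) := by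
      linear_combination k4 - k2 - k3
    have c5 : (Q.e : ℚ) * ω = (-(2 * a * (s₁.imI * s₃.imI)) - 2 * b * (s₁.imJ * s₃.imJ) + 2 * a * b * (s₁.imK * s₃.imK)) := by
      linear_combination k5 - k1 - k3
    have c6 : (Q.f : ℚ) * ω = (-(2 * a * (s₁.imI * s₂.imI)) - 2 * b * (s₁.imJ * s₂.imJ) + 2 * a * b * (s₁.imK * s₂.imK)) := by
      linear_combination k6 - k1 - k2
    have hdet : (Q.det : ℚ) * ω ^ 3 = 8 * (Q.a * ω) * (Q.b * ω) * (Q.c * ω) + 2 * (Q.d * ω) * (Q.e * ω) * (Q.f * ω)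
        - 2 * (Q.a * ω) * (Q.d * ω) ^ 2 - 2 * (Q.b * ω) * (Q.e * ω) ^ 2 - 2 * (Q.c * ω) * (Q.f * ω) ^ 2 := by
      rw [TernaryForm.det]; push_cast; ring
    rw [hdet, k1, k2, k3, c4, c5, c6]
    simp
    ring

variable [Fact (a < 0)] [Fact (b < 0)]

lemma IsNormForm.isPos {ω : ℕ} (hω : ω ≠ 0) {Q : TernaryForm} (h : IsNormForm ω R Q) : Q.IsPos := by
  obtain ⟨e, he⟩ := h
  refine TernaryForm.isPos_of_eval_pos fun x hx => ?_
  have h1 : (e x : 𝔹 a b) ≠ 0 := by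
    intro h0
    exact hx (e.map_eq_zero_iff.1 (Subtype.ext h0))
  have h2 : 0 < nrd (e x : 𝔹 a b) := lt_of_le_of_ne (nrd_nonneg _) (nrd_ne_zero h1).symm
  rw [he] at h2
  have h3 : (0 : ℚ) < ω := by exact_mod_cast Nat.pos_of_ne_zero hω
  exact_mod_cast pos_of_mul_pos_right h2 h3.le

end NormForm

/-! ### The level -/

section Level

variable {a b : ℚ}

/-- The traces `tr (x q)`, where `q` runs through `1, i, j, k`, have bounded denominators. -/
lemma traceDual_nrd_denom (ha : a ≠ 0) (hb : b ≠ 0) {O : Subring (𝔹 a b)} (hO : IsOrder O) :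
    ∃ D : ℕ, D ≠ 0 ∧ ∀ s ∈ nrd '' traceDual (O : Set (𝔹 a b)), ∃ k : ℤ, D * s = k := by
  have hspan : Submodule.span ℚ (subringLattice O : Set (𝔹 a b)) = ⊤ :=
    Submodule.IsLattice.span_eq_top (self := hO)
  have hmem : ∀ q : 𝔹 a b, ∃ k : ℕ, k ≠ 0 ∧ ∀ x ∈ traceDual (O : Set (𝔹 a b)),
      ∃ t : ℤ, k * trd (x * q) = t := by
    intro q
    obtain ⟨k, hk, hkq⟩ := exists_nsmul_mem_of_mem_span (x := q) (by rw [hspan]; trivial)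
    refine ⟨k, hk, fun x hx => ?_⟩
    obtain ⟨t, ht⟩ := hx _ (mem_subringLattice.1 hkq)
    refine ⟨t, ?_⟩
    rw [← ht, mul_smul_comm, ← Nat.cast_smul_eq_nsmul ℚ, trd_smul]
  obtain ⟨k1, hk1, h1⟩ := hmem 1
  obtain ⟨k2, hk2, h2⟩ := hmem ⟨0, 1, 0, 0⟩
  obtain ⟨k3, hk3, h3⟩ := hmem ⟨0, 0, 1, 0⟩
  obtain ⟨k4, hk4, h4⟩ := hmem ⟨0, 0, 0, 1⟩
  refine ⟨4 * (k1 * k2 * k3 * k4) ^ 2 * a.num.natAbs ^ 2 * b.num.natAbs ^ 2, ?_, ?_⟩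
  · have : a.num.natAbs ≠ 0 := by simpa using ha
    have : b.num.natAbs ≠ 0 := by simpa using hb
    positivity
  rintro _ ⟨x, hx, rfl⟩
  obtain ⟨t1, e1⟩ := h1 x hx
  obtain ⟨t2, e2⟩ := h2 x hx
  obtain ⟨t3, e3⟩ := h3 x hx
  obtain ⟨t4, e4⟩ := h4 x hx
  simp only [trd_eq, QuaternionAlgebra.re_mul, mul_one] at e1 e2 e3 e4
  simp at e1 e2 e3 e4
  have ha' : a * (a.den : ℚ) = a.num := Rat.mul_den_eq_num a
  have hb' : b * (b.den : ℚ) = b.num := Rat.mul_den_eq_num b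
  refine ⟨a.num * b.num * ((k2 * k3 * k4 : ℕ) ^ 2 * a.num * b.num * t1 ^ 2
    - (k1 * k3 * k4 : ℕ) ^ 2 * a.den * b.num * t2 ^ 2
    - (k1 * k2 * k4 : ℕ) ^ 2 * a.num * b.den * t3 ^ 2
    + (k1 * k2 * k3 : ℕ) ^ 2 * a.den * b.den * t4 ^ 2), ?_⟩
  rw [nrd_eq]
  push_cast
  have sq_natAbs : ∀ n : ℤ, ((n.natAbs : ℕ) : ℚ) ^ 2 = (n : ℚ) ^ 2 := fun n => by
    rw [← Int.cast_natCast, ← Int.cast_pow, Int.natAbs_sq, Int.cast_pow]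
  rw [sq_natAbs, sq_natAbs, ← e1, ← e2, ← e3, ← e4, ← ha', ← hb']
  ring

variable [ha : Fact (a < 0)] [hb : Fact (b < 0)] {O : Subring (𝔹 a b)}

lemma IsOrder.nrd_traceDual (hO : IsOrder O) {x : 𝔹 a b}
    (hx : x ∈ traceDual (O : Set (𝔹 a b))) :
    ∃ k : ℤ, nrd x = k * latticeNorm (traceDual (O : Set (𝔹 a b))) :=
  exists_eq_mul_ratGcd (traceDual_nrd_denom ha.out.ne hb.out.ne hO) (Set.mem_image_of_mem _ hx)

omit ha hb in
lemma trd_pureMap_mul (x s : 𝔹 a b) (hs : trd s = 0) : trd (pureMap x * s) = 2 * trd (x * s) := by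
  have : trd (star x * s) = -trd (x * s) := by
    rw [← trd_star, star_mul, star_star, star_eq_sub s, hs, zero_smul, zero_sub, neg_mul,
      trd_mul_comm, ← neg_one_smul ℚ, trd_smul]
    ring
  rw [pureMap_apply, sub_mul, trd_sub, this]
  ring

omit ha hb in
/-- Elements of the dual of `O` of trace zero, obtained from the dual of the lattice `{x - x̄}`. -/
lemma smul_mem_traceDual {ω : ℚ} (hω : ω ≠ 0) {R : Subring (𝔹 a b)} {X : 𝔹 a b}
    (hX : trd X = 0) (h : ∀ s ∈ pureLattice R, ∃ k : ℤ, trd (s * star X) = ω * k) :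
    (2 / ω) • X ∈ traceDual (R : Set (𝔹 a b)) := by
  intro x hx
  obtain ⟨k, hk⟩ := h (pureMap x) (mem_pureLattice.2 ⟨x, hx, rfl⟩)
  refine ⟨-k, ?_⟩
  rw [star_eq_sub, hX, zero_smul, zero_sub, mul_neg, ← neg_one_smul ℚ (pureMap x * X), trd_smul,
    trd_pureMap_mul x X hX] at hk
  rw [smul_mul_assoc, trd_smul, trd_mul_comm]
  push_cast
  field_simp
  linarith

lemma IsOrder.latticeNorm_traceDual_pos (hO : IsOrder O) :
    0 < latticeNorm (traceDual (O : Set (𝔹 a b))) := by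
  have hspec := ratGcd_spec (traceDual_nrd_denom ha.out.ne hb.out.ne hO)
  refine lt_of_le_of_ne hspec.1 fun h0 => ?_
  have h1 : (1 : 𝔹 a b) ∈ traceDual (O : Set (𝔹 a b)) := fun y hy => by
    rw [one_mul]; exact hO.trd_int hy
  obtain ⟨k, hk⟩ := hO.nrd_traceDual h1
  rw [← h0, mul_zero, nrd_one] at hk
  exact one_ne_zero hk

lemma IsOrder.orderN_pos (hO : IsOrder O) : 0 < orderN O := inv_pos.2 hO.latticeNorm_traceDual_pos

omit ha hb in
/-- The polar form of the norm form on the lattice `{x - x̄}` is divisible by `ω(O)`. -/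
lemma trd_mul_star_pureLattice {ω : ℕ} {R : Subring (𝔹 a b)}
    (h : ∀ s ∈ pureLattice R, ∃ k : ℤ, nrd s = ω * k) {s t : 𝔹 a b} (hs : s ∈ pureLattice R)
    (ht : t ∈ pureLattice R) : ∃ k : ℤ, trd (s * star t) = (ω : ℚ) * k := by
  obtain ⟨k1, h1⟩ := h s hs
  obtain ⟨k2, h2⟩ := h t ht
  obtain ⟨k3, h3⟩ := h (s + t) (add_mem hs ht)
  refine ⟨k3 - k1 - k2, ?_⟩
  rw [nrd_add, h1, h2] at h3
  push_cast
  linear_combination h3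

lemma IsOrder.nrd_pureLattice (hO : IsOrder O) {s : 𝔹 a b} (hs : s ∈ pureLattice O) :
    ∃ k : ℤ, nrd s = orderOmega O * k := by
  obtain ⟨x, hx, rfl⟩ := mem_pureLattice.1 hs
  obtain ⟨k, hk⟩ := hO.omega_spec.2.1 x hx
  exact ⟨-k, by rw [nrd_pureMap, hk]; push_cast; ring⟩

/-- The number `4 N(O) / ω(O)` is a positive integer. -/
lemma IsOrder.exists_level (hO : IsOrder O) : ∃ L : ℕ, 0 < L ∧ (L : ℚ) = 4 * orderN O / orderOmega O := by
  obtain ⟨hω, hdvd, hgcd⟩ := hO.omega_spec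
  have hωQ : (orderOmega O : ℚ) ≠ 0 := by exact_mod_cast hω
  have hωpos : (0 : ℚ) < orderOmega O := by exact_mod_cast Nat.pos_of_ne_zero hω
  set l : ℚ := 4 * orderN O / orderOmega O with hl
  have hlpos : 0 < l := by have := hO.orderN_pos; positivity
  have hN := hO.latticeNorm_traceDual_pos
  have key : ∀ x ∈ O, ∃ k : ℤ, l * charDisc x = orderOmega O * k := by
    intro x hx
    have hX := smul_mem_traceDual (R := O) hωQ (trd_pureMap x) fun s hs =>
      trd_mul_star_pureLattice (fun _ => hO.nrd_pureLattice) hs (mem_pureLattice.2 ⟨x, hx, rfl⟩)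
    obtain ⟨k, hk⟩ := hO.nrd_traceDual hX
    refine ⟨-k, ?_⟩
    rw [nrd_smul, nrd_pureMap] at hk
    rw [hl, orderN]
    field_simp at hk ⊢
    push_cast
    linear_combination -hk
  have hden : l.den = 1 := by
    have h1 := hgcd (l.den * orderOmega O) fun x hx => by
      obtain ⟨k, hk⟩ := key x hx
      obtain ⟨k', hk'⟩ := hdvd x hx
      rw [hk', mul_left_comm, mul_right_inj' hωQ] at hk
      have h2 : l.num * k' = l.den * k := by
        have : l * l.den = l.num := Rat.mul_den_eq_num l
        have h3 : (l.num : ℚ) * k' = l.den * k := by rw [← this, ← hk]; ring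
        exact_mod_cast h3
      have h4 : (l.den : ℤ) ∣ k' := by
        have hc : IsCoprime (l.den : ℤ) l.num := by
          rw [Int.isCoprime_iff_gcd_eq_one, Int.gcd, Int.natAbs_natCast, Nat.gcd_comm]
          exact l.reduced
        exact hc.dvd_of_dvd_mul_left ⟨k, h2⟩
      obtain ⟨j, hj⟩ := h4
      exact ⟨j, by rw [hk', hj]; push_cast; ring⟩
    have h5 : l.den * orderOmega O ∣ 1 * orderOmega O := by rw [one_mul]; exact_mod_cast h1
    exact Nat.dvd_one.1 (Nat.dvd_of_mul_dvd_mul_right (Nat.pos_of_ne_zero hω) h5)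
  refine ⟨l.num.natAbs, Int.natAbs_pos.2 (Rat.num_ne_zero.2 hlpos.ne'), ?_⟩
  have h6 : (l.num.natAbs : ℤ) = l.num := Int.natAbs_of_nonneg (Rat.num_nonneg.2 hlpos.le)
  have h7 : ((l.num.natAbs : ℕ) : ℚ) = l.num := by rw [← Int.cast_natCast, h6]
  rw [h7]
  have := Rat.mul_den_eq_num l
  rw [← this, hden, Nat.cast_one, mul_one]

/-- The norm form of the right order of an ideal is divisible by `ω(O)`: locally this order is
conjugate to `O`. -/
lemma LeftIdeal.nrd_pureLattice (hO : IsOrder O) (I : LeftIdeal O) {s : 𝔹 a b}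
    (hs : s ∈ pureLattice (rightRing I.lattice)) : ∃ k : ℤ, nrd s = orderOmega O * k := by
  have hωQ : (orderOmega O : ℚ) ≠ 0 := by exact_mod_cast hO.omega_spec.1
  obtain ⟨x, hx, rfl⟩ := mem_pureLattice.1 hs
  have h : ∀ p : ℕ, p.Prime → PInt p (nrd (pureMap x) / orderOmega O) := by
    intro p hp
    obtain ⟨y, -, hy⟩ := I.exists_isLocGen hO p hp
    have h1 : x ∈ locRing p (rightRing I.lattice) := mem_locRing.2 (le_locAt p _ hx)
    obtain ⟨m, hm, hmx⟩ := mem_locAt.1 (mem_locRing.1 ((LeftIdeal.mem_locRing_rightRing hy).1 h1))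
    obtain ⟨k, hk⟩ := hO.omega_spec.2.1 _ (mem_subringLattice.1 hmx)
    rw [← Nat.cast_smul_eq_nsmul ℚ, charDisc_smul, charDisc_conj] at hk
    refine pInt_of_mul_eq_intCast (m := m ^ 2) (Nat.Coprime.pow_left 2 hm) (k := -k) ?_
    rw [nrd_pureMap]
    field_simp
    push_cast
    linear_combination -hk
  obtain ⟨k, hk⟩ := eq_intCast_of_forall_pInt h
  exact ⟨k, by rw [← hk]; field_simp⟩

/-- The norm of the dual of the right order of an ideal divides that of the dual of `O`. -/
lemma LeftIdeal.orderN_mul_nrd (hO : IsOrder O) (I : LeftIdeal O) {X : 𝔹 a b}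
    (hX : X ∈ traceDual (rightRing I.lattice : Set (𝔹 a b))) : ∃ k : ℤ, orderN O * nrd X = k := by
  refine eq_intCast_of_forall_pInt fun p hp => ?_
  obtain ⟨y, -, hy⟩ := I.exists_isLocGen hO p hp
  have hle : (subringLattice O).map (LinearMap.mulRight ℤ (y : 𝔹 a b) ∘ₗ LinearMap.mulLeft ℤ (↑y⁻¹ : 𝔹 a b))
      ≤ locAt p (subringLattice (rightRing I.lattice)) := by
    rintro _ ⟨z, hz, rfl⟩
    refine mem_locRing.1 ((LeftIdeal.mem_locRing_rightRing hy).2 (mem_locRing.2 ?_))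
    have : (y : 𝔹 a b) * ((↑y⁻¹ : 𝔹 a b) * z * (y : 𝔹 a b)) * (↑y⁻¹ : 𝔹 a b) = z := by
      simp [mul_assoc]
    change (y : 𝔹 a b) * ((↑y⁻¹ : 𝔹 a b) * z * (y : 𝔹 a b)) * (↑y⁻¹ : 𝔹 a b) ∈ _
    rw [this]
    exact le_locAt p _ hz
  obtain ⟨m, hm, hmem⟩ := exists_nsmul_mem_of_fg (hO.fg.map _) hle
  have hX' : (m : ℚ) • ((y : 𝔹 a b) * X * (↑y⁻¹ : 𝔹 a b)) ∈ traceDual (O : Set (𝔹 a b)) := by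
    intro z hz
    obtain ⟨k, hk⟩ := hX _ (mem_subringLattice.1 (hmem _ ⟨z, hz, rfl⟩))
    refine ⟨k, ?_⟩
    rw [← hk, ← Nat.cast_smul_eq_nsmul ℚ, mul_smul_comm, smul_mul_assoc, trd_smul, trd_smul]
    congr 1
    change _ = trd (X * ((↑y⁻¹ : 𝔹 a b) * z * (y : 𝔹 a b)))
    rw [mul_assoc, mul_assoc, trd_mul_comm]
    simp only [mul_assoc]
  obtain ⟨k, hk⟩ := hO.nrd_traceDual hX'
  rw [nrd_smul, nrd_conj] at hk
  refine pInt_of_mul_eq_intCast (m := m ^ 2) (Nat.Coprime.pow_left 2 hm) (k := k) ?_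
  have := hO.latticeNorm_traceDual_pos
  rw [orderN]
  push_cast
  field_simp
  linear_combination hk

/-- The norm forms of all right orders have level `4 N(O) / ω(O)`. -/
lemma LeftIdeal.hasLevel (hO : IsOrder O) (I : LeftIdeal O) {L : ℕ}
    (hL : (L : ℚ) = 4 * orderN O / orderOmega O) {Q : TernaryForm}
    (hQ : IsNormForm (orderOmega O) (rightRing I.lattice) Q) : Q.HasLevel L := by
  have hω : orderOmega O ≠ 0 := hO.omega_spec.1
  have hωQ : (orderOmega O : ℚ) ≠ 0 := by exact_mod_cast hω
  have hdet : (Q.det : ℚ) ≠ 0 := by exact_mod_cast (hQ.isPos hω).det_pos.ne'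
  obtain ⟨e, he⟩ := hQ
  intro y
  set s₁ := (e (1, 0, 0) : 𝔹 a b) with hs₁
  set s₂ := (e (0, 1, 0) : 𝔹 a b) with hs₂
  set s₃ := (e (0, 0, 1) : 𝔹 a b) with hs₃
  -- the coordinates `A⁻¹ y`, where `A` is the Gram matrix
  obtain ⟨y₁, y₂, y₃⟩ := y
  set u₁ : ℚ := ((4 * Q.b * Q.c - Q.d ^ 2) * y₁ + (Q.d * Q.e - 2 * Q.c * Q.f) * y₂
    + (Q.d * Q.f - 2 * Q.b * Q.e) * y₃) / Q.det with hu₁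
  set u₂ : ℚ := ((Q.d * Q.e - 2 * Q.c * Q.f) * y₁ + (4 * Q.a * Q.c - Q.e ^ 2) * y₂
    + (Q.e * Q.f - 2 * Q.a * Q.d) * y₃) / Q.det with hu₂
  set u₃ : ℚ := ((Q.d * Q.f - 2 * Q.b * Q.e) * y₁ + (Q.e * Q.f - 2 * Q.a * Q.d) * y₂
    + (4 * Q.a * Q.b - Q.f ^ 2) * y₃) / Q.det with hu₃
  have hdet' : (Q.det : ℚ) = 8 * Q.a * Q.b * Q.c + 2 * Q.d * Q.e * Q.f - 2 * Q.a * Q.d ^ 2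
      - 2 * Q.b * Q.e ^ 2 - 2 * Q.c * Q.f ^ 2 := by rw [TernaryForm.det]; push_cast; ring
  have m₁ : 2 * Q.a * u₁ + Q.f * u₂ + Q.e * u₃ = y₁ := by
    rw [hu₁, hu₂, hu₃]; field_simp; rw [hdet']; ring
  have m₂ : Q.f * u₁ + 2 * Q.b * u₂ + Q.d * u₃ = y₂ := by
    rw [hu₁, hu₂, hu₃]; field_simp; rw [hdet']; ring
  have m₃ : Q.e * u₁ + Q.d * u₂ + 2 * Q.c * u₃ = y₃ := by
    rw [hu₁, hu₂, hu₃]; field_simp; rw [hdet']; ring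
  -- the values of the norm form over the rationals
  have hnrd : ∀ x y z : ℚ, nrd (x • s₁ + y • s₂ + z • s₃) = orderOmega O *
      (Q.a * x ^ 2 + Q.b * y ^ 2 + Q.c * z ^ 2 + Q.d * y * z + Q.e * x * z + Q.f * x * y) := by
    intro x y z
    have hadd : ∀ x y : ℤ × ℤ × ℤ, (e x : 𝔹 a b) + e y = e (x + y) := fun x y => by
      rw [map_add]; rfl
    rw [nrd_combination, hs₁, hs₂, hs₃, hadd, hadd, hadd]
    simp only [he, Prod.mk_add_mk, add_zero, zero_add, TernaryForm.eval]
    push_cast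
    ring
  set X := u₁ • s₁ + u₂ • s₂ + u₃ • s₃ with hXdef
  have htr : ∀ x, trd (e x : 𝔹 a b) = 0 := by
    intro x
    obtain ⟨r, -, hr⟩ := mem_pureLattice.1 (e x).2
    rw [← hr, trd_pureMap]
  have hXtr : trd X = 0 := by
    rw [hXdef, trd_add, trd_add, trd_smul, trd_smul, trd_smul, hs₁, hs₂, hs₃, htr, htr, htr]
    ring
  have hdual : ∀ s ∈ pureLattice (rightRing I.lattice), ∃ k : ℤ, trd (s * star X) = (orderOmega O : ℚ) * k := by
    intro s hs
    obtain ⟨x, hx⟩ := e.surjective ⟨s, hs⟩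
    have hsx : s = (x.1 : ℚ) • s₁ + (x.2.1 : ℚ) • s₂ + (x.2.2 : ℚ) • s₃ := by
      rw [hs₁, hs₂, hs₃, ← pureLattice_equiv_apply, hx]
    refine ⟨x.1 * y₁ + x.2.1 * y₂ + x.2.2 * y₃, ?_⟩
    have h1 := nrd_add s X
    have h2 : s + X = (x.1 + u₁ : ℚ) • s₁ + (x.2.1 + u₂ : ℚ) • s₂ + (x.2.2 + u₃ : ℚ) • s₃ := by
      rw [hsx, hXdef]; simp only [add_smul]; abel
    rw [h2, hnrd] at h1
    nth_rewrite 1 [hsx] at h1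
    rw [hnrd, hXdef, hnrd, ← hXdef] at h1
    push_cast
    rw [← m₁, ← m₂, ← m₃]
    linear_combination -h1
  obtain ⟨k, hk⟩ := I.orderN_mul_nrd hO (smul_mem_traceDual hωQ hXtr hdual)
  refine ⟨k, ?_⟩
  have h3 : (L : ℚ) * (Q.adj.eval (y₁, y₂, y₃) : ℤ) = 2 * Q.det * k := by
    rw [nrd_smul, hXdef, hnrd] at hk
    have h4 : ((Q.adj.eval (y₁, y₂, y₃) : ℤ) : ℚ) = 2 * Q.det *
        (Q.a * u₁ ^ 2 + Q.b * u₂ ^ 2 + Q.c * u₃ ^ 2 + Q.d * u₂ * u₃ + Q.e * u₁ * u₃ + Q.f * u₁ * u₂) := by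
      have h5 : 2 * (Q.a * u₁ ^ 2 + Q.b * u₂ ^ 2 + Q.c * u₃ ^ 2 + Q.d * u₂ * u₃ + Q.e * u₁ * u₃ + Q.f * u₁ * u₂)
          = u₁ * y₁ + u₂ * y₂ + u₃ * y₃ := by rw [← m₁, ← m₂, ← m₃]; ring
      rw [mul_comm 2 (Q.det : ℚ), mul_assoc, h5, hu₁, hu₂, hu₃]
      field_simp
      simp only [TernaryForm.eval, TernaryForm.adj]
      push_cast
      ring
    rw [h4, hL, ← hk]
    field_simp
    ring
  exact_mod_cast h3

end Level

namespace TernaryForm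

variable {Q : TernaryForm}

/-- The integral form `L A⁻¹` attached to a form with Gram matrix `A` and level `L`. -/
lemma HasLevel.exists_dual {L : ℤ} (hL : Q.HasLevel L) : ∃ B : TernaryForm,
    L * Q.adj.a = 2 * Q.det * B.a ∧ L * Q.adj.b = 2 * Q.det * B.b ∧ L * Q.adj.c = 2 * Q.det * B.c ∧
    L * Q.adj.d = 2 * Q.det * B.d ∧ L * Q.adj.e = 2 * Q.det * B.e ∧ L * Q.adj.f = 2 * Q.det * B.f := by
  obtain ⟨k1, h1⟩ := hL (1, 0, 0)
  obtain ⟨k2, h2⟩ := hL (0, 1, 0)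
  obtain ⟨k3, h3⟩ := hL (0, 0, 1)
  obtain ⟨k4, h4⟩ := hL (0, 1, 1)
  obtain ⟨k5, h5⟩ := hL (1, 0, 1)
  obtain ⟨k6, h6⟩ := hL (1, 1, 0)
  simp [eval] at h1 h2 h3 h4 h5 h6
  exact ⟨⟨k1, k2, k3, k4 - k2 - k3, k5 - k1 - k3, k6 - k1 - k2⟩, h1, h2, h3,
    by linear_combination h4 - h2 - h3, by linear_combination h5 - h1 - h3, by linear_combination h6 - h1 - h2⟩

/-- Some entries of the identity `A B = L`. -/
lemma HasLevel.exists_inverse {L : ℤ} (hQ : Q.IsPos) (hL : Q.HasLevel L) : ∃ B : TernaryForm,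
    4 * (Q.a * B.a) + Q.f * B.f + Q.e * B.e = L ∧ 4 * (Q.b * B.b) + Q.f * B.f + Q.d * B.d = L ∧
    4 * (Q.c * B.c) + Q.e * B.e + Q.d * B.d = L ∧ 2 * (Q.a * B.f) + 2 * (Q.f * B.b) + Q.e * B.d = 0 := by
  obtain ⟨B, ha, hb, hc, hd, he, hf⟩ := hL.exists_dual
  have hdet := hQ.det_pos.ne'
  have hD : Q.det = 8 * Q.a * Q.b * Q.c + 2 * Q.d * Q.e * Q.f - 2 * Q.a * Q.d ^ 2
      - 2 * Q.b * Q.e ^ 2 - 2 * Q.c * Q.f ^ 2 := rfl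
  generalize Q.det = D at *
  simp only [adj] at ha hb hc hd he hf
  have cancel : ∀ {x y : ℤ}, 2 * D * x = 2 * D * y → x = y := fun h =>
    mul_left_cancel₀ (mul_ne_zero two_ne_zero hdet) h
  refine ⟨B, cancel ?_, cancel ?_, cancel ?_, cancel ?_⟩
  · linear_combination -4 * Q.a * ha - Q.f * hf - Q.e * he - 2 * L * hD
  · linear_combination -4 * Q.b * hb - Q.f * hf - Q.d * hd - 2 * L * hD
  · linear_combination -4 * Q.c * hc - Q.e * he - Q.d * hd - 2 * L * hD
  · linear_combination -2 * Q.a * hf - 2 * Q.f * hb - Q.e * hd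

/-- The level of a ternary form is divisible by four: in the product `A B = L` of even symmetric
matrices of size three the products of corresponding off-diagonal entries are even. -/
lemma HasLevel.four_dvd {L : ℤ} (hQ : Q.IsPos) (hL : Q.HasLevel L) : 4 ∣ L := by
  obtain ⟨B, e11, e22, e33, e12⟩ := hL.exists_inverse hQ
  have h1 : Even (Q.d * B.d * (Q.e * B.e)) := by
    have h2 : Even (Q.e * B.d) := ⟨-(Q.a * B.f) - Q.f * B.b, by linarith⟩
    have h3 : Q.d * B.d * (Q.e * B.e) = Q.e * B.d * (Q.d * B.e) := by ring
    rw [h3]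
    exact h2.mul_right _
  rw [Int.even_mul] at h1
  generalize Q.d * B.d = x at *
  generalize Q.e * B.e = y at *
  generalize Q.f * B.f = z at *
  generalize Q.a * B.a = u at *
  generalize Q.b * B.b = v at *
  generalize Q.c * B.c = w at *
  rcases h1 with ⟨k, hk⟩ | ⟨k, hk⟩ <;> omega

/-- The determinants in `A B = L` multiply. -/
lemma HasLevel.det_dvd {L : ℤ} (hQ : Q.IsPos) (hL : Q.HasLevel L) : Q.det ∣ L ^ 3 := by
  obtain ⟨B, ha, hb, hc, hd, he, hf⟩ := hL.exists_dual
  have hdet := hQ.det_pos.ne'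
  refine ⟨B.det, ?_⟩
  have h1 : (2 * Q.det) ^ 3 * B.det = L ^ 3 * Q.adj.det := by
    have : (2 * Q.det) ^ 3 * B.det = 8 * (2 * Q.det * B.a) * (2 * Q.det * B.b) * (2 * Q.det * B.c)
      + 2 * (2 * Q.det * B.d) * (2 * Q.det * B.e) * (2 * Q.det * B.f) - 2 * (2 * Q.det * B.a) * (2 * Q.det * B.d) ^ 2
      - 2 * (2 * Q.det * B.b) * (2 * Q.det * B.e) ^ 2 - 2 * (2 * Q.det * B.c) * (2 * Q.det * B.f) ^ 2 := by
      rw [det.eq_def B]; ring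
    rw [this, ← ha, ← hb, ← hc, ← hd, ← he, ← hf, det.eq_def Q.adj]
    ring
  have h2 : Q.adj.det = 8 * Q.det ^ 2 := by simp only [adj, det]; ring
  rw [h2] at h1
  refine mul_left_cancel₀ (mul_ne_zero (by norm_num : (8 : ℤ) ≠ 0) (pow_ne_zero 2 hdet)) ?_
  linear_combination -h1

end TernaryForm

/-! ### Gauss sums modulo primes -/

section GaussSums

variable (p : ℕ) [hp : Fact p.Prime]

/-- The quadratic Gauss sum of one variable. -/
def quadGauss (t : ZMod p) : ℂ := ∑ x : ZMod p, ZMod.stdAddChar (t * x ^ 2)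

variable {p}

/-- The Gauss sum is the sum of the quadratic character against the additive character. -/
lemma quadGauss_eq (h2 : p ≠ 2) {t : ZMod p} (ht : t ≠ 0) :
    quadGauss p t = (quadraticChar (ZMod p) t : ℂ) * quadGauss p 1 := by
  have hchar : ringChar (ZMod p) ≠ 2 := by rwa [ZMod.ringChar_zmod_n]
  have hprim : (ZMod.stdAddChar (N := p)).IsPrimitive := ZMod.isPrimitive_stdAddChar p
  have h1 : ∀ t : ZMod p, t ≠ 0 → quadGauss p t =
      ∑ u : ZMod p, (quadraticChar (ZMod p) u : ℂ) * ZMod.stdAddChar (t * u) := by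
    intro t ht
    have h2 : quadGauss p t = ∑ u : ZMod p, ((quadraticChar (ZMod p) u : ℂ) + 1) * ZMod.stdAddChar (t * u) := by
      rw [quadGauss, ← Finset.sum_fiberwise (s := Finset.univ) (g := fun x : ZMod p => x ^ 2)]
      refine Finset.sum_congr rfl fun u _ => ?_
      have h3 := quadraticChar_card_sqrts hchar u
      rw [Finset.sum_congr rfl (g := fun _ => ZMod.stdAddChar (t * u)) (by
        intro x hx; rw [(Finset.mem_filter.1 hx).2]), Finset.sum_const, nsmul_eq_mul]
      congr 1
      have h4 : (((Finset.univ.filter fun x : ZMod p => x ^ 2 = u).card : ℕ) : ℤ)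
          = quadraticChar (ZMod p) u + 1 := by
        rw [← h3]
        congr 2
        ext x; simp
      exact_mod_cast congrArg (Int.cast : ℤ → ℂ) h4
    rw [h2]
    simp only [add_mul, one_mul, Finset.sum_add_distrib]
    have h5 : ∑ u : ZMod p, ZMod.stdAddChar (t * u) = (0 : ℂ) := by
      have := AddChar.sum_mulShift t hprim
      rw [if_neg ht] at this
      rw [← Nat.cast_zero, ← this]
      exact Finset.sum_congr rfl fun u _ => by rw [mul_comm]
    rw [h5, add_zero]
  rw [h1 t ht, h1 1 one_ne_zero, ← Equiv.sum_comp (Equiv.mulLeft₀ t ht)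
    (fun u => (quadraticChar (ZMod p) u : ℂ) * ZMod.stdAddChar (1 * u)), Finset.mul_sum]
  refine Finset.sum_congr rfl fun u _ => ?_
  change _ = (quadraticChar (ZMod p) t : ℂ) * (((quadraticChar (ZMod p) (t * u) : ℤ) : ℂ) * ZMod.stdAddChar (1 * (t * u)))
  rw [one_mul, map_mul (quadraticChar (ZMod p)), Int.cast_mul, ← mul_assoc, ← mul_assoc]
  have : (quadraticChar (ZMod p) t : ℂ) * quadraticChar (ZMod p) t = 1 := by
    have := quadraticChar_sq_one ht
    rw [sq] at this
    exact_mod_cast this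
  rw [this, one_mul]

lemma quadGauss_ne_zero (h2 : p ≠ 2) : quadGauss p 1 ≠ 0 := by
  intro h0
  -- otherwise all non-trivial values vanish, and Fourier inversion gives a contradiction
  have h1 : ∀ t : ZMod p, t ≠ 0 → quadGauss p t = 0 := fun t ht => by
    rw [quadGauss_eq h2 ht, h0, mul_zero]
  have h3 : ∑ t : ZMod p, quadGauss p t = p := by
    simp only [quadGauss]
    rw [Finset.sum_comm]
    have hprim : (ZMod.stdAddChar (N := p)).IsPrimitive := ZMod.isPrimitive_stdAddChar p
    have h4 : ∀ x : ZMod p, ∑ t : ZMod p, ZMod.stdAddChar (t * x ^ 2) = if x = 0 then (p : ℂ) else 0 := by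
      intro x
      rw [AddChar.sum_mulShift _ hprim]
      simp [ZMod.card]
    simp only [h4]
    simp
  rw [Finset.sum_eq_single 0 (fun t _ ht => h1 t ht) (by simp)] at h3
  have h5 : quadGauss p 0 = p := by simp [quadGauss, ZMod.card]
  -- both sums equal `p`, so the count is exact; compare with a non-square
  have hchar : ringChar (ZMod p) ≠ 2 := by rwa [ZMod.ringChar_zmod_n]
  have h6 : ∑ t : ZMod p, ZMod.stdAddChar (-t) * quadGauss p t = 2 * p := by
    simp only [quadGauss, Finset.mul_sum]
    rw [Finset.sum_comm]
    have hprim : (ZMod.stdAddChar (N := p)).IsPrimitive := ZMod.isPrimitive_stdAddChar p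
    have h4 : ∀ x : ZMod p, ∑ t : ZMod p, ZMod.stdAddChar (-t) * ZMod.stdAddChar (t * x ^ 2)
        = if x ^ 2 = 1 then (p : ℂ) else 0 := by
      intro x
      have := AddChar.sum_mulShift (x ^ 2 - 1) hprim
      rw [ZMod.card] at this
      have h7 : ∀ t : ZMod p, ZMod.stdAddChar (-t) * ZMod.stdAddChar (t * x ^ 2)
          = (ZMod.stdAddChar (t * (x ^ 2 - 1)) : ℂ) := by
        intro t
        rw [← AddChar.map_add_eq_mul]
        congr 1; ring
      simp only [h7, this, sub_eq_zero]
      split_ifs <;> simp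
    simp only [h4]
    rw [← Finset.sum_filter, Finset.sum_const, nsmul_eq_mul]
    have h8 := quadraticChar_card_sqrts hchar (1 : ZMod p)
    rw [map_one] at h8
    have h9 : (Finset.univ.filter fun x : ZMod p => x ^ 2 = 1).card = 2 := by
      have : (Finset.univ.filter fun x : ZMod p => x ^ 2 = 1) = {x : ZMod p | x ^ 2 = 1}.toFinset := by
        ext x; simp
      rw [this]
      exact_mod_cast h8
    rw [h9]
    norm_num
  rw [Finset.sum_eq_single 0 (fun t _ ht => by rw [h1 t ht, mul_zero]) (by simp), h5] at h6
  have hp0 : (p : ℂ) ≠ 0 := by exact_mod_cast hp.out.ne_zero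
  have : (p : ℂ) = 2 * p := by simpa using h6
  apply hp0
  linear_combination -this

end GaussSums

namespace TernaryForm

/-- The Gauss sum of a form that is diagonalised modulo `p`. -/
lemma gaussSum_of_diagonal {p : ℕ} [hp : Fact p.Prime] (h2 : p ≠ 2) {Q : TernaryForm} {r : ℤ}
    (hr : (r : ZMod p) ≠ 0) {α β γ : ZMod p} (hα : α ≠ 0) (hβ : β ≠ 0) (hγ : γ ≠ 0)
    (T : ZMod p × ZMod p × ZMod p → ZMod p × ZMod p × ZMod p) (hT : Function.Injective T)
    (hQ : ∀ x, Q.eval x = α * (T x).1 ^ 2 + β * (T x).2.1 ^ 2 + γ * (T x).2.2 ^ 2) :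
    Q.gaussSum p r 0 = (quadraticChar (ZMod p) (r * (α * β * γ)) : ℂ) * quadGauss p 1 ^ 3 := by
  have h1 : Q.gaussSum p r 0 = ∑ x : ZMod p × ZMod p × ZMod p, ZMod.stdAddChar
      ((r : ZMod p) * (α * x.1 ^ 2 + β * x.2.1 ^ 2 + γ * x.2.2 ^ 2)) := by
    rw [gaussSum, ← Equiv.sum_comp (Equiv.ofBijective T (Finite.injective_iff_bijective.1 hT))
      (fun x => (ZMod.stdAddChar ((r : ZMod p) * (α * x.1 ^ 2 + β * x.2.1 ^ 2 + γ * x.2.2 ^ 2)) : ℂ))]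
    refine Finset.sum_congr rfl fun x _ => ?_
    rw [hQ, Equiv.ofBijective_apply]
    congr 1
    simp [dot, castVec]
  have h3 : ∀ x : ZMod p × ZMod p × ZMod p, (ZMod.stdAddChar
      ((r : ZMod p) * (α * x.1 ^ 2 + β * x.2.1 ^ 2 + γ * x.2.2 ^ 2)) : ℂ) =
      ZMod.stdAddChar ((r : ZMod p) * α * x.1 ^ 2) * (ZMod.stdAddChar ((r : ZMod p) * β * x.2.1 ^ 2)
        * ZMod.stdAddChar ((r : ZMod p) * γ * x.2.2 ^ 2)) := by
    intro x
    rw [← AddChar.map_add_eq_mul, ← AddChar.map_add_eq_mul]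
    congr 1; ring
  have h4 : Q.gaussSum p r 0 = quadGauss p (r * α) * (quadGauss p (r * β) * quadGauss p (r * γ)) := by
    rw [h1]
    simp only [h3, quadGauss]
    simp only [Fintype.sum_prod_type, ← Finset.mul_sum, ← Finset.sum_mul]
  rw [h4, quadGauss_eq h2 (mul_ne_zero hr hα), quadGauss_eq h2 (mul_ne_zero hr hβ),
    quadGauss_eq h2 (mul_ne_zero hr hγ)]
  have h5 : quadraticChar (ZMod p) (r * (α * β * γ)) = quadraticChar (ZMod p) (r * α)
      * quadraticChar (ZMod p) (r * β) * quadraticChar (ZMod p) (r * γ) := by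
    rw [← map_mul, ← map_mul]
    have : (r : ZMod p) * α * (r * β) * (r * γ) = (r * (α * β * γ)) * r ^ 2 := by ring
    rw [this, map_mul (quadraticChar (ZMod p)) (r * (α * β * γ)) (r ^ 2), quadraticChar_sq_one' hr, mul_one]
  rw [h5]
  push_cast
  ring

lemma gaussSum_sumThreeSquares {p : ℕ} [hp : Fact p.Prime] (h2 : p ≠ 2) {r : ℤ}
    (hr : (r : ZMod p) ≠ 0) :
    sumThreeSquares.gaussSum p r 0 = (quadraticChar (ZMod p) r : ℂ) * quadGauss p 1 ^ 3 := by
  rw [gaussSum_of_diagonal h2 hr one_ne_zero one_ne_zero one_ne_zero id Function.injective_id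
    (by intro x; simp [sumThreeSquares, eval])]
  simp

lemma gaussSum_sumThreeSquares_ne_zero {p : ℕ} [hp : Fact p.Prime] (h2 : p ≠ 2) {r : ℤ}
    (hr : (r : ZMod p) ≠ 0) : sumThreeSquares.gaussSum p r 0 ≠ 0 := by
  rw [gaussSum_sumThreeSquares h2 hr]
  refine mul_ne_zero ?_ (pow_ne_zero 3 (quadGauss_ne_zero h2))
  exact_mod_cast (quadraticChar_eq_zero_iff.not.2 hr)

/-- The Gauss sums of `Q` modulo almost all primes `p` differ from those of the sum of three squares
by the factor `(ω / p)`. -/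
def HasGaussCharacter (Q : TernaryForm) (ω : ℤ) : Prop :=
  ∃ C : ℕ, C ≠ 0 ∧ ∀ (p : ℕ) [Fact p.Prime], ¬ p ∣ C → ∀ r : ℤ, (r : ZMod p) ≠ 0 →
    Q.gaussSum p r 0 = (quadraticChar (ZMod p) ω : ℂ) * sumThreeSquares.gaussSum p r 0

end TernaryForm

/-- The norm forms of orders in `(a, b / ℚ)` are diagonalised by `i, j, k`, with coefficients
`-a, -b, ab` whose product is a square. -/
lemma IsNormForm.hasGaussCharacter {a b : ℚ} (ha : a ≠ 0) (hb : b ≠ 0) {R : Subring (𝔹 a b)}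
    {ω : ℕ} (hω : ω ≠ 0) {Q : TernaryForm} (hdet : Q.det ≠ 0) (h : IsNormForm ω R Q) :
    Q.HasGaussCharacter ω := by
  obtain ⟨M, m, hM, hm, hMdet⟩ := h.det_eq
  have hm0 : m ≠ 0 := by
    rintro rfl
    have h1 : (Q.det : ℚ) * ω ^ 3 ≠ 0 := mul_ne_zero (by exact_mod_cast hdet) (pow_ne_zero 3 (by exact_mod_cast hω))
    exact h1 (by rw [hMdet]; ring)
  have ha' : a * (a.den : ℚ) = a.num := Rat.mul_den_eq_num a
  have hb' : b * (b.den : ℚ) = b.num := Rat.mul_den_eq_num b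
  have dA : (a.den : ℚ) ≠ 0 := by exact_mod_cast a.den_nz
  have dB : (b.den : ℚ) ≠ 0 := by exact_mod_cast b.den_nz
  have nA : a.num ≠ 0 := Rat.num_ne_zero.2 ha
  have nB : b.num ≠ 0 := Rat.num_ne_zero.2 hb
  -- a common denominator `D` of the entries of `M`
  obtain ⟨D, hD, N, hN⟩ : ∃ D : ℕ, D ≠ 0 ∧ ∃ N : Fin 3 → Fin 3 → ℤ, ∀ i j, M i j * D = N i j := by
    refine ⟨∏ i, ∏ j, (M i j).den, Finset.prod_ne_zero_iff.2 fun i _ => Finset.prod_ne_zero_iff.2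
      fun j _ => (M i j).den_nz, ?_⟩
    have : ∀ i j, ∃ k : ℤ, M i j * ((∏ i, ∏ j, (M i j).den : ℕ) : ℚ) = k := by
      intro i j
      obtain ⟨c, hc⟩ : (M i j).den ∣ ∏ i, ∏ j, (M i j).den :=
        (Finset.dvd_prod_of_mem (fun j => (M i j).den) (Finset.mem_univ j)).trans
          (Finset.dvd_prod_of_mem (fun i => ∏ j, (M i j).den) (Finset.mem_univ i))
      refine ⟨(M i j).num * c, ?_⟩
      rw [hc]
      push_cast
      rw [← mul_assoc, Rat.mul_den_eq_num]
    choose N hN using this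
    exact ⟨N, hN⟩
  have hDQ : (D : ℚ) ≠ 0 := by exact_mod_cast hD
  set δ : ℤ := N 0 0 * (N 1 1 * N 2 2 - N 1 2 * N 2 1) - N 0 1 * (N 1 0 * N 2 2 - N 1 2 * N 2 0)
        + N 0 2 * (N 1 0 * N 2 1 - N 1 1 * N 2 0) with hδ
  have hδ' : (δ : ℚ) = m * D ^ 3 := by
    rw [hδ, hm]; push_cast; simp only [← hN]; ring
  have hδ0 : δ ≠ 0 := by
    have : (δ : ℚ) ≠ 0 := by rw [hδ']; exact mul_ne_zero hm0 (pow_ne_zero 3 hDQ)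
    exact_mod_cast this
  refine ⟨2 * a.num.natAbs * b.num.natAbs * a.den * b.den * D * ω * δ.natAbs, by simp [ha, hb, hD, hω, hδ0], ?_⟩
  intro p hp hpC r hr
  have hpC' : ∀ k : ℕ, k ∣ 2 * a.num.natAbs * b.num.natAbs * a.den * b.den * D * ω * δ.natAbs → (k : ZMod p) ≠ 0 :=
    fun k hk h0 => hpC (((ZMod.natCast_eq_zero_iff k p).1 h0).trans hk)
  have hint : ∀ k : ℤ, k.natAbs ∣ 2 * a.num.natAbs * b.num.natAbs * a.den * b.den * D * ω * δ.natAbs → (k : ZMod p) ≠ 0 := by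
    intro k hk h0
    refine hpC' _ hk ?_
    rw [ZMod.natCast_eq_zero_iff, ← Int.natCast_dvd, ← ZMod.intCast_zmod_eq_zero_iff_dvd _ p]
    exact h0
  have h2 : p ≠ 2 := by
    rintro rfl
    exact hpC ⟨a.num.natAbs * b.num.natAbs * a.den * b.den * D * ω * δ.natAbs, by ring⟩
  have qA : (a.num : ZMod p) ≠ 0 := hint _ ⟨2 * b.num.natAbs * a.den * b.den * D * ω * δ.natAbs, by ring⟩
  have qB : (b.num : ZMod p) ≠ 0 := hint _ ⟨2 * a.num.natAbs * a.den * b.den * D * ω * δ.natAbs, by ring⟩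
  have qδ : (δ : ZMod p) ≠ 0 := hint _ ⟨2 * a.num.natAbs * b.num.natAbs * a.den * b.den * D * ω, by ring⟩
  have eA : (a.den : ZMod p) ≠ 0 := hpC' _ ⟨2 * a.num.natAbs * b.num.natAbs * b.den * D * ω * δ.natAbs, by ring⟩
  have eB : (b.den : ZMod p) ≠ 0 := hpC' _ ⟨2 * a.num.natAbs * b.num.natAbs * a.den * D * ω * δ.natAbs, by ring⟩
  have eD : (D : ZMod p) ≠ 0 := hpC' _ ⟨2 * a.num.natAbs * b.num.natAbs * a.den * b.den * ω * δ.natAbs, by ring⟩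
  have eω : (ω : ZMod p) ≠ 0 := hpC' _ ⟨2 * a.num.natAbs * b.num.natAbs * a.den * b.den * D * δ.natAbs, by ring⟩
  -- the diagonalisation over the integers
  have hdiag : ∀ x : ℤ × ℤ × ℤ, (a.den * b.den * D ^ 2 * ω : ℤ) * Q.eval x =
      -a.num * b.den * (N 0 0 * x.1 + N 0 1 * x.2.1 + N 0 2 * x.2.2) ^ 2
        - b.num * a.den * (N 1 0 * x.1 + N 1 1 * x.2.1 + N 1 2 * x.2.2) ^ 2
        + a.num * b.num * (N 2 0 * x.1 + N 2 1 * x.2.1 + N 2 2 * x.2.2) ^ 2 := by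
    intro x
    have h1 := hM x
    have h3 : (a.den * b.den * D ^ 2 : ℚ) * (ω * (Q.eval x : ℤ)) = _ := congrArg (fun t => (a.den * b.den * D ^ 2 : ℚ) * t) h1
    have h4 : ((a.den * b.den * D ^ 2 * ω : ℤ) * Q.eval x : ℚ) =
      -a.num * b.den * (N 0 0 * x.1 + N 0 1 * x.2.1 + N 0 2 * x.2.2) ^ 2
        - b.num * a.den * (N 1 0 * x.1 + N 1 1 * x.2.1 + N 1 2 * x.2.2) ^ 2
        + a.num * b.num * (N 2 0 * x.1 + N 2 1 * x.2.1 + N 2 2 * x.2.2) ^ 2 := by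
      simp only [← hN, ← ha', ← hb']
      push_cast
      linear_combination h3
    exact_mod_cast h4
  have hdiag' : ∀ x : ZMod p × ZMod p × ZMod p, (a.den * b.den * D ^ 2 * ω : ZMod p) * Q.eval x =
      -a.num * b.den * (N 0 0 * x.1 + N 0 1 * x.2.1 + N 0 2 * x.2.2) ^ 2
        - b.num * a.den * (N 1 0 * x.1 + N 1 1 * x.2.1 + N 1 2 * x.2.2) ^ 2
        + a.num * b.num * (N 2 0 * x.1 + N 2 1 * x.2.1 + N 2 2 * x.2.2) ^ 2 := by
    rintro ⟨x, y, z⟩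
    obtain ⟨x, rfl⟩ := ZMod.intCast_surjective x
    obtain ⟨y, rfl⟩ := ZMod.intCast_surjective y
    obtain ⟨z, rfl⟩ := ZMod.intCast_surjective z
    have h1 := congrArg (Int.cast : ℤ → ZMod p) (hdiag (x, y, z))
    push_cast at h1
    rw [← TernaryForm.eval_castVec] at h1
    exact h1
  set κ : ZMod p := (a.den * b.den * D ^ 2 * ω : ZMod p)⁻¹ with hκ
  have hκ0 : (a.den * b.den * D ^ 2 * ω : ZMod p) ≠ 0 :=
    mul_ne_zero (mul_ne_zero (mul_ne_zero eA eB) (pow_ne_zero 2 eD)) eω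
  have hκ1 : κ ≠ 0 := inv_ne_zero hκ0
  have key := TernaryForm.gaussSum_of_diagonal (Q := Q) h2 hr (α := κ * (-a.num * b.den))
    (β := κ * (-(b.num * a.den))) (γ := κ * (a.num * b.num))
    (mul_ne_zero hκ1 (mul_ne_zero (neg_ne_zero.2 qA) eB)) (mul_ne_zero hκ1 (neg_ne_zero.2 (mul_ne_zero qB eA)))
    (mul_ne_zero hκ1 (mul_ne_zero qA qB))
    (fun x => (N 0 0 * x.1 + N 0 1 * x.2.1 + N 0 2 * x.2.2, N 1 0 * x.1 + N 1 1 * x.2.1 + N 1 2 * x.2.2,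
      N 2 0 * x.1 + N 2 1 * x.2.1 + N 2 2 * x.2.2)) ?_ ?_
  · have h5 : (r : ZMod p) * (κ * (-a.num * b.den) * (κ * (-(b.num * a.den))) * (κ * (a.num * b.num)))
        = (ω : ℤ) * r * (κ ^ 2 * (a.num * b.num * D * a.den * b.den)) ^ 2 := by
      have h6 : (a.den * b.den * D ^ 2 * ω : ZMod p) * κ = 1 := mul_inv_cancel₀ hκ0
      push_cast
      linear_combination -(r * κ ^ 3 * a.num ^ 2 * b.num ^ 2 * a.den * b.den : ZMod p) * h6
    rw [key, TernaryForm.gaussSum_sumThreeSquares h2 hr, h5, map_mul _ (((ω : ℤ) : ZMod p) * r),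
      quadraticChar_sq_one', mul_one, map_mul, Int.cast_mul, mul_assoc]
    exact mul_ne_zero (pow_ne_zero 2 hκ1) (mul_ne_zero (mul_ne_zero (mul_ne_zero (mul_ne_zero qA qB) eD) eA) eB)
  · -- injectivity, by the adjugate matrix
    rintro ⟨x, y, z⟩ ⟨x', y', z'⟩ h
    simp only [Prod.mk.injEq] at h
    obtain ⟨e1, e2, e3⟩ := h
    have hδp : (δ : ZMod p) = N 0 0 * (N 1 1 * N 2 2 - N 1 2 * N 2 1) - N 0 1 * (N 1 0 * N 2 2 - N 1 2 * N 2 0)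
        + N 0 2 * (N 1 0 * N 2 1 - N 1 1 * N 2 0) := by rw [hδ]; push_cast; ring
    refine Prod.ext ?_ (Prod.ext ?_ ?_) <;> refine mul_left_cancel₀ qδ ?_ <;> rw [hδp]
    · linear_combination (N 1 1 * N 2 2 - N 1 2 * N 2 1 : ZMod p) * e1 - (N 0 1 * N 2 2 - N 0 2 * N 2 1 : ZMod p) * e2
        + (N 0 1 * N 1 2 - N 0 2 * N 1 1 : ZMod p) * e3
    · linear_combination -(N 1 0 * N 2 2 - N 1 2 * N 2 0 : ZMod p) * e1 + (N 0 0 * N 2 2 - N 0 2 * N 2 0 : ZMod p) * e2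
        - (N 0 0 * N 1 2 - N 0 2 * N 1 0 : ZMod p) * e3
    · linear_combination (N 1 0 * N 2 1 - N 1 1 * N 2 0 : ZMod p) * e1 - (N 0 0 * N 2 1 - N 0 1 * N 2 0 : ZMod p) * e2
        + (N 0 0 * N 1 1 - N 0 1 * N 1 0 : ZMod p) * e3
  · intro x
    have := hdiag' x
    refine mul_left_cancel₀ hκ0 ?_
    rw [this]
    have h6 : (a.den * b.den * D ^ 2 * ω : ZMod p) * κ = 1 := mul_inv_cancel₀ hκ0
    linear_combination -(-a.num * b.den * (N 0 0 * x.1 + N 0 1 * x.2.1 + N 0 2 * x.2.2) ^ 2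
        - b.num * a.den * (N 1 0 * x.1 + N 1 1 * x.2.1 + N 1 2 * x.2.2) ^ 2
        + a.num * b.num * (N 2 0 * x.1 + N 2 1 * x.2.1 + N 2 2 * x.2.2) ^ 2 : ZMod p) * h6

/-! ### The character -/

lemma thetaFactor_ne_zero (γ : SL(2, ℤ)) (z : UpperHalfPlane) : thetaFactor γ z ≠ 0 :=
  div_ne_zero (shimuraTheta_ne_zero _) (shimuraTheta_ne_zero _)

lemma thetaFactor_mul (γ γ' : SL(2, ℤ)) (z : UpperHalfPlane) :
    thetaFactor (γ * γ') z = thetaFactor γ (γ' • z) * thetaFactor γ' z := by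
  have h1 := shimuraTheta_ne_zero z
  have h2 := shimuraTheta_ne_zero (γ' • z)
  rw [thetaFactor, thetaFactor, thetaFactor, mul_smul]
  field_simp

lemma coe_T_zpow_smul (k : ℤ) (z : UpperHalfPlane) :
    ((ModularGroup.T ^ k • z : UpperHalfPlane) : ℂ) = k + z := by
  rw [UpperHalfPlane.modular_T_zpow_smul, UpperHalfPlane.coe_vadd]
  norm_cast

lemma mul_T_zpow_apply (γ : SL(2, ℤ)) (k : ℤ) :
    (γ * ModularGroup.T ^ k) 0 0 = γ 0 0 ∧ (γ * ModularGroup.T ^ k) 1 0 = γ 1 0 ∧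
      (γ * ModularGroup.T ^ k) 1 1 = γ 1 1 + k * γ 1 0 := by
  have h : ((γ * ModularGroup.T ^ k : SL(2, ℤ)) : Matrix (Fin 2) (Fin 2) ℤ) =
      (γ : Matrix (Fin 2) (Fin 2) ℤ) * !![1, k; 0, 1] := by
    rw [Matrix.SpecialLinearGroup.coe_mul, ModularGroup.coe_T_zpow]
  refine ⟨?_, ?_, ?_⟩
  · rw [h]; simp [Matrix.mul_apply, Fin.sum_univ_two]
  · rw [h]; simp [Matrix.mul_apply, Fin.sum_univ_two]
  · rw [h]; simp [Matrix.mul_apply, Fin.sum_univ_two]; ring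

namespace TernaryForm

open Complex Real

variable {Q : TernaryForm}

lemma theta_add_int (Q : TernaryForm) (k : ℤ) (z : ℂ) : Q.theta (k + z) = Q.theta z := by
  refine tsum_congr fun x => ?_
  have h := Complex.exp_int_mul_two_pi_mul_I (k * Q.eval x)
  have e : 2 * π * I * (k + z) * (Q.eval x : ℤ) = 2 * π * I * z * (Q.eval x : ℤ)
      + ((k * Q.eval x : ℤ) : ℂ) * (2 * π * I) := by push_cast; ring
  rw [e, Complex.exp_add, h, mul_one]

lemma thetaFactor_T_zpow (k : ℤ) (z : UpperHalfPlane) : thetaFactor (ModularGroup.T ^ k) z = 1 := by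
  rw [thetaFactor]
  have h : shimuraTheta (ModularGroup.T ^ k • z) = shimuraTheta z := by
    rw [shimuraTheta, shimuraTheta, coe_T_zpow_smul]
    refine tsum_congr fun n => ?_
    have h := Complex.exp_int_mul_two_pi_mul_I (n ^ 2 * k)
    have e : π * I * (n : ℂ) ^ 2 * (2 * (k + z)) = π * I * (n : ℂ) ^ 2 * (2 * z)
        + ((n ^ 2 * k : ℤ) : ℂ) * (2 * π * I) := by push_cast; ring
    rw [e, Complex.exp_add, h, mul_one]
  rw [h, div_self (shimuraTheta_ne_zero z)]

lemma theta_I_ne_zero (hQ : Q.IsPos) : Q.theta (UpperHalfPlane.I : ℂ) ≠ 0 := by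
  have h : Q.theta (UpperHalfPlane.I : ℂ) = ((∑' x : ℤ × ℤ × ℤ, rexp (-(2 * π) * (Q.eval x : ℤ)) : ℝ) : ℂ) := by
    rw [theta, Complex.ofReal_tsum]
    refine tsum_congr fun x => ?_
    rw [Complex.ofReal_exp]
    congr 1
    rw [UpperHalfPlane.coe_I]
    push_cast
    linear_combination 2 * π * (Q.eval x : ℤ) * Complex.I_mul_I
  rw [h]
  exact_mod_cast ((summable_gaussian hQ (t := 2 * π) (by positivity)).tsum_pos
    (fun _ => (Real.exp_pos _).le) 0 (Real.exp_pos _)).ne'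

/-- The theta series transforms under `γ` as the third power of Shimura's theta series,
up to the factor `ε`. -/
def TransformsWith (Q : TernaryForm) (γ : SL(2, ℤ)) (ε : ℂ) : Prop :=
  ∀ z : UpperHalfPlane, Q.theta (γ • z : UpperHalfPlane) = ε * thetaFactor γ z ^ 3 * Q.theta z

lemma TransformsWith.unique (hQ : Q.IsPos) {γ : SL(2, ℤ)} {ε ε' : ℂ} (h : Q.TransformsWith γ ε)
    (h' : Q.TransformsWith γ ε') : ε = ε' := by
  have h1 := (h UpperHalfPlane.I).symm.trans (h' UpperHalfPlane.I)
  exact mul_right_cancel₀ (pow_ne_zero 3 (thetaFactor_ne_zero γ _))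
    (mul_right_cancel₀ (theta_I_ne_zero hQ) h1)

lemma transformsWith_mul_T_zpow {γ : SL(2, ℤ)} {k : ℤ} {ε : ℂ} :
    Q.TransformsWith (γ * ModularGroup.T ^ k) ε ↔ Q.TransformsWith γ ε := by
  have key : ∀ z : UpperHalfPlane, Q.theta (ModularGroup.T ^ k • z : UpperHalfPlane) = Q.theta z := by
    intro z; rw [coe_T_zpow_smul, theta_add_int]
  constructor
  · intro h z
    have := h (ModularGroup.T ^ (-k) • z)
    rwa [thetaFactor_mul, mul_smul, ← mul_smul (ModularGroup.T ^ k), ← zpow_add, add_neg_cancel, zpow_zero, one_smul,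
      thetaFactor_T_zpow, mul_one, ← key (ModularGroup.T ^ (-k) • z), ← mul_smul (ModularGroup.T ^ k),
      ← zpow_add, add_neg_cancel, zpow_zero, one_smul] at this
  · intro h z
    rw [mul_smul, h, thetaFactor_mul, thetaFactor_T_zpow, mul_one, key]

/-- The data that determine the behaviour of a theta series under `Γ₀(L)`. -/
structure HasNebentypus (Q : TernaryForm) (L D : ℕ) : Prop where
  isPos : Q.IsPos
  level_ne_zero : L ≠ 0
  hasLevel : Q.HasLevel L
  hasGaussCharacter : Q.HasGaussCharacter D
  dvd_level : ∀ p : ℕ, p.Prime → p ∣ D → p ∣ L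
  char_ne_zero : D ≠ 0

namespace HasNebentypus

variable {L D : ℕ} (h : Q.HasNebentypus L D)

include h

lemma four_dvd : 4 ∣ L := by exact_mod_cast h.hasLevel.four_dvd h.isPos

/-- The transformation under a matrix whose lower right entry is a large prime. -/
lemma transformsWith_of_prime : ∃ C : ℕ, ∀ p : ℕ, p.Prime → C < p →
    ∀ γ : SL(2, ℤ), (L : ℤ) ∣ γ 1 0 → γ 1 1 = p → Q.TransformsWith γ (jacobiSym D p : ℂ) := by
  obtain ⟨C, hC, hG⟩ := h.hasGaussCharacter
  refine ⟨2 * C, fun p hp hpC γ hγ hd z => ?_⟩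
  have : Fact p.Prime := ⟨hp⟩
  have h2 : p ≠ 2 := by have := Nat.pos_of_ne_zero hC; omega
  have hr : ((γ 0 1 : ℤ) : ZMod p) ≠ 0 := by
    intro h0
    have h3 := γ.det_coe
    rw [Matrix.det_fin_two, hd] at h3
    have h4 := congrArg (Int.cast : ℤ → ZMod p) h3
    push_cast at h4
    rw [h0, ZMod.natCast_self] at h4
    simp at h4
  have e1 := theta_smul h.isPos (by exact_mod_cast h.four_dvd) h.hasLevel γ hγ p hd z
  rw [hG p (fun hdvd => absurd (Nat.le_of_dvd (Nat.pos_of_ne_zero hC) hdvd) (by omega)) _ hr] at e1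
  have e2 : jacobiSym D p = quadraticChar (ZMod p) (D : ℤ) := by
    rw [← jacobiSym.legendreSym.to_jacobiSym]; rfl
  rw [e2]
  refine mul_right_cancel₀ (gaussSum_sumThreeSquares_ne_zero h2 hr) ?_
  rw [e1]; ring

/-- Right multiplication by a translation turns a matrix with lower row `L, p` into one with lower
row `L, p + k L`, and does not change the factor of the theta series. -/
lemma jacobiSym_eq_of_primes : ∃ C : ℕ, ∀ p p' : ℕ, p.Prime → p'.Prime → C < p → C < p' → p.Coprime L →
    p ≡ p' [MOD L] → jacobiSym D p = jacobiSym D p' := by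
  obtain ⟨C, hC⟩ := h.transformsWith_of_prime
  refine ⟨C, fun p p' hp hp' hpC hpC' hcop hmod => ?_⟩
  obtain ⟨x, y, hxy⟩ := Int.isCoprime_iff_gcd_eq_one.2 (by exact_mod_cast hcop : Int.gcd (p : ℤ) (L : ℤ) = 1)
  let γ : SL(2, ℤ) := ⟨!![x, -y; (L : ℤ), p], by rw [Matrix.det_fin_two_of]; linarith⟩
  obtain ⟨k, hk⟩ := (Nat.modEq_iff_dvd.1 hmod : (L : ℤ) ∣ p' - p)
  have h1 := hC p hp hpC γ (dvd_refl _) rfl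
  have h2 := hC p' hp' hpC' (γ * ModularGroup.T ^ k) (by rw [(mul_T_zpow_apply γ k).2.1]; exact dvd_refl _)
    (by rw [(mul_T_zpow_apply γ k).2.2]; change (p : ℤ) + k * L = p'; linarith)
  have := h1.unique h.isPos (transformsWith_mul_T_zpow.1 h2)
  exact_mod_cast this

/-- The symbol `(D / n)` depends only on `n` modulo `L`. -/
lemma jacobiSym_periodic {n n' : ℕ} (hn : n.Coprime L) (hn' : n'.Coprime L) (hmod : n ≡ n' [MOD L]) :
    jacobiSym D n = jacobiSym D n' := by
  obtain ⟨C, hC⟩ := h.jacobiSym_eq_of_primes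
  have hD := h.char_ne_zero
  have hL := h.level_ne_zero
  have hex : ∀ n : ℕ, n.Coprime L → ∃ p > C, p.Prime ∧ p ≡ n [MOD L] ∧ jacobiSym D p = jacobiSym D n := by
    intro n hn
    have hodd : Odd n := by
      rw [← Nat.not_even_iff_odd, even_iff_two_dvd]
      intro h2
      have : 2 ∣ Nat.gcd n L := Nat.dvd_gcd h2 ((by norm_num : 2 ∣ 4).trans h.four_dvd)
      rw [hn] at this
      omega
    have hcop : n.Coprime (4 * D * L) := by
      refine Nat.Coprime.mul_right (Nat.Coprime.mul_right ?_ ?_) hn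
      · exact hn.coprime_dvd_right h.four_dvd
      · refine Nat.Coprime.symm (Nat.coprime_of_dvd fun p hp hpD hpn => ?_)
        have : p ∣ Nat.gcd n L := Nat.dvd_gcd hpn (h.dvd_level p hp hpD)
        rw [hn] at this
        exact hp.one_lt.ne' (Nat.dvd_one.1 this)
    have : NeZero (4 * D * L) := ⟨by positivity⟩
    obtain ⟨p, hpC, hp, hpn⟩ := Nat.forall_exists_prime_gt_and_eq_mod
      ((ZMod.isUnit_iff_coprime n (4 * D * L)).2 hcop) (max C 2)
    rw [ZMod.natCast_eq_natCast_iff] at hpn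
    refine ⟨p, lt_of_le_of_lt (le_max_left _ _) hpC, hp, hpn.of_dvd (Dvd.intro_left _ rfl), ?_⟩
    have hpodd : Odd p := hp.odd_of_ne_two (lt_of_le_of_lt (le_max_right C 2) hpC).ne'
    rw [jacobiSym.mod_right _ hodd, jacobiSym.mod_right _ hpodd, Int.natAbs_natCast]
    congr 1
    exact hpn.of_dvd (Dvd.intro _ rfl)
  obtain ⟨p, hpC, hp, hpn, e⟩ := hex n hn
  obtain ⟨p', hpC', hp', hpn', e'⟩ := hex n' hn'
  rw [← e, ← e']
  refine hC p p' hp hp' hpC hpC' ?_ (hpn.trans (hmod.trans hpn'.symm))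
  rw [Nat.Coprime, hpn.gcd_eq]
  exact hn

end HasNebentypus

end TernaryForm

/-- A multiplicative function on the integers prime to `L` that is periodic modulo `L` is a
Dirichlet character. -/
lemma exists_dirichletCharacter {L : ℕ} (hL : 1 < L) {f : ℕ → ℤ} (h1 : f 1 = 1)
    (hmul : ∀ m n : ℕ, m.Coprime L → n.Coprime L → f (m * n) = f m * f n)
    (hper : ∀ m n : ℕ, m.Coprime L → n.Coprime L → m ≡ n [MOD L] → f m = f n) :
    ∃ χ : DirichletCharacter ℂ L, ∀ n : ℕ, n.Coprime L → χ n = f n := by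
  classical
  have : NeZero L := ⟨by omega⟩
  have hval : ∀ x : ZMod L, IsUnit x → x.val.Coprime L := fun x hx => by
    rw [← ZMod.isUnit_iff_coprime, ZMod.natCast_zmod_val]; exact hx
  refine ⟨⟨⟨⟨fun x => if IsUnit x then (f x.val : ℂ) else 0, ?_⟩, ?_⟩, ?_⟩, ?_⟩
  · rw [if_pos isUnit_one, ZMod.val_one'' (by omega), h1, Int.cast_one]
  · intro x y
    change (if IsUnit (x * y) then (f (x * y).val : ℂ) else 0) = (if IsUnit x then (f x.val : ℂ) else 0)
      * (if IsUnit y then (f y.val : ℂ) else 0)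
    by_cases hx : IsUnit x
    · by_cases hy : IsUnit y
      · rw [if_pos hx, if_pos hy, if_pos (hx.mul hy), ← Int.cast_mul, ← hmul _ _ (hval x hx) (hval y hy)]
        congr 1
        refine hper _ _ (hval _ (hx.mul hy)) ((hval x hx).mul_left (hval y hy)) ?_
        rw [ZMod.val_mul]
        exact Nat.mod_modEq _ _
      · rw [if_neg hy, mul_zero, if_neg fun h => hy (isUnit_of_mul_isUnit_right h)]
    · rw [if_neg hx, zero_mul, if_neg fun h => hx (isUnit_of_mul_isUnit_left h)]
  · intro x hx
    exact if_neg hx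
  · intro n hn
    have hu := (ZMod.isUnit_iff_coprime n L).2 hn
    change (if IsUnit (n : ZMod L) then (f (n : ZMod L).val : ℂ) else 0) = f n
    rw [if_pos hu]
    congr 1
    refine hper _ _ (hval _ hu) hn ?_
    rw [ZMod.val_natCast]
    exact Nat.mod_modEq _ _

namespace TernaryForm.HasNebentypus

variable {Q : TernaryForm} {L D : ℕ}

/-- The character `n ↦ (D / n)` modulo `L`. -/
lemma exists_character (h : Q.HasNebentypus L D) : ∃ χ : DirichletCharacter ℂ L,
    ∀ n : ℕ, n.Coprime L → χ n = jacobiSym D n := by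
  have h4 := Nat.le_of_dvd (Nat.pos_of_ne_zero h.level_ne_zero) h.four_dvd
  have hne : ∀ n : ℕ, n.Coprime L → n ≠ 0 := by
    rintro n hn rfl
    rw [Nat.coprime_zero_left] at hn
    omega
  refine exists_dirichletCharacter (by omega) (f := fun n => jacobiSym D n) (jacobiSym.one_right _) ?_
    fun m n hm hn => h.jacobiSym_periodic hm hn
  intro m n hm hn
  have : NeZero m := ⟨hne m hm⟩
  have : NeZero n := ⟨hne n hn⟩
  exact jacobiSym.mul_right _ m n

/-- The theta series is modular on `Γ₀(L)` with this character. -/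
lemma transformsWith (h : Q.HasNebentypus L D) {χ : DirichletCharacter ℂ L}
    (hχ : ∀ n : ℕ, n.Coprime L → χ n = jacobiSym D n) (γ : SL(2, ℤ)) (hγ : (L : ℤ) ∣ γ 1 0) :
    Q.TransformsWith γ (χ ((γ 1 1 : ℤ) : ZMod L)) := by
  have hL := h.level_ne_zero
  -- a lower right entry can be replaced by a prime unless the lower left entry vanishes
  have main : ∀ γ : SL(2, ℤ), (L : ℤ) ∣ γ 1 0 → γ 1 0 ≠ 0 → Q.TransformsWith γ (χ ((γ 1 1 : ℤ) : ZMod L)) := by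
    intro γ hγ hc
    obtain ⟨C, hC⟩ := h.transformsWith_of_prime
    have hdet := γ.det_coe
    rw [Matrix.det_fin_two] at hdet
    have hcop : IsCoprime (γ 1 1) (((γ 1 0).natAbs : ℕ) : ℤ) := by
      rw [Int.natCast_natAbs, IsCoprime.abs_right_iff]
      exact ⟨γ 0 0, -γ 0 1, by linarith⟩
    obtain ⟨p, hpC, hp, hpd⟩ := Nat.forall_exists_prime_gt_and_zmodEq C (Int.natAbs_ne_zero.2 hc) hcop
    obtain ⟨k, hk⟩ : γ 1 0 ∣ p - γ 1 1 := by
      have := hpd.symm.dvd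
      rwa [Int.natCast_natAbs, abs_dvd] at this
    have h1 := hC p hp hpC (γ * ModularGroup.T ^ k) (by rw [(mul_T_zpow_apply γ k).2.1]; exact hγ)
      (by rw [(mul_T_zpow_apply γ k).2.2]; linarith)
    have hpL : ((γ 1 1 : ℤ) : ZMod L) = ((p : ℕ) : ZMod L) := by
      rw [← Int.cast_natCast, ZMod.intCast_eq_intCast_iff, Int.modEq_iff_dvd]
      exact hγ.trans ⟨k, hk⟩
    have hpcop : p.Coprime L := by
      have h2 : IsCoprime (γ 1 1) (L : ℤ) := hcop.of_isCoprime_of_dvd_right (by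
        rw [Int.natCast_natAbs, dvd_abs]; exact hγ)
      rw [← ZMod.isUnit_iff_coprime, ← hpL, ZMod.coe_int_isUnit_iff_isCoprime]
      exact h2.symm
    rw [hpL, hχ p hpcop]
    exact transformsWith_mul_T_zpow.1 h1
  by_cases hc : γ 1 0 = 0
  · have hdet := γ.det_coe
    rw [Matrix.det_fin_two, hc, mul_zero, sub_zero] at hdet
    have hsmul : ∀ z : UpperHalfPlane, Q.theta (γ • z : UpperHalfPlane) = Q.theta z ∧
        shimuraTheta (γ • z) = shimuraTheta z := by
      intro z
      have hd : γ 1 1 ≠ 0 := by intro h0; rw [h0] at hdet; simp at hdet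
      obtain ⟨k, hk⟩ : ∃ k : ℤ, γ • z = ModularGroup.T ^ k • z := by
        refine ⟨γ 0 1 * γ 1 1, UpperHalfPlane.ext ?_⟩
        rw [coe_T_zpow_smul, UpperHalfPlane.coe_specialLinearGroup_apply]
        rcases Int.mul_eq_one_iff_eq_one_or_neg_one.1 hdet with ⟨e1, e2⟩ | ⟨e1, e2⟩
        · simp [hc, e1, e2]; ring
        · simp [hc, e1, e2]; ring
      have h3 := thetaFactor_T_zpow k z
      rw [thetaFactor, div_eq_one_iff_eq (shimuraTheta_ne_zero z)] at h3
      rw [hk]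
      exact ⟨by rw [coe_T_zpow_smul, theta_add_int], h3⟩
    have hχ1 : χ ((γ 1 1 : ℤ) : ZMod L) = 1 := by
      rcases Int.mul_eq_one_iff_eq_one_or_neg_one.1 hdet with ⟨-, e2⟩ | ⟨-, e2⟩
      · rw [e2, Int.cast_one, map_one]
      · rw [e2]
        -- `(1, 0; L, 1)` and its negative act in the same way
        let γ₁ : SL(2, ℤ) := ⟨!![1, 0; (L : ℤ), 1], by rw [Matrix.det_fin_two_of]; ring⟩
        have hLz : (L : ℤ) ≠ 0 := by exact_mod_cast hL
        have t1 := main γ₁ (dvd_refl _) hLz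
        have t2 := main (-γ₁) (by change (L : ℤ) ∣ -(L : ℤ); exact (dvd_refl _).neg_right)
          (by change -(L : ℤ) ≠ 0; exact neg_ne_zero.2 hLz)
        have t3 : Q.TransformsWith γ₁ (χ (((-γ₁) 1 1 : ℤ) : ZMod L)) := by
          intro z
          have := t2 z
          rwa [thetaFactor, ModularGroup.SL_neg_smul] at this
        have t4 := t1.unique h.isPos t3
        have e3 : (γ₁ 1 1 : ℤ) = 1 := rfl
        have e4 : ((-γ₁) 1 1 : ℤ) = -1 := rfl
        rw [e3, e4, Int.cast_one, map_one] at t4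
        exact t4.symm
    intro z
    rw [hχ1, thetaFactor, (hsmul z).1, (hsmul z).2, div_self (shimuraTheta_ne_zero z)]
    ring
  · exact main γ hγ hc

end TernaryForm.HasNebentypus

/-! ### The nebentypus of the theta series of an ideal -/

section Nebentypus

variable {a b : ℚ} {R : Subring (𝔹 a b)} {ω : ℕ} {Q : TernaryForm}

lemma TernaryForm.HasGaussCharacter.squarefreePart (hω : ω ≠ 0) (h : Q.HasGaussCharacter ω) :
    Q.HasGaussCharacter (squarefreePart ω) := by
  obtain ⟨f, hf⟩ := squarefreePart_mul_sq ω hω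
  have hf0 : f ≠ 0 := by rintro rfl; exact hω (by simpa using hf)
  obtain ⟨C, hC, hG⟩ := h
  refine ⟨C * f, mul_ne_zero hC hf0, fun p _ hpC r hr => ?_⟩
  rw [hG p (fun hd => hpC (hd.mul_right f)) r hr]
  have hfp : (f : ZMod p) ≠ 0 := fun h0 => hpC (((ZMod.natCast_eq_zero_iff f p).1 h0).mul_left C)
  have h1 : ((ω : ℤ) : ZMod p) = ((_root_.squarefreePart ω : ℕ) : ℤ) * (f : ZMod p) ^ 2 := by
    nth_rewrite 1 [hf]; push_cast; ring
  rw [h1, map_mul, quadraticChar_sq_one' hfp, mul_one]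

lemma squarefreePart_ne_zero (n : ℕ) : squarefreePart n ≠ 0 :=
  Finset.prod_ne_zero_iff.2 fun _ hp =>
    (Nat.prime_of_mem_primeFactors (Finset.mem_filter.1 hp).1).ne_zero

lemma odd_factorization_of_dvd_squarefreePart {p n : ℕ} (hp : p.Prime) (h : p ∣ squarefreePart n) :
    Odd (n.factorization p) := by
  obtain ⟨q, hq, hpq⟩ := (Prime.dvd_finsetProd_iff hp.prime _).1 h
  rw [Finset.mem_filter] at hq
  rw [(Nat.prime_dvd_prime_iff_eq hp (Nat.prime_of_mem_primeFactors hq.1)).1 hpq]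
  exact hq.2

/-- Twice the product of `ω` and the determinant is a square, so that a prime that divides `ω` to an
odd power divides the determinant or is `2`. -/
lemma IsNormForm.dvd_level (hω : ω ≠ 0) (hQ : Q.IsPos) (h : IsNormForm ω R Q) {L : ℕ}
    (hL : Q.HasLevel L) {p : ℕ} (hp : p.Prime) (hpD : p ∣ squarefreePart ω) : p ∣ L := by
  have : Fact p.Prime := ⟨hp⟩
  by_contra hpL
  obtain ⟨M, m, -, -, hdet⟩ := h.det_eq
  have hL4 : 4 ∣ L := by exact_mod_cast hL.four_dvd hQ
  have h2 : p ≠ 2 := by rintro rfl; exact hpL ((by norm_num : 2 ∣ 4).trans hL4)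
  have hpdet : ¬ (p : ℤ) ∣ Q.det := fun hd => hpL (by
    have := hd.trans (hL.det_dvd hQ)
    exact hp.dvd_of_dvd_pow (by exact_mod_cast this))
  have hd0 : (Q.det : ℚ) ≠ 0 := by exact_mod_cast hQ.det_pos.ne'
  have hω0 : (ω : ℚ) ≠ 0 := by exact_mod_cast hω
  have hm0 : a * b * m ≠ 0 := by
    intro h0
    rw [h0] at hdet
    exact mul_ne_zero hd0 (pow_ne_zero 3 hω0) (by rw [hdet]; ring)
  have h8 : padicValRat p (8 : ℚ) = 0 := by
    have h9 : padicValNat p 8 = 0 := padicValNat.eq_zero_of_not_dvd fun hd =>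
      h2 ((Nat.prime_dvd_prime_iff_eq hp Nat.prime_two).1 (hp.dvd_of_dvd_pow (by norm_num; exact hd : p ∣ 2 ^ 3)))
    have := padicValRat.of_nat (p := p) (n := 8)
    rw [h9] at this
    exact_mod_cast this
  have hv := congrArg (padicValRat p) hdet
  rw [padicValRat.mul hd0 (pow_ne_zero 3 hω0), padicValRat.pow,
    padicValRat.mul (by norm_num) (pow_ne_zero 2 hm0), padicValRat.pow, h8, padicValRat.of_int,
    padicValInt.eq_zero_of_not_dvd hpdet, padicValRat.of_nat] at hv
  obtain ⟨k, hk⟩ := odd_factorization_of_dvd_squarefreePart hp hpD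
  rw [Nat.factorization_def _ hp] at hk
  push_cast [hk] at hv
  omega

variable [Fact (a < 0)] [Fact (b < 0)] {O : Subring (𝔹 a b)}

/-- The ternary form attached to a left ideal: the norm form of its right order. -/
lemma LeftIdeal.exists_form (hO : IsOrder O) (I : LeftIdeal O) :
    ∃ Q, IsNormForm (orderOmega O) (rightRing I.lattice) Q :=
  exists_isNormForm (I.rightRing_isOrder hO) fun _ hs => I.nrd_pureLattice hO hs

lemma LeftIdeal.hasNebentypus (hO : IsOrder O) (I : LeftIdeal O) {L : ℕ} (hL0 : 0 < L)
    (hL : (L : ℚ) = 4 * orderN O / orderOmega O)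
    (hQ : IsNormForm (orderOmega O) (rightRing I.lattice) Q) :
    Q.HasNebentypus L (squarefreePart (orderOmega O)) := by
  have hω := hO.omega_spec.1
  have ha : a < 0 := Fact.out
  have hb : b < 0 := Fact.out
  have hpos := hQ.isPos hω
  have hlev := I.hasLevel hO hL hQ
  exact ⟨hpos, hL0.ne', hlev,
    (hQ.hasGaussCharacter ha.ne hb.ne hω hpos.det_pos.ne').squarefreePart hω,
    fun p hp hd => hQ.dvd_level hω hpos hlev hp hd, squarefreePart_ne_zero _⟩

end Nebentypus

/-! ### Theta series at the cusps -/

namespace TernaryForm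

open Complex Real
open UpperHalfPlane hiding I

variable {Q : TernaryForm}

/-- A theta series with bounded coefficients tends to its constant term. -/
lemma tendsto_tsum_exp (hQ : Q.IsPos) {T : ℝ} (hT : 0 < T) (δ : ℝ) (G : ℤ × ℤ × ℤ → ℂ) {M : ℝ}
    (hG : ∀ y, ‖G y‖ ≤ M) :
    Filter.Tendsto (fun z : ℍ => ∑' y : ℤ × ℤ × ℤ,
      cexp (2 * π * I * (z + δ) * ((Q.eval y : ℤ) / T : ℝ)) * G y) atImInfty (nhds (G 0)) := by
  have hM : 0 ≤ M := (norm_nonneg _).trans (hG 0)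
  have hnorm : ∀ (z : ℍ) (x : ℝ), ‖cexp (2 * π * I * (z + δ) * (x : ℝ))‖ = rexp (-(2 * π * x) * z.im) := by
    intro z x
    rw [Complex.norm_exp]
    congr 1
    have : (2 * π * I * (z + δ) * (x : ℝ) : ℂ) = ((2 * π * x : ℝ) : ℂ) * (I * (z + δ)) := by push_cast; ring
    rw [this, Complex.re_ofReal_mul, Complex.I_mul_re, Complex.add_im, Complex.ofReal_im, coe_im]
    ring
  have hlim : ∑' y : ℤ × ℤ × ℤ, (if y = 0 then G 0 else 0) = G 0 := by
    rw [tsum_eq_single 0 (fun y hy => if_neg hy), if_pos rfl]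
  rw [← hlim]
  refine tendsto_tsum_of_dominated_convergence
    (bound := fun y => rexp (-(2 * π / T) * (Q.eval y : ℤ)) * M)
    ((summable_gaussian hQ (by positivity)).mul_right M) ?_ ?_
  · intro y
    by_cases hy : y = 0
    · subst hy
      have h0 : Q.eval (0 : ℤ × ℤ × ℤ) = 0 := by simp [eval]
      simp [h0]
    · rw [if_neg hy]
      have hpos : (0 : ℝ) < (Q.eval y : ℤ) := by exact_mod_cast hQ.eval_pos hy
      refine squeeze_zero_norm (a := fun z : ℍ => rexp (-(2 * π * ((Q.eval y : ℤ) / T)) * z.im) * M) ?_ ?_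
      · intro z
        rw [norm_mul, hnorm]
        exact mul_le_mul_of_nonneg_left (hG y) (Real.exp_pos _).le
      · rw [← zero_mul M]
        refine Filter.Tendsto.mul_const M (Real.tendsto_exp_atBot.comp ?_)
        refine Filter.Tendsto.const_mul_atTop_of_neg ?_ Filter.tendsto_comap
        have : 0 < 2 * π * ((Q.eval y : ℤ) / T) := by positivity
        linarith
  · filter_upwards [Filter.preimage_mem_comap (Filter.Ici_mem_atTop (1 : ℝ))] with z hz y
    have hz1 : 1 ≤ z.im := hz
    rw [norm_mul, hnorm]
    refine mul_le_mul (Real.exp_le_exp.2 ?_) (hG y) (norm_nonneg _) (Real.exp_pos _).le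
    have hnn : (0 : ℝ) ≤ (Q.eval y : ℤ) := by
      by_cases hy : y = 0
      · subst hy; simp [eval]
      · exact_mod_cast (hQ.eval_pos hy).le
    have h1 : 0 ≤ 2 * π * ((Q.eval y : ℤ) / T) := by positivity
    have h2 : 2 * π / T * (Q.eval y : ℤ) = 2 * π * ((Q.eval y : ℤ) / T) := by ring
    rw [neg_mul, neg_mul, h2]
    nlinarith

/-- The constant term of a theta series at the cusp `γ ∞`, up to a factor that does not depend on the
form. -/
def cuspValue (Q : TernaryForm) (γ : SL(2, ℤ)) : ℂ :=
  if h : γ 1 0 = 0 then 1 else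
    haveI : NeZero (γ 1 0).natAbs := ⟨Int.natAbs_ne_zero.2 h⟩
    (1 / √(Q.det : ℝ) : ℝ) * Q.gaussSum (γ 1 0).natAbs ((γ 1 0).sign * γ 0 0) 0

lemma norm_cpow_neg (w : ℂ) : ‖w ^ (-(3 / 2) : ℂ)‖ = ‖w‖ ^ (-(3 / 2) : ℝ) := by
  have := Complex.norm_cpow_real w (-(3 / 2))
  push_cast at this
  exact this

/-- The behaviour of theta series at a cusp: up to a common factor of constant absolute value they
tend to `cuspValue`. -/
lemma exists_cusp_expansion (γ : SL(2, ℤ)) : ∃ (u : ℍ → ℂ) (K : ℝ), 0 < K ∧ (∀ z, ‖u z‖ = K) ∧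
    ∀ Q : TernaryForm, Q.IsPos → ∃ S : ℍ → ℂ, (∀ z, atCusp γ (fun z => Q.theta z) z = u z * S z) ∧
      Filter.Tendsto S atImInfty (nhds (Q.cuspValue γ)) := by
  have hdet : (γ 0 0 : ℂ) * γ 1 1 - γ 0 1 * γ 1 0 = 1 := by
    have := γ.det_coe
    rw [Matrix.det_fin_two] at this
    exact_mod_cast this
  have hdenom : ∀ z : ℍ, denom γ z = γ 1 0 * z + γ 1 1 := fun z => by simp [denom]
  have hcoe : ∀ z : ℍ, ((γ • z : ℍ) : ℂ) = (γ 0 0 * z + γ 0 1) / (γ 1 0 * z + γ 1 1) := fun z => by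
    rw [coe_specialLinearGroup_apply]; simp
  by_cases hc : γ 1 0 = 0
  · have hdet' := γ.det_coe
    rw [Matrix.det_fin_two, hc, mul_zero, sub_zero] at hdet'
    have hd2 : (γ 1 1 : ℂ) * γ 1 1 = 1 := by
      rcases Int.mul_eq_one_iff_eq_one_or_neg_one.1 hdet' with ⟨-, e⟩ | ⟨-, e⟩ <;> rw [e] <;> norm_num
    have hd1 : ‖(γ 1 1 : ℂ)‖ = 1 := by
      rcases Int.mul_eq_one_iff_eq_one_or_neg_one.1 hdet' with ⟨-, e⟩ | ⟨-, e⟩ <;> rw [e] <;> norm_num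
    refine ⟨fun z => (denom γ z) ^ (-(3 / 2) : ℂ), 1, one_pos, fun z => ?_, fun Q hQ => ?_⟩
    · rw [norm_cpow_neg, hdenom, hc, Int.cast_zero, zero_mul, zero_add, hd1, Real.one_rpow]
    · refine ⟨fun z => Q.theta (γ • z : ℍ), fun z => rfl, ?_⟩
      rw [cuspValue, dif_pos hc]
      have h := tendsto_tsum_exp hQ one_pos (γ 0 1 * γ 1 1 : ℝ) (fun _ => 1) (M := 1) (by simp)
      refine h.congr fun z => ?_
      rw [theta]
      refine tsum_congr fun y => ?_
      have e : ((γ • z : ℍ) : ℂ) = z + (γ 0 1 * γ 1 1 : ℝ) := by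
        have hd0 : (γ 1 1 : ℂ) ≠ 0 := by intro h0; rw [h0] at hd2; simp at hd2
        rw [hcoe, hc]
        rw [hc] at hdet
        push_cast at hdet ⊢
        rw [zero_mul, zero_add, div_eq_iff hd0]
        linear_combination (γ 1 1 * z : ℂ) * hdet - (γ 0 1 + γ 0 0 * z : ℂ) * hd2
      rw [e, mul_one, div_one, Complex.ofReal_intCast]
  -- here `γ z = a / c - 1 / (c² ζ)` with `ζ = z + d / c`, so that `theta_add_rat` applies
  · have : NeZero (γ 1 0).natAbs := ⟨Int.natAbs_ne_zero.2 hc⟩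
    have hcC : (γ 1 0 : ℂ) ≠ 0 := by exact_mod_cast hc
    have hn2 : (((γ 1 0).natAbs : ℕ) : ℂ) ^ 2 = (γ 1 0 : ℂ) ^ 2 := by
      rw [← Int.cast_natCast, ← Int.cast_pow, Int.natAbs_sq, Int.cast_pow]
    have hsign : ((((γ 1 0).sign * γ 0 0 : ℤ)) : ℂ) / ((γ 1 0).natAbs : ℕ) = γ 0 0 / γ 1 0 := by
      have h1 : (((γ 1 0).natAbs : ℕ) : ℂ) = (((γ 1 0).sign : ℤ) : ℂ) * γ 1 0 := by
        rw [← Int.cast_natCast, ← Int.sign_mul_self_eq_natAbs, Int.cast_mul]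
      have h3 : (((γ 1 0).sign : ℤ) : ℂ) ≠ 0 := by exact_mod_cast mt Int.sign_eq_zero_iff_zero.1 hc
      rw [h1]; push_cast; field_simp
    have hden : ∀ z : ℍ, (γ 1 0 * z + γ 1 1 : ℂ) ≠ 0 := fun z => by
      rw [← hdenom]; exact denom_ne_zero γ z
    have hz' : ∀ z : ℍ, (γ 1 0 * z + γ 1 1 : ℂ) = γ 1 0 * (z + (γ 1 1 / γ 1 0 : ℝ)) := fun z => by
      push_cast; field_simp
    set ζ : ℍ → ℂ := fun z => z + (γ 1 1 / γ 1 0 : ℝ) with hζ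
    have hζ0 : ∀ z, ζ z ≠ 0 := fun z h0 => hden z (by rw [hz' z]; change (γ 1 0 : ℂ) * ζ z = 0; rw [h0, mul_zero])
    have hζim : ∀ z, 0 < (-1 / ζ z).im := fun z => by
      have h1 : 0 < (ζ z).im := by
        rw [hζ]; simp only [Complex.add_im, Complex.ofReal_im, add_zero, coe_im]; exact z.im_pos
      rw [neg_div, Complex.neg_im, one_div, Complex.inv_im, neg_div, neg_neg]
      have := Complex.normSq_pos.2 (hζ0 z)
      positivity
    refine ⟨fun z => (denom γ z) ^ (-(3 / 2) : ℂ) * invFactor (-1 / ζ z), ‖(γ 1 0 : ℂ)‖ ^ (-(3 / 2) : ℝ),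
      Real.rpow_pos_of_pos (norm_pos_iff.2 hcC) _, fun z => ?_, fun Q hQ => ?_⟩
    · rw [norm_mul, norm_cpow_neg, hdenom, hz' z, norm_invFactor (hζim z), norm_mul, norm_div, norm_neg,
        norm_one, one_div, Real.mul_rpow (norm_nonneg _) (norm_nonneg _), mul_assoc]
      have h1 : ‖ζ z‖ ^ (-(3 / 2) : ℝ) * ‖ζ z‖⁻¹ ^ (-(3 / 2) : ℝ) = 1 := by
        rw [← Real.mul_rpow (norm_nonneg _) (inv_nonneg.2 (norm_nonneg _)),
          mul_inv_cancel₀ (norm_ne_zero_iff.2 (hζ0 z)), Real.one_rpow]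
      change _ * (‖ζ z‖ ^ (-(3 / 2) : ℝ) * _) = _
      rw [h1, mul_one]
    · have hdetQ : (0 : ℝ) < 2 * Q.det := by
        have : (0 : ℝ) < Q.det := by exact_mod_cast hQ.det_pos
        positivity
      refine ⟨fun z => (1 / √(Q.det : ℝ) : ℝ) * ∑' y : ℤ × ℤ × ℤ,
        cexp (2 * π * I * (z + (γ 1 1 / γ 1 0 : ℝ)) * ((Q.adj.eval y : ℤ) / (2 * Q.det : ℝ) : ℝ)) *
          Q.gaussSum (γ 1 0).natAbs ((γ 1 0).sign * γ 0 0) y, fun z => ?_, ?_⟩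
      · have hw : 0 < (-1 / ((γ 1 0 : ℂ) ^ 2 * ζ z)).im := by
          have h1 : -1 / ((γ 1 0 : ℂ) ^ 2 * ζ z) = (((γ 1 0 : ℝ) ^ 2)⁻¹ : ℝ) * (-1 / ζ z) := by
            push_cast; field_simp
          rw [h1, Complex.im_ofReal_mul]
          have h2 : (0 : ℝ) < ((γ 1 0 : ℝ) ^ 2)⁻¹ := by
            have : (γ 1 0 : ℝ) ≠ 0 := by exact_mod_cast hc
            positivity
          exact mul_pos h2 (hζim z)
        have key := theta_add_rat hQ (γ 1 0).natAbs ((γ 1 0).sign * γ 0 0) hw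
        have e1 : (((γ 1 0).natAbs : ℕ) : ℂ) ^ 2 * (-1 / ((γ 1 0 : ℂ) ^ 2 * ζ z)) = -1 / ζ z := by
          rw [hn2]; have := hζ0 z; field_simp
        have e2 : -1 / (-1 / ζ z) = ζ z := by have := hζ0 z; field_simp
        have e3 : (γ 0 0 / γ 1 0 : ℂ) + -1 / ((γ 1 0 : ℂ) ^ 2 * ζ z) = ((γ • z : ℍ) : ℂ) := by
          have h1 : (γ 1 0 : ℂ) ^ 2 * ζ z = γ 1 0 * (γ 1 0 * z + γ 1 1) := by rw [hz' z]; ring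
          have h2 := hden z
          rw [h1, hcoe, div_add_div _ _ hcC (mul_ne_zero hcC h2), div_eq_div_iff (mul_ne_zero hcC (mul_ne_zero hcC h2)) h2]
          linear_combination (γ 1 0 : ℂ) * (γ 1 0 * z + γ 1 1) * hdet
        rw [hsign, e1, e2, e3] at key
        rw [atCusp, key]
        simp only [hζ]
        ring
      · rw [cuspValue, dif_neg hc]
        refine Filter.Tendsto.const_mul _ ?_
        exact tendsto_tsum_exp hQ.adj_isPos hdetQ (γ 1 1 / γ 1 0 : ℝ) _
          (fun y => norm_gaussSum_le Q _ _ y)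

end TernaryForm

/-! ### The genus of the ternary forms -/

namespace TernaryForm

/-- Linear maps in both directions that multiply the forms by squares of integers prime to `n` and
whose composites are multiplications by such integers: they make the forms equivalent over `ℤ_p`
for all `p ∣ n`. -/
def SimilarAt (n : ℕ) (Q Q' : TernaryForm) : Prop :=
  ∃ (m m' : ℤ) (P P' : (ℤ × ℤ × ℤ) →ₗ[ℤ] ℤ × ℤ × ℤ), IsCoprime m n ∧ IsCoprime m' n ∧
    (∀ x, Q'.eval (P x) = m ^ 2 * Q.eval x) ∧ (∀ x, P' (P x) = (m' * m) • x)

variable {Q Q' : TernaryForm}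

/-- The determinant of one form, times `m⁶`, is that of the other times the square of `det P`. -/
lemma SimilarAt.det_dvd {n : ℕ} (h : SimilarAt n Q Q') (hn : Q'.det ∣ n) : Q'.det ∣ Q.det := by
  obtain ⟨m, m', P, P', hm, -, hP, -⟩ := h
  have key : m ^ 6 * Q.det = Q'.det * ((P (1, 0, 0)).1 * ((P (0, 1, 0)).2.1 * (P (0, 0, 1)).2.2
      - (P (0, 1, 0)).2.2 * (P (0, 0, 1)).2.1) - (P (0, 1, 0)).1 * ((P (1, 0, 0)).2.1 * (P (0, 0, 1)).2.2
      - (P (1, 0, 0)).2.2 * (P (0, 0, 1)).2.1) + (P (0, 0, 1)).1 * ((P (1, 0, 0)).2.1 * (P (0, 1, 0)).2.2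
      - (P (1, 0, 0)).2.2 * (P (0, 1, 0)).2.1)) ^ 2 := by
    have h1 := hP (1, 0, 0)
    have h2 := hP (0, 1, 0)
    have h3 := hP (0, 0, 1)
    have h4 := hP ((0, 1, 0) + (0, 0, 1))
    have h5 := hP ((1, 0, 0) + (0, 0, 1))
    have h6 := hP ((1, 0, 0) + (0, 1, 0))
    rw [map_add] at h4 h5 h6
    generalize P (1, 0, 0) = u at *
    generalize P (0, 1, 0) = v at *
    generalize P (0, 0, 1) = w at *
    obtain ⟨u₁, u₂, u₃⟩ := u
    obtain ⟨v₁, v₂, v₃⟩ := v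
    obtain ⟨w₁, w₂, w₃⟩ := w
    simp only [eval, Int.cast_id, Prod.mk_add_mk] at h1 h2 h3 h4 h5 h6
    have e4 : m ^ 2 * Q.d = m ^ 2 * (Q.b + Q.c + Q.d) - m ^ 2 * Q.b - m ^ 2 * Q.c := by ring
    have e5 : m ^ 2 * Q.e = m ^ 2 * (Q.a + Q.c + Q.e) - m ^ 2 * Q.a - m ^ 2 * Q.c := by ring
    have e6 : m ^ 2 * Q.f = m ^ 2 * (Q.a + Q.b + Q.f) - m ^ 2 * Q.a - m ^ 2 * Q.b := by ring
    have k : m ^ 6 * Q.det = 8 * (m ^ 2 * Q.a) * (m ^ 2 * Q.b) * (m ^ 2 * Q.c)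
        + 2 * (m ^ 2 * Q.d) * (m ^ 2 * Q.e) * (m ^ 2 * Q.f) - 2 * (m ^ 2 * Q.a) * (m ^ 2 * Q.d) ^ 2
        - 2 * (m ^ 2 * Q.b) * (m ^ 2 * Q.e) ^ 2 - 2 * (m ^ 2 * Q.c) * (m ^ 2 * Q.f) ^ 2 := by
      rw [det]; ring
    have g1 : m ^ 2 * Q.a = Q'.eval (u₁, u₂, u₃) := by rw [eval]; simp only [Int.cast_id]; linear_combination -h1
    have g2 : m ^ 2 * Q.b = Q'.eval (v₁, v₂, v₃) := by rw [eval]; simp only [Int.cast_id]; linear_combination -h2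
    have g3 : m ^ 2 * Q.c = Q'.eval (w₁, w₂, w₃) := by rw [eval]; simp only [Int.cast_id]; linear_combination -h3
    have g4 : m ^ 2 * Q.d = 2 * Q'.a * v₁ * w₁ + 2 * Q'.b * v₂ * w₂ + 2 * Q'.c * v₃ * w₃
        + Q'.d * (v₂ * w₃ + v₃ * w₂) + Q'.e * (v₁ * w₃ + v₃ * w₁) + Q'.f * (v₁ * w₂ + v₂ * w₁) := by
      linear_combination h2 + h3 - h4
    have g5 : m ^ 2 * Q.e = 2 * Q'.a * u₁ * w₁ + 2 * Q'.b * u₂ * w₂ + 2 * Q'.c * u₃ * w₃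
        + Q'.d * (u₂ * w₃ + u₃ * w₂) + Q'.e * (u₁ * w₃ + u₃ * w₁) + Q'.f * (u₁ * w₂ + u₂ * w₁) := by
      linear_combination h1 + h3 - h5
    have g6 : m ^ 2 * Q.f = 2 * Q'.a * u₁ * v₁ + 2 * Q'.b * u₂ * v₂ + 2 * Q'.c * u₃ * v₃
        + Q'.d * (u₂ * v₃ + u₃ * v₂) + Q'.e * (u₁ * v₃ + u₃ * v₁) + Q'.f * (u₁ * v₂ + u₂ * v₁) := by
      linear_combination h1 + h2 - h6
    rw [k, g1, g2, g3, g4, g5, g6, eval, eval, eval, det]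
    simp only [Int.cast_id]
    ring
  have hc : IsCoprime (m ^ 6) Q'.det := (hm.of_isCoprime_of_dvd_right hn).pow_left
  exact hc.symm.dvd_of_dvd_mul_left (key ▸ Dvd.intro _ rfl)

/-- Gauss sums modulo `n` only depend on the form over the `ℤ_p`, `p ∣ n`. -/
lemma SimilarAt.gaussSum_eq {n : ℕ} [NeZero n] (h : SimilarAt n Q Q') (r : ℤ) :
    Q.gaussSum n r 0 = Q'.gaussSum n r 0 := by
  obtain ⟨m, m', P, P', hm, hm', hP, hPP⟩ := h
  -- `k` is inverse to `m` modulo `n`, and `k P` is an isometry modulo `n`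
  obtain ⟨k, l, hk⟩ := hm
  have hkm : (k : ZMod n) * m = 1 := by
    have := congrArg (Int.cast : ℤ → ZMod n) hk
    push_cast at this
    simpa using this
  have hs : Function.Surjective (castVec n) := by
    rintro ⟨g₁, g₂, g₃⟩
    obtain ⟨x₁, rfl⟩ := ZMod.intCast_surjective g₁
    obtain ⟨x₂, rfl⟩ := ZMod.intCast_surjective g₂
    obtain ⟨x₃, rfl⟩ := ZMod.intCast_surjective g₃
    exact ⟨(x₁, x₂, x₃), rfl⟩
  have hker : ∀ x y, castVec n x = castVec n y ↔ ∃ w, x - y = (n : ℤ) • w := by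
    rintro ⟨x₁, x₂, x₃⟩ ⟨y₁, y₂, y₃⟩
    simp only [castVec, Prod.mk.injEq, ZMod.intCast_eq_intCast_iff_dvd_sub, Prod.exists, Prod.mk_sub_mk,
      Prod.smul_mk, smul_eq_mul]
    constructor
    · rintro ⟨⟨a, ha⟩, ⟨b, hb⟩, ⟨c, hc⟩⟩
      exact ⟨-a, -b, -c, by linarith, by linarith, by linarith⟩
    · rintro ⟨a, b, c, ha, hb, hc⟩
      exact ⟨⟨-a, by linarith⟩, ⟨-b, by linarith⟩, ⟨-c, by linarith⟩⟩
  set φ : ZMod n × ZMod n × ZMod n → ZMod n × ZMod n × ZMod n := fun g =>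
    castVec n (k • P (Function.surjInv hs g)) with hφ
  have hφi : Function.Injective φ := by
    intro g g' hgg
    obtain ⟨w, hw⟩ := (hker _ _).1 hgg
    obtain ⟨k', l', hk'⟩ := hm'
    rw [← Function.surjInv_eq hs g, ← Function.surjInv_eq hs g', hker]
    rw [← smul_sub, ← map_sub] at hw
    have h1 := congrArg P' hw
    rw [map_smul, map_smul, hPP] at h1
    set d := Function.surjInv hs g - Function.surjInv hs g'
    refine ⟨k' • P' w + (k' * m' * l) • d + l' • d, ?_⟩
    have e : (k' * (k * (m' * m)) + n * (k' * m' * l) + n * l' : ℤ) = 1 := by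
      linear_combination k' * m' * hk + hk'
    calc d = (k' * (k * (m' * m)) + n * (k' * m' * l) + n * l' : ℤ) • d := by rw [e, one_smul]
      _ = k' • (k • (m' * m) • d) + n • ((k' * m' * l) • d + l' • d) := by module
      _ = _ := by rw [h1]; module
  rw [gaussSum, gaussSum]
  refine Eq.trans ?_ ((Equiv.ofBijective φ (Finite.injective_iff_bijective.1 hφi)).sum_comp _)
  refine Finset.sum_congr rfl fun g _ => ?_
  have h0 : ∀ g, dot (castVec n 0) g = 0 := fun g => by simp [dot, castVec]
  rw [h0, h0, Equiv.ofBijective_apply, hφ]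
  congr 3
  have hQs : Q'.eval (k • P (Function.surjInv hs g)) = k ^ 2 * Q'.eval (P (Function.surjInv hs g)) := by
    simp only [eval, Prod.smul_fst, Prod.smul_snd, smul_eq_mul]; ring
  have hg : Q.eval g = ((Q.eval (Function.surjInv hs g) : ℤ) : ZMod n) := by
    conv_lhs => rw [← Function.surjInv_eq hs g]
    exact eval_castVec _ _ _
  simp only
  rw [eval_castVec, hQs, hP, hg]
  push_cast
  linear_combination (-(k * m + 1 : ZMod n) * (Q.eval (Function.surjInv hs g) : ℤ)) * hkm

lemma cuspValue_eq (γ : SL(2, ℤ)) (hd : Q.det = Q'.det) (h : SimilarAt (γ 1 0).natAbs Q Q') :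
    Q.cuspValue γ = Q'.cuspValue γ := by
  rw [cuspValue, cuspValue, hd]
  split_ifs with hc
  · rfl
  · have : NeZero (γ 1 0).natAbs := ⟨Int.natAbs_ne_zero.2 hc⟩
    rw [h.gaussSum_eq]

end TernaryForm

section Genus

variable {a b : ℚ} {O R R' : Subring (𝔹 a b)}

/-- Denominators can be cleared by an integer prime to `n` if they can be cleared locally at the
primes that divide `n`. -/
lemma exists_zsmul_mem_of_forall_le_locAt {V : Type*} [AddCommGroup V] {M N : Submodule ℤ V} (hN : N.FG)
    {n : ℕ} (h : ∀ p : ℕ, p.Prime → p ∣ n → N ≤ locAt p M) :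
    ∃ m : ℤ, IsCoprime m n ∧ ∀ x ∈ N, m • x ∈ M := by
  obtain ⟨g, hg⟩ := (IsPrincipalIdealRing.principal (M.colon (N : Set V))).principal
  have hmem : ∀ m : ℤ, (∀ x ∈ N, m • x ∈ M) ↔ g ∣ m := fun m => by
    rw [← Ideal.mem_span_singleton, ← Ideal.submodule_span_eq, ← hg, Submodule.mem_colon]
    rfl
  refine ⟨g, ?_, (hmem g).2 dvd_rfl⟩
  rw [Int.isCoprime_iff_gcd_eq_one]
  refine Nat.Coprime.symm (Nat.coprime_of_dvd fun p hp hpn hpg => ?_)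
  obtain ⟨m, hm, hx⟩ := exists_nsmul_mem_of_fg hN (h p hp hpn)
  have h1 : g ∣ (m : ℤ) := (hmem m).1 fun x hx' => by rw [natCast_zsmul]; exact hx x hx'
  have h2 : p ∣ m := hpg.trans (Int.natAbs_dvd_natAbs.2 h1)
  exact hp.one_lt.ne' (Nat.eq_one_of_dvd_coprimes hm h2 dvd_rfl)

/-- Conjugation by `y`, up to a factor prime to `n`, in coordinates. -/
lemma exists_conj_coord (hR : IsOrder R) (e : (ℤ × ℤ × ℤ) ≃ₗ[ℤ] pureLattice R)
    (e' : (ℤ × ℤ × ℤ) ≃ₗ[ℤ] pureLattice R') (y : (𝔹 a b)ˣ) {n : ℕ}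
    (h : ∀ p : ℕ, p.Prime → p ∣ n → ∀ x ∈ R,
      (y : 𝔹 a b) * x * (↑y⁻¹ : 𝔹 a b) ∈ locRing p R') :
    ∃ (m : ℤ) (P : (ℤ × ℤ × ℤ) →ₗ[ℤ] ℤ × ℤ × ℤ), IsCoprime m n ∧ ∀ x, (e' (P x) : 𝔹 a b) =
      m • ((y : 𝔹 a b) * e x * (↑y⁻¹ : 𝔹 a b)) := by
  set C : 𝔹 a b →ₗ[ℤ] 𝔹 a b :=
    LinearMap.mulRight ℤ (↑y⁻¹ : 𝔹 a b) ∘ₗ LinearMap.mulLeft ℤ (y : 𝔹 a b) with hC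
  obtain ⟨m, hm, hmem⟩ := exists_zsmul_mem_of_forall_le_locAt (M := pureLattice R')
    (hR.pureLattice_fg.map C) (n := n) (by
      rintro p hp hpn _ ⟨_, ⟨x, hx, rfl⟩, rfl⟩
      obtain ⟨k, hk, hkx⟩ := h p hp hpn x hx
      refine ⟨k, hk, _, hkx, ?_⟩
      rw [map_nsmul, pureMap_conj]; rfl)
  refine ⟨m, e'.symm ∘ₗ ((m • C ∘ₗ (pureLattice R).subtype).codRestrict (pureLattice R')
    (fun x => hmem _ ⟨x, x.2, rfl⟩)) ∘ₗ e, hm, fun x => ?_⟩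
  simp [hC]

/-- An element of the localized order that is congruent to `1` modulo `p` is a unit. -/
lemma IsOrder.exists_unit_eq_one_add (hO : IsOrder O) {p : ℕ} (hp : p.Prime) {t : 𝔹 a b}
    (ht : t ∈ locRing p O) : ∃ u : (𝔹 a b)ˣ, (u : 𝔹 a b) = 1 + p • t ∧
      (u : 𝔹 a b) ∈ locRing p O ∧ (↑u⁻¹ : 𝔹 a b) ∈ locRing p O := by
  have huO : 1 + p • t ∈ locRing p O := add_mem (one_mem _) (nsmul_mem ht p)
  obtain ⟨m, hm, hmt⟩ := ht
  obtain ⟨j, hj⟩ := hO.trd_int (mem_subringLattice.1 hmt)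
  obtain ⟨k, hk⟩ := hO.nrd_int (mem_subringLattice.1 hmt)
  have hnu : (m : ℚ) ^ 2 * nrd (1 + p • t) = ((m ^ 2 + p * (m * j + p * k) : ℤ) : ℚ) := by
    push_cast
    rw [← hj, ← hk]
    simp only [← Nat.cast_smul_eq_nsmul ℚ, nrd_eq, trd_eq, QuaternionAlgebra.re_add,
      QuaternionAlgebra.imI_add, QuaternionAlgebra.imJ_add, QuaternionAlgebra.imK_add,
      QuaternionAlgebra.re_smul, QuaternionAlgebra.imI_smul, QuaternionAlgebra.imJ_smul,
      QuaternionAlgebra.imK_smul, QuaternionAlgebra.re_one, QuaternionAlgebra.imI_one,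
      QuaternionAlgebra.imJ_one, QuaternionAlgebra.imK_one, smul_eq_mul]
    ring
  have hNp : IsCoprime (m ^ 2 + p * (m * j + p * k) : ℤ) (p : ℤ) :=
    IsCoprime.add_mul_left_left (IsCoprime.pow_left (Nat.isCoprime_iff_coprime.2 hm)) _
  generalize (m ^ 2 + p * (m * j + p * k) : ℤ) = N at hnu hNp
  have hN0 : (N : ℚ) ≠ 0 := by
    intro h0
    rw [Int.cast_eq_zero.1 h0, isCoprime_zero_left] at hNp
    exact hp.one_lt.ne' (by simpa using Int.isUnit_iff_natAbs_eq.1 hNp)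
  have hu0 : nrd (1 + p • t) ≠ 0 := fun h0 => hN0 (by rw [← hnu, h0, mul_zero])
  refine ⟨unitOfNrd _ hu0, rfl, huO, hO.inv_mem_locRing huO ?_⟩
  change PInt p (nrd (1 + p • t))⁻¹
  have hm0 : (m : ℚ) ≠ 0 := fun h0 => hN0 (by rw [← hnu, h0]; ring)
  have e : (nrd (1 + p • t))⁻¹ = m ^ 2 / N := by rw [← hnu]; field_simp
  rw [e]
  refine pInt_of_mul_eq_intCast (m := N.natAbs) (Int.isCoprime_iff_gcd_eq_one.1 hNp)
    (k := N.sign * m ^ 2) ?_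
  have hs : ((N.natAbs : ℕ) : ℚ) = N.sign * N := by
    rw [← Int.cast_natCast, ← Int.sign_mul_self_eq_natAbs, Int.cast_mul]
  rw [hs]; push_cast; field_simp

/-- An element congruent to a local generator at `p` modulo `p` is a local generator. -/
lemma IsLocGen.exists_of_sub_eq (hO : IsOrder O) {I : Submodule ℤ (𝔹 a b)} {p : ℕ} (hp : p.Prime)
    {y : (𝔹 a b)ˣ} (hy : IsLocGen p O I y) {y' w : 𝔹 a b} (hw : w ∈ I)
    (h : y' - y = p • w) : ∃ z : (𝔹 a b)ˣ, (z : 𝔹 a b) = y' ∧ IsLocGen p O I z := by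
  obtain ⟨u, hu, huO, huinv⟩ := hO.exists_unit_eq_one_add hp ((hy w).1 (le_locAt p I hw))
  refine ⟨u * y, ?_, fun x => ?_⟩
  · rw [Units.val_mul, hu, add_mul, one_mul, smul_mul_assoc, mul_assoc, Units.inv_mul, mul_one, ← h]
    abel
  · rw [hy x, mul_inv_rev, Units.val_mul, ← mul_assoc]
    refine ⟨fun hx => (locRing p O).mul_mem hx huinv, fun hx => ?_⟩
    have := (locRing p O).mul_mem hx huO
    rwa [mul_assoc, Units.inv_mul, mul_one] at this

variable [Fact (a < 0)] [Fact (b < 0)]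

/-- Finitely many primes admit a common local generator. -/
lemma LeftIdeal.exists_isLocGen_finset (hO : IsOrder O) (I : LeftIdeal O) (S : Finset ℕ)
    (hS : ∀ p ∈ S, p.Prime) : ∃ y : (𝔹 a b)ˣ, (y : 𝔹 a b) ∈ I.lattice ∧
      ∀ p ∈ S, IsLocGen p O I.lattice y := by
  induction S using Finset.induction_on with
  | empty =>
    obtain ⟨y, hy, -⟩ := I.exists_isLocGen hO 2 Nat.prime_two
    exact ⟨y, hy, by simp⟩
  | insert p S hpS ih =>
    obtain ⟨y, hyI, hy⟩ := ih fun q hq => hS q (Finset.mem_insert_of_mem hq)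
    have hp := hS p (Finset.mem_insert_self p S)
    obtain ⟨z, hzI, hz⟩ := I.exists_isLocGen hO p hp
    have hcop : IsCoprime ((∏ q ∈ S, q : ℕ) : ℤ) (p : ℤ) := by
      refine Nat.isCoprime_iff_coprime.2 (Nat.Coprime.prod_left fun q hq => ?_)
      refine (Nat.coprime_primes (hS q (Finset.mem_insert_of_mem hq)) hp).2 ?_
      rintro rfl; exact hpS hq
    obtain ⟨u, v, huv⟩ := hcop
    set m : ℤ := ((∏ q ∈ S, q : ℕ) : ℤ) with hm
    set y' : 𝔹 a b := (v * p) • (y : 𝔹 a b) + (u * m) • (z : 𝔹 a b) with hy'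
    have h1 : y' - z = p • (v • ((y : 𝔹 a b) - z)) := by
      have e : u * m = 1 - v * p := by linear_combination huv
      rw [hy', e, ← natCast_zsmul]; module
    obtain ⟨g, hg, hgen⟩ := hz.exists_of_sub_eq hO hp (I.lattice.smul_mem v (I.lattice.sub_mem hyI hzI)) h1
    refine ⟨g, hg ▸ I.lattice.add_mem (I.lattice.smul_mem _ hyI) (I.lattice.smul_mem _ hzI),
      fun q hq => ?_⟩
    rcases Finset.mem_insert.1 hq with rfl | hqS
    · exact hgen
    · obtain ⟨k, hk⟩ := Finset.dvd_prod_of_mem (fun q : ℕ => q) hqS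
      have h2 : y' - y = q • ((u * k) • ((z : 𝔹 a b) - y)) := by
        have e : v * p = 1 - u * (q * k) := by
          rw [hm, hk] at huv; push_cast at huv; linear_combination huv
        have e' : m = q * k := by rw [hm, hk]; push_cast; rfl
        rw [hy', e, e', ← natCast_zsmul]; module
      obtain ⟨g', hg', hgen'⟩ := (hy q hqS).exists_of_sub_eq hO (hS q hq)
        (I.lattice.smul_mem (u * k) (I.lattice.sub_mem hzI hyI)) h2
      rwa [Units.ext (hg.trans hg'.symm) (u := g)]

/-- The forms of an order and of the right orders of its ideals are in the same genus. -/
lemma LeftIdeal.similarAt (hO : IsOrder O) (I : LeftIdeal O) {Q Q' : TernaryForm}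
    (hQ : IsNormForm (orderOmega O) (rightRing I.lattice) Q) (hQ' : IsNormForm (orderOmega O) O Q')
    {n : ℕ} (hn : n ≠ 0) : Q.SimilarAt n Q' ∧ Q'.SimilarAt n Q := by
  obtain ⟨e, he⟩ := hQ
  obtain ⟨e', he'⟩ := hQ'
  have hω : (orderOmega O : ℚ) ≠ 0 := by exact_mod_cast hO.omega_spec.1
  obtain ⟨y, -, hy⟩ := I.exists_isLocGen_finset hO n.primeFactors fun p hp => Nat.prime_of_mem_primeFactors hp
  have hy' : ∀ p : ℕ, p.Prime → p ∣ n → IsLocGen p O I.lattice y := fun p hp hpn =>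
    hy p (Nat.mem_primeFactors.2 ⟨hp, hpn, hn⟩)
  obtain ⟨m, P, hm, hP⟩ := exists_conj_coord (I.rightRing_isOrder hO) e e' y (n := n)
    fun p hp hpn x hx => (LeftIdeal.mem_locRing_rightRing (hy' p hp hpn)).1
      (le_locAt p _ (mem_subringLattice.2 hx))
  obtain ⟨m', P', hm', hP'⟩ := exists_conj_coord hO e' e y⁻¹ (n := n)
    fun p hp hpn x hx => (LeftIdeal.mem_locRing_rightRing (hy' p hp hpn)).2 (by
      have h := le_locAt p _ (mem_subringLattice.2 hx)
      rw [← mem_locRing] at h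
      simpa [mul_assoc] using h)
  have nrd_zsmul : ∀ (k : ℤ) (s : 𝔹 a b), nrd (k • s) = k ^ 2 * nrd s := fun k s => by
    rw [← Int.cast_smul_eq_zsmul ℚ, nrd_smul]
  refine ⟨⟨m, m', P, P', hm, hm', fun x => ?_, fun x => ?_⟩, ⟨m', m, P', P, hm', hm, fun x => ?_, fun x => ?_⟩⟩
  · have h := he' (P x)
    rw [hP, nrd_zsmul, nrd_conj, he] at h
    have : (orderOmega O : ℚ) * ((Q'.eval (P x) : ℤ) : ℚ) = orderOmega O * ((m ^ 2 * Q.eval x : ℤ) : ℚ) := by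
      rw [← h]; push_cast; ring
    exact_mod_cast mul_left_cancel₀ hω this
  · refine e.injective (Subtype.ext ?_)
    rw [hP', hP, map_smul, mul_smul_comm, smul_mul_assoc, smul_smul]
    simp [mul_assoc]
  · have h := he (P' x)
    rw [hP', nrd_zsmul, nrd_conj, he'] at h
    have : (orderOmega O : ℚ) * ((Q.eval (P' x) : ℤ) : ℚ) = orderOmega O * ((m' ^ 2 * Q'.eval x : ℤ) : ℚ) := by
      rw [← h]; push_cast; ring
    exact_mod_cast mul_left_cancel₀ hω this
  · refine e'.injective (Subtype.ext ?_)
    rw [hP, hP', map_smul, mul_smul_comm, smul_mul_assoc, smul_smul]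
    simp [mul_assoc]

/-- The theta series of the ideals of an order have the same value at each cusp. -/
lemma LeftIdeal.cuspValue_eq (hO : IsOrder O) (I : LeftIdeal O) {Q Q' : TernaryForm}
    (hQ : IsNormForm (orderOmega O) (rightRing I.lattice) Q) (hQ' : IsNormForm (orderOmega O) O Q')
    (γ : SL(2, ℤ)) : Q.cuspValue γ = Q'.cuspValue γ := by
  have hd := (hQ.isPos hO.omega_spec.1).det_pos
  have hd' := (hQ'.isPos hO.omega_spec.1).det_pos
  have hdet : Q.det = Q'.det := by
    obtain ⟨h, h'⟩ := I.similarAt hO hQ hQ' (n := Q.det.natAbs * Q'.det.natAbs)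
      (mul_ne_zero (Int.natAbs_ne_zero.2 hd.ne') (Int.natAbs_ne_zero.2 hd'.ne'))
    refine Int.dvd_antisymm hd.le hd'.le (h'.det_dvd ?_) (h.det_dvd ?_) <;> push_cast
    · exact ((dvd_abs _ _).2 dvd_rfl).mul_right _
    · exact ((dvd_abs _ _).2 dvd_rfl).mul_left _
  by_cases hc : γ 1 0 = 0
  · rw [TernaryForm.cuspValue, TernaryForm.cuspValue, dif_pos hc, dif_pos hc]
  · exact TernaryForm.cuspValue_eq γ hdet (I.similarAt hO hQ hQ' (Int.natAbs_ne_zero.2 hc)).1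

end Genus

/-! ### Theta series as modular forms -/

namespace TernaryForm

open Complex Real
open UpperHalfPlane hiding I

variable {Q : TernaryForm}

lemma differentiableOn_theta (hQ : Q.IsPos) : DifferentiableOn ℂ Q.theta {w | 0 < w.im} := by
  intro w (hw : 0 < w.im)
  have hopen : IsOpen {z : ℂ | w.im / 2 < z.im} := isOpen_lt continuous_const Complex.continuous_im
  have hmem : w ∈ {z : ℂ | w.im / 2 < z.im} := by simp only [Set.mem_ofPred_eq]; linarith
  refine DifferentiableAt.differentiableWithinAt (DifferentiableOn.differentiableAt ?_ (hopen.mem_nhds hmem))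
  refine differentiableOn_tsum_of_summable_norm
    (summable_gaussian hQ (t := 2 * π * (w.im / 2)) (by positivity)) (fun x => by fun_prop) hopen ?_
  intro x z (hz : w.im / 2 < z.im)
  have hnn : (0 : ℝ) ≤ (Q.eval x : ℤ) := by
    by_cases hx : x = 0
    · subst hx; simp [eval]
    · exact_mod_cast (hQ.eval_pos hx).le
  have : (2 * π * I * z * (Q.eval x : ℤ) : ℂ) = ((2 * π * (Q.eval x : ℤ) : ℝ) : ℂ) * (I * z) := by
    push_cast; ring
  rw [Complex.norm_exp, this, Complex.re_ofReal_mul, Complex.I_mul_re]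
  refine Real.exp_le_exp.2 ?_
  have h1 : 0 ≤ 2 * π * ((Q.eval x : ℤ) : ℝ) := by positivity
  nlinarith

lemma HasNebentypus.theta_mem {L D : ℕ} (h : Q.HasNebentypus L D) {χ : DirichletCharacter ℂ L}
    (hχ : ∀ n : ℕ, n.Coprime L → χ n = jacobiSym D n) :
    (fun z : ℍ => Q.theta z) ∈ ModularForms32 L χ := by
  refine ⟨(differentiableOn_theta h.isPos).congr fun w (hw : 0 < w.im) => ?_, fun γ hγ z => ?_,
    fun γ => ?_⟩
  · rw [ofComplex_apply_of_im_pos hw]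
  · refine h.transformsWith hχ γ ?_ z
    rw [CongruenceSubgroup.Gamma0_mem] at hγ
    exact (ZMod.intCast_zmod_eq_zero_iff_dvd _ _).1 hγ
  · obtain ⟨u, K, -, hu, hS⟩ := exists_cusp_expansion γ
    obtain ⟨S, hS, hlim⟩ := hS Q h.isPos
    refine Asymptotics.IsBigO.trans (g := S) (Asymptotics.IsBigO.of_bound K ?_) (hlim.isBigO_one ℝ)
    exact Filter.Eventually.of_forall fun z => by rw [hS, norm_mul, hu]

/-- A combination of theta series of forms in one genus vanishes at a cusp if and only if the sum of its
coefficients, times the common value at the cusp, is zero. -/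
lemma isZeroAtImInfty_atCusp_sum_iff {ι : Type*} (s : Finset ι) {Q : ι → TernaryForm}
    (hQ : ∀ i, (Q i).IsPos) (w : ι → ℂ) (γ : SL(2, ℤ)) {κ : ℂ} (hκ : ∀ i, (Q i).cuspValue γ = κ) :
    IsZeroAtImInfty (atCusp γ fun z => ∑ i ∈ s, w i * (Q i).theta z) ↔ (∑ i ∈ s, w i) * κ = 0 := by
  obtain ⟨u, K, hK, hu, hS⟩ := exists_cusp_expansion γ
  choose S hS hlim using fun i => hS (Q i) (hQ i)
  have hlim' : Filter.Tendsto (fun z => ∑ i ∈ s, w i * S i z) atImInfty (nhds ((∑ i ∈ s, w i) * κ)) := by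
    rw [Finset.sum_mul]
    exact tendsto_finsetSum _ fun i _ => ((hκ i ▸ hlim i).const_mul (w i))
  have heq : (atCusp γ fun z => ∑ i ∈ s, w i * (Q i).theta z) = fun z => u z * ∑ i ∈ s, w i * S i z := by
    funext z
    rw [atCusp, Finset.mul_sum, Finset.mul_sum]
    refine Finset.sum_congr rfl fun i _ => ?_
    have := hS i z
    rw [atCusp] at this
    linear_combination w i * this
  have hnorm : IsZeroAtImInfty (atCusp γ fun z => ∑ i ∈ s, w i * (Q i).theta z) ↔
      Filter.Tendsto (fun z => K * ‖∑ i ∈ s, w i * S i z‖) atImInfty (nhds 0) := by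
    rw [heq]
    change Filter.Tendsto _ _ _ ↔ _
    rw [tendsto_zero_iff_norm_tendsto_zero]
    simp only [norm_mul, hu]
  rw [hnorm]
  have h2 := hlim'.norm.const_mul K
  constructor
  · intro h
    have := tendsto_nhds_unique h2 h
    rwa [mul_eq_zero, or_iff_right hK.ne', norm_eq_zero] at this
  · intro h
    rwa [h, norm_zero, mul_zero] at h2

end TernaryForm

/-- The coefficients of an expansion in powers of `exp (2πiz)` are those of the `q`-expansion. -/
lemma qExpansion_coeff_eq {L : ℕ} {χ : DirichletCharacter ℂ L} {f : UpperHalfPlane → ℂ}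
    (hf : f ∈ ModularForms32 L χ) {c : ℕ → ℂ}
    (h : ∀ z : UpperHalfPlane, HasSum (fun m : ℕ => c m *
      Complex.exp (2 * Real.pi * Complex.I * m * (z : ℂ))) (f z)) (m : ℕ) :
    (UpperHalfPlane.qExpansion 1 f).coeff m = c m := by
  have hhol := UpperHalfPlane.mdifferentiable_iff.2 hf.1
  have hbdd : UpperHalfPlane.IsBoundedAtImInfty f := by
    have := hf.2.2 1
    have h1 : atCusp 1 f = f := by
      funext z
      rw [atCusp, one_smul]
      simp [UpperHalfPlane.denom]
    rwa [h1] at this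
  have hper : Function.Periodic (f ∘ UpperHalfPlane.ofComplex) ((1 : ℝ) : ℂ) := by
    intro w
    by_cases hw : 0 < w.im
    · have hw' : 0 < (w + (1 : ℝ)).im := by simpa using hw
      simp only [Function.comp_apply, UpperHalfPlane.ofComplex_apply_of_im_pos hw',
        UpperHalfPlane.ofComplex_apply_of_im_pos hw]
      refine (h ⟨_, hw'⟩).unique (Eq.mp ?_ (h ⟨_, hw⟩))
      congr 1
      funext k
      have e : (2 * Real.pi * Complex.I * k * (w + (1 : ℝ)) : ℂ)
          = 2 * Real.pi * Complex.I * k * w + k * (2 * Real.pi * Complex.I) := by push_cast; ring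
      change _ = c k * Complex.exp (2 * Real.pi * Complex.I * k * (w + (1 : ℝ)))
      rw [e, Complex.exp_add, Complex.exp_nat_mul_two_pi_mul_I, mul_one]
    · have hw' : (w + (1 : ℝ)).im ≤ 0 := by simpa using hw
      simp only [Function.comp_apply, UpperHalfPlane.ofComplex_apply_of_im_nonpos hw',
        UpperHalfPlane.ofComplex_apply_of_im_nonpos (not_lt.1 hw)]
  refine (UpperHalfPlane.qExpansion_coeff_unique (⟨f, hhol.continuous⟩ : C(UpperHalfPlane, ℂ)) one_pos
    (UpperHalfPlane.analyticAt_cuspFunction_zero one_pos hper hhol hbdd) (fun z => ?_) m).symm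
  refine Eq.mp ?_ (h z)
  congr 1
  funext k
  rw [Function.Periodic.qParam, ← Complex.exp_nat_mul, smul_eq_mul]
  congr 2
  push_cast; ring

section Assembly

variable {a b : ℚ} {O R : Subring (𝔹 a b)}

/-- The theta series of a norm form counts the vectors of given norm. -/
lemma IsNormForm.hasSum_theta {ω : ℕ} (hω : ω ≠ 0) {Q : TernaryForm} (hQ : Q.IsPos) (h : IsNormForm ω R Q)
    {z : ℂ} (hz : 0 < z.im) :
    HasSum (fun m : ℕ => ((pureSet (ω * m) R).ncard : ℂ) * Complex.exp (2 * Real.pi * Complex.I * m * z))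
      (Q.theta z) := by
  obtain ⟨e, he⟩ := h
  have hnn : ∀ x, 0 ≤ Q.eval (x : ℤ × ℤ × ℤ) := fun x => by
    by_cases hx : x = 0
    · subst hx; simp [TernaryForm.eval]
    · exact (hQ.eval_pos hx).le
  have hs := (TernaryForm.summable_theta hQ hz).hasSum.tsum_fiberwise
    (fun x : ℤ × ℤ × ℤ => (Q.eval x : ℤ).toNat)
  refine Eq.mp ?_ hs
  congr 1
  funext m
  have hmem : ∀ x, x ∈ (fun x : ℤ × ℤ × ℤ => (Q.eval x : ℤ).toNat) ⁻¹' {m} ↔ Q.eval x = m := fun x => by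
    have := hnn x
    simp only [Set.mem_preimage, Set.mem_singleton_iff]
    omega
  have h1 : pureSet (ω * m) R = (fun x => (e x : 𝔹 a b)) ''
      ((fun x : ℤ × ℤ × ℤ => (Q.eval x : ℤ).toNat) ⁻¹' {m}) := by
    have hω' : (ω : ℚ) ≠ 0 := by exact_mod_cast hω
    ext s
    constructor
    · rintro ⟨hs, hn⟩
      refine ⟨e.symm ⟨s, hs⟩, (hmem _).2 ?_, by simp⟩
      have h2 := he (e.symm ⟨s, hs⟩)
      rw [LinearEquiv.apply_symm_apply, hn] at h2
      push_cast at h2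
      exact_mod_cast (mul_left_cancel₀ hω' h2).symm
    · rintro ⟨x, hx, rfl⟩
      refine ⟨(e x).2, ?_⟩
      rw [he, (hmem x).1 hx]; push_cast; rfl
  have h2 : (pureSet (ω * m) R).ncard =
      Nat.card ((fun x : ℤ × ℤ × ℤ => (Q.eval x : ℤ).toNat) ⁻¹' {m}) := by
    rw [h1, Set.ncard_image_of_injective _ (f := fun x => (e x : 𝔹 a b))
      (Subtype.val_injective.comp e.injective), Nat.card_coe_set_eq]
  have h3 : ∀ x : (fun x : ℤ × ℤ × ℤ => (Q.eval x : ℤ).toNat) ⁻¹' {m},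
      Complex.exp (2 * Real.pi * Complex.I * z * (Q.eval (x : ℤ × ℤ × ℤ) : ℤ))
        = Complex.exp (2 * Real.pi * Complex.I * m * z) := fun x => by
    rw [(hmem _).1 x.2]; congr 1; push_cast; ring
  rw [tsum_congr h3, tsum_const, h2, nsmul_eq_mul]

variable [Fact (a < 0)] [Fact (b < 0)]

omit [Fact (a < 0)] [Fact (b < 0)] in
lemma heightClass_of_ne {c c' : IdealClass O} (h : c ≠ c') : heightClass c c' = 0 := by
  have : IsEmpty {x : (𝔹 a b)ˣ // latticeMul c.out.lattice x = c'.out.lattice} :=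
    ⟨fun x => h (by
      rw [← c.out_eq, ← c'.out_eq]
      exact Quotient.sound ⟨x.1, x.2⟩)⟩
  rw [heightClass, Nat.card_of_isEmpty]; simp

/-- An ideal has finitely many automorphisms, because their reduced norms are equal to `1`. -/
lemma heightClass_self_ne_zero (hO : IsOrder O) (c : IdealClass O) : heightClass c c ≠ 0 := by
  have hnrd : ∀ x : (𝔹 a b)ˣ, latticeMul c.out.lattice x = c.out.lattice →
      (x : 𝔹 a b) ∈ rightRing c.out.lattice ∧ nrd (x : 𝔹 a b) = 1 := by
    intro x hx
    refine ⟨mem_rightRing.2 fun v hv => hx ▸ mem_latticeMul.2 ⟨v, hv, rfl⟩, ?_⟩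
    have h1 := LeftIdeal.norm_latticeMul c.out.lattice c.out.fg x (nrd_unit_pos x)
    rw [hx] at h1
    obtain ⟨y, -, hy⟩ := c.out.exists_isLocGen hO 2 Nat.prime_two
    have h2 := latticeNorm_pos c.out.fg hy Nat.prime_two
    exact mul_right_cancel₀ h2.ne' (by rw [one_mul]; exact h1.symm)
  have hfin : Finite {x : (𝔹 a b)ˣ // latticeMul c.out.lattice x = c.out.lattice} := by
    have h := finite_nrd_eq (c.out.rightRing_isOrder hO).fg 1
    have := h.to_subtype
    refine Finite.of_injective (β := {x | x ∈ subringLattice (rightRing c.out.lattice) ∧ nrd x = 1})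
      (fun x => ⟨x.1, (hnrd x.1 x.2)⟩) fun x y hxy => ?_
    exact Subtype.ext (Units.ext (congrArg Subtype.val hxy))
  have : Nonempty {x : (𝔹 a b)ˣ // latticeMul c.out.lattice x = c.out.lattice} :=
    ⟨1, latticeMul_one _⟩
  have := Nat.card_pos (α := {x : (𝔹 a b)ˣ // latticeMul c.out.lattice x = c.out.lattice})
  rw [heightClass]
  positivity

/-- Only the diagonal terms of the height pairing contribute. -/
lemma heightPairing_eVec (hO : IsOrder O) (d : ℕ) (v : IdealModule O) :
    heightPairing (eVec O d) v = v.sum fun c n => (specialNum d c.out.lattice : ℚ) * n := by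
  refine Finsupp.sum_congr fun c _ => ?_
  rw [finsum_eq_single _ c fun c' h => by rw [heightClass_of_ne h, mul_zero], eVec,
    div_mul_cancel₀ _ (heightClass_self_ne_zero hO c), specialCount,
    ncard_specialPoints d _ (c.out.rightRing_isOrder hO)]

/-- The coefficients of the theta series of an element of `M(O)`. -/
def thetaCoeff (O : Subring (𝔹 a b)) : IdealModule O →ₗ[ℤ] ℕ → ℂ :=
  Finsupp.lift _ ℤ _ fun c => (1 / 2 : ℂ) • LeftIdeal.specialSeq c.out

omit [Fact (a < 0)] [Fact (b < 0)] in
lemma thetaCoeff_apply (v : IdealModule O) (m : ℕ) : thetaCoeff O v m =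
    v.sum fun c n => (n : ℂ) * (1 / 2 * LeftIdeal.specialSeq c.out m) := by
  rw [thetaCoeff, Finsupp.lift_apply, Finsupp.sum, Finsupp.sum, Finset.sum_apply]
  simp

/-- The numbers of special points depend only on the ideal class. -/
lemma specialSeq_out (hO : IsOrder O) (J : LeftIdeal O) :
    LeftIdeal.specialSeq (⟦J⟧ : IdealClass O).out = LeftIdeal.specialSeq J := by
  obtain ⟨x, hx⟩ := Quotient.exact (⟦J⟧ : IdealClass O).out_eq
  rw [← LeftIdeal.specialSeq_mulUnit hO _ x]
  exact congrArg _ (LeftIdeal.ext_lattice hx)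

/-- The map from `M(O)` to sequences of coefficients commutes with the Hecke operators. -/
lemma heckeCoeff_thetaCoeff (hO : IsOrder O) {n : ℕ} (hn : n ≠ 0) (hcop : n.Coprime (reducedDisc O))
    (v : IdealModule O) :
    heckeCoeff (squarefreePart (orderOmega O)) n (thetaCoeff O v) = thetaCoeff O (heckeT n v) := by
  induction v using Finsupp.induction_linear with
  | zero => simp
  | add v w hv hw => rw [map_add, map_add, map_add, map_add, hv, hw]
  | single c k =>
    have hsingle : ∀ (c : IdealClass O) (k : ℤ),
        thetaCoeff O (Finsupp.single c k) = k • (1 / 2 : ℂ) • LeftIdeal.specialSeq c.out := fun c k => by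
      simp [thetaCoeff]
    have hT : heckeT n (Finsupp.single c k) = k • LeftIdeal.heckeSum n
        (fun J => Finsupp.single (⟦J⟧ : IdealClass O) (1 : ℤ)) c.out := by
      simp only [heckeT, Finsupp.lift_apply, Finsupp.sum_single_index, zero_smul]; rfl
    have hmap := LeftIdeal.map_heckeSum hO (I := c.out) (thetaCoeff O).toAddMonoidHom hn
      (fun J => Finsupp.single (⟦J⟧ : IdealClass O) (1 : ℤ))
    have hmap' := LeftIdeal.map_heckeSum hO (I := c.out)
      (DistribSMul.toAddMonoidHom (ℕ → ℂ) (1 / 2 : ℂ)) hn LeftIdeal.specialSeq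
    simp only [LinearMap.toAddMonoidHom_coe, hsingle, one_smul, specialSeq_out hO] at hmap
    simp only [DistribSMul.toAddMonoidHom_apply] at hmap'
    rw [hsingle, hT, map_zsmul, map_zsmul, hmap, ← hmap', LeftIdeal.heckeSum_specialSeq hO hn hcop, map_smul]

lemma specialNum_eq_zero (hO : IsOrder O) (I : LeftIdeal O) {d : ℕ} (h : ¬ orderOmega O ∣ d) :
    specialNum d I.lattice = 0 := by
  have : pureSet d (rightRing I.lattice) = ∅ := by
    refine Set.eq_empty_of_forall_notMem ?_
    rintro s ⟨hs, hn⟩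
    obtain ⟨k, hk⟩ := I.nrd_pureLattice hO hs
    rw [hn] at hk
    exact h (Int.natCast_dvd_natCast.1 ⟨k, by exact_mod_cast hk⟩)
  rw [specialNum, this, Set.ncard_empty]

end Assembly

end

theorem mainTheorem1 (a b : ℚ) (ha : a < 0) (hb : b < 0)
    (O : Subring (QuatAlg ℚ a b)) (hO : IsOrder O) :
    ∃ L : ℕ, 0 < L ∧ 4 ∣ L ∧ (L : ℚ) = 4 * orderN O / orderOmega O ∧
    ∃ χ : DirichletCharacter ℂ L,
      (∀ n : ℕ, n.Coprime L → χ n = kroneckerSymbol (squarefreePart (orderOmega O)) n) ∧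
    ∃ Θ : IdealModule O →ₗ[ℤ] ModularForms32 L χ,
      (∀ (v : IdealModule O) (z : UpperHalfPlane),
        HasSum (fun d : ℕ => (1 / 2 : ℂ) * (heightPairing (eVec O d) v : ℂ) *
            Complex.exp (2 * Real.pi * Complex.I * ((d : ℂ) / (orderOmega O : ℂ)) * (z : ℂ)))
          ((Θ v : UpperHalfPlane → ℂ) z)) ∧
      (∀ v : IdealModule O, IsCuspForm32 L χ (Θ v) ↔ degree v = 0) ∧
      (∀ n : ℕ, 1 ≤ n → n.Coprime (reducedDisc O) → ∀ v : IdealModule O,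
        heckeForm (squarefreePart (orderOmega O)) n (Θ v) = Θ (heckeT n v)) := by
  have := Fact.mk ha
  have := Fact.mk hb
  have hω := hO.omega_spec.1
  obtain ⟨L, hL0, hL⟩ := hO.exists_level
  -- the theta series of a class is half that of the norm form of the right order of an ideal
  choose Q hQ using fun c : IdealClass O => c.out.exists_form hO
  have hpos : ∀ c, (Q c).IsPos := fun c => (hQ c).isPos hω
  have hneb : ∀ c, (Q c).HasNebentypus L (squarefreePart (orderOmega O)) := fun c =>
    c.out.hasNebentypus hO hL0 hL (hQ c)
  obtain ⟨Q₀, hQ₀⟩ := exists_isNormForm hO (fun s hs => hO.nrd_pureLattice hs)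
  have hκ : ∀ γ c, (Q c).cuspValue γ = Q₀.cuspValue γ := fun γ c => c.out.cuspValue_eq hO (hQ c) hQ₀ γ
  -- the order itself is a left ideal, so that there is at least one class
  let c₀ : IdealClass O := ⟦⟨subringLattice O, hO, fun p _ => ⟨1, by simp⟩⟩⟧
  obtain ⟨χ, hχ⟩ := (hneb c₀).exists_character
  have h4 := (hneb c₀).four_dvd
  let F : IdealClass O → ModularForms32 L χ := fun c => (1 / 2 : ℂ) • ⟨_, (hneb c).theta_mem hχ⟩
  let Θ : IdealModule O →ₗ[ℤ] ModularForms32 L χ := Finsupp.lift _ ℤ _ F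
  have hΘ : ∀ v, (Θ v : UpperHalfPlane → ℂ) =
      fun z : UpperHalfPlane => ∑ c ∈ v.support, (v c * (1 / 2) : ℂ) * (Q c).theta z := fun v => by
    funext z
    simp only [Θ, F, Finsupp.lift_apply, Finsupp.sum, Submodule.coe_sum, Finset.sum_apply]
    refine Finset.sum_congr rfl fun c _ => ?_
    simp
    ring
  have hcoeff : ∀ (v : IdealModule O) (z : UpperHalfPlane), HasSum (fun m : ℕ => thetaCoeff O v m *
      Complex.exp (2 * Real.pi * Complex.I * m * (z : ℂ))) ((Θ v : UpperHalfPlane → ℂ) z) := fun v z => by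
    have h := hasSum_sum (s := v.support) fun c _ =>
      ((hQ c).hasSum_theta hω (hpos c) z.im_pos).mul_left (v c * (1 / 2) : ℂ)
    rw [hΘ]
    refine Eq.mp ?_ h
    congr 1
    funext m
    rw [thetaCoeff_apply, Finsupp.sum, Finset.sum_mul]
    refine Finset.sum_congr rfl fun c _ => ?_
    rw [LeftIdeal.specialSeq, specialNum]
    ring
  refine ⟨L, hL0, h4, hL, χ, fun n hn => ?_, Θ, fun v z => ?_, fun v => ?_, fun n hn hcop v => ?_⟩
  · have h2 : n.factorization 2 = 0 := Nat.factorization_eq_zero_of_not_dvd fun h2 => by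
      have := Nat.dvd_gcd h2 ((by norm_num : 2 ∣ 4).trans h4)
      rw [hn] at this
      norm_num at this
    rw [hχ n hn, kroneckerSymbol, h2]
    simp
  · -- only multiples of `ω` contribute
    have hωC : (orderOmega O : ℂ) ≠ 0 := by exact_mod_cast hω
    have hinj : Function.Injective fun m : ℕ => orderOmega O * m :=
      fun _ _ h => Nat.eq_of_mul_eq_mul_left (Nat.pos_of_ne_zero hω) h
    refine (hinj.hasSum_iff fun d hd => ?_).1 ?_
    · have hd' : ¬ orderOmega O ∣ d := fun ⟨m, hm⟩ => hd ⟨m, hm.symm⟩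
      have h0 : heightPairing (eVec O d) v = 0 := by
        rw [heightPairing_eVec hO, Finsupp.sum]
        exact Finset.sum_eq_zero fun c _ => by rw [specialNum_eq_zero hO _ hd']; simp
      rw [h0]; simp
    · refine Eq.mp ?_ (hcoeff v z)
      congr 1
      funext m
      have e : (2 * Real.pi * Complex.I * (((orderOmega O * m : ℕ) : ℂ) / (orderOmega O : ℂ)) * (z : ℂ) : ℂ)
          = 2 * Real.pi * Complex.I * m * z := by push_cast; field_simp
      rw [Function.comp_apply, e, heightPairing_eVec hO, thetaCoeff_apply, Finsupp.sum, Finsupp.sum]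
      congr 1
      push_cast
      rw [Finset.mul_sum]
      refine Finset.sum_congr rfl fun c _ => ?_
      rw [LeftIdeal.specialSeq]
      ring
  · have hdeg : ∑ c ∈ v.support, (v c * (1 / 2) : ℂ) = degree v * (1 / 2) := by
      rw [← Finset.sum_mul, degree, Finsupp.sum]; push_cast; rfl
    rw [IsCuspForm32, and_iff_right (Θ v).2, hΘ]
    constructor
    · intro h
      -- at the cusp `∞` the common value is `1`
      have h1 := (TernaryForm.isZeroAtImInfty_atCusp_sum_iff _ hpos _ _ (hκ 1)).1 (h 1)
      rw [hdeg, TernaryForm.cuspValue, dif_pos (by simp)] at h1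
      simpa using h1
    · intro h γ
      rw [TernaryForm.isZeroAtImInfty_atCusp_sum_iff _ hpos _ _ (hκ γ), hdeg, h]
      simp
  · funext z
    have hq : (fun k => (UpperHalfPlane.qExpansion 1 (Θ v : UpperHalfPlane → ℂ)).coeff k) = thetaCoeff O v :=
      funext fun m => qExpansion_coeff_eq (Θ v).2 (hcoeff v) m
    rw [heckeForm, hq, heckeCoeff_thetaCoeff hO (by omega) hcop]
    exact (hcoeff (heckeT n v) z).tsum_eq
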